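/- Let $\langle\nabla\rangle=(1-\Delta)^{1/2}$ on $\mathbb R^2$, $H^s=\langle\nabla\rangle^{-s}L^2(\mathbb R^2)$, $\langle x\rangle=(1+|x|^2)^{1/2}$. Let $\kappa\neq0$ be real, $V$ a real polynomial, and $I\subset\mathbb R$ a bounded interval; $C(I;H^s)$ denotes the bounded continuous functions $I\to H^s$ (boundedness is automatic if $I$ is compact). Indices $\mu,\nu,\rho$ run over $0,1,2$, are raised with $\mathrm{diag}(1,-1,-1)$ and summed when repeated; $\epsilon_{\mu\nu\rho}$ is skew-symmetric with $\epsilon_{012}=1$. For complex-valued $\phi_\pm\in C(I;H^1)$ and $A_{\mu,\pm}\in C(I;H^{1/2})$ put $\phi=\phi_++\phi_-$, $\partial_0\phi=\partial_t\phi=i\langle\nabla\rangle(\phi_+-\phi_-)$, $A_\mu=A_{\mu,+}+A_{\mu,-}$, $\partial_0A_\mu=\partial_tA_\mu=i\langle\nabla\rangle(A_{\mu,+}-A_{\mu,-})$, $Q_{\mu\nu}(u,v)=\partial_\mu u\,\partial_\nu v-\partial_\nu u\,\partial_\mu v$, and $$M_\mu=-\tfrac1\kappa\epsilon_{\mu\nu\rho}\,\mathrm{Im}\,Q^{\nu\rho}(\overline\phi,\phi)+\tfrac2\kappa\epsilon_{\mu\nu\rho}\partial^\nu(A^\rho|\phi|^2)+A_\mu,\qquad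 N=2iA_\mu\partial^\mu\phi+A_\mu A^\mu\phi-\phi V'(|\phi|^2)+\phi .$$ For $s,b\in\mathbb R$ let $X^{s,b}_\pm$ be the space of tempered distributions $v$ on $\mathbb R^{1+2}$ whose space-time Fourier transform $\widetilde v(\tau,\xi)$ is a function with $\langle\xi\rangle^s\langle-\tau\pm|\xi|\rangle^b\,\widetilde v\in L^2_{\tau,\xi}$, and let $X^{s,b}_\pm(I)$ be the space of those $u$ that coincide on $I\times\mathbb R^2$ with some $v\in X^{s,b}_\pm$. **Proposition.** Suppose that $\phi_\pm\in C(I;H^1)$ and $A_{\mu,\pm}\in C(I;H^{1/2})$ satisfy the Lorenz gauge condition $\partial^\mu A_\mu=0$ on $I$ and solve, in the sense of distributions on $I\times\mathbb R^2$, the half-wave form of the Chern–Simons–Higgs system $$(i\partial_t\pm\langle\nabla\rangle)A_{\mu,\pm}=\pm\tfrac12\langle\nabla\rangle^{-1}M_\mu,\qquad (i\partial_t\pm\langle\nabla\rangle)\phi_\pm=\pm\tfrac12\langle\nabla\rangle^{-1}N .$$ Then, for both signs, all $\mu$ and all $\epsilon>0$, $$\phi_\pm\in X_\pm^{\frac34-\epsilon,\frac34}(I)\qquad\text{and}\qquad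 A_{\mu,\pm}\in X_\pm^{\frac14,\frac34}(I).$$ -/

import Mathlib

open MeasureTheory FourierTransform LineDeriv
open scoped SchwartzMap ENNReal

namespace CSH

noncomputable section

/-- The space `ℝ²`. -/
abbrev Space := EuclideanSpace ℝ (Fin 2)

/-- The space-time `ℝ^{1+2}`; coordinate `0` is time, coordinates `1, 2` are space. -/
abbrev Spacetime := EuclideanSpace ℝ (Fin 3)

/-- The spatial part of a point of space-time (or of a space-time frequency). -/
def spatial (p : Spacetime) : Space := !₂[p 1, p 2]

/-- The inclusion of the time slice at time `t`: `x ↦ (t, x)`. -/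
def embed (t : ℝ) (x : Space) : Spacetime := !₂[t, x 0, x 1]

/-- The unit vector of `ℝ^{1+2}` in direction `μ`. -/
def eST (μ : Fin 3) : Spacetime := EuclideanSpace.single μ (1 : ℝ)

/-- The unit vector of `ℝ²` in direction `j`. -/
def eSp (j : Fin 2) : Space := EuclideanSpace.single j (1 : ℝ)

/-! ### Time slices of Schwartz functions -/

/-- The linear map `x ↦ (0, x)`. -/
def embedLin : Space →ₗ[ℝ] Spacetime where
  toFun x := embed 0 x
  map_add' x y := by
    ext i; fin_cases i <;> simp [embed]
  map_smul' c x := by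
    ext i; fin_cases i <;> simp [embed]

theorem embed_eq (t : ℝ) :
    embed t = fun x => embedLin.toContinuousLinearMap x + embed t 0 := by
  funext x
  ext i; fin_cases i <;> simp [embedLin, embed]

theorem embed_hasTemperateGrowth (t : ℝ) : (embed t).HasTemperateGrowth := by
  rw [embed_eq]
  exact (embedLin.toContinuousLinearMap.hasTemperateGrowth).add (.const _)

theorem embed_isometry (t : ℝ) : Isometry (embed t) := by
  refine Isometry.of_dist_eq fun x y => ?_
  simp [EuclideanSpace.dist_eq, embed, Fin.sum_univ_three, Fin.sum_univ_two]

/-- Restriction of a Schwartz function `ψ` on space-time to the time `t`: `x ↦ ψ (t, x)`. -/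
def slice (t : ℝ) : 𝓢(Spacetime, ℂ) →L[ℂ] 𝓢(Space, ℂ) :=
  SchwartzMap.compCLMOfAntilipschitz ℂ (embed_hasTemperateGrowth t) (embed_isometry t).antilipschitz

theorem slice_apply (t : ℝ) (ψ : 𝓢(Spacetime, ℂ)) (x : Space) : slice t ψ x = ψ (embed t x) := rfl

/-! ### The operators `⟨∇⟩^s` and the spaces `C(I; H^s)` -/

/-- The symbol `⟨ξ⟩^s = (1 + |ξ|²)^{s/2}` of `⟨∇⟩^s = (1 - Δ)^{s/2}`, at the frequency `ξ = 2πk`;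
Mathlib's Fourier transform uses the phase `exp (-2πi ⟪x, k⟫)`. -/
def japSymbol (s : ℝ) (k : Space) : ℂ := ((1 + ‖(2 * Real.pi) • k‖ ^ 2) ^ (s / 2) : ℝ)

theorem japSymbol_hasTemperateGrowth (s : ℝ) : (japSymbol s).HasTemperateGrowth := by
  have h := Function.hasTemperateGrowth_one_add_norm_sq_rpow (H := Space) (s / 2)
  have h2 : (fun k : Space => (2 * Real.pi) • k).HasTemperateGrowth :=
    (((2 * Real.pi) • ContinuousLinearMap.id ℝ Space).hasTemperateGrowth)
  exact (Function.HasTemperateGrowth.comp Function.Complex.hasTemperateGrowth_ofReal h).comp h2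

/-- `⟨∇⟩^s = (1 - Δ)^{s/2}` on tempered distributions on `ℝ²`. -/
def jap (s : ℝ) : 𝓢'(Space, ℂ) →L[ℂ] 𝓢'(Space, ℂ) :=
  TemperedDistribution.fourierMultiplierCLM ℂ (japSymbol s)

/-- `⟨∇⟩^s = (1 - Δ)^{s/2}` on Schwartz functions on `ℝ²`. -/
def japS (s : ℝ) : 𝓢(Space, ℂ) →L[ℂ] 𝓢(Space, ℂ) :=
  SchwartzMap.fourierMultiplierCLM ℂ (japSymbol s)

/-- `u ∈ C(I; H^s)`, the space of bounded continuous functions `I → H^s`, where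
`H^s = ⟨∇⟩^{-s} L²(ℝ²)` carries the norm `‖⟨∇⟩^s f‖_{L²}`. The values of `u` off `I` are
irrelevant. If `I` is compact, the bound follows from continuity. -/
def MemCH (s : ℝ) (I : Set ℝ) (u : ℝ → 𝓢'(Space, ℂ)) : Prop :=
  ∃ g : ℝ → Lp ℂ 2 (volume : Measure Space),
    ContinuousOn g I ∧ (∃ C : ℝ, ∀ t ∈ I, ‖g t‖ ≤ C) ∧
      ∀ t ∈ I, jap s (u t) = (g t : 𝓢'(Space, ℂ))

open Classical in
/-- The function that represents a distribution in `L²(ℝ²)` (and `0` if the distribution is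
not in `L²`; for `φ_± ∈ H¹` and `A_{μ,±} ∈ H^{1/2}` every distribution that is multiplied
below is in `L²`). -/
def toFn (T : 𝓢'(Space, ℂ)) : Space → ℂ :=
  if h : ∃ f : Lp ℂ 2 (volume : Measure Space), (f : 𝓢'(Space, ℂ)) = T then
    (h.choose : Lp ℂ 2 (volume : Measure Space))
  else 0

/-! ### The nonlinearities

The signs `±` are the elements of `ℤˣ`; `φ 1, φ (-1)` are `φ_+, φ_-`, and `A μ 1, A μ (-1)` are
`A_{μ,+}, A_{μ,-}`. -/

/-- The diagonal of the Minkowski metric `diag (1, -1, -1)`. -/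
def metric (μ : Fin 3) : ℝ := if μ = 0 then 1 else -1

/-- The skew-symmetric tensor `ε_{μνρ}` with `ε_{012} = 1`. -/
def eps (μ ν ρ : Fin 3) : ℝ :=
  (((μ : ℕ) : ℝ) - ((ν : ℕ) : ℝ)) * (((ν : ℕ) : ℝ) - ((ρ : ℕ) : ℝ)) *
    (((ρ : ℕ) : ℝ) - ((μ : ℕ) : ℝ)) / 2

/-- `φ = φ_+ + φ_-` at time `t`; also used for `A_μ = A_{μ,+} + A_{μ,-}`. -/
def total (u : ℤˣ → ℝ → 𝓢'(Space, ℂ)) (t : ℝ) : 𝓢'(Space, ℂ) := u 1 t + u (-1) t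

/-- The first derivatives at time `t`: `∂_0 φ = i⟨∇⟩(φ_+ - φ_-)` and `∂_j φ = ∂_j (φ_+ + φ_-)`. -/
def grad (u : ℤˣ → ℝ → 𝓢'(Space, ℂ)) (t : ℝ) : Fin 3 → 𝓢'(Space, ℂ) :=
  ![Complex.I • jap 1 (u 1 t - u (-1) t), ∂_{eSp 0} (total u t), ∂_{eSp 1} (total u t)]

/-- The null form `Q_{νρ}(φ̄, φ) = ∂_ν φ̄ ∂_ρ φ - ∂_ρ φ̄ ∂_ν φ` at time `t`. -/
def nullQ (φ : ℤˣ → ℝ → 𝓢'(Space, ℂ)) (t : ℝ) (ν ρ : Fin 3) (x : Space) : ℂ :=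
  (starRingEnd ℂ) (toFn (grad φ t ν) x) * toFn (grad φ t ρ) x -
    (starRingEnd ℂ) (toFn (grad φ t ρ) x) * toFn (grad φ t ν) x

/-- `A^ρ |φ|²` at time `t`, with the index raised by the metric. -/
def cubic (A : Fin 3 → ℤˣ → ℝ → 𝓢'(Space, ℂ)) (φ : ℤˣ → ℝ → 𝓢'(Space, ℂ)) (t : ℝ)
    (ρ : Fin 3) (x : Space) : ℂ :=
  metric ρ * toFn (total (A ρ) t) x * ((‖toFn (total φ t) x‖ ^ 2 : ℝ) : ℂ)

/-- The part `-κ⁻¹ ε_{μνρ} Im Q^{νρ}(φ̄, φ) + A_μ` of `M_μ` at time `t`; it is a function. -/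
def fnM (κ : ℝ) (A : Fin 3 → ℤˣ → ℝ → 𝓢'(Space, ℂ)) (φ : ℤˣ → ℝ → 𝓢'(Space, ℂ)) (μ : Fin 3)
    (t : ℝ) (x : Space) : ℂ :=
  -(κ⁻¹ : ℝ) * ∑ ν, ∑ ρ, ((eps μ ν ρ * (metric ν * metric ρ * (nullQ φ t ν ρ x).im) : ℝ) : ℂ) +
    toFn (total (A μ) t) x

/-- `N(A, φ) = 2i A_μ ∂^μ φ + A_μ A^μ φ - φ V'(|φ|²) + φ` at time `t`; it is a function. -/
def fnN (V : Polynomial ℝ) (A : Fin 3 → ℤˣ → ℝ → 𝓢'(Space, ℂ)) (φ : ℤˣ → ℝ → 𝓢'(Space, ℂ))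
    (t : ℝ) (x : Space) : ℂ :=
  2 * Complex.I * ∑ μ, toFn (total (A μ) t) x * (metric μ * toFn (grad φ t μ) x) +
    (∑ μ, metric μ * toFn (total (A μ) t) x ^ 2) * toFn (total φ t) x -
    toFn (total φ t) x * ((V.derivative.eval (‖toFn (total φ t) x‖ ^ 2) : ℝ) : ℂ) +
    toFn (total φ t) x

/-! ### The half-wave system, in the sense of distributions -/

/-- Test functions on `I × ℝ²`: smooth functions with compact support in `(interior I) × ℝ²`. -/
def IsTest (I : Set ℝ) (ψ : 𝓢(Spacetime, ℂ)) : Prop :=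
  HasCompactSupport ψ ∧ tsupport ψ ⊆ {p : Spacetime | p 0 ∈ interior I}

/-- The distribution `⟨∇⟩^{-1} M_μ(A, φ)` on `I × ℝ²`, applied to a test function, with
`M_μ = -κ⁻¹ ε_{μνρ} Im Q^{νρ}(φ̄, φ) + 2 κ⁻¹ ε_{μνρ} ∂^ν (A^ρ |φ|²) + A_μ`. -/
def japInvM (κ : ℝ) (I : Set ℝ) (A : Fin 3 → ℤˣ → ℝ → 𝓢'(Space, ℂ)) (φ : ℤˣ → ℝ → 𝓢'(Space, ℂ))
    (μ : Fin 3) (ψ : 𝓢(Spacetime, ℂ)) : ℂ :=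
  ∫ t in I, ((∫ x, fnM κ A φ μ t x * japS (-1) (slice t ψ) x) -
    2 * (κ⁻¹ : ℝ) * ∑ ν, ∑ ρ, (eps μ ν ρ : ℂ) *
      ∫ x, cubic A φ t ρ x * (metric ν * japS (-1) (slice t (∂_{eST ν} ψ)) x))

/-- The distribution `⟨∇⟩^{-1} N(A, φ)` on `I × ℝ²`, applied to a test function. -/
def japInvN (V : Polynomial ℝ) (I : Set ℝ) (A : Fin 3 → ℤˣ → ℝ → 𝓢'(Space, ℂ))
    (φ : ℤˣ → ℝ → 𝓢'(Space, ℂ)) (ψ : 𝓢(Spacetime, ℂ)) : ℂ :=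
  ∫ t in I, ∫ x, fnN V A φ t x * japS (-1) (slice t ψ) x

/-- `(i∂_t ± ⟨∇⟩) u = ± (1/2) F` in the sense of distributions on `I × ℝ²`, where `±` is the
sign `σ`. -/
def SolvesHalfWave (I : Set ℝ) (σ : ℤˣ) (u : ℝ → 𝓢'(Space, ℂ)) (F : 𝓢(Spacetime, ℂ) → ℂ) : Prop :=
  ∀ ψ : 𝓢(Spacetime, ℂ), IsTest I ψ →
    ∫ t in I, (-Complex.I * u t (slice t (∂_{eST 0} ψ)) +
      ((σ : ℤ) : ℂ) * jap 1 (u t) (slice t ψ)) = ((σ : ℤ) : ℂ) * (1 / 2) * F ψ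

/-- `(A_{μ,±}, φ_±)` solves the half-wave form of the Chern-Simons-Higgs system on `I × ℝ²`. -/
def SolvesHalfWaveSystem (κ : ℝ) (V : Polynomial ℝ) (I : Set ℝ)
    (A : Fin 3 → ℤˣ → ℝ → 𝓢'(Space, ℂ)) (φ : ℤˣ → ℝ → 𝓢'(Space, ℂ)) : Prop :=
  (∀ μ σ, SolvesHalfWave I σ (A μ σ) (japInvM κ I A φ μ)) ∧
    ∀ σ, SolvesHalfWave I σ (φ σ) (japInvN V I A φ)

/-- The Lorenz gauge condition `∂^μ A_μ = 0` on `I`, with `∂_0 A_0 = i⟨∇⟩(A_{0,+} - A_{0,-})`. -/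
def LorenzGauge (I : Set ℝ) (A : Fin 3 → ℤˣ → ℝ → 𝓢'(Space, ℂ)) : Prop :=
  ∀ t ∈ I, ∑ μ, metric μ • grad (A μ) t μ = 0

/-! ### The spaces `X_±^{s,b}` and `X_±^{s,b}(I)` -/

/-- The weight `⟨ξ⟩^s ⟨-τ ± |ξ|⟩^b` at the space-time frequency `(τ, ξ) = 2πk`. -/
def weight (σ : ℤˣ) (s b : ℝ) (k : Spacetime) : ℝ :=
  (1 + ‖(2 * Real.pi) • spatial k‖ ^ 2) ^ (s / 2) *
    (1 + (-(2 * Real.pi * k 0) + ((σ : ℤ) : ℝ) * ‖(2 * Real.pi) • spatial k‖) ^ 2) ^ (b / 2)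

/-- `v ∈ X_±^{s,b}`: the space-time Fourier transform of `v` is a function `f` and
`⟨ξ⟩^s ⟨-τ ± |ξ|⟩^b f ∈ L²`. -/
def MemX (σ : ℤˣ) (s b : ℝ) (v : 𝓢'(Spacetime, ℂ)) : Prop :=
  ∃ f : Spacetime → ℂ, MemLp (fun k => (weight σ s b k : ℂ) * f k) 2 volume ∧
    ∀ ψ : 𝓢(Spacetime, ℂ), 𝓕 v ψ = ∫ k, f k * ψ k

/-- `u ∈ X_±^{s,b}(I)`: some `v ∈ X_±^{s,b}` equals `u` on `I × ℝ²`, as a distribution. -/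
def MemXOn (σ : ℤˣ) (s b : ℝ) (I : Set ℝ) (u : ℝ → 𝓢'(Space, ℂ)) : Prop :=
  ∃ v : 𝓢'(Spacetime, ℂ), MemX σ s b v ∧
    ∀ ψ : 𝓢(Spacetime, ℂ), IsTest I ψ → v ψ = ∫ t in I, u t (slice t ψ)

end

end CSH

/-! Write each half wave on the Fourier side as e^{iσt⟨ξ⟩} f_σ(t,ξ). Since |ξ| and ⟨ξ⟩ differ by at
most 1, the weight ⟨-τ±|ξ|⟩^{3/4} measures three quarters of a time derivative of the profile f_σ.
After a cut-off in time and Plancherel in time, it therefore suffices that f_σ is bounded in H^s and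
that ∫_0^1 δ^{-5/2} ‖f_σ(t+δ)-f_σ(t)‖²_{H^s} dδ is bounded uniformly in t. This is the class `HT`;
the passage to X^{s,3/4} is `memXOn_of_HT`. A profile that is bounded and Lipschitz in H^s is of
class `HT s`, so everything turns on ∂_t f_σ.

Product estimates alone put ∂_t f_σ only in H^{1/2-} for φ and in H^{0-} for A. The missing quarter
derivative comes from null structure together with oscillation. In the Lorenz gauge a Hodge
decomposition of the spatial potential turns A_μ∂^μφ into null forms plus a smoother rest
(`null_identity`, `roughF_eq`); the terms Q_{νρ}(φ̄,φ) are null forms already (`QF_eq`). Their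
symbols vanish with the angle θ, where θ²⟨ξ⟩⟨η⟩ = ⟨ξ⟩⟨η⟩ - σ₁σ₂ ξ·η. Expressed through profiles,
such a term carries the factor e^{itΦ} with Φ = σ₁⟨ξ⟩+σ₂⟨η⟩-σ₀⟨ξ+η⟩, and the key geometric fact
(`dl_le_ph`) is θ² ≤ 2|Φ|(⟨ξ⟩^{-1}+⟨η⟩^{-1}).

The bilinear term is cut at |Φ| = ⟨η⟩^{2κ} (`normal_form`). Where Φ is small, θ is small and the
term is estimated directly. Where Φ is large, e^{itΦ} is integrated in time: the term equals ∂_t G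
minus terms with a derivative on one of the profiles, where G has the symbol m/(iΦ). The latter
terms are estimated with the bounds on ∂_t f already known. The boundary term G is not Lipschitz in
the required space, but it need not be: three quarters of a derivative falling on e^{itΦ} cost
|Φ|^{3/4}, which leaves θ|Φ|^{-1/4} ≲ ⟨ξ⟩^{-1/4}+⟨η⟩^{-1/4}. So each profile is a sum of a Lipschitz
part and of some G of class `HT` (`Split.profile`).

This is done twice. For φ (`exists_HT_phi`) the known bounds give a Lipschitz part in H^{3/4-γ} and
a part G which is of class `HT` there and moreover bounded in H^{5/4+γ/4}. For A (`exists_HT_A`)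
this decomposition of φ is inserted into Q_{νρ}: if a factor is G, its extra smoothness makes the
term bounded in H^{-3/4} without any normal form; if both are Lipschitz parts, the normal form
applies with the better derivative bound just obtained. The regularity 1/4 is reached without loss
because the product law used for G holds at the endpoint 1/4 + 3/4 = 1 (`Adm.endpoint_left`).

The cubic term of M_μ contains a time derivative of A^ρ|φ|². It is taken classically: the sources of
the two half waves cancel in A_+ + A_- and φ_+ + φ_-, so ∂_tA and ∂_tφ are i⟨∇⟩ of differences of
half waves (`total_ode`), and ⟨∇⟩^{-1}∂_t(A^ρ|φ|²) lies in H^{1/2-}.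

All estimates are for moduli of Fourier transforms, with product laws in the form `Adm`. The
distributional system is brought to this side by testing against tensor products, which shows that
for almost every frequency the profile is a primitive in time. -/

namespace CSH

noncomputable section

section


/-! ### Japanese bracket and the geometry of the resonance function -/

/-- The bracket `⟨ξ⟩` at `ξ = 2πk`. -/
def jb (k : Space) : ℝ := Real.sqrt (1 + ‖(2 * Real.pi) • k‖ ^ 2)

/-- The coordinates of `ξ = 2πk`. -/
def fq (k : Space) (j : Fin 2) : ℝ := 2 * Real.pi * k j

theorem norm_fq_sq (k : Space) : ‖(2 * Real.pi) • k‖ ^ 2 = fq k 0 ^ 2 + fq k 1 ^ 2 := by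
  rw [EuclideanSpace.norm_eq, Real.sq_sqrt (by positivity)]
  simp [Fin.sum_univ_two, fq, mul_pow]

theorem jb_sq (k : Space) : jb k ^ 2 = 1 + (fq k 0 ^ 2 + fq k 1 ^ 2) := by
  rw [jb, Real.sq_sqrt (by positivity), norm_fq_sq]

theorem one_le_jb (k : Space) : 1 ≤ jb k := by
  rw [jb]; apply Real.one_le_sqrt.mpr; nlinarith [sq_nonneg ‖(2 * Real.pi) • k‖]

theorem jb_pos (k : Space) : 0 < jb k := lt_of_lt_of_le one_pos (one_le_jb k)

theorem jb_neg (k : Space) : jb (-k) = jb k := by simp [jb]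

theorem fq_add (k l : Space) (j : Fin 2) : fq (k + l) j = fq k j + fq l j := by
  simp [fq, mul_add]

theorem fq_neg (k : Space) (j : Fin 2) : fq (-k) j = - fq k j := by simp [fq]

theorem continuous_jb : Continuous jb := by unfold jb; fun_prop

theorem continuous_fq (j : Fin 2) : Continuous fun k => fq k j := by unfold fq; fun_prop

@[fun_prop]
theorem measurable_jb : Measurable jb := continuous_jb.measurable

@[fun_prop]
theorem measurable_fq (j : Fin 2) : Measurable fun k => fq k j := (continuous_fq j).measurable

theorem jb_rpow (k : Space) (s : ℝ) :
    (1 + ‖(2 * Real.pi) • k‖ ^ 2) ^ (s / 2) = jb k ^ s := by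
  rw [jb, Real.sqrt_eq_rpow, ← Real.rpow_mul (by positivity)]; congr 1; ring

theorem abs_fq_le_jb (k : Space) (j : Fin 2) : |fq k j| ≤ jb k := by
  apply abs_le_of_sq_le_sq _ (jb_pos k).le
  rw [jb_sq]; fin_cases j <;> simp <;> nlinarith [sq_nonneg (fq k 0), sq_nonneg (fq k 1)]

/-- The scalar product of two frequencies. -/
def ip (k l : Space) : ℝ := fq k 0 * fq l 0 + fq k 1 * fq l 1

/-- The determinant of two frequencies. -/
def wd (k l : Space) : ℝ := fq k 0 * fq l 1 - fq k 1 * fq l 0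

/-- The angular quantity `⟨ξ⟩⟨η⟩ - s ξ·η`. -/
def dl (s : ℝ) (k l : Space) : ℝ := jb k * jb l - s * ip k l

/-- The resonance function. -/
def ph (s₀ s₁ s₂ : ℝ) (k l : Space) : ℝ := s₁ * jb k + s₂ * jb l - s₀ * jb (k + l)

@[fun_prop]
theorem measurable_dl (s : ℝ) : Measurable fun p : Space × Space => dl s p.1 p.2 := by
  unfold dl ip; fun_prop

@[fun_prop]
theorem measurable_ph (s₀ s₁ s₂ : ℝ) :
    Measurable fun p : Space × Space => ph s₀ s₁ s₂ p.1 p.2 := by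
  unfold ph; fun_prop

/-- Cauchy–Schwarz for (1, ξ) and (1, ±η), proved with Lagrange's identity. The summand 1 is what
makes `dl` at least 1 for both signs, so no frequencies have to be excluded later. -/
theorem jb_mul_ge (k l : Space) : 1 + |ip k l| ≤ jb k * jb l := by
  have hk := jb_pos k
  have hl := jb_pos l
  apply le_of_sq_le_sq _ (by positivity)
  rw [mul_pow, jb_sq, jb_sq]
  have h1 : ip k l ^ 2 + wd k l ^ 2
      = (fq k 0 ^ 2 + fq k 1 ^ 2) * (fq l 0 ^ 2 + fq l 1 ^ 2) := by
    unfold ip wd; ring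
  have h2 : 2 * |ip k l| ≤ (fq k 0 ^ 2 + fq k 1 ^ 2) + (fq l 0 ^ 2 + fq l 1 ^ 2) := by
    rcases abs_cases (ip k l) with ⟨h, _⟩ | ⟨h, _⟩ <;> rw [h] <;> unfold ip <;>
    nlinarith [sq_nonneg (fq k 0 - fq l 0), sq_nonneg (fq k 1 - fq l 1),
      sq_nonneg (fq k 0 + fq l 0), sq_nonneg (fq k 1 + fq l 1)]
  nlinarith [sq_abs (ip k l), sq_nonneg (wd k l)]

theorem abs_mul_of_sq {s : ℝ} (hs : s ^ 2 = 1) (x : ℝ) : |s * x| = |x| := by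
  have : |s| = 1 := by rw [← sq_eq_sq₀ (abs_nonneg _) zero_le_one, sq_abs, hs]; simp
  rw [abs_mul, this, one_mul]

theorem eq_one_or_neg_one {s : ℝ} (hs : s ^ 2 = 1) : s = 1 ∨ s = -1 := by
  have : (s - 1) * (s + 1) = 0 := by linarith [show (s - 1) * (s + 1) = s ^ 2 - 1 by ring]
  rcases mul_eq_zero.mp this with h | h
  · left; linarith
  · right; linarith

theorem one_le_dl {s : ℝ} (hs : s ^ 2 = 1) (k l : Space) : 1 ≤ dl s k l := by
  have := jb_mul_ge k l
  have h := le_abs_self (s * ip k l)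
  rw [abs_mul_of_sq hs] at h
  unfold dl; linarith

theorem dl_le {s : ℝ} (hs : s ^ 2 = 1) (k l : Space) : dl s k l ≤ 2 * (jb k * jb l) := by
  have := jb_mul_ge k l
  have h := neg_abs_le (s * ip k l)
  rw [abs_mul_of_sq hs] at h
  unfold dl; linarith

/-- By Lagrange's identity wd² ≤ (⟨ξ⟩⟨η⟩)² - (ξ·η)², and the right side factors as dl · (2⟨ξ⟩⟨η⟩ -
dl). The same bound holds for both signs, as the sine of the angle does not see them. -/
theorem wd_sq_le {s : ℝ} (hs : s ^ 2 = 1) (k l : Space) :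
    wd k l ^ 2 ≤ 2 * (jb k * jb l) * dl s k l := by
  have h1 : ip k l ^ 2 + wd k l ^ 2 = (jb k ^ 2 - 1) * (jb l ^ 2 - 1) := by
    rw [jb_sq, jb_sq]; unfold ip wd; ring
  have h2 := dl_le hs k l
  have h3 := one_le_dl hs k l
  have h4 := one_le_jb k
  have h5 := one_le_jb l
  have h6 : (s * ip k l) ^ 2 = ip k l ^ 2 := by rw [mul_pow, hs, one_mul]
  have h7 : wd k l ^ 2 ≤ dl s k l * (2 * (jb k * jb l) - dl s k l) := by
    have : dl s k l * (2 * (jb k * jb l) - dl s k l) = (jb k * jb l) ^ 2 - ip k l ^ 2 := by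
      rw [← h6]; unfold dl; ring
    rw [this]; nlinarith
  nlinarith

/-- Expanding the squares and summing over the two coordinates gives exactly 2⟨ξ⟩⟨η⟩ dl - ⟨ξ⟩² -
⟨η⟩². This is the bound for the null forms that contain one time derivative. -/
theorem null_sq_le {s₁ s₂ : ℝ} (h1 : s₁ ^ 2 = 1) (h2 : s₂ ^ 2 = 1) (k l : Space) (j : Fin 2) :
    (s₁ * jb k * fq l j - s₂ * jb l * fq k j) ^ 2 ≤ 2 * (jb k * jb l) * dl (s₁ * s₂) k l := by
  have key : ∑ j : Fin 2, (s₁ * jb k * fq l j - s₂ * jb l * fq k j) ^ 2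
      = 2 * (jb k * jb l) * dl (s₁ * s₂) k l - jb k ^ 2 - jb l ^ 2 := by
    have e : ∑ j : Fin 2, (s₁ * jb k * fq l j - s₂ * jb l * fq k j) ^ 2
      = s₁ ^ 2 * jb k ^ 2 * (jb l ^ 2 - 1) + s₂ ^ 2 * jb l ^ 2 * (jb k ^ 2 - 1)
        - 2 * (s₁ * s₂) * jb k * jb l * ip k l := by
      have a := jb_sq k
      have b := jb_sq l
      rw [show jb l ^ 2 - 1 = fq l 0 ^ 2 + fq l 1 ^ 2 by linarith,
        show jb k ^ 2 - 1 = fq k 0 ^ 2 + fq k 1 ^ 2 by linarith]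
      simp only [Fin.sum_univ_two, ip]; ring
    rw [e, h1, h2]; unfold dl; ring
  have := Finset.single_le_sum (f := fun j : Fin 2 => (s₁ * jb k * fq l j - s₂ * jb l * fq k j) ^ 2)
    (fun i _ => sq_nonneg _) (Finset.mem_univ j)
  nlinarith [sq_nonneg (jb k), sq_nonneg (jb l)]

theorem jb_add_le (k l : Space) : jb (k + l) ≤ jb k + jb l := by
  have hk := jb_pos k
  have hl := jb_pos l
  apply le_of_sq_le_sq _ (by positivity)
  have := jb_mul_ge k l
  have h := le_abs_self (ip k l)
  have a := jb_sq k
  have b := jb_sq l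
  rw [jb_sq, fq_add, fq_add]
  unfold ip at *
  nlinarith

/-- Difference of squares: Φ times its conjugate s₁⟨ξ⟩ + s₂⟨η⟩ + s₀⟨ξ+η⟩ is 1 + 2s₁s₂ dl, and the
conjugate is at most 2(⟨ξ⟩+⟨η⟩). When s₁s₂ = -1 the bound dl ≥ 1 absorbs the 1. A small phase thus
forces a small angle, which is the source of every gain below. -/
theorem dl_le_ph {s₀ s₁ s₂ : ℝ} (h0 : s₀ ^ 2 = 1) (h1 : s₁ ^ 2 = 1) (h2 : s₂ ^ 2 = 1)
    (k l : Space) :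
    dl (s₁ * s₂) k l ≤ 2 * (jb k + jb l) * |ph s₀ s₁ s₂ k l| := by
  have h12 : (s₁ * s₂) ^ 2 = 1 := by rw [mul_pow, h1, h2, one_mul]
  have hD := one_le_dl h12 k l
  have key : ph s₀ s₁ s₂ k l * (s₁ * jb k + s₂ * jb l + s₀ * jb (k + l))
      = 1 + 2 * (s₁ * s₂) * dl (s₁ * s₂) k l := by
    have e : ph s₀ s₁ s₂ k l * (s₁ * jb k + s₂ * jb l + s₀ * jb (k + l))
      = s₁ ^ 2 * jb k ^ 2 + s₂ ^ 2 * jb l ^ 2 + 2 * (s₁ * s₂) * (jb k * jb l)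
        - s₀ ^ 2 * jb (k + l) ^ 2 := by
      unfold ph; ring
    have e2 : 2 * (s₁ * s₂) * dl (s₁ * s₂) k l
        = 2 * (s₁ * s₂) * (jb k * jb l) - 2 * (s₁ * s₂) ^ 2 * ip k l := by
      unfold dl; ring
    rw [e, e2, h0, h1, h2, h12, jb_sq, jb_sq, jb_sq, fq_add, fq_add]
    unfold ip; ring
  have habs : dl (s₁ * s₂) k l ≤ |1 + 2 * (s₁ * s₂) * dl (s₁ * s₂) k l| := by
    rcases eq_one_or_neg_one h12 with h | h
    · rw [h] at hD ⊢; exact le_trans (by linarith) (le_abs_self _)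
    · rw [h] at hD ⊢; exact le_trans (by linarith) (neg_le_abs _)
  have h3 : |s₁ * jb k + s₂ * jb l + s₀ * jb (k + l)| ≤ 2 * (jb k + jb l) := by
    refine (abs_add_three _ _ _).trans ?_
    rw [abs_mul_of_sq h0, abs_mul_of_sq h1, abs_mul_of_sq h2, abs_of_pos (jb_pos _),
      abs_of_pos (jb_pos _), abs_of_pos (jb_pos _)]
    linarith [jb_add_le k l]
  rw [← key, abs_mul] at habs
  nlinarith [abs_nonneg (ph s₀ s₁ s₂ k l)]

/-! ### Consequences for the symbols -/

/-- Here and in the next two lemmas x, y are the brackets, D = dl and P = |Φ|, so that the root is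
the angle θ and `dl_le_ph` reads θ² ≤ 2P(1/x + 1/y). This version serves the region of small phase.
-/
theorem theta_small {x y D P K : ℝ} (hx : 1 ≤ x) (hy : 1 ≤ y) (hK : 0 < K)
    (hDP : D ≤ 2 * (x + y) * P) (hP : P ≤ K) :
    Real.sqrt (D / (x * y)) ≤ 2 * K ^ (1 / 2 : ℝ) * (x ^ (-(1 / 2) : ℝ) + y ^ (-(1 / 2) : ℝ)) := by
  have hx0 : 0 < x := by linarith
  have hy0 : 0 < y := by linarith
  have hu := Real.rpow_pos_of_pos hx0 (-(1 / 2))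
  have hv := Real.rpow_pos_of_pos hy0 (-(1 / 2))
  have hw := Real.rpow_pos_of_pos hK (1 / 2)
  apply Real.sqrt_le_iff.mpr ⟨by positivity, ?_⟩
  have eu : (x ^ (-(1 / 2) : ℝ)) ^ 2 = x⁻¹ := by
    rw [← Real.rpow_natCast, ← Real.rpow_mul hx0.le]; norm_num [Real.rpow_neg_one]
  have ev : (y ^ (-(1 / 2) : ℝ)) ^ 2 = y⁻¹ := by
    rw [← Real.rpow_natCast, ← Real.rpow_mul hy0.le]; norm_num [Real.rpow_neg_one]
  have ew : (K ^ (1 / 2 : ℝ)) ^ 2 = K := by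
    rw [← Real.rpow_natCast, ← Real.rpow_mul hK.le]; norm_num
  have h1 : D / (x * y) ≤ 2 * K * (x⁻¹ + y⁻¹) := by
    rw [div_le_iff₀ (by positivity)]
    have : 2 * K * (x⁻¹ + y⁻¹) * (x * y) = 2 * (x + y) * K := by field_simp; ring
    rw [this]
    exact hDP.trans (by gcongr)
  refine h1.trans ?_
  rw [mul_pow, mul_pow, ew, add_sq, eu, ev]
  have : 0 < x⁻¹ := by positivity
  have : 0 < y⁻¹ := by positivity
  have : 0 < 2 * x ^ (-(1 / 2) : ℝ) * y ^ (-(1 / 2) : ℝ) := by positivity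
  nlinarith

/-- For the region of large phase: `theta_small` with K = P gives θ/P ≲ P^{-1/2}(x^{-1/2}+y^{-1/2}),
which decreases in P. -/
theorem theta_div {x y D P K : ℝ} (hx : 1 ≤ x) (hy : 1 ≤ y) (hK : 0 < K)
    (hDP : D ≤ 2 * (x + y) * P) (hP : K ≤ P) :
    Real.sqrt (D / (x * y)) / P
      ≤ 2 * K ^ (-(1 / 2) : ℝ) * (x ^ (-(1 / 2) : ℝ) + y ^ (-(1 / 2) : ℝ)) := by
  have hx0 : 0 < x := by linarith
  have hy0 : 0 < y := by linarith
  have hP0 : 0 < P := by linarith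
  have h := theta_small hx hy hP0 hDP le_rfl
  rw [div_le_iff₀ hP0]
  have e : P ^ (1 / 2 : ℝ) = P ^ (-(1 / 2) : ℝ) * P := by
    nth_rewrite 3 [← Real.rpow_one P]
    rw [← Real.rpow_add hP0]; norm_num
  have h2 : P ^ (-(1 / 2) : ℝ) ≤ K ^ (-(1 / 2) : ℝ) :=
    Real.rpow_le_rpow_of_nonpos hK hP (by norm_num)
  have hu := Real.rpow_pos_of_pos hx0 (-(1 / 2))
  have hv := Real.rpow_pos_of_pos hy0 (-(1 / 2))
  refine h.trans ?_
  rw [e]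
  calc _ = 2 * P ^ (-(1 / 2) : ℝ) * (x ^ (-(1 / 2) : ℝ) + y ^ (-(1 / 2) : ℝ)) * P := by ring
    _ ≤ _ := by gcongr

/-- Interpolation: of θ = (θ²)^{1/2}, the power 1/4 - η of θ² is spent on the bound by P, where it
cancels P^{-1/4+η}; the rest is controlled by θ² ≤ 2. It is this that leaves a quarter derivative
after |Φ|^{3/4} is lost in the boundary term of the normal form. -/
theorem theta_holder {x y D P η : ℝ} (hx : 1 ≤ x) (hy : 1 ≤ y) (hD : 1 ≤ D)
    (hD2 : D ≤ 2 * (x * y)) (hη : 0 ≤ η) (hη' : η ≤ 1 / 4)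
    (hDP : D ≤ 2 * (x + y) * P) :
    Real.sqrt (D / (x * y)) * P ^ (-(1 / 4) + η)
      ≤ 4 * (x ^ (-(1 / 4) + η) + y ^ (-(1 / 4) + η)) := by
  have hx0 : 0 < x := by linarith
  have hy0 : 0 < y := by linarith
  -- The phase cannot vanish, since D ≥ 1.
  have hP0 : 0 < P := by
    by_contra h
    push Not at h
    nlinarith
  set T := D / (x * y) with hT
  have hT0 : 0 < T := by positivity
  have hT2 : T ≤ 2 := by rw [hT, div_le_iff₀ (by positivity)]; linarith
  have hTP : T ≤ 2 * P * (x⁻¹ + y⁻¹) := by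
    rw [hT, div_le_iff₀ (by positivity)]
    have : 2 * P * (x⁻¹ + y⁻¹) * (x * y) = 2 * (x + y) * P := by field_simp; ring
    rw [this]; exact hDP
  have e1 : Real.sqrt T = T ^ (1 / 4 - η) * T ^ (1 / 4 + η) := by
    rw [← Real.rpow_add hT0, Real.sqrt_eq_rpow]; congr 1; ring
  have e2 : T ^ (1 / 4 - η) ≤ 2 ^ (1 / 4 - η) * P ^ (1 / 4 - η) *
      (x ^ (-(1 / 4) + η) + y ^ (-(1 / 4) + η)) := by
    have hb : (x⁻¹ + y⁻¹) ^ (1 / 4 - η) ≤ x⁻¹ ^ (1 / 4 - η) + y⁻¹ ^ (1 / 4 - η) :=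
      Real.rpow_add_le_add_rpow (by positivity) (by positivity) (by linarith) (by linarith)
    rw [Real.inv_rpow hx0.le, Real.inv_rpow hy0.le, ← Real.rpow_neg hx0.le,
      ← Real.rpow_neg hy0.le] at hb
    calc T ^ (1 / 4 - η) ≤ (2 * P * (x⁻¹ + y⁻¹)) ^ (1 / 4 - η) :=
          Real.rpow_le_rpow hT0.le hTP (by linarith)
      _ = 2 ^ (1 / 4 - η) * P ^ (1 / 4 - η) * (x⁻¹ + y⁻¹) ^ (1 / 4 - η) := by
          rw [Real.mul_rpow (by positivity) (by positivity), Real.mul_rpow (by norm_num) hP0.le]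
      _ ≤ _ := by
          have : -(1 / 4 - η) = -(1 / 4) + η := by ring
          rw [this] at hb
          gcongr
  have e3 : T ^ (1 / 4 + η) ≤ 2 ^ (1 / 4 + η) := Real.rpow_le_rpow hT0.le hT2 (by linarith)
  have e4 : P ^ (1 / 4 - η) * P ^ (-(1 / 4) + η) = 1 := by
    rw [← Real.rpow_add hP0]; norm_num
  have e5 : (2:ℝ) ^ (1 / 4 - η) * 2 ^ (1 / 4 + η) ≤ 4 := by
    rw [← Real.rpow_add two_pos]
    calc (2:ℝ) ^ (1 / 4 - η + (1 / 4 + η)) ≤ 2 ^ (2:ℝ) :=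
          Real.rpow_le_rpow_of_exponent_le one_le_two (by linarith)
      _ = 4 := by norm_num
  have hu := Real.rpow_pos_of_pos hx0 (-(1 / 4) + η)
  have hv := Real.rpow_pos_of_pos hy0 (-(1 / 4) + η)
  have hp := Real.rpow_pos_of_pos hP0 (-(1 / 4) + η)
  calc Real.sqrt T * P ^ (-(1 / 4) + η)
      = T ^ (1 / 4 - η) * T ^ (1 / 4 + η) * P ^ (-(1 / 4) + η) := by rw [e1]
    _ ≤ (2 ^ (1 / 4 - η) * P ^ (1 / 4 - η) *
      (x ^ (-(1 / 4) + η) + y ^ (-(1 / 4) + η))) * 2 ^ (1 / 4 + η) * P ^ (-(1 / 4) + η) := by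
        gcongr
    _ = (2 ^ (1 / 4 - η) * 2 ^ (1 / 4 + η)) * (P ^ (1 / 4 - η) * P ^ (-(1 / 4) + η)) *
      (x ^ (-(1 / 4) + η) + y ^ (-(1 / 4) + η)) := by ring
    _ ≤ _ := by rw [e4, mul_one]; gcongr

/-! ### Trilinear weights -/

/-- With nonnegative exponents all three bases may be lowered to the smallest one. -/
theorem weight_nonneg {u v w x y z : ℝ} (hu : 1 ≤ u) (hv : 1 ≤ v) (hw : 1 ≤ w)
    (hx : 0 ≤ x) (hy : 0 ≤ y) (hz : 0 ≤ z) :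
    u ^ (-x) * v ^ (-y) * w ^ (-z)
      ≤ u ^ (-(x + y + z)) + v ^ (-(x + y + z)) + w ^ (-(x + y + z)) := by
  have key : ∀ m : ℝ, 1 ≤ m → m ≤ u → m ≤ v → m ≤ w →
      u ^ (-x) * v ^ (-y) * w ^ (-z) ≤ m ^ (-(x + y + z)) := by
    intro m hm h1 h2 h3
    have hm0 : 0 < m := by linarith
    have a := Real.rpow_le_rpow_of_nonpos hm0 h1 (neg_nonpos.mpr hx)
    have b := Real.rpow_le_rpow_of_nonpos hm0 h2 (neg_nonpos.mpr hy)
    have c := Real.rpow_le_rpow_of_nonpos hm0 h3 (neg_nonpos.mpr hz)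
    have : m ^ (-(x + y + z)) = m ^ (-x) * m ^ (-y) * m ^ (-z) := by
      rw [← Real.rpow_add hm0, ← Real.rpow_add hm0]; congr 1; ring
    rw [this]
    gcongr
  have pu : 0 ≤ u ^ (-(x + y + z)) := by positivity
  have pv : 0 ≤ v ^ (-(x + y + z)) := by positivity
  have pw : 0 ≤ w ^ (-(x + y + z)) := by positivity
  rcases le_total u v with h | h <;> rcases le_total v w with h' | h' <;>
    rcases le_total u w with h'' | h''
  all_goals first
    | (have := key u hu le_rfl (by linarith) (by linarith); linarith)
    | (have := key v hv (by linarith) le_rfl (by linarith); linarith)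
    | (have := key w hw (by linarith) (by linarith) le_rfl; linarith)

/-- A growing power of u is passed on to v or w through u ≤ v + w; the sums x + y and x + z being
nonnegative, this reduces to the case of nonnegative exponents. -/
theorem weight_neg {u v w x y z : ℝ} (hu : 1 ≤ u) (hv : 1 ≤ v) (hw : 1 ≤ w)
    (huvw : u ≤ v + w) (hx : x ≤ 0) (hxy : 0 ≤ x + y) (hxz : 0 ≤ x + z) :
    u ^ (-x) * v ^ (-y) * w ^ (-z)
      ≤ 2 * 2 ^ (-x) * (u ^ (-(x + y + z)) + v ^ (-(x + y + z)) + w ^ (-(x + y + z))) := by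
  have hv0 : 0 < v := by linarith
  have hw0 : 0 < w := by linarith
  have h1 : u ^ (-x) ≤ 2 ^ (-x) * (v ^ (-x) + w ^ (-x)) := by
    have pv : 0 ≤ v ^ (-x) := by positivity
    have pw : 0 ≤ w ^ (-x) := by positivity
    rcases le_total v w with h | h
    · calc u ^ (-x) ≤ (2 * w) ^ (-x) :=
            Real.rpow_le_rpow (by linarith) (by linarith) (by linarith)
        _ = 2 ^ (-x) * w ^ (-x) := Real.mul_rpow (by norm_num) hw0.le
        _ ≤ _ := by gcongr; linarith
    · calc u ^ (-x) ≤ (2 * v) ^ (-x) :=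
            Real.rpow_le_rpow (by linarith) (by linarith) (by linarith)
        _ = 2 ^ (-x) * v ^ (-x) := Real.mul_rpow (by norm_num) hv0.le
        _ ≤ _ := by gcongr; linarith
  have a := weight_nonneg hu hv hw le_rfl hxy (by linarith : 0 ≤ z)
  have b := weight_nonneg hu hv hw le_rfl (by linarith : 0 ≤ y) hxz
  rw [neg_zero, Real.rpow_zero, one_mul, show 0 + (x + y) + z = x + y + z by ring] at a
  rw [neg_zero, Real.rpow_zero, one_mul, show 0 + y + (x + z) = x + y + z by ring] at b
  have ev : v ^ (-(x + y)) = v ^ (-x) * v ^ (-y) := by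
    rw [← Real.rpow_add hv0]; congr 1; ring
  have ew : w ^ (-(x + z)) = w ^ (-x) * w ^ (-z) := by
    rw [← Real.rpow_add hw0]; congr 1; ring
  rw [ev] at a
  rw [ew] at b
  calc u ^ (-x) * v ^ (-y) * w ^ (-z)
      ≤ (2 ^ (-x) * (v ^ (-x) + w ^ (-x))) * v ^ (-y) * w ^ (-z) := by gcongr
    _ = 2 ^ (-x) * (v ^ (-x) * v ^ (-y) * w ^ (-z) + v ^ (-y) * (w ^ (-x) * w ^ (-z))) := by ring
    _ ≤ 2 ^ (-x) * ((u ^ (-(x + y + z)) + v ^ (-(x + y + z)) + w ^ (-(x + y + z))) +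
        (u ^ (-(x + y + z)) + v ^ (-(x + y + z)) + w ^ (-(x + y + z)))) := by gcongr
    _ = _ := by ring

/-- The admissible exponents for the product law `H^y · H^z ⊂ H^{-x}` on `ℝ²`. -/
structure Expo (x y z : ℝ) : Prop where
  sum : 1 < x + y + z
  xy : 0 ≤ x + y
  xz : 0 ≤ x + z
  yz : 0 ≤ y + z

/-- The pairwise conditions allow at most one negative exponent, and the triangle inequality holds
whichever of ξ + η, ξ, η plays the dominated role. The effect is to put the whole decay, of total
order above 1, on a single frequency. -/
theorem Expo.weight {x y z : ℝ} (h : Expo x y z) :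
    ∃ C : ℝ, 0 < C ∧ ∀ k l : Space, jb (k + l) ^ (-x) * jb k ^ (-y) * jb l ^ (-z)
      ≤ C * (jb (k + l) ^ (-(x + y + z)) + jb k ^ (-(x + y + z)) + jb l ^ (-(x + y + z))) := by
  obtain ⟨hs, hxy, hxz, hyz⟩ := h
  have tri1 : ∀ k l : Space, jb k ≤ jb (k + l) + jb l := fun k l => by
    have := jb_add_le (k + l) (-l); rwa [jb_neg, add_neg_cancel_right] at this
  have tri2 : ∀ k l : Space, jb l ≤ jb (k + l) + jb k := fun k l => by
    have := jb_add_le (k + l) (-k); rwa [jb_neg, add_comm k l, add_neg_cancel_right, add_comm l k] at this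
  by_cases hx : x ≤ 0
  · refine ⟨2 * 2 ^ (-x), by positivity, fun k l => ?_⟩
    exact weight_neg (one_le_jb _) (one_le_jb _) (one_le_jb _) (jb_add_le k l) hx hxy hxz
  by_cases hy : y ≤ 0
  · refine ⟨2 * 2 ^ (-y), by positivity, fun k l => ?_⟩
    have := weight_neg (z := z) (one_le_jb k) (one_le_jb (k + l)) (one_le_jb l) (tri1 k l) hy
      (by linarith : 0 ≤ y + x) hyz
    rw [add_comm y x] at this
    linarith
  by_cases hz : z ≤ 0
  · refine ⟨2 * 2 ^ (-z), by positivity, fun k l => ?_⟩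
    have := weight_neg (z := y) (one_le_jb l) (one_le_jb (k + l)) (one_le_jb k) (tri2 k l) hz
      (by linarith : 0 ≤ z + x) (by linarith)
    rw [show z + x + y = x + y + z by ring] at this
    linarith
  · refine ⟨1, one_pos, fun k l => ?_⟩
    rw [one_mul]
    exact weight_nonneg (one_le_jb _) (one_le_jb _) (one_le_jb _) (by linarith) (by linarith)
      (by linarith)

end

section


/-! ### Weighted square norms -/

/-- The weight `⟨ξ⟩^s` with values in `[0, ∞]`. -/
def wt (s : ℝ) (k : Space) : ℝ≥0∞ := ENNReal.ofReal (jb k ^ s)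

@[fun_prop]
theorem measurable_wt (s : ℝ) : Measurable (wt s) := by unfold wt; fun_prop

theorem wt_ne_top (s : ℝ) (k : Space) : wt s k ≠ ∞ := ENNReal.ofReal_ne_top

theorem wt_pos (s : ℝ) (k : Space) : 0 < wt s k :=
  ENNReal.ofReal_pos.mpr (Real.rpow_pos_of_pos (jb_pos k) s)

theorem wt_add (s t : ℝ) (k : Space) : wt (s + t) k = wt s k * wt t k := by
  rw [wt, wt, wt, Real.rpow_add (jb_pos k),
    ENNReal.ofReal_mul (Real.rpow_nonneg (jb_pos k).le _)]

theorem wt_zero (k : Space) : wt 0 k = 1 := by simp [wt]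

theorem wt_mul_neg (s : ℝ) (k : Space) : wt s k * wt (-s) k = 1 := by
  rw [← wt_add, add_neg_cancel, wt_zero]

theorem wt_mono {s t : ℝ} (h : s ≤ t) (k : Space) : wt s k ≤ wt t k :=
  ENNReal.ofReal_le_ofReal (Real.rpow_le_rpow_of_exponent_le (one_le_jb k) h)

theorem wt_neg (s : ℝ) (k : Space) : wt s (-k) = wt s k := by simp [wt, jb_neg]

/-- The square of the norm of `F` in the weighted space `L²(⟨ξ⟩^{2s})`. -/
def wn (s : ℝ) (F : Space → ℝ≥0∞) : ℝ≥0∞ := ∫⁻ k, (wt s k * F k) ^ 2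

theorem wn_mono {s t : ℝ} (h : s ≤ t) {F G : Space → ℝ≥0∞} (hFG : ∀ k, F k ≤ G k) :
    wn s F ≤ wn t G :=
  lintegral_mono fun k => by gcongr; exacts [wt_mono h k, hFG k]

theorem wn_mono_ae {s : ℝ} {F G : Space → ℝ≥0∞} (hFG : ∀ᵐ k, F k ≤ G k) :
    wn s F ≤ wn s G :=
  lintegral_mono_ae (by filter_upwards [hFG] with k hk; gcongr)

theorem add_sq_le_ennreal (x y : ℝ≥0∞) : (x + y) ^ 2 ≤ 2 * (x ^ 2 + y ^ 2) := by
  have := ENNReal.rpow_add_le_mul_rpow_add_rpow x y (p := 2) (by norm_num)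
  norm_num at this
  exact this

theorem wn_add_le {s : ℝ} {F G : Space → ℝ≥0∞} (hF : Measurable F) :
    wn s (fun k => F k + G k) ≤ 2 * (wn s F + wn s G) := by
  unfold wn
  rw [← lintegral_add_left (by fun_prop), ← lintegral_const_mul' _ _ (by simp)]
  apply lintegral_mono fun k => ?_
  rw [mul_add]
  exact add_sq_le_ennreal _ _

theorem wn_const_mul {s : ℝ} {C : ℝ≥0∞} (hC : C ≠ ∞) {F : Space → ℝ≥0∞} :
    wn s (fun k => C * F k) = C ^ 2 * wn s F := by
  unfold wn
  rw [← lintegral_const_mul' _ _ (by finiteness)]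
  congr 1; ext k; ring

theorem wn_wt_mul {s t : ℝ} {F : Space → ℝ≥0∞} :
    wn s (fun k => wt t k * F k) = wn (s + t) F := by
  unfold wn
  congr 1; ext k; rw [wt_add, mul_assoc]

theorem lintegral_mul_sq_le {α : Type*} [MeasurableSpace α] {μ : Measure α} {f g : α → ℝ≥0∞}
    (hf : AEMeasurable f μ) (hg : AEMeasurable g μ) :
    (∫⁻ x, f x * g x ∂μ) ^ 2 ≤ (∫⁻ x, f x ^ 2 ∂μ) * ∫⁻ x, g x ^ 2 ∂μ := by
  have h := ENNReal.lintegral_mul_le_Lp_mul_Lq μ Real.HolderConjugate.two_two hf hg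
  simp only [Pi.mul_apply, ENNReal.rpow_two] at h
  calc (∫⁻ x, f x * g x ∂μ) ^ 2 ≤ _ := pow_le_pow_left₀ zero_le h 2
    _ = _ := by
      rw [mul_pow, ← ENNReal.rpow_natCast, ← ENNReal.rpow_natCast, ← ENNReal.rpow_mul,
        ← ENNReal.rpow_mul]
      norm_num

theorem lintegral_wt_sq_lt_top {p : ℝ} (hp : 1 < p) : ∫⁻ k, wt (-p) k ^ 2 < ∞ := by
  have h := integrable_rpow_neg_one_add_norm_sq (E := Space) (μ := volume) (r := 2 * p)
    (by simp; linarith)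
  have h2 := h.comp_smul (R := 2 * Real.pi) (by positivity)
  refine lt_of_le_of_lt (lintegral_mono fun k => ?_) h2.lintegral_lt_top
  rw [show -(2 * p) / 2 = (-(2 * p)) / 2 by ring, jb_rpow, wt,
    ← ENNReal.ofReal_pow (Real.rpow_nonneg (jb_pos k).le _), ← Real.rpow_natCast,
    ← Real.rpow_mul (jb_pos k).le]
  apply le_of_eq
  congr 2; push_cast; ring

/-! ### Convolutions -/

/-- Convolution with a bilinear symbol. -/
def cv (N : Space → Space → ℝ≥0∞) (F G : Space → ℝ≥0∞) (k : Space) : ℝ≥0∞ :=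
  ∫⁻ l, N l (k - l) * (F l * G (k - l))

theorem measurable_cv {N : Space → Space → ℝ≥0∞} (hN : Measurable fun p : Space × Space => N p.1 p.2)
    {F G : Space → ℝ≥0∞} (hF : Measurable F) (hG : Measurable G) : Measurable (cv N F G) := by
  unfold cv
  apply Measurable.lintegral_prod_right' (f := fun p : Space × Space =>
    N p.2 (p.1 - p.2) * (F p.2 * G (p.1 - p.2)))
  have h : Measurable fun p : Space × Space => N p.2 (p.1 - p.2) :=
    hN.comp (measurable_snd.prodMk (measurable_fst.sub measurable_snd))
  fun_prop

theorem cv_swap (N : Space → Space → ℝ≥0∞) (F G : Space → ℝ≥0∞) (k : Space) :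
    cv N F G k = cv (fun x y => N y x) G F k := by
  unfold cv
  rw [← lintegral_sub_left_eq_self _ k]
  congr 1; ext l
  rw [sub_sub_cancel, mul_comm (G l)]

/-- The bilinear operator with symbol `N` maps `H^{s₁} × H^{s₂}` into `H^r`, on the level of the
moduli of the Fourier transforms. -/
def Adm (r s₁ s₂ : ℝ) (N : Space → Space → ℝ≥0∞) : Prop :=
  ∃ C : ℝ≥0∞, C ≠ ∞ ∧ ∀ F G : Space → ℝ≥0∞, Measurable F → Measurable G →
    wn r (cv N F G) ≤ C * (wn s₁ F * wn s₂ G)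

theorem cv_mono {N N' : Space → Space → ℝ≥0∞} (h : ∀ k l, N k l ≤ N' k l) {F G F' G' : Space → ℝ≥0∞}
    (hF : ∀ k, F k ≤ F' k) (hG : ∀ k, G k ≤ G' k) (k : Space) : cv N F G k ≤ cv N' F' G' k :=
  lintegral_mono fun l => by gcongr; exacts [h _ _, hF _, hG _]

theorem Adm.mono {r s₁ s₂ r' s₁' s₂' : ℝ} {N N' : Space → Space → ℝ≥0∞} (h : Adm r s₁ s₂ N)
    (hr : r' ≤ r) (h1 : s₁ ≤ s₁') (h2 : s₂ ≤ s₂') (hN : ∀ k l, N' k l ≤ N k l) :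
    Adm r' s₁' s₂' N' := by
  obtain ⟨C, hC, h⟩ := h
  refine ⟨C, hC, fun F G hF hG => ?_⟩
  refine (wn_mono hr (cv_mono hN (fun _ => le_rfl) (fun _ => le_rfl))).trans
    ((h F G hF hG).trans ?_)
  gcongr
  · exact wn_mono h1 fun _ => le_rfl
  · exact wn_mono h2 fun _ => le_rfl

theorem Adm.add {r s₁ s₂ : ℝ} {N N' : Space → Space → ℝ≥0∞} (h : Adm r s₁ s₂ N)
    (h' : Adm r s₁ s₂ N') (hN : Measurable fun p : Space × Space => N p.1 p.2) :
    Adm r s₁ s₂ (fun k l => N k l + N' k l) := by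
  obtain ⟨C, hC, h⟩ := h
  obtain ⟨C', hC', h'⟩ := h'
  refine ⟨2 * (C + C'), by finiteness, fun F G hF hG => ?_⟩
  have e : cv (fun k l => N k l + N' k l) F G = fun k => cv N F G k + cv N' F G k := by
    ext k
    unfold cv
    rw [← lintegral_add_left]
    · congr 1; ext l; ring
    · have : Measurable fun l : Space => N l (k - l) :=
        hN.comp (measurable_id.prodMk (measurable_const.sub measurable_id))
      fun_prop
  rw [e]
  refine (wn_add_le (measurable_cv hN hF hG)).trans ?_
  rw [mul_assoc, add_mul]
  gcongr
  · exact h F G hF hG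
  · exact h' F G hF hG

theorem Adm.const_mul {r s₁ s₂ : ℝ} {N : Space → Space → ℝ≥0∞} (h : Adm r s₁ s₂ N) {c : ℝ≥0∞}
    (hc : c ≠ ∞) : Adm r s₁ s₂ (fun k l => c * N k l) := by
  obtain ⟨C, hC, h⟩ := h
  refine ⟨c ^ 2 * C, by finiteness, fun F G hF hG => ?_⟩
  have e : cv (fun k l => c * N k l) F G = fun k => c * cv N F G k := by
    ext k
    unfold cv
    rw [← lintegral_const_mul' _ _ hc]
    congr 1; ext l; ring
  rw [e, wn_const_mul hc, mul_assoc]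
  gcongr
  exact h F G hF hG

theorem Adm.weights {r s₁ s₂ a b : ℝ} {N : Space → Space → ℝ≥0∞} (h : Adm r s₁ s₂ N) :
    Adm r (s₁ + a) (s₂ + b) (fun k l => wt a k * wt b l * N k l) := by
  obtain ⟨C, hC, h⟩ := h
  refine ⟨C, hC, fun F G hF hG => ?_⟩
  have := h (fun k => wt a k * F k) (fun k => wt b k * G k) (by fun_prop) (by fun_prop)
  rw [wn_wt_mul, wn_wt_mul] at this
  convert this using 2
  ext k
  unfold cv
  congr 1; ext l; ring

/-- Young's inequality L¹ * L² → L², the L¹ factor being f⟨·⟩^{-p} by Cauchy–Schwarz. This handles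
decay that sits on an input frequency. -/
theorem wn_young {p : ℝ} {f g : Space → ℝ≥0∞} (hf : Measurable f)
    (hg : Measurable g) :
    ∫⁻ k, (∫⁻ l, f l * wt (-p) l * g (k - l)) ^ 2
      ≤ (∫⁻ k, wt (-p) k ^ 2) * ((∫⁻ k, f k ^ 2) * ∫⁻ k, g k ^ 2) := by
  set φ : Space → ℝ≥0∞ := fun l => f l * wt (-p) l
  have hφ : Measurable φ := by fun_prop
  have h1 : ∀ k, (∫⁻ l, φ l * g (k - l)) ^ 2 ≤ (∫⁻ l, φ l) * ∫⁻ l, φ l * g (k - l) ^ 2 := by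
    intro k
    have h := lintegral_mul_sq_le (μ := (volume : Measure Space).withDensity φ)
      (f := fun _ => 1) (g := fun l => g (k - l)) (by fun_prop) (by fun_prop)
    rw [lintegral_withDensity_eq_lintegral_mul _ hφ (by fun_prop),
      lintegral_withDensity_eq_lintegral_mul _ hφ (by fun_prop),
      lintegral_withDensity_eq_lintegral_mul _ hφ (by fun_prop)] at h
    simpa using h
  calc _ ≤ ∫⁻ k, (∫⁻ l, φ l) * ∫⁻ l, φ l * g (k - l) ^ 2 := lintegral_mono h1
    _ = (∫⁻ l, φ l) * ∫⁻ k, ∫⁻ l, φ l * g (k - l) ^ 2 := by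
        rw [lintegral_const_mul]
        apply Measurable.lintegral_prod_right' (f := fun q : Space × Space =>
          φ q.2 * g (q.1 - q.2) ^ 2)
        fun_prop
    _ = (∫⁻ l, φ l) * ((∫⁻ l, φ l) * ∫⁻ k, g k ^ 2) := by
        rw [lintegral_lintegral_swap (by fun_prop)]
        congr 1
        rw [← lintegral_mul_const _ hφ]
        congr 1; ext l
        rw [lintegral_const_mul _ (by fun_prop)]
        congr 1
        exact lintegral_sub_right_eq_self (fun k => g k ^ 2) l
    _ = (∫⁻ l, φ l) ^ 2 * ∫⁻ k, g k ^ 2 := by ring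
    _ ≤ ((∫⁻ k, f k ^ 2) * (∫⁻ k, wt (-p) k ^ 2)) * ∫⁻ k, g k ^ 2 := by
        gcongr
        exact lintegral_mul_sq_le (by fun_prop) (by fun_prop)
    _ = _ := by ring

/-- Decay on the output frequency: the convolution of two L² functions is bounded, and the weight is
square integrable. -/
theorem wn_out {p : ℝ} {f g : Space → ℝ≥0∞} (hf : Measurable f)
    (hg : Measurable g) :
    ∫⁻ k, (wt (-p) k * ∫⁻ l, f l * g (k - l)) ^ 2
      ≤ (∫⁻ k, wt (-p) k ^ 2) * ((∫⁻ k, f k ^ 2) * ∫⁻ k, g k ^ 2) := by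
  rw [← lintegral_mul_const _ (by fun_prop)]
  apply lintegral_mono fun k => ?_
  rw [mul_pow]
  gcongr
  refine (lintegral_mul_sq_le (by fun_prop) (by fun_prop)).trans (le_of_eq ?_)
  congr 1
  exact lintegral_sub_left_eq_self (fun l => g l ^ 2) k

/-- The Sobolev product law on ℝ². `Expo.weight` splits the weight into three parts with the decay
⟨·⟩^{-p}, p > 1, on the output or on one of the inputs; `wn_out` and twice `wn_young` treat them.
Since p > 1, ⟨·⟩^{-p} is in L²(ℝ²). -/
theorem Adm.of_expo {r s₁ s₂ : ℝ} (h : Expo (-r) s₁ s₂) : Adm r s₁ s₂ (fun _ _ => 1) := by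
  obtain ⟨C, hC, hw⟩ := h.weight
  set p := -r + s₁ + s₂ with hp
  have hp1 : 1 < p := h.sum
  set I := ∫⁻ k, wt (-p) k ^ 2 with hI
  have hI' : I ≠ ∞ := (lintegral_wt_sq_lt_top hp1).ne
  refine ⟨ENNReal.ofReal C ^ 2 * (2 * (I + 2 * (I + I))), by finiteness, fun F G hF hG => ?_⟩
  set f : Space → ℝ≥0∞ := fun k => wt s₁ k * F k
  set g : Space → ℝ≥0∞ := fun k => wt s₂ k * G k
  have hf : Measurable f := by fun_prop
  have hg : Measurable g := by fun_prop
  have key : ∀ k l : Space, wt r (k + l) * (F k * G l) ≤ ENNReal.ofReal C *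
      (wt (-p) (k + l) * (f k * g l) + (f k * wt (-p) k * g l + f k * (wt (-p) l * g l))) := by
    intro k l
    have h1 : wt r (k + l) * wt (-s₁) k * wt (-s₂) l ≤ ENNReal.ofReal C *
        (wt (-p) (k + l) + wt (-p) k + wt (-p) l) := by
      have := hw k l
      rw [neg_neg] at this
      have p1 := Real.rpow_nonneg (jb_pos (k + l)).le (-p)
      have p2 := Real.rpow_nonneg (jb_pos k).le (-p)
      have p3 := Real.rpow_nonneg (jb_pos l).le (-p)
      unfold wt
      rw [← ENNReal.ofReal_add p1 p2, ← ENNReal.ofReal_add (by positivity) p3,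
        ← ENNReal.ofReal_mul hC.le, ← ENNReal.ofReal_mul (Real.rpow_nonneg (jb_pos _).le _),
        ← ENNReal.ofReal_mul (mul_nonneg (Real.rpow_nonneg (jb_pos _).le _)
          (Real.rpow_nonneg (jb_pos _).le _))]
      exact ENNReal.ofReal_le_ofReal this
    calc wt r (k + l) * (F k * G l)
        = wt r (k + l) * wt (-s₁) k * wt (-s₂) l * (f k * g l) := by
          simp only [f, g]
          calc _ = wt r (k + l) * (F k * G l) * ((wt s₁ k * wt (-s₁) k) * (wt s₂ l * wt (-s₂) l)) := by
                rw [wt_mul_neg, wt_mul_neg]; simp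
            _ = _ := by ring
      _ ≤ ENNReal.ofReal C * (wt (-p) (k + l) + wt (-p) k + wt (-p) l) * (f k * g l) := by gcongr
      _ = _ := by ring
  set A0 : Space → ℝ≥0∞ := fun k => wt (-p) k * ∫⁻ l, f l * g (k - l)
  set A1 : Space → ℝ≥0∞ := fun k => ∫⁻ l, f l * wt (-p) l * g (k - l)
  set A2 : Space → ℝ≥0∞ := fun k => ∫⁻ l, f l * (wt (-p) (k - l) * g (k - l))
  have mA0 : Measurable A0 := by
    apply Measurable.mul (by fun_prop)
    exact Measurable.lintegral_prod_right' (f := fun q : Space × Space => f q.2 * g (q.1 - q.2))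
      (by fun_prop)
  have mA1 : Measurable A1 :=
    Measurable.lintegral_prod_right' (f := fun q : Space × Space =>
      f q.2 * wt (-p) q.2 * g (q.1 - q.2)) (by fun_prop)
  have hpt : ∀ k, wt r k * cv (fun _ _ => 1) F G k ≤ ENNReal.ofReal C * (A0 k + (A1 k + A2 k)) := by
    intro k
    have e : A0 k + (A1 k + A2 k) = ∫⁻ l, (wt (-p) k * (f l * g (k - l)) +
        (f l * wt (-p) l * g (k - l) + f l * (wt (-p) (k - l) * g (k - l)))) := by
      rw [lintegral_add_left (by fun_prop), lintegral_add_left (by fun_prop),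
        lintegral_const_mul _ (by fun_prop)]
    rw [e, cv, ← lintegral_const_mul' _ _ (wt_ne_top _ _),
      ← lintegral_const_mul' _ _ ENNReal.ofReal_ne_top]
    apply lintegral_mono fun l => ?_
    have := key l (k - l)
    rw [add_sub_cancel] at this
    rw [one_mul]
    exact this
  have b0 : ∫⁻ k, A0 k ^ 2 ≤ I * (wn s₁ F * wn s₂ G) := wn_out hf hg
  have b1 : ∫⁻ k, A1 k ^ 2 ≤ I * (wn s₁ F * wn s₂ G) := wn_young hf hg
  have b2 : ∫⁻ k, A2 k ^ 2 ≤ I * (wn s₁ F * wn s₂ G) := by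
    have := wn_young (p := p) hg hf
    rw [mul_comm (wn s₁ F)]
    refine le_trans (le_of_eq ?_) this
    congr 1; ext k
    simp only [A2]
    rw [← lintegral_sub_left_eq_self _ k]
    congr 2; ext l
    rw [sub_sub_cancel]; ring
  calc wn r (cv (fun _ _ => 1) F G) ≤ ∫⁻ k, (ENNReal.ofReal C * (A0 k + (A1 k + A2 k))) ^ 2 :=
        lintegral_mono fun k => pow_le_pow_left₀ zero_le (hpt k) 2
    _ ≤ ∫⁻ k, ENNReal.ofReal C ^ 2 * (2 * (A0 k ^ 2 + 2 * (A1 k ^ 2 + A2 k ^ 2))) := by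
        apply lintegral_mono fun k => ?_
        rw [mul_pow]
        gcongr
        refine (add_sq_le_ennreal _ _).trans ?_
        gcongr
        exact add_sq_le_ennreal _ _
    _ = ENNReal.ofReal C ^ 2 * (2 * ((∫⁻ k, A0 k ^ 2) + 2 * ((∫⁻ k, A1 k ^ 2) + ∫⁻ k, A2 k ^ 2))) := by
        rw [lintegral_const_mul' _ _ (by finiteness), lintegral_const_mul' _ _ (by finiteness),
          lintegral_add_left (by fun_prop), lintegral_const_mul' _ _ (by finiteness),
          lintegral_add_left (by fun_prop)]
    _ ≤ ENNReal.ofReal C ^ 2 * (2 * (I * (wn s₁ F * wn s₂ G) + 2 * (I * (wn s₁ F * wn s₂ G) +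
        I * (wn s₁ F * wn s₂ G)))) := by gcongr
    _ = _ := by ring

/-- Admissibility of a symbol that is bounded by a product of weights. -/
theorem Adm.of_expo_wt {r s₁ s₂ a b : ℝ} (h : Expo (-r) (s₁ - a) (s₂ - b)) :
    Adm r s₁ s₂ (fun k l => wt a k * wt b l) := by
  have := (Adm.of_expo h).weights (a := a) (b := b)
  simpa using this

/-! ### The endpoint case -/

/-- Polar coordinates in the plane; b < 2 makes the singularity at the origin integrable, so that
|k|^{-b} can replace ⟨k⟩^{-b}. -/
theorem lintegral_norm_rpow_le {b : ℝ} (hb : b < 2) : ∃ C : ℝ≥0∞, C ≠ ∞ ∧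
    ∀ R : ℝ, 1 ≤ R → ∫⁻ k : Space, ENNReal.ofReal ((Set.Iic R).indicator (fun y => y ^ (-b)) ‖k‖)
      ≤ C * ENNReal.ofReal (R ^ (2 - b)) := by
  set c : ℝ := 2 * (volume : Measure Space).real (Metric.ball 0 1) / (2 - b) with hc
  have hc0 : 0 ≤ c := by have : 0 < 2 - b := by linarith
                         positivity
  refine ⟨ENNReal.ofReal c, by simp, fun R hR => ?_⟩
  have hR0 : 0 < R := by linarith
  have hd : Module.finrank ℝ Space - 1 = 1 := by simp
  have e1 : ∀ y ∈ Set.Ioi (0:ℝ), y ^ (Module.finrank ℝ Space - 1) •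
      (Set.Iic R).indicator (fun y => y ^ (-b)) y =
      (Set.Ioc 0 R).indicator (fun y => y ^ (1 - b)) y := by
    intro y hy
    rw [hd]
    by_cases h : y ≤ R
    · rw [Set.indicator_of_mem (by exact h), Set.indicator_of_mem (show y ∈ Set.Ioc 0 R from ⟨hy, h⟩), pow_one, smul_eq_mul,
        sub_eq_add_neg, Real.rpow_add hy, Real.rpow_one]
    · rw [Set.indicator_of_notMem (by exact h), Set.indicator_of_notMem (fun h' => h h'.2), smul_zero]
  have e2 : IntegrableOn (fun y : ℝ => y ^ (1 - b)) (Set.Ioc 0 R) := by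
    rw [← intervalIntegrable_iff_integrableOn_Ioc_of_le hR0.le]
    exact intervalIntegral.intervalIntegrable_rpow' (by linarith)
  have hint : Integrable (fun k : Space => (Set.Iic R).indicator (fun y => y ^ (-b)) ‖k‖) := by
    rw [integrable_fun_norm_addHaar, integrableOn_congr_fun e1 measurableSet_Ioi]
    exact ((integrable_indicator_iff measurableSet_Ioc).mpr e2).integrableOn
  rw [← ofReal_integral_eq_lintegral_ofReal hint (Filter.Eventually.of_forall fun k => by
    simp only [Set.indicator, Pi.zero_apply]; split_ifs <;> positivity), ← ENNReal.ofReal_mul hc0]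
  apply ENNReal.ofReal_le_ofReal
  rw [integral_fun_norm_addHaar, setIntegral_congr_fun measurableSet_Ioi e1]
  rw [setIntegral_indicator measurableSet_Ioc,
    Set.inter_eq_right.mpr (fun y hy => hy.1), ← intervalIntegral.integral_of_le hR0.le,
    integral_rpow (Or.inl (by linarith)), Real.zero_rpow (by linarith)]
  simp only [finrank_euclideanSpace, Fintype.card_fin, smul_eq_mul, nsmul_eq_mul, hc]
  apply le_of_eq
  rw [show 1 - b + 1 = 2 - b by ring]
  push_cast; ring

theorem norm_le_jb (k : Space) : ‖k‖ ≤ jb k := by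
  rw [jb]
  apply Real.le_sqrt_of_sq_le
  rw [norm_smul, mul_pow, Real.norm_of_nonneg (by positivity)]
  have : 1 ≤ (2 * Real.pi) ^ 2 := by nlinarith [Real.pi_gt_three]
  nlinarith [sq_nonneg ‖k‖]

theorem lintegral_small_le {a : ℝ} (ha : 0 < a) (ha2 : a < 1) : ∃ C : ℝ≥0∞, C ≠ ∞ ∧
    ∀ l : Space, ∫⁻ k, (if jb k ≤ jb l then wt (-a) k ^ 2 else 0)
      ≤ C * wt (1 - a) l ^ 2 := by
  obtain ⟨C, hC, h⟩ := lintegral_norm_rpow_le (b := 2 * a) (by linarith)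
  refine ⟨C, hC, fun l => ?_⟩
  have e : wt (1 - a) l ^ 2 = ENNReal.ofReal (jb l ^ (2 - 2 * a)) := by
    rw [wt, ← ENNReal.ofReal_pow (Real.rpow_nonneg (jb_pos l).le _), ← Real.rpow_natCast,
      ← Real.rpow_mul (jb_pos l).le]
    congr 2; push_cast; ring
  rw [e]
  refine le_trans ?_ (h _ (one_le_jb l))
  apply lintegral_mono_ae
  have h0 : ∀ᵐ k : Space, k ≠ 0 := by simp [ae_iff]
  filter_upwards [h0] with k hk
  split_ifs with hkl
  · rw [Set.indicator_of_mem (show ‖k‖ ∈ Set.Iic (jb l) from (norm_le_jb k).trans hkl), wt,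
      ← ENNReal.ofReal_pow (Real.rpow_nonneg (jb_pos k).le _), ← Real.rpow_natCast,
      ← Real.rpow_mul (jb_pos k).le]
    apply ENNReal.ofReal_le_ofReal
    rw [show -a * ((2:ℕ):ℝ) = -(2 * a) by push_cast; ring]
    exact Real.rpow_le_rpow_of_nonpos (norm_pos_iff.mpr hk) (norm_le_jb k) (by linarith)
  · exact zero_le

/-- The part `⟨η⟩ ≤ ⟨ξ⟩` of the endpoint weight. -/
def kerLow (a : ℝ) (k l : Space) : ℝ≥0∞ := if jb l ≤ jb k then wt (-a) l else 0

/-- The part `⟨ξ⟩ ≤ ⟨η⟩` of the endpoint weight. -/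
def kerHigh (a b : ℝ) (k l : Space) : ℝ≥0∞ :=
  if jb k ≤ jb l then wt (-a) l * wt (-b) k else 0

@[fun_prop]
theorem measurable_kerLow (a : ℝ) : Measurable fun p : Space × Space => kerLow a p.1 p.2 := by
  unfold kerLow
  exact Measurable.ite (measurableSet_le (by fun_prop) (by fun_prop)) (by fun_prop)
    measurable_const

@[fun_prop]
theorem measurable_kerHigh (a b : ℝ) :
    Measurable fun p : Space × Space => kerHigh a b p.1 p.2 := by
  unfold kerHigh
  exact Measurable.ite (measurableSet_le (by fun_prop) (by fun_prop)) (by fun_prop)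
    measurable_const

@[fun_prop]
theorem measurable_kerLow_right (a : ℝ) (k : Space) : Measurable fun l => kerLow a k l := by
  unfold kerLow
  exact Measurable.ite (measurableSet_le (by fun_prop) (by fun_prop)) (by fun_prop)
    measurable_const

@[fun_prop]
theorem measurable_kerHigh_right (a b : ℝ) (k : Space) :
    Measurable fun l => kerHigh a b k l := by
  unfold kerHigh
  exact Measurable.ite (measurableSet_le (by fun_prop) (by fun_prop)) (by fun_prop)
    measurable_const

@[fun_prop]
theorem measurable_kerHigh_left (a b : ℝ) (l : Space) :
    Measurable fun k => kerHigh a b k l := by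
  unfold kerHigh
  exact Measurable.ite (measurableSet_le (by fun_prop) (by fun_prop)) (by fun_prop)
    measurable_const

/-- Total decay 1 is the borderline where ⟨·⟩^{-1} is not in L²(ℝ²), so `Adm.of_expo` fails. With
both a, b positive one separates the cases where the weighted input is smaller or larger than the
output and applies Cauchy–Schwarz in each. In the first, the integral of ⟨l⟩^{-2a} over ⟨l⟩ ≤ ⟨k⟩ is
cancelled by ⟨k⟩^{-2b}; in the second, the output is integrated first, and the integral of ⟨k⟩^{-2b}
over ⟨k⟩ ≤ ⟨l⟩ is cancelled by ⟨l⟩^{-2a}. -/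
theorem Adm.endpoint_left {a b : ℝ} (ha : 0 < a) (hb : 0 < b) (hab : a + b = 1) :
    Adm (-b) 0 0 (fun k _ => wt (-a) k) := by
  have hab1 : 1 - a = b := by linarith
  have hab2 : 1 - b = a := by linarith
  obtain ⟨C, hC, h⟩ := lintegral_small_le ha (by linarith)
  obtain ⟨C', hC', h'⟩ := lintegral_small_le hb (by linarith)
  refine ⟨2 * (C + C'), by finiteness, fun F G hF hG => ?_⟩
  have hz : ∀ H : Space → ℝ≥0∞, wn 0 H = ∫⁻ k, H k ^ 2 := fun H => by simp [wn, wt_zero]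
  rw [hz, hz]
  set A1 : Space → ℝ≥0∞ := fun k => wt (-b) k * ∫⁻ l, kerLow a k l * (F l * G (k - l))
  set A2 : Space → ℝ≥0∞ := fun k => ∫⁻ l, (F l * kerHigh a b k l) * G (k - l)
  have mA1 : Measurable A1 := by
    apply Measurable.mul (by fun_prop)
    exact Measurable.lintegral_prod_right' (f := fun q : Space × Space =>
      kerLow a q.1 q.2 * (F q.2 * G (q.1 - q.2))) (by fun_prop)
  have hpt : ∀ k, wt (-b) k * cv (fun k _ => wt (-a) k) F G k ≤ A1 k + A2 k := by
    intro k
    simp only [A1, A2, cv]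
    rw [← lintegral_const_mul' _ _ (wt_ne_top _ _), ← lintegral_const_mul' _ _ (wt_ne_top _ _),
      ← lintegral_add_left (by fun_prop)]
    apply lintegral_mono fun l => ?_
    simp only [kerLow, kerHigh]
    rcases le_total (jb l) (jb k) with hl | hl
    · rw [if_pos hl]; exact le_self_add
    · rw [if_pos hl]
      refine le_trans (le_of_eq ?_) le_add_self
      ring
  have b1 : ∫⁻ k, A1 k ^ 2 ≤ C * ((∫⁻ k, F k ^ 2) * ∫⁻ k, G k ^ 2) := by
    have : ∀ k, A1 k ^ 2 ≤ C * ∫⁻ l, F l ^ 2 * G (k - l) ^ 2 := by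
      intro k
      simp only [A1]
      rw [mul_pow]
      have e1 := lintegral_mul_sq_le (μ := volume) (f := kerLow a k) (g := fun l => F l * G (k - l))
        (by fun_prop) (by fun_prop)
      have e2 : ∫⁻ l, kerLow a k l ^ 2 ≤ C * wt b k ^ 2 := by
        have := h k
        rw [hab1] at this
        refine le_trans (le_of_eq ?_) this
        congr 1; ext l; simp only [kerLow]; split_ifs <;> simp
      calc _ ≤ wt (-b) k ^ 2 * ((C * wt b k ^ 2) * ∫⁻ l, (F l * G (k - l)) ^ 2) := by
            gcongr; exact e1.trans (by gcongr)
        _ = C * (wt b k * wt (-b) k) ^ 2 * ∫⁻ l, (F l * G (k - l)) ^ 2 := by ring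
        _ = _ := by rw [wt_mul_neg, one_pow, mul_one]; simp_rw [mul_pow]
    refine (lintegral_mono this).trans ?_
    rw [lintegral_const_mul' _ _ hC, lintegral_lintegral_swap (by fun_prop),
      ← lintegral_mul_const _ (by fun_prop)]
    gcongr with l
    rw [lintegral_const_mul _ (by fun_prop)]
    exact mul_le_mul' le_rfl (lintegral_sub_right_eq_self (fun k => G k ^ 2) l).le
  have b2 : ∫⁻ k, A2 k ^ 2 ≤ C' * ((∫⁻ k, F k ^ 2) * ∫⁻ k, G k ^ 2) := by
    have : ∀ k, A2 k ^ 2 ≤ (∫⁻ l, F l ^ 2 * kerHigh a b k l ^ 2) * ∫⁻ k, G k ^ 2 := by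
      intro k
      refine (lintegral_mul_sq_le (by fun_prop) (by fun_prop)).trans (le_of_eq ?_)
      simp_rw [mul_pow]
      congr 1
      exact lintegral_sub_left_eq_self (fun l => G l ^ 2) k
    refine (lintegral_mono this).trans ?_
    have mm : Measurable fun q : Space × Space => F q.2 ^ 2 * kerHigh a b q.1 q.2 ^ 2 := by fun_prop
    rw [lintegral_mul_const _ (Measurable.lintegral_prod_right' mm), ← mul_assoc]
    gcongr
    rw [lintegral_lintegral_swap mm.aemeasurable, ← lintegral_const_mul' _ _ hC']
    gcongr with l
    dsimp only
    rw [lintegral_const_mul _ (by fun_prop), mul_comm]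
    refine mul_le_mul' ?_ le_rfl
    have e2 : ∀ k, kerHigh a b k l ^ 2 = wt (-a) l ^ 2 *
        (if jb k ≤ jb l then wt (-b) k ^ 2 else 0) := by
      intro k; simp only [kerHigh]; split_ifs
      · ring
      · simp
    simp_rw [e2]
    rw [lintegral_const_mul' _ _ (by have := wt_ne_top (-a) l; finiteness)]
    have := h' l
    rw [hab2] at this
    calc _ ≤ wt (-a) l ^ 2 * (C' * wt a l ^ 2) := by gcongr
      _ = C' * (wt a l * wt (-a) l) ^ 2 := by ring
      _ = C' := by rw [wt_mul_neg, one_pow, mul_one]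
  calc wn (-b) (cv (fun k _ => wt (-a) k) F G) ≤ ∫⁻ k, 2 * (A1 k ^ 2 + A2 k ^ 2) := by
        apply lintegral_mono fun k => ?_
        refine le_trans ?_ (add_sq_le_ennreal _ _)
        exact pow_le_pow_left₀ zero_le (hpt k) 2
    _ ≤ _ := by
        rw [lintegral_const_mul' _ _ (by simp), lintegral_add_left (by fun_prop), mul_assoc, add_mul]
        gcongr

theorem Adm.swap {r s₁ s₂ : ℝ} {N : Space → Space → ℝ≥0∞} (h : Adm r s₁ s₂ N) :
    Adm r s₂ s₁ (fun k l => N l k) := by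
  obtain ⟨C, hC, h⟩ := h
  refine ⟨C, hC, fun F G hF hG => ?_⟩
  rw [mul_comm (wn s₂ F)]
  refine le_trans (le_of_eq ?_) (h G F hG hF)
  congr 1; ext k
  exact cv_swap _ _ _ _

theorem Adm.endpoint_right {a b : ℝ} (ha : 0 < a) (hb : 0 < b) (hab : a + b = 1) :
    Adm (-b) 0 0 (fun _ l => wt (-a) l) :=
  (Adm.endpoint_left ha hb hab).swap

end

section


/-! ### Primitives of locally integrable functions -/

/-- `u` is a primitive of the locally integrable function `u'`. -/
structure Prim {E : Type*} [NormedAddCommGroup E] [NormedSpace ℝ E] (u u' : ℝ → E) : Prop where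
  int : ∀ s t, IntervalIntegrable u' volume s t
  eq : ∀ s t, u t - u s = ∫ r in s..t, u' r

section Prim

variable {E : Type*} [NormedAddCommGroup E] [NormedSpace ℝ E] {u u' v v' : ℝ → E}

theorem Prim.continuous (h : Prim u u') : Continuous u := by
  have e : u = fun t => u 0 + ∫ r in (0:ℝ)..t, u' r := by
    ext t; rw [← h.eq]; abel
  rw [e]
  exact continuous_const.add (intervalIntegral.continuous_primitive h.int 0)

theorem Prim.add (h : Prim u u') (h' : Prim v v') : Prim (fun t => u t + v t) fun t => u' t + v' t where
  int s t := (h.int s t).add (h'.int s t)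
  eq s t := by
    rw [intervalIntegral.integral_add (h.int s t) (h'.int s t), ← h.eq, ← h'.eq]; abel

theorem Prim.sub (h : Prim u u') (h' : Prim v v') : Prim (fun t => u t - v t) fun t => u' t - v' t where
  int s t := (h.int s t).sub (h'.int s t)
  eq s t := by
    rw [intervalIntegral.integral_sub (h.int s t) (h'.int s t), ← h.eq, ← h'.eq]; abel

theorem Prim.congr (h : Prim u u') (hu : u' =ᵐ[volume] v') : Prim u v' where
  int s t := (h.int s t).congr_ae (ae_restrict_of_ae hu)
  eq s t := by
    rw [h.eq]
    exact intervalIntegral.integral_congr_ae (by filter_upwards [hu] with x hx _ using hx)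

theorem Prim.of_integral {E : Type*} [NormedAddCommGroup E] [NormedSpace ℝ E] {u' : ℝ → E}
    (h : ∀ s t, IntervalIntegrable u' volume s t) (c : E) (a : ℝ) :
    Prim (fun t => c + ∫ r in a..t, u' r) u' where
  int := h
  eq s t := by
    rw [← intervalIntegral.integral_interval_sub_left (h a t) (h a s)]; abel

end Prim

/-- Primitives of locally integrable functions are absolutely continuous, and integration by parts
is valid for those. Continuity of the derivatives is not available, since profiles are
differentiable only for almost every time. -/
theorem Prim.mul_real {u u' v v' : ℝ → ℝ} (h : Prim u u') (h' : Prim v v') :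
    Prim (fun t => u t * v t) (fun t => u' t * v t + u t * v' t) := by
  have hc := h.continuous
  have hc' := h'.continuous
  have hi : ∀ s t, IntervalIntegrable (fun t => u' t * v t + u t * v' t) volume s t := fun s t =>
    ((h.int s t).mul_continuousOn hc'.continuousOn).add
      ((h'.int s t).continuousOn_mul hc.continuousOn)
  refine ⟨hi, fun s t => ?_⟩
  have eu : u = fun t => u s + ∫ r in s..t, u' r := by
    ext x; rw [← h.eq]; ring
  have ev : v = fun t => v s + ∫ r in s..t, v' r := by
    ext x; rw [← h'.eq]; ring
  have ac : ∀ (c : ℝ) (w : ℝ → ℝ), IntervalIntegrable w volume s t →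
      AbsolutelyContinuousOnInterval (fun x => c + ∫ r in s..x, w r) s t := fun c w hw =>
    ((LipschitzWith.const c).lipschitzOnWith.absolutelyContinuousOnInterval).add
      (hw.absolutelyContinuousOnInterval_intervalIntegral (by simp))
  have au : AbsolutelyContinuousOnInterval u s t := by rw [eu]; exact ac _ _ (h.int s t)
  have av : AbsolutelyContinuousOnInterval v s t := by rw [ev]; exact ac _ _ (h'.int s t)
  have der : ∀ (c : ℝ) (w : ℝ → ℝ), IntervalIntegrable w volume s t →
      ∀ᵐ x, x ∈ Set.uIcc s t → deriv (fun x => c + ∫ r in s..x, w r) x = w x := by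
    intro c w hw
    filter_upwards [hw.ae_hasDerivAt_integral] with x hx hxs
    exact ((hx hxs s (by simp)).const_add c).deriv
  have key := au.integral_deriv_mul_eq_sub av
  rw [← key]
  apply intervalIntegral.integral_congr_ae
  have du := der (u s) u' (h.int s t)
  have dv := der (v s) v' (h'.int s t)
  rw [← eu] at du
  rw [← ev] at dv
  filter_upwards [du, dv] with x h1 h2 hx
  rw [h1 (Set.uIoc_subset_uIcc hx), h2 (Set.uIoc_subset_uIcc hx)]

theorem Prim.re {u u' : ℝ → ℂ} (h : Prim u u') : Prim (fun t => (u t).re) (fun t => (u' t).re) where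
  int s t := ⟨(h.int s t).1.re, (h.int s t).2.re⟩
  eq s t := by
    have := congrArg Complex.re (h.eq s t)
    rw [Complex.sub_re] at this
    rw [this]
    exact (Complex.reCLM.intervalIntegral_comp_comm (h.int s t)).symm

theorem Prim.im {u u' : ℝ → ℂ} (h : Prim u u') : Prim (fun t => (u t).im) (fun t => (u' t).im) where
  int s t := ⟨(h.int s t).1.im, (h.int s t).2.im⟩
  eq s t := by
    have := congrArg Complex.im (h.eq s t)
    rw [Complex.sub_im] at this
    rw [this]
    exact (Complex.imCLM.intervalIntegral_comp_comm (h.int s t)).symm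

theorem Prim.of_re_im {x x' y y' : ℝ → ℝ} (h : Prim x x') (h' : Prim y y') :
    Prim (fun t => (x t : ℂ) + y t * Complex.I) (fun t => (x' t : ℂ) + y' t * Complex.I) where
  int s t := IntervalIntegrable.add ⟨(h.int s t).1.ofReal, (h.int s t).2.ofReal⟩
    (IntervalIntegrable.mul_const ⟨(h'.int s t).1.ofReal, (h'.int s t).2.ofReal⟩ _)
  eq s t := by
    have i1 : IntervalIntegrable (fun r => (x' r : ℂ)) volume s t :=
      ⟨(h.int s t).1.ofReal, (h.int s t).2.ofReal⟩
    have i2 : IntervalIntegrable (fun r => (y' r : ℂ)) volume s t :=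
      ⟨(h'.int s t).1.ofReal, (h'.int s t).2.ofReal⟩
    rw [intervalIntegral.integral_add i1 (i2.mul_const _), intervalIntegral.integral_mul_const,
      intervalIntegral.integral_ofReal, intervalIntegral.integral_ofReal, ← h.eq, ← h'.eq]
    push_cast; ring

theorem Prim.mul {u u' v v' : ℝ → ℂ} (h : Prim u u') (h' : Prim v v') :
    Prim (fun t => u t * v t) (fun t => u' t * v t + u t * v' t) := by
  have h1 := ((h.re.mul_real h'.re).sub (h.im.mul_real h'.im)).of_re_im
    ((h.re.mul_real h'.im).add (h.im.mul_real h'.re))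
  convert h1 using 1
  · ext t; apply Complex.ext <;> simp
  · ext t; apply Complex.ext <;> simp <;> ring

theorem Prim.const_mul {u u' : ℝ → ℂ} (h : Prim u u') (c : ℂ) :
    Prim (fun t => c * u t) (fun t => c * u' t) where
  int s t := (h.int s t).const_mul c
  eq s t := by rw [intervalIntegral.integral_const_mul, ← h.eq]; ring

theorem Prim.of_hasDerivAt {u u' : ℝ → ℂ} (h : ∀ t, HasDerivAt u (u' t) t) (hc : Continuous u') :
    Prim u u' where
  int s t := hc.intervalIntegrable s t
  eq s t := by
    rw [intervalIntegral.integral_eq_sub_of_hasDerivAt (fun x _ => h x)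
      (hc.intervalIntegrable s t)]

theorem Prim.cexp (Φ : ℝ) : Prim (fun t : ℝ => Complex.exp (t * Φ * Complex.I))
    (fun t : ℝ => Complex.I * Φ * Complex.exp (t * Φ * Complex.I)) := by
  apply Prim.of_hasDerivAt
  · intro t
    have h1 : HasDerivAt (fun t : ℝ => (t : ℂ) * (Φ * Complex.I)) (1 * (Φ * Complex.I)) t :=
      (Complex.ofRealCLM.hasDerivAt (x := t)).mul_const _
    have h2 := h1.cexp
    simp only [← mul_assoc] at h2
    convert h2 using 1
    ring
  · fun_prop

/-! ### Bounded families of functions in weighted `L²` spaces -/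

/-- `a` is jointly measurable and bounded with values in `L²(⟨ξ⟩^{2s})`. -/
structure Bdd (s : ℝ) (a : ℝ → Space → ℂ) : Prop where
  meas : Measurable fun p : ℝ × Space => a p.1 p.2
  bound : ∃ C : ℝ≥0∞, C ≠ ∞ ∧ ∀ t, wn s (fun k => ‖a t k‖ₑ) ≤ C

theorem Bdd.meas_slice {s : ℝ} {a : ℝ → Space → ℂ} (h : Bdd s a) (t : ℝ) : Measurable (a t) :=
  h.meas.comp measurable_prodMk_left

theorem Bdd.mono {s s' : ℝ} {a : ℝ → Space → ℂ} (h : Bdd s a) (hs : s' ≤ s) : Bdd s' a := by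
  obtain ⟨C, hC, hb⟩ := h.bound
  exact ⟨h.meas, C, hC, fun t => (wn_mono hs fun _ => le_rfl).trans (hb t)⟩

theorem Bdd.of_le {s : ℝ} {a b : ℝ → Space → ℂ} (h : Bdd s a)
    (hm : Measurable fun p : ℝ × Space => b p.1 p.2) (hb : ∀ t k, ‖b t k‖ ≤ ‖a t k‖) : Bdd s b := by
  obtain ⟨C, hC, hb'⟩ := h.bound
  exact ⟨hm, C, hC, fun t => (wn_mono le_rfl fun k => enorm_le_iff_norm_le.mpr (hb t k)).trans (hb' t)⟩

theorem Bdd.add {s : ℝ} {a b : ℝ → Space → ℂ} (h : Bdd s a) (h' : Bdd s b) :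
    Bdd s (fun t k => a t k + b t k) := by
  obtain ⟨C, hC, hb⟩ := h.bound
  obtain ⟨C', hC', hb'⟩ := h'.bound
  refine ⟨h.meas.add h'.meas, 2 * (C + C'), by finiteness, fun t => ?_⟩
  have := h.meas_slice t
  refine (wn_mono le_rfl fun k => enorm_add_le (a t k) (b t k)).trans ?_
  refine (wn_add_le (by fun_prop)).trans ?_
  gcongr
  exacts [hb t, hb' t]

theorem Bdd.zero (s : ℝ) : Bdd s (fun _ _ => 0) :=
  ⟨measurable_const, 0, by simp, fun t => by simp [wn]⟩

theorem Bdd.sum {ι : Type*} {s : ℝ} {a : ι → ℝ → Space → ℂ} (S : Finset ι)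
    (h : ∀ i ∈ S, Bdd s (a i)) : Bdd s (fun t k => ∑ i ∈ S, a i t k) := by
  classical
  induction S using Finset.induction_on with
  | empty => simpa using Bdd.zero s
  | insert i S hi ih =>
    simp only [Finset.sum_insert hi]
    exact (h i (by simp)).add (ih fun j hj => h j (by simp [hj]))

/-- Multiplication by a symbol of order `r`. -/
theorem Bdd.mul_symbol {s r C : ℝ} {a m : ℝ → Space → ℂ} (h : Bdd s a)
    (hm : Measurable fun p : ℝ × Space => m p.1 p.2) (hb : ∀ t k, ‖m t k‖ ≤ C * jb k ^ r) :
    Bdd (s - r) (fun t k => m t k * a t k) := by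
  obtain ⟨D, hD, hb'⟩ := h.bound
  refine ⟨hm.mul h.meas, ENNReal.ofReal C ^ 2 * D, by finiteness, fun t => ?_⟩
  have hC : 0 ≤ C := by
    have h1 := (norm_nonneg _).trans (hb 0 0)
    exact nonneg_of_mul_nonneg_left h1 (Real.rpow_pos_of_pos (jb_pos _) _)
  have e : ∀ k, ‖m t k * a t k‖ₑ ≤ ENNReal.ofReal C * (wt r k * ‖a t k‖ₑ) := by
    intro k
    rw [enorm_mul, ← mul_assoc, wt, ← ENNReal.ofReal_mul hC]
    gcongr
    rw [← ofReal_norm]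
    exact ENNReal.ofReal_le_ofReal (hb t k)
  refine (wn_mono le_rfl e).trans ?_
  rw [wn_const_mul (by simp), wn_wt_mul, sub_add_cancel]
  gcongr
  exact hb' t

theorem Bdd.const_mul {s : ℝ} {a : ℝ → Space → ℂ} (h : Bdd s a) (c : ℂ) :
    Bdd s (fun t k => c * a t k) := by
  have := h.mul_symbol (m := fun _ _ => c) (r := 0) (C := ‖c‖) (by fun_prop) (by simp)
  simpa using this

theorem Bdd.sub {s : ℝ} {a b : ℝ → Space → ℂ} (h : Bdd s a) (h' : Bdd s b) :
    Bdd s (fun t k => a t k - b t k) := by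
  have := h.add (h'.const_mul (-1))
  simpa [sub_eq_add_neg] using this

/-- Multiplication by a unimodular factor. -/
theorem Bdd.mul_unit {s : ℝ} {a m : ℝ → Space → ℂ} (h : Bdd s a)
    (hm : Measurable fun p : ℝ × Space => m p.1 p.2) (hb : ∀ t k, ‖m t k‖ ≤ 1) :
    Bdd s (fun t k => m t k * a t k) := by
  have := h.mul_symbol (r := 0) (C := 1) hm (by simpa using hb)
  simpa using this

theorem enorm_le_one_add_sq (x : ℝ≥0∞) : x ≤ 1 + x ^ 2 := by
  rcases le_total x 1 with h | h
  · exact h.trans le_self_add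
  · calc x = x * 1 := by rw [mul_one]
      _ ≤ x * x := by gcongr
      _ = x ^ 2 := by ring
      _ ≤ _ := le_add_self

theorem wn_lt_top_ae {s : ℝ} {F : Space → ℝ≥0∞} (hF : Measurable F) (h : wn s F ≠ ∞) :
    ∀ᵐ k, F k < ∞ := by
  filter_upwards [ae_lt_top (by fun_prop) h] with k hk
  rw [lt_top_iff_ne_top]
  rintro h'
  rw [h', ENNReal.mul_top (wt_pos s k).ne'] at hk
  simp at hk

/-- A bound uniform in time makes the family square integrable over bounded time intervals jointly
with the frequency; Fubini then gives local integrability in time at almost every frequency. -/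
theorem ae_lintegral_time_lt_top {s : ℝ} {H : ℝ → Space → ℝ≥0∞}
    (hm : Measurable fun p : ℝ × Space => H p.1 p.2) {C : ℝ≥0∞} (hC : C ≠ ∞)
    (hb : ∀ t, wn s (H t) ≤ C) : ∀ᵐ k, ∀ n : ℕ, ∫⁻ t in Set.Icc (-n : ℝ) n, H t k < ∞ := by
  have hm' : Measurable fun p : Space × ℝ => H p.2 p.1 := hm.comp measurable_swap
  have hm2 : Measurable fun p : Space × ℝ => (wt s p.1 * H p.2 p.1) ^ 2 := by fun_prop
  rw [ae_all_iff]
  intro n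
  set T := Set.Icc (-n : ℝ) n
  have hT : volume T ≠ ∞ := by simp [T]
  have h1 : ∫⁻ k, ∫⁻ t in T, (wt s k * H t k) ^ 2 ≤ C * volume T := by
    rw [lintegral_lintegral_swap hm2.aemeasurable]
    calc _ ≤ ∫⁻ t in T, C := lintegral_mono fun t => hb t
      _ = _ := by simp
  have h2 : ∀ᵐ k, ∫⁻ t in T, (wt s k * H t k) ^ 2 < ∞ :=
    ae_lt_top hm2.lintegral_prod_right' (h1.trans_lt (by finiteness)).ne
  filter_upwards [h2] with k hk
  have hw := wt_ne_top (-s) k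
  have e : ∫⁻ t in T, H t k ^ 2 = wt (-s) k ^ 2 * ∫⁻ t in T, (wt s k * H t k) ^ 2 := by
    rw [← lintegral_const_mul' _ _ (by finiteness)]
    congr 1; ext t
    calc H t k ^ 2 = (wt s k * wt (-s) k) ^ 2 * H t k ^ 2 := by rw [wt_mul_neg]; simp
      _ = _ := by ring
  have e2 : ∫⁻ t in T, H t k ^ 2 < ∞ := by
    rw [e]; exact ENNReal.mul_lt_top (by finiteness) hk
  calc ∫⁻ t in T, H t k ≤ ∫⁻ t in T, (1 + H t k ^ 2) :=
        lintegral_mono fun t => enorm_le_one_add_sq _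
    _ < ∞ := by
        rw [lintegral_add_left measurable_const]
        refine ENNReal.add_lt_top.mpr ⟨?_, e2⟩
        simpa using hT.lt_top

theorem exists_nat_uIoc_subset (x y : ℝ) : ∃ n : ℕ, Set.uIoc x y ⊆ Set.Icc (-n : ℝ) n := by
  obtain ⟨n, hn⟩ := exists_nat_gt (max |x| |y|)
  refine ⟨n, ?_⟩
  have h1 := (le_max_left |x| |y|).trans hn.le
  have h2 := (le_max_right |x| |y|).trans hn.le
  refine Set.uIoc_subset_uIcc.trans (Set.uIcc_subset_Icc ?_ ?_) <;>
    constructor <;> linarith [neg_abs_le x, neg_abs_le y, le_abs_self x, le_abs_self y]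

theorem Bdd.intervalIntegrable {s : ℝ} {a : ℝ → Space → ℂ} (h : Bdd s a) :
    ∀ᵐ k, ∀ x y, IntervalIntegrable (fun t => a t k) volume x y := by
  obtain ⟨C, hC, hb⟩ := h.bound
  have h1 := ae_lintegral_time_lt_top (H := fun t k => ‖a t k‖ₑ) h.meas.enorm hC hb
  filter_upwards [h1] with k hk x y
  obtain ⟨n, hn⟩ := exists_nat_uIoc_subset x y
  rw [intervalIntegrable_iff]
  refine IntegrableOn.mono_set ?_ hn
  have hm : Measurable fun t => a t k := h.meas.comp measurable_prodMk_right
  exact ⟨hm.aestronglyMeasurable, hk n⟩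

/-! ### Differentiable families -/

/-- `a` is a primitive in time of `a'`, for almost every frequency. -/
def Deriv (a a' : ℝ → Space → ℂ) : Prop := ∀ᵐ k, Prim (fun t => a t k) fun t => a' t k

theorem Deriv.add {a a' b b' : ℝ → Space → ℂ} (h : Deriv a a') (h' : Deriv b b') :
    Deriv (fun t k => a t k + b t k) fun t k => a' t k + b' t k := by
  filter_upwards [h, h'] with k h1 h2 using h1.add h2

theorem Deriv.sub {a a' b b' : ℝ → Space → ℂ} (h : Deriv a a') (h' : Deriv b b') :
    Deriv (fun t k => a t k - b t k) fun t k => a' t k - b' t k := by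
  filter_upwards [h, h'] with k h1 h2 using h1.sub h2

theorem Deriv.const_mul {a a' : ℝ → Space → ℂ} (h : Deriv a a') (m : Space → ℂ) :
    Deriv (fun t k => m k * a t k) fun t k => m k * a' t k := by
  filter_upwards [h] with k h1 using h1.const_mul _

theorem Deriv.zero : Deriv (fun _ _ => 0) fun _ _ => 0 :=
  Filter.Eventually.of_forall fun _ => ⟨by simp, by simp⟩

theorem Deriv.sum {ι : Type*} {a a' : ι → ℝ → Space → ℂ} (S : Finset ι)
    (h : ∀ i ∈ S, Deriv (a i) (a' i)) :
    Deriv (fun t k => ∑ i ∈ S, a i t k) fun t k => ∑ i ∈ S, a' i t k := by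
  classical
  induction S using Finset.induction_on with
  | empty => simpa using Deriv.zero
  | insert i S hi ih =>
    simp only [Finset.sum_insert hi]
    exact (h i (by simp)).add (ih fun j hj => h j (by simp [hj]))

/-- A family whose derivative is bounded in H^s is Lipschitz with values in H^s: Cauchy–Schwarz in
time yields one factor δ, integration over an interval of length δ the other. -/
theorem Deriv.diff_bound {s : ℝ} {a a' : ℝ → Space → ℂ} (h : Deriv a a') (hb : Bdd s a') :
    ∃ C : ℝ≥0∞, C ≠ ∞ ∧ ∀ t δ, 0 ≤ δ →
      wn s (fun k => ‖a (t + δ) k - a t k‖ₑ) ≤ C * ENNReal.ofReal δ ^ 2 := by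
  obtain ⟨C, hC, hb'⟩ := hb.bound
  refine ⟨C, hC, fun t δ hδ => ?_⟩
  have hm := hb.meas
  have hm' : Measurable fun p : Space × ℝ => a' p.2 p.1 := hm.comp measurable_swap
  set T := Set.Ioc t (t + δ)
  have hT : volume T = ENNReal.ofReal δ := by simp [T]
  have h1 : ∀ᵐ k, ‖a (t + δ) k - a t k‖ₑ ≤ ∫⁻ r in T, ‖a' r k‖ₑ := by
    filter_upwards [h] with k hk
    rw [hk.eq, intervalIntegral.integral_of_le (by linarith)]
    exact enorm_integral_le_lintegral_enorm _
  refine (wn_mono_ae h1).trans ?_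
  have h2 : ∀ k, (wt s k * ∫⁻ r in T, ‖a' r k‖ₑ) ^ 2 ≤
      ENNReal.ofReal δ * ∫⁻ r in T, (wt s k * ‖a' r k‖ₑ) ^ 2 := by
    intro k
    have hmk : Measurable fun t => a' t k := hm.comp measurable_prodMk_right
    have := lintegral_mul_sq_le (μ := volume.restrict T) (f := fun _ => 1)
      (g := fun r => wt s k * ‖a' r k‖ₑ) (by fun_prop) (by fun_prop)
    simp only [one_mul, one_pow, lintegral_one, Measure.restrict_apply_univ, hT] at this
    rwa [lintegral_const_mul' _ _ (wt_ne_top _ _)] at this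
  refine (lintegral_mono h2).trans ?_
  have hm2 : Measurable fun p : Space × ℝ => (wt s p.1 * ‖a' p.2 p.1‖ₑ) ^ 2 := by fun_prop
  rw [lintegral_const_mul' _ _ (by simp), lintegral_lintegral_swap hm2.aemeasurable]
  calc _ ≤ ENNReal.ofReal δ * ∫⁻ r in T, C := by gcongr with r; exact hb' r
    _ = _ := by rw [lintegral_const, Measure.restrict_apply_univ, hT]; ring

/-- Fubini allows integration over the parameter to be exchanged with integration in time.
Integrability at all times follows from that at time 0. -/
theorem Prim.integral {α : Type*} [MeasurableSpace α] {μ : Measure α} [SFinite μ]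
    {e d : ℝ → α → ℂ} (hp : ∀ᵐ x ∂μ, Prim (fun t => e t x) fun t => d t x)
    (h0 : Integrable (e 0) μ)
    (hd : ∀ n : ℕ, Integrable (Function.uncurry d) ((volume.restrict (Set.Icc (-n : ℝ) n)).prod μ)) :
    Prim (fun t => ∫ x, e t x ∂μ) fun t => ∫ x, d t x ∂μ := by
  have hd' : ∀ s t, Integrable (Function.uncurry d) ((volume.restrict (Set.uIoc s t)).prod μ) := by
    intro s t
    obtain ⟨n, hn⟩ := exists_nat_uIoc_subset s t
    exact (hd n).mono_measure (Measure.prod_mono (Measure.restrict_mono hn le_rfl) le_rfl)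
  have he : ∀ t, Integrable (e t) μ := by
    intro t
    have h1 : Integrable (fun x => ∫ r in (0:ℝ)..t, d r x) μ := by
      simp_rw [intervalIntegral.intervalIntegral_eq_integral_uIoc]
      exact (hd' 0 t).integral_prod_right.smul _
    refine (h0.add h1).congr ?_
    filter_upwards [hp] with x hx
    simp only [Pi.add_apply]
    rw [← hx.eq]; ring
  refine ⟨fun s t => ?_, fun s t => ?_⟩
  · rw [intervalIntegrable_iff]
    exact (hd' s t).integral_prod_left
  · rw [← integral_sub (he t) (he s), intervalIntegral.intervalIntegral_eq_integral_uIoc,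
      integral_integral_swap (hd' s t), ← integral_smul]
    apply integral_congr_ae
    filter_upwards [hp] with x hx
    rw [hx.eq, intervalIntegral.intervalIntegral_eq_integral_uIoc]

/-! ### Bilinear operators with an oscillating symbol -/

/-- The bilinear operator with symbol `e^{itΦ} m`. -/
def bil (Φ : Space → Space → ℝ) (m : Space → Space → ℂ) (a b : ℝ → Space → ℂ) (t : ℝ)
    (k : Space) : ℂ :=
  ∫ l, Complex.exp (t * Φ l (k - l) * Complex.I) * m l (k - l) * (a t l * b t (k - l))

theorem norm_osc (t Φ : ℝ) : ‖Complex.exp (t * Φ * Complex.I)‖ = 1 := by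
  rw [← Complex.ofReal_mul, Complex.norm_exp_ofReal_mul_I]

theorem enorm_osc (t Φ : ℝ) : ‖Complex.exp (t * Φ * Complex.I)‖ₑ = 1 := by
  rw [← ofReal_norm, norm_osc]; simp

section bil

variable {Φ : Space → Space → ℝ} {m : Space → Space → ℂ} {a b a' b' : ℝ → Space → ℂ}

theorem enorm_bil_le (t : ℝ) (k : Space) :
    ‖bil Φ m a b t k‖ₑ ≤ cv (fun k l => ‖m k l‖ₑ) (fun k => ‖a t k‖ₑ) (fun k => ‖b t k‖ₑ) k := by
  refine (enorm_integral_le_lintegral_enorm _).trans (le_of_eq ?_)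
  unfold cv
  congr 1; ext l
  simp only [enorm_mul, enorm_osc, one_mul]

theorem measurable_integrand (hΦ : Measurable fun p : Space × Space => Φ p.1 p.2)
    (hm : Measurable fun p : Space × Space => m p.1 p.2)
    (ha : Measurable fun p : ℝ × Space => a p.1 p.2)
    (hb : Measurable fun p : ℝ × Space => b p.1 p.2) :
    Measurable fun q : (ℝ × Space) × Space =>
      Complex.exp (q.1.1 * Φ q.2 (q.1.2 - q.2) * Complex.I) * m q.2 (q.1.2 - q.2) *
        (a q.1.1 q.2 * b q.1.1 (q.1.2 - q.2)) := by
  have h1 : Measurable fun q : (ℝ × Space) × Space => Φ q.2 (q.1.2 - q.2) :=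
    hΦ.comp (measurable_snd.prodMk (measurable_fst.snd.sub measurable_snd))
  have h2 : Measurable fun q : (ℝ × Space) × Space => m q.2 (q.1.2 - q.2) :=
    hm.comp (measurable_snd.prodMk (measurable_fst.snd.sub measurable_snd))
  have h3 : Measurable fun q : (ℝ × Space) × Space => a q.1.1 q.2 :=
    ha.comp (measurable_fst.fst.prodMk measurable_snd)
  have h4 : Measurable fun q : (ℝ × Space) × Space => b q.1.1 (q.1.2 - q.2) :=
    hb.comp (measurable_fst.fst.prodMk (measurable_fst.snd.sub measurable_snd))
  fun_prop

theorem measurable_bil (hΦ : Measurable fun p : Space × Space => Φ p.1 p.2)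
    (hm : Measurable fun p : Space × Space => m p.1 p.2)
    (ha : Measurable fun p : ℝ × Space => a p.1 p.2)
    (hb : Measurable fun p : ℝ × Space => b p.1 p.2) :
    Measurable fun p : ℝ × Space => bil Φ m a b p.1 p.2 :=
  ((measurable_integrand hΦ hm ha hb).stronglyMeasurable.integral_prod_right').measurable

theorem measurable_cv_time {N : Space → Space → ℝ≥0∞}
    (hN : Measurable fun p : Space × Space => N p.1 p.2)
    (ha : Measurable fun p : ℝ × Space => a p.1 p.2)
    (hb : Measurable fun p : ℝ × Space => b p.1 p.2) :
    Measurable fun p : ℝ × Space => cv N (fun k => ‖a p.1 k‖ₑ) (fun k => ‖b p.1 k‖ₑ) p.2 := by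
  unfold cv
  have h2 : Measurable fun q : (ℝ × Space) × Space => N q.2 (q.1.2 - q.2) :=
    hN.comp (measurable_snd.prodMk (measurable_fst.snd.sub measurable_snd))
  have h3 : Measurable fun q : (ℝ × Space) × Space => a q.1.1 q.2 :=
    ha.comp (measurable_fst.fst.prodMk measurable_snd)
  have h4 : Measurable fun q : (ℝ × Space) × Space => b q.1.1 (q.1.2 - q.2) :=
    hb.comp (measurable_fst.fst.prodMk (measurable_fst.snd.sub measurable_snd))
  exact Measurable.lintegral_prod_right' (f := fun q : (ℝ × Space) × Space =>
    N q.2 (q.1.2 - q.2) * (‖a q.1.1 q.2‖ₑ * ‖b q.1.1 (q.1.2 - q.2)‖ₑ)) (by fun_prop)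

theorem Adm.cv_bound {r s₁ s₂ : ℝ} {N : Space → Space → ℝ≥0∞} (h : Adm r s₁ s₂ N)
    (ha : Bdd s₁ a) (hb : Bdd s₂ b) : ∃ C : ℝ≥0∞, C ≠ ∞ ∧
      ∀ t, wn r (cv N (fun k => ‖a t k‖ₑ) (fun k => ‖b t k‖ₑ)) ≤ C := by
  obtain ⟨C, hC, h⟩ := h
  obtain ⟨Ca, hCa, hba⟩ := ha.bound
  obtain ⟨Cb, hCb, hbb⟩ := hb.bound
  refine ⟨C * (Ca * Cb), by finiteness, fun t => ?_⟩
  refine (h _ _ (ha.meas_slice t).enorm (hb.meas_slice t).enorm).trans ?_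
  gcongr
  exacts [hba t, hbb t]

theorem Adm.bdd {r s₁ s₂ : ℝ} (h : Adm r s₁ s₂ fun k l => ‖m k l‖ₑ)
    (hΦ : Measurable fun p : Space × Space => Φ p.1 p.2)
    (hm : Measurable fun p : Space × Space => m p.1 p.2)
    (ha : Bdd s₁ a) (hb : Bdd s₂ b) : Bdd r (bil Φ m a b) := by
  obtain ⟨C, hC, h⟩ := h.cv_bound ha hb
  exact ⟨measurable_bil hΦ hm ha.meas hb.meas, C, hC,
    fun t => (wn_mono le_rfl fun k => enorm_bil_le t k).trans (h t)⟩

theorem measurable_integrand_time (hΦ : Measurable fun p : Space × Space => Φ p.1 p.2)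
    (hm : Measurable fun p : Space × Space => m p.1 p.2)
    (ha : Measurable fun p : ℝ × Space => a p.1 p.2)
    (hb : Measurable fun p : ℝ × Space => b p.1 p.2) (k : Space) :
    Measurable (Function.uncurry fun (t : ℝ) l =>
      Complex.exp (t * Φ l (k - l) * Complex.I) * m l (k - l) * (a t l * b t (k - l))) := by
  have h1 : Measurable fun q : ℝ × Space => Φ q.2 (k - q.2) :=
    hΦ.comp (measurable_snd.prodMk (measurable_const.sub measurable_snd))
  have h2 : Measurable fun q : ℝ × Space => m q.2 (k - q.2) :=
    hm.comp (measurable_snd.prodMk (measurable_const.sub measurable_snd))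
  have h4 : Measurable fun q : ℝ × Space => b q.1 (k - q.2) :=
    hb.comp (measurable_fst.prodMk (measurable_const.sub measurable_snd))
  simp only [Function.uncurry_def]
  fun_prop

theorem measurable_integrand_slice (hΦ : Measurable fun p : Space × Space => Φ p.1 p.2)
    (hm : Measurable fun p : Space × Space => m p.1 p.2) {f g : Space → ℂ}
    (hf : Measurable f) (hg : Measurable g) (t : ℝ) (k : Space) :
    Measurable fun l =>
      Complex.exp (t * Φ l (k - l) * Complex.I) * m l (k - l) * (f l * g (k - l)) := by
  have h1 : Measurable fun l : Space => Φ l (k - l) :=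
    hΦ.comp (measurable_id.prodMk (measurable_const.sub measurable_id))
  have h2 : Measurable fun l : Space => m l (k - l) :=
    hm.comp (measurable_id.prodMk (measurable_const.sub measurable_id))
  fun_prop

theorem bil_integrand_integrable_time {r s₁ s₂ : ℝ} (h : Adm r s₁ s₂ fun k l => ‖m k l‖ₑ)
    (hΦ : Measurable fun p : Space × Space => Φ p.1 p.2)
    (hm : Measurable fun p : Space × Space => m p.1 p.2)
    (ha : Bdd s₁ a) (hb : Bdd s₂ b) : ∀ᵐ k, ∀ n : ℕ, Integrable
      (Function.uncurry fun (t : ℝ) l =>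
        Complex.exp (t * Φ l (k - l) * Complex.I) * m l (k - l) * (a t l * b t (k - l)))
      ((volume.restrict (Set.Icc (-n : ℝ) n)).prod volume) := by
  obtain ⟨C, hC, h⟩ := h.cv_bound ha hb
  filter_upwards [ae_lintegral_time_lt_top (measurable_cv_time (N := fun k l => ‖m k l‖ₑ) hm.enorm ha.meas hb.meas) hC h]
    with k hk n
  have hMk := measurable_integrand_time hΦ hm ha.meas hb.meas k
  refine ⟨hMk.aestronglyMeasurable, ?_⟩
  rw [HasFiniteIntegral, lintegral_prod _ hMk.enorm.aemeasurable]
  refine lt_of_le_of_lt (le_of_eq ?_) (hk n)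
  congr 1; ext t
  unfold cv
  congr 1; ext l
  simp only [Function.uncurry, enorm_mul, enorm_osc, one_mul]

theorem bil_integrand_integrable {r s₁ s₂ : ℝ} (h : Adm r s₁ s₂ fun k l => ‖m k l‖ₑ)
    (hΦ : Measurable fun p : Space × Space => Φ p.1 p.2)
    (hm : Measurable fun p : Space × Space => m p.1 p.2)
    (ha : Bdd s₁ a) (hb : Bdd s₂ b) (t : ℝ) : ∀ᵐ k, Integrable fun l =>
        Complex.exp (t * Φ l (k - l) * Complex.I) * m l (k - l) * (a t l * b t (k - l)) := by
  obtain ⟨C, hC, h⟩ := h.cv_bound ha hb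
  have hc := measurable_cv (N := fun k l => ‖m k l‖ₑ) hm.enorm (ha.meas_slice t).enorm
    (hb.meas_slice t).enorm
  filter_upwards [wn_lt_top_ae hc ((h t).trans_lt hC.lt_top).ne] with k hk
  have hMk := measurable_integrand_slice hΦ hm (ha.meas_slice t) (hb.meas_slice t) t k
  refine ⟨hMk.aestronglyMeasurable, lt_of_le_of_lt (le_of_eq ?_) hk⟩
  unfold cv
  congr 1; ext l
  simp only [enorm_mul, enorm_osc, one_mul]

theorem ae_integrable_slice {d : ℝ → Space → ℂ}
    (h : ∀ n : ℕ, Integrable (Function.uncurry d)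
      ((volume.restrict (Set.Icc (-n : ℝ) n)).prod (volume : Measure Space))) :
    ∀ᵐ t, Integrable (d t) := by
  have h1 : ∀ᵐ t, ∀ n : ℕ, t ∈ Set.Icc (-n : ℝ) n → Integrable (d t) := by
    rw [ae_all_iff]
    intro n
    exact (ae_restrict_iff' measurableSet_Icc).mp (h n).prod_right_ae
  filter_upwards [h1] with t ht
  obtain ⟨n, hn⟩ := exists_nat_gt |t|
  exact ht n ⟨by linarith [neg_abs_le t], by linarith [le_abs_self t]⟩

/-- The Leibniz rule for bilinear operators with oscillating symbols. -/
theorem Deriv.bil {r r₀ r₁ r₂ s₁ s₂ s₁' s₂' : ℝ}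
    (hΦ : Measurable fun p : Space × Space => Φ p.1 p.2)
    (hm : Measurable fun p : Space × Space => m p.1 p.2)
    (ha : Bdd s₁ a) (hb : Bdd s₂ b) (ha' : Bdd s₁' a') (hb' : Bdd s₂' b')
    (hda : Deriv a a') (hdb : Deriv b b')
    (A : Adm r s₁ s₂ fun k l => ‖m k l‖ₑ)
    (A₀ : Adm r₀ s₁ s₂ fun k l => ‖Complex.I * Φ k l * m k l‖ₑ)
    (A₁ : Adm r₁ s₁' s₂ fun k l => ‖m k l‖ₑ) (A₂ : Adm r₂ s₁ s₂' fun k l => ‖m k l‖ₑ) :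
    Deriv (CSH.bil Φ m a b) fun t k =>
      CSH.bil Φ (fun k l => Complex.I * Φ k l * m k l) a b t k +
        (CSH.bil Φ m a' b t k + CSH.bil Φ m a b' t k) := by
  have hm0 : Measurable fun p : Space × Space => Complex.I * Φ p.1 p.2 * m p.1 p.2 := by fun_prop
  have i0 := bil_integrand_integrable_time A₀ hΦ hm0 ha hb
  have i1 := bil_integrand_integrable_time A₁ hΦ hm ha' hb
  have i2 := bil_integrand_integrable_time A₂ hΦ hm ha hb'
  have i3 := bil_integrand_integrable A hΦ hm ha hb 0
  filter_upwards [i0, i1, i2, i3] with k h0 h1 h2 h3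
  have hdb' : ∀ᵐ l, Prim (fun t => b t (k - l)) fun t => b' t (k - l) :=
    (Measure.measurePreserving_sub_left volume k).quasiMeasurePreserving.ae hdb
  have hp : ∀ᵐ l, Prim (fun t : ℝ => Complex.exp (t * Φ l (k - l) * Complex.I) * m l (k - l) *
      (a t l * b t (k - l)))
      (fun t : ℝ => Complex.exp (t * Φ l (k - l) * Complex.I) *
          (Complex.I * Φ l (k - l) * m l (k - l)) * (a t l * b t (k - l)) +
        (Complex.exp (t * Φ l (k - l) * Complex.I) * m l (k - l) * (a' t l * b t (k - l)) +
        Complex.exp (t * Φ l (k - l) * Complex.I) * m l (k - l) * (a t l * b' t (k - l)))) := by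
    filter_upwards [hda, hdb'] with l hl1 hl2
    have := ((Prim.cexp (Φ l (k - l))).mul (hl1.mul hl2)).const_mul (m l (k - l))
    convert this using 1
    · ext t; ring
    · ext t; ring
  have key := Prim.integral hp h3 (fun n => (h0 n).add ((h1 n).add (h2 n)))
  refine key.congr ?_
  filter_upwards [ae_integrable_slice h0, ae_integrable_slice h1, ae_integrable_slice h2]
    with t j0 j1 j2
  rw [integral_add j0 (by exact j1.add j2), integral_add j1 j2]
  rfl

end bil

end

section


/-! ### Regularity of order `3/4` in time -/

/-- The measure `δ^{-5/2} dδ` on `(0, 1]`. -/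
def incrMeasure : Measure ℝ :=
  (volume.restrict (Set.Ioc 0 1)).withDensity fun δ => ENNReal.ofReal (δ ^ (-(5 / 2) : ℝ))

instance : SFinite incrMeasure := by unfold incrMeasure; infer_instance

theorem measurable_incr_density : Measurable fun δ : ℝ => ENNReal.ofReal (δ ^ (-(5 / 2) : ℝ)) := by
  fun_prop

theorem lintegral_incrMeasure {f : ℝ → ℝ≥0∞} (hf : Measurable f) :
    ∫⁻ δ, f δ ∂incrMeasure = ∫⁻ δ in Set.Ioc 0 1, ENNReal.ofReal (δ ^ (-(5 / 2) : ℝ)) * f δ := by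
  unfold incrMeasure
  rw [lintegral_withDensity_eq_lintegral_mul _ measurable_incr_density hf]
  rfl

theorem ae_incrMeasure : ∀ᵐ δ ∂incrMeasure, 0 ≤ δ := by
  refine (withDensity_absolutelyContinuous _ _).ae_le ?_
  exact (ae_restrict_iff' measurableSet_Ioc).mpr (Filter.Eventually.of_forall fun x hx => hx.1.le)

theorem lintegral_Ioc_rpow {c p : ℝ} (hc : 0 < c) (hp : -1 < p) :
    ∫⁻ δ in Set.Ioc 0 c, ENNReal.ofReal (δ ^ p) = ENNReal.ofReal (c ^ (p + 1) / (p + 1)) := by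
  have hint : IntegrableOn (fun y : ℝ => y ^ p) (Set.Ioc 0 c) := by
    rw [← intervalIntegrable_iff_integrableOn_Ioc_of_le hc.le]
    exact intervalIntegral.intervalIntegrable_rpow' hp
  rw [← ofReal_integral_eq_lintegral_ofReal hint, ← intervalIntegral.integral_of_le hc.le,
    integral_rpow (Or.inl hp), Real.zero_rpow (by linarith), sub_zero]
  exact (ae_restrict_iff' measurableSet_Ioc).mpr (Filter.Eventually.of_forall fun x hx =>
    Real.rpow_nonneg hx.1.le _)

theorem lintegral_Ioi_rpow {c p : ℝ} (hc : 0 < c) (hp : p < -1) :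
    ∫⁻ δ in Set.Ioi c, ENNReal.ofReal (δ ^ p) = ENNReal.ofReal (-c ^ (p + 1) / (p + 1)) := by
  rw [← ofReal_integral_eq_lintegral_ofReal (integrableOn_Ioi_rpow_of_lt hp hc),
    integral_Ioi_rpow_of_lt hp hc]
  exact (ae_restrict_iff' measurableSet_Ioi).mpr (Filter.Eventually.of_forall fun x hx =>
    Real.rpow_nonneg (hc.le.trans (le_of_lt hx)) _)

theorem lintegral_incr_sq_le : ∫⁻ δ, ENNReal.ofReal δ ^ 2 ∂incrMeasure ≤ 2 := by
  rw [lintegral_incrMeasure (by fun_prop)]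
  calc _ = ∫⁻ δ in Set.Ioc (0:ℝ) 1, ENNReal.ofReal (δ ^ (-(1 / 2) : ℝ)) := by
        apply setLIntegral_congr_fun measurableSet_Ioc fun δ hδ => ?_
        rw [← ENNReal.ofReal_pow hδ.1.le, ← ENNReal.ofReal_mul (Real.rpow_nonneg hδ.1.le _),
          ← Real.rpow_natCast, ← Real.rpow_add hδ.1]
        norm_num
    _ ≤ _ := by
        rw [lintegral_Ioc_rpow one_pos (by norm_num)]
        norm_num

/-- Scaling: |e^{iδx}-1| is at most min(δ|x|, 2), and δ^{-5/2}dδ gives |x|^{3/2}. The exponent 5/2 =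
1 + 2·(3/4) is chosen so that the norm in δ costs |x|^{3/4}. -/
theorem lintegral_incr_osc_le (x : ℝ) :
    ∫⁻ δ : ℝ, ‖Complex.exp (δ * x * Complex.I) - 1‖ₑ ^ 2 ∂incrMeasure
      ≤ (3 * ENNReal.ofReal (|x| ^ (3 / 4 : ℝ))) ^ 2 := by
  rcases eq_or_ne x 0 with rfl | hx
  · simp
  have hx0 : 0 < |x| := abs_pos.mpr hx
  have hc : 0 < |x|⁻¹ := inv_pos.mpr hx0
  rw [lintegral_incrMeasure (by fun_prop)]
  have b1 : ∀ δ : ℝ, 0 < δ → ‖Complex.exp (δ * x * Complex.I) - 1‖ ≤ δ * |x| := by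
    intro δ hδ
    rw [← Complex.ofReal_mul, mul_comm _ Complex.I]
    refine Real.norm_exp_I_mul_ofReal_sub_one_le.trans ?_
    rw [Real.norm_eq_abs, abs_mul, abs_of_pos hδ]
  have b2 : ∀ δ : ℝ, ‖Complex.exp (δ * x * Complex.I) - 1‖ ≤ 2 := by
    intro δ
    refine (norm_sub_le _ _).trans ?_
    rw [norm_osc]; norm_num
  -- The two bounds for the oscillation meet, up to a factor, at δ = 1/|x|.
  have hsub : Set.Ioc (0:ℝ) 1 ⊆ Set.Ioc 0 |x|⁻¹ ∪ Set.Ioi |x|⁻¹ := by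
    rw [Set.Ioc_union_Ioi_eq_Ioi hc.le]
    exact fun y hy => hy.1
  refine (lintegral_mono_set hsub).trans ((lintegral_union_le _ _ _).trans ?_)
  have c1 : ∫⁻ δ in Set.Ioc 0 |x|⁻¹, ENNReal.ofReal (δ ^ (-(5 / 2) : ℝ)) *
      ‖Complex.exp (δ * x * Complex.I) - 1‖ₑ ^ 2 ≤ ENNReal.ofReal (2 * |x| ^ (3 / 2 : ℝ)) := by
    calc _ ≤ ∫⁻ δ in Set.Ioc 0 |x|⁻¹, ENNReal.ofReal (|x| ^ 2) * ENNReal.ofReal (δ ^ (-(1 / 2) : ℝ)) := by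
          apply setLIntegral_mono (by fun_prop) fun δ hδ => ?_
          rw [← ofReal_norm, ← ENNReal.ofReal_pow (norm_nonneg _),
            ← ENNReal.ofReal_mul (Real.rpow_nonneg hδ.1.le _), ← ENNReal.ofReal_mul (by positivity)]
          apply ENNReal.ofReal_le_ofReal
          have e : δ ^ (-(1 / 2) : ℝ) = δ ^ (-(5 / 2) : ℝ) * δ ^ 2 := by
            rw [← Real.rpow_natCast, ← Real.rpow_add hδ.1]; norm_num
          rw [e]
          calc _ ≤ δ ^ (-(5 / 2) : ℝ) * (δ * |x|) ^ 2 := by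
                have := b1 δ hδ.1
                have := hδ.1
                gcongr
            _ = _ := by ring
      _ = ENNReal.ofReal (|x| ^ 2 * ((|x|⁻¹) ^ (-(1 / 2) + 1 : ℝ) / (-(1 / 2) + 1))) := by
          rw [lintegral_const_mul' _ _ (by simp), lintegral_Ioc_rpow hc (by norm_num),
            ← ENNReal.ofReal_mul (by positivity)]
      _ ≤ _ := by
          apply ENNReal.ofReal_le_ofReal
          apply le_of_eq
          have e : |x| ^ (3 / 2 : ℝ) = |x| ^ 2 * (|x|⁻¹) ^ (1 / 2 : ℝ) := by
            rw [Real.inv_rpow hx0.le, ← Real.rpow_neg hx0.le, ← Real.rpow_natCast,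
              ← Real.rpow_add hx0]
            norm_num
          rw [e]; norm_num; ring
  have c2 : ∫⁻ δ in Set.Ioi |x|⁻¹, ENNReal.ofReal (δ ^ (-(5 / 2) : ℝ)) *
      ‖Complex.exp (δ * x * Complex.I) - 1‖ₑ ^ 2 ≤ ENNReal.ofReal (8 / 3 * |x| ^ (3 / 2 : ℝ)) := by
    calc _ ≤ ∫⁻ δ in Set.Ioi |x|⁻¹, ENNReal.ofReal 4 * ENNReal.ofReal (δ ^ (-(5 / 2) : ℝ)) := by
          apply setLIntegral_mono (by fun_prop) fun δ hδ => ?_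
          have hδ0 : 0 < δ := hc.trans hδ
          rw [← ofReal_norm, ← ENNReal.ofReal_pow (norm_nonneg _), mul_comm,
            ← ENNReal.ofReal_mul (by positivity), ← ENNReal.ofReal_mul (by positivity)]
          apply ENNReal.ofReal_le_ofReal
          gcongr
          calc _ ≤ (2:ℝ) ^ 2 := by
                have := b2 δ
                gcongr
            _ = 4 := by norm_num
      _ = ENNReal.ofReal (4 * (-(|x|⁻¹) ^ (-(5 / 2) + 1 : ℝ) / (-(5 / 2) + 1))) := by
          rw [lintegral_const_mul' _ _ (by simp), lintegral_Ioi_rpow hc (by norm_num),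
            ← ENNReal.ofReal_mul (by positivity)]
      _ ≤ _ := by
          apply ENNReal.ofReal_le_ofReal
          apply le_of_eq
          have e : |x| ^ (3 / 2 : ℝ) = (|x|⁻¹) ^ (-(3 / 2) : ℝ) := by
            rw [Real.inv_rpow hx0.le, ← Real.rpow_neg hx0.le]; norm_num
          rw [e]; norm_num; ring
  -- The two contributions amount to 2 + 8/3, which is below 3².
  refine (add_le_add c1 c2).trans ?_
  rw [← ENNReal.ofReal_add (by positivity) (by positivity), mul_pow, ← ENNReal.ofReal_pow (by positivity),
    ← Real.rpow_natCast, ← Real.rpow_mul hx0.le]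
  have : (3:ℝ≥0∞) ^ 2 = ENNReal.ofReal 9 := by norm_num
  rw [this, ← ENNReal.ofReal_mul (by norm_num)]
  apply ENNReal.ofReal_le_ofReal
  norm_num
  have : 0 ≤ |x| ^ (3 / 2 : ℝ) := by positivity
  linarith

/-- Minkowski's inequality in `L²`. -/
theorem minkowski_sq {α β : Type*} [MeasurableSpace α] [MeasurableSpace β] {μ : Measure α}
    {ν : Measure β} [SFinite μ] [SFinite ν] {A B : α → ℝ≥0∞} {e : β → α → ℝ≥0∞}
    (hA : Measurable A) (hB : Measurable B) (he : Measurable fun p : β × α => e p.1 p.2)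
    (h : ∀ x, ∫⁻ y, e y x ^ 2 ∂ν ≤ B x ^ 2) :
    ∫⁻ y, (∫⁻ x, A x * e y x ∂μ) ^ 2 ∂ν ≤ (∫⁻ x, A x * B x ∂μ) ^ 2 := by
  have he1 : ∀ y, Measurable (e y) := fun y => he.comp measurable_prodMk_left
  have he2 : ∀ x, Measurable fun y => e y x := fun x => he.comp measurable_prodMk_right
  -- The square becomes a double integral, so that the integral over y can be taken first and
  -- estimated by Cauchy–Schwarz.
  have e1 : ∀ y, (∫⁻ x, A x * e y x ∂μ) ^ 2 =
      ∫⁻ p, (A p.1 * A p.2) * (e y p.1 * e y p.2) ∂(μ.prod μ) := by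
    intro y
    have := he1 y
    rw [sq, ← lintegral_prod_mul (by fun_prop) (by fun_prop)]
    congr 1; ext p; ring
  have m1 : Measurable fun q : β × (α × α) => e q.1 q.2.1 :=
    he.comp (measurable_fst.prodMk measurable_snd.fst)
  have m2 : Measurable fun q : β × (α × α) => e q.1 q.2.2 :=
    he.comp (measurable_fst.prodMk measurable_snd.snd)
  simp_rw [e1]
  rw [lintegral_lintegral_swap (by fun_prop)]
  have key : ∀ p : α × α, ∫⁻ y, A p.1 * A p.2 * (e y p.1 * e y p.2) ∂ν ≤
      (A p.1 * B p.1) * (A p.2 * B p.2) := by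
    intro p
    have n1 := he2 p.1
    have n2 := he2 p.2
    rw [lintegral_const_mul _ (by fun_prop)]
    have cs : (∫⁻ y, e y p.1 * e y p.2 ∂ν) ^ 2 ≤ (B p.1 * B p.2) ^ 2 := by
      refine (lintegral_mul_sq_le n1.aemeasurable n2.aemeasurable).trans ?_
      rw [mul_pow]
      exact mul_le_mul' (h _) (h _)
    have cs' := (ENNReal.pow_le_pow_left_iff two_ne_zero).mp cs
    calc _ ≤ A p.1 * A p.2 * (B p.1 * B p.2) := by gcongr
      _ = _ := by ring
  refine (lintegral_mono key).trans ?_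
  rw [sq]
  exact (lintegral_prod_mul (f := fun x => A x * B x) (g := fun x => A x * B x)
    (by fun_prop) (by fun_prop)).le

end

/-! ### Families with three quarters of a derivative in time -/

section


/-- Functions `h` of time with bounded values in `H^s` and `3/4` derivatives in time in `L²`. -/
structure HT (s : ℝ) (h : ℝ → Space → ℂ) : Prop where
  bdd : Bdd s h
  incr : ∃ C : ℝ≥0∞, C ≠ ∞ ∧ ∀ t : ℝ,
    ∫⁻ δ : ℝ, wn s (fun k => ‖h (t + δ) k - h t k‖ₑ) ∂incrMeasure ≤ C

theorem HT.mono {s s' : ℝ} {h : ℝ → Space → ℂ} (hh : HT s h) (hs : s' ≤ s) : HT s' h := by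
  obtain ⟨hb, C, hC, hi⟩ := hh
  exact ⟨hb.mono hs, C, hC, fun t =>
    (lintegral_mono fun δ => wn_mono hs fun k => le_rfl).trans (hi t)⟩

theorem measurable_wn_time {s : ℝ} {H : ℝ → Space → ℝ≥0∞}
    (hm : Measurable fun p : ℝ × Space => H p.1 p.2) : Measurable fun t => wn s (H t) := by
  unfold wn
  have h2 := measurable_wt s
  exact Measurable.lintegral_prod_right'
    (f := fun p : ℝ × Space => (wt s p.2 * H p.1 p.2) ^ 2) (by fun_prop)

theorem Bdd.measurable_wn_incr {s : ℝ} {h : ℝ → Space → ℂ} (hb : Bdd s h) (t : ℝ) :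
    Measurable fun δ : ℝ => wn s (fun k => ‖h (t + δ) k - h t k‖ₑ) := by
  have h1 := hb.meas
  have h2 := hb.meas_slice t
  have h3 : Measurable fun p : ℝ × Space => h (t + p.1) p.2 :=
    h1.comp ((measurable_const.add measurable_fst).prodMk measurable_snd)
  exact measurable_wn_time (H := fun δ k => ‖h (t + δ) k - h t k‖ₑ)
    (h3.sub (h2.comp measurable_snd)).enorm

theorem HT.add {s : ℝ} {h h' : ℝ → Space → ℂ} (hh : HT s h) (hh' : HT s h') :
    HT s (fun t k => h t k + h' t k) := by
  obtain ⟨hb, C, hC, hi⟩ := hh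
  obtain ⟨hb', C', hC', hi'⟩ := hh'
  refine ⟨hb.add hb', 2 * (C + C'), by finiteness, fun t => ?_⟩
  calc _ ≤ ∫⁻ δ : ℝ, 2 * (wn s (fun k => ‖h (t + δ) k - h t k‖ₑ) +
        wn s (fun k => ‖h' (t + δ) k - h' t k‖ₑ)) ∂incrMeasure := by
        refine lintegral_mono fun δ => ?_
        have := hb.meas_slice t
        have := hb.meas_slice (t + δ)
        refine (wn_mono le_rfl fun k => ?_).trans (wn_add_le (by fun_prop))
        rw [add_sub_add_comm]
        exact enorm_add_le _ _
    _ = 2 * (∫⁻ δ : ℝ, wn s (fun k => ‖h (t + δ) k - h t k‖ₑ) ∂incrMeasure +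
        ∫⁻ δ : ℝ, wn s (fun k => ‖h' (t + δ) k - h' t k‖ₑ) ∂incrMeasure) := by
        rw [lintegral_const_mul' _ _ (by simp), lintegral_add_left (hb.measurable_wn_incr t)]
    _ ≤ _ := by
        gcongr
        · exact hi t
        · exact hi' t

theorem HT.zero (s : ℝ) : HT s (fun _ _ => 0) :=
  ⟨Bdd.zero s, 0, by simp, fun t => by simp [wn]⟩

theorem HT.mul_symbol {s r C : ℝ} {h : ℝ → Space → ℂ} {m : Space → ℂ} (hh : HT s h)
    (hm : Measurable m) (hb : ∀ k, ‖m k‖ ≤ C * jb k ^ r) :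
    HT (s - r) (fun t k => m k * h t k) := by
  obtain ⟨hbd, D, hD, hi⟩ := hh
  refine ⟨hbd.mul_symbol (m := fun _ k => m k) (by fun_prop) (fun _ k => hb k),
    ENNReal.ofReal C ^ 2 * D, by finiteness, fun t => ?_⟩
  calc _ ≤ ∫⁻ δ : ℝ, ENNReal.ofReal C ^ 2 * wn s (fun k => ‖h (t + δ) k - h t k‖ₑ) ∂incrMeasure := by
        refine lintegral_mono fun δ => ?_
        rw [← wn_const_mul ENNReal.ofReal_ne_top]
        have : wn s (fun k => ENNReal.ofReal C * ‖h (t + δ) k - h t k‖ₑ) =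
          wn (s - r) (fun k => wt r k * (ENNReal.ofReal C * ‖h (t + δ) k - h t k‖ₑ)) := by
          rw [wn_wt_mul]; congr 1; ring
        rw [this]
        refine wn_mono le_rfl fun k => ?_
        rw [← mul_sub, enorm_mul, ← mul_assoc]
        gcongr
        rw [wt, ← ofReal_norm, mul_comm, ← ENNReal.ofReal_mul' (by positivity [jb_pos k])]
        exact ENNReal.ofReal_le_ofReal (hb k)
    _ ≤ _ := by
        rw [lintegral_const_mul' _ _ (by finiteness)]
        gcongr
        exact hi t

/-- Lipschitz families qualify because δ² · δ^{-5/2} is integrable at 0. -/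
theorem HT.of_deriv {s : ℝ} {h h' : ℝ → Space → ℂ} (hb : Bdd s h) (hb' : Bdd s h')
    (hd : Deriv h h') : HT s h := by
  obtain ⟨C, hC, hi⟩ := hd.diff_bound hb'
  refine ⟨hb, C * 2, by finiteness, fun t => ?_⟩
  calc _ ≤ ∫⁻ δ : ℝ, C * ENNReal.ofReal δ ^ 2 ∂incrMeasure := by
        refine lintegral_mono_ae ?_
        filter_upwards [ae_incrMeasure] with δ hδ using hi t δ hδ
    _ ≤ _ := by
        rw [lintegral_const_mul' _ _ hC]
        gcongr
        exact lintegral_incr_sq_le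

variable {a b a' b' : ℝ → Space → ℂ} {Φ : Space → Space → ℝ} {m : Space → Space → ℂ}

/-- The part of the increment of `bil Φ m a b` that comes from the oscillating factor. -/
def oscIncr (Φ : Space → Space → ℝ) (m : Space → Space → ℂ) (F G : Space → ℂ) (δ : ℝ)
    (k : Space) : ℝ≥0∞ :=
  ∫⁻ l, (‖m l (k - l)‖ₑ * (‖F l‖ₑ * ‖G (k - l)‖ₑ)) *
    ‖Complex.exp (δ * Φ l (k - l) * Complex.I) - 1‖ₑ

theorem measurable_oscIncr (hΦ : Measurable fun p : Space × Space => Φ p.1 p.2)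
    (hm : Measurable fun p : Space × Space => m p.1 p.2) {F G : Space → ℂ}
    (hF : Measurable F) (hG : Measurable G) :
    Measurable fun p : ℝ × Space => oscIncr Φ m F G p.1 p.2 := by
  have h1 : Measurable fun q : (ℝ × Space) × Space => Φ q.2 (q.1.2 - q.2) :=
    hΦ.comp (measurable_snd.prodMk (measurable_fst.snd.sub measurable_snd))
  have h2 : Measurable fun q : (ℝ × Space) × Space => m q.2 (q.1.2 - q.2) :=
    hm.comp (measurable_snd.prodMk (measurable_fst.snd.sub measurable_snd))
  have h3 : Measurable fun q : (ℝ × Space) × Space => G (q.1.2 - q.2) :=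
    hG.comp (measurable_fst.snd.sub measurable_snd)
  exact Measurable.lintegral_prod_right'
    (f := fun q : (ℝ × Space) × Space => (‖m q.2 (q.1.2 - q.2)‖ₑ * (‖F q.2‖ₑ * ‖G (q.1.2 - q.2)‖ₑ)) *
    ‖Complex.exp (q.1.1 * Φ q.2 (q.1.2 - q.2) * Complex.I) - 1‖ₑ) (by fun_prop)

theorem measurable_oscIncr_slice (hΦ : Measurable fun p : Space × Space => Φ p.1 p.2)
    (hm : Measurable fun p : Space × Space => m p.1 p.2) {F G : Space → ℂ}
    (hF : Measurable F) (hG : Measurable G) (δ : ℝ) : Measurable (oscIncr Φ m F G δ) := by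
  have h1 : Measurable fun q : Space × Space => Φ q.2 (q.1 - q.2) :=
    hΦ.comp (measurable_snd.prodMk (measurable_fst.sub measurable_snd))
  have h2 : Measurable fun q : Space × Space => m q.2 (q.1 - q.2) :=
    hm.comp (measurable_snd.prodMk (measurable_fst.sub measurable_snd))
  have h3 : Measurable fun q : Space × Space => G (q.1 - q.2) :=
    hG.comp (measurable_fst.sub measurable_snd)
  exact Measurable.lintegral_prod_right'
    (f := fun q : Space × Space => (‖m q.2 (q.1 - q.2)‖ₑ * (‖F q.2‖ₑ * ‖G (q.1 - q.2)‖ₑ)) *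
    ‖Complex.exp (δ * Φ q.2 (q.1 - q.2) * Complex.I) - 1‖ₑ) (by fun_prop)

/-- Minkowski's inequality moves the norm in δ inside the frequency integral, where it acts on
e^{iδΦ}-1 alone and becomes the multiplier 3|Φ|^{3/4}; the 9 is the square of this 3. -/
theorem lintegral_wn_oscIncr_le {r : ℝ} (hΦ : Measurable fun p : Space × Space => Φ p.1 p.2)
    (hm : Measurable fun p : Space × Space => m p.1 p.2) {F G : Space → ℂ}
    (hF : Measurable F) (hG : Measurable G) :
    ∫⁻ δ, wn r (oscIncr Φ m F G δ) ∂incrMeasure ≤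
      9 * wn r (cv (fun k l => ‖m k l‖ₑ * ENNReal.ofReal (|Φ k l| ^ (3 / 4 : ℝ)))
        (fun k => ‖F k‖ₑ) fun k => ‖G k‖ₑ) := by
  have hw := measurable_wt r
  have ho := measurable_oscIncr hΦ hm hF hG
  have e9 : (9 : ℝ≥0∞) = 3 ^ 2 := by norm_num
  rw [e9, ← wn_const_mul (by simp)]
  unfold wn
  rw [lintegral_lintegral_swap (by fun_prop)]
  refine lintegral_mono fun k => ?_
  simp_rw [mul_pow]
  rw [lintegral_const_mul' _ _ (by have := wt_ne_top r k; finiteness)]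
  gcongr
  have g1 : Measurable fun l => Φ l (k - l) := hΦ.comp (measurable_id.prodMk (by fun_prop))
  have g2 : Measurable fun l => m l (k - l) := hm.comp (measurable_id.prodMk (by fun_prop))
  have g3 : Measurable fun l => G (k - l) := hG.comp (by fun_prop)
  refine (minkowski_sq (A := fun l => ‖m l (k - l)‖ₑ * (‖F l‖ₑ * ‖G (k - l)‖ₑ)) (B := fun l => 3 * ENNReal.ofReal (|Φ l (k - l)| ^ (3 / 4 : ℝ)))
    (e := fun (δ : ℝ) l => ‖Complex.exp (δ * Φ l (k - l) * Complex.I) - 1‖ₑ)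
    (by fun_prop) (by fun_prop) (by fun_prop) fun l => lintegral_incr_osc_le _).trans ?_
  rw [← mul_pow]
  apply pow_le_pow_left₀ zero_le
  unfold cv
  rw [← lintegral_const_mul' _ _ (by simp)]
  refine lintegral_mono fun l => le_of_eq ?_
  ring

/-- Product rule for increments: the difference is split into changes of the exponential, of a and
of b, in such a way that the remaining exponential always has modulus one. -/
theorem enorm_bil_sub_le {t δ : ℝ} {k : Space}
    (h0 : Integrable fun l => Complex.exp (t * Φ l (k - l) * Complex.I) * m l (k - l) *
      (a t l * b t (k - l)))
    (h1 : Integrable fun l => Complex.exp ((t + δ : ℝ) * Φ l (k - l) * Complex.I) * m l (k - l) *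
      (a (t + δ) l * b (t + δ) (k - l)))
    (hΦ : Measurable fun p : Space × Space => Φ p.1 p.2)
    (hm : Measurable fun p : Space × Space => m p.1 p.2)
    (ha : Measurable fun p : ℝ × Space => a p.1 p.2)
    (hb : Measurable fun p : ℝ × Space => b p.1 p.2) :
    ‖bil Φ m a b (t + δ) k - bil Φ m a b t k‖ₑ ≤ oscIncr Φ m (a t) (b t) δ k +
      (cv (fun k l => ‖m k l‖ₑ) (fun k => ‖a (t + δ) k - a t k‖ₑ) (fun k => ‖b (t + δ) k‖ₑ) k +
        cv (fun k l => ‖m k l‖ₑ) (fun k => ‖a t k‖ₑ) (fun k => ‖b (t + δ) k - b t k‖ₑ) k) := by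
  have a1 : ∀ s, Measurable (a s) := fun s => ha.comp (measurable_const.prodMk measurable_id)
  have b1 : ∀ s, Measurable (b s) := fun s => hb.comp (measurable_const.prodMk measurable_id)
  have b2 : ∀ s, Measurable fun l => b s (k - l) := fun s => (b1 s).comp (by fun_prop)
  have g1 : Measurable fun l => Φ l (k - l) := hΦ.comp (measurable_id.prodMk (by fun_prop))
  have g2 : Measurable fun l => m l (k - l) := hm.comp (measurable_id.prodMk (by fun_prop))
  have at0 := a1 t
  have bt0 := b2 t
  have at1 := a1 (t + δ)
  have bt1 := b2 (t + δ)
  unfold bil oscIncr cv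
  rw [← integral_sub h1 h0, ← lintegral_add_left (by fun_prop), ← lintegral_add_left (by fun_prop)]
  refine (enorm_integral_le_lintegral_enorm _).trans (lintegral_mono fun l => ?_)
  have e : Complex.exp ((t + δ : ℝ) * Φ l (k - l) * Complex.I) * m l (k - l) *
      (a (t + δ) l * b (t + δ) (k - l)) - Complex.exp (t * Φ l (k - l) * Complex.I) * m l (k - l) *
      (a t l * b t (k - l)) =
      Complex.exp (t * Φ l (k - l) * Complex.I) * ((m l (k - l) * (a t l * b t (k - l))) *
        (Complex.exp (δ * Φ l (k - l) * Complex.I) - 1)) +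
      (Complex.exp ((t + δ : ℝ) * Φ l (k - l) * Complex.I) * (m l (k - l) *
        ((a (t + δ) l - a t l) * b (t + δ) (k - l))) +
      Complex.exp ((t + δ : ℝ) * Φ l (k - l) * Complex.I) * (m l (k - l) *
        (a t l * (b (t + δ) (k - l) - b t (k - l))))) := by
    have : Complex.exp ((t + δ : ℝ) * Φ l (k - l) * Complex.I) =
      Complex.exp (t * Φ l (k - l) * Complex.I) * Complex.exp (δ * Φ l (k - l) * Complex.I) := by
      rw [← Complex.exp_add]; congr 1; push_cast; ring
    rw [this]; ring
  rw [e]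
  refine (enorm_add_le _ _).trans (add_le_add ?_ ((enorm_add_le _ _).trans (add_le_add ?_ ?_)))
  · rw [enorm_mul, enorm_osc, one_mul, enorm_mul, enorm_mul, enorm_mul]
  · rw [enorm_mul, enorm_osc, one_mul, enorm_mul, enorm_mul]
  · rw [enorm_mul, enorm_osc, one_mul, enorm_mul, enorm_mul]

/-- The increments of a and b are Lipschitz, hence harmless. Only the increment of e^{itΦ} uses the
fractional order, and it costs |Φ|^{3/4} in the symbol, not a full power of Φ. -/
theorem HT.bil {r s₁ s₂ s₁' s₂' : ℝ}
    (hΦ : Measurable fun p : Space × Space => Φ p.1 p.2)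
    (hm : Measurable fun p : Space × Space => m p.1 p.2)
    (ha : Bdd s₁ a) (hb : Bdd s₂ b) (ha' : Bdd s₁' a') (hb' : Bdd s₂' b')
    (hda : Deriv a a') (hdb : Deriv b b')
    (A : Adm r s₁ s₂ fun k l => ‖m k l‖ₑ)
    (A₀ : Adm r s₁ s₂ fun k l => ‖m k l‖ₑ * ENNReal.ofReal (|Φ k l| ^ (3 / 4 : ℝ)))
    (A₁ : Adm r s₁' s₂ fun k l => ‖m k l‖ₑ) (A₂ : Adm r s₁ s₂' fun k l => ‖m k l‖ₑ) :
    HT r (CSH.bil Φ m a b) := by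
  obtain ⟨B₀, hB₀, i0⟩ := A₀.cv_bound ha hb
  obtain ⟨B₁, hB₁, i1⟩ := A₁
  obtain ⟨B₂, hB₂, i2⟩ := A₂
  obtain ⟨Ca, hCa, ja⟩ := ha.bound
  obtain ⟨Cb, hCb, jb⟩ := hb.bound
  obtain ⟨Da, hDa, da⟩ := hda.diff_bound ha'
  obtain ⟨Db, hDb, db⟩ := hdb.diff_bound hb'
  have hK : 2 * (2 * (B₁ * (Da * Cb) + B₂ * (Ca * Db))) ≠ ∞ := by finiteness
  refine ⟨A.bdd hΦ hm ha hb, 2 * (9 * B₀) + 2 * (2 * (B₁ * (Da * Cb) + B₂ * (Ca * Db))) * 2,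
    by finiteness, fun t => ?_⟩
  have mo := measurable_oscIncr hΦ hm (ha.meas_slice t) (hb.meas_slice t)
  have mo1 : ∀ δ, Measurable (oscIncr Φ m (a t) (b t) δ) := fun δ =>
    measurable_oscIncr_slice hΦ hm (ha.meas_slice t) (hb.meas_slice t) δ
  have mw : Measurable fun δ => 2 * wn r (oscIncr Φ m (a t) (b t) δ) :=
    (measurable_wn_time mo).const_mul 2
  have mm : Measurable fun p : Space × Space => ‖m p.1 p.2‖ₑ := hm.enorm
  calc _ ≤ ∫⁻ δ : ℝ, (2 * wn r (oscIncr Φ m (a t) (b t) δ) +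
        2 * (2 * (B₁ * (Da * Cb) + B₂ * (Ca * Db))) * ENNReal.ofReal δ ^ 2) ∂incrMeasure := by
        refine lintegral_mono_ae ?_
        filter_upwards [ae_incrMeasure] with δ hδ
        have ma := ha.meas_slice t
        have ma1 := ha.meas_slice (t + δ)
        have mb := hb.meas_slice t
        have mb1 := hb.meas_slice (t + δ)
        refine (wn_mono_ae (G := fun k => oscIncr Φ m (a t) (b t) δ k +
          (cv (fun k l => ‖m k l‖ₑ) (fun k => ‖a (t + δ) k - a t k‖ₑ) (fun k => ‖b (t + δ) k‖ₑ) k +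
          cv (fun k l => ‖m k l‖ₑ) (fun k => ‖a t k‖ₑ) (fun k => ‖b (t + δ) k - b t k‖ₑ) k)) ?_).trans ?_
        · filter_upwards [bil_integrand_integrable A hΦ hm ha hb t,
            bil_integrand_integrable A hΦ hm ha hb (t + δ)] with k h0 h1
          exact enorm_bil_sub_le h0 h1 hΦ hm ha.meas hb.meas
        refine (wn_add_le (mo1 δ)).trans ?_
        rw [mul_add, mul_assoc (2 : ℝ≥0∞)]
        gcongr
        refine (wn_add_le (measurable_cv mm (by fun_prop) (by fun_prop))).trans ?_
        rw [mul_assoc, add_mul]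
        gcongr
        · refine (i1 _ _ (by fun_prop) (by fun_prop)).trans ?_
          rw [mul_assoc, mul_right_comm Da]
          gcongr
          · exact da t δ hδ
          · exact jb _
        · refine (i2 _ _ (by fun_prop) (by fun_prop)).trans ?_
          rw [mul_assoc, mul_assoc Ca]
          gcongr
          · exact ja _
          · exact db t δ hδ
    _ ≤ _ := by
        rw [lintegral_add_right _ (by fun_prop), lintegral_const_mul' _ _ (by simp),
          lintegral_const_mul' _ _ hK]
        gcongr
        · exact (lintegral_wn_oscIncr_le hΦ hm (ha.meas_slice t) (hb.meas_slice t)).trans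
            (by gcongr; exact i0 t)
        · exact lintegral_incr_sq_le

end

section


/-! ### The normal form transformation -/

variable {a b a' b' : ℝ → Space → ℂ} {Φ : Space → Space → ℝ} {m : Space → Space → ℂ}

theorem Adm.of_bound {r s₁ s₂ a₁ b₁ a₂ b₂ C : ℝ} {N : Space → Space → ℝ≥0∞}
    (h₁ : Adm r s₁ s₂ fun k l => wt a₁ k * wt b₁ l) (h₂ : Adm r s₁ s₂ fun k l => wt a₂ k * wt b₂ l)
    (hN : ∀ k l, N k l ≤ ENNReal.ofReal (C * (jb k ^ a₁ * jb l ^ b₁ + jb k ^ a₂ * jb l ^ b₂))) :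
    Adm r s₁ s₂ N := by
  have hm : Measurable fun p : Space × Space => wt a₁ p.1 * wt b₁ p.2 := by
    have := measurable_wt a₁
    have := measurable_wt b₁
    fun_prop
  refine ((h₁.add h₂ hm).const_mul (c := ENNReal.ofReal C) ENNReal.ofReal_ne_top).mono le_rfl
    le_rfl le_rfl fun k l => (hN k l).trans ?_
  have hk := jb_pos k
  have hl := jb_pos l
  rw [ENNReal.ofReal_mul' (by positivity), ENNReal.ofReal_add (by positivity) (by positivity),
    ENNReal.ofReal_mul (by positivity), ENNReal.ofReal_mul (by positivity)]
  rfl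

theorem Adm.of_bound_single {r s₁ s₂ a₁ b₁ C : ℝ} {N : Space → Space → ℝ≥0∞}
    (h₁ : Adm r s₁ s₂ fun k l => wt a₁ k * wt b₁ l)
    (hN : ∀ k l, N k l ≤ ENNReal.ofReal (C * (jb k ^ a₁ * jb l ^ b₁))) :
    Adm r s₁ s₂ N := by
  refine (h₁.const_mul (c := ENNReal.ofReal C) ENNReal.ofReal_ne_top).mono le_rfl
    le_rfl le_rfl fun k l => (hN k l).trans ?_
  have hk := jb_pos k
  have hl := jb_pos l
  rw [ENNReal.ofReal_mul' (by positivity), ENNReal.ofReal_mul (by positivity)]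
  rfl

/-- `bil` is additive in the symbol, almost everywhere. -/
theorem bil_add_symbol {r s₁ s₂ : ℝ} {m₁ m₂ : Space → Space → ℂ}
    (A₁ : Adm r s₁ s₂ fun k l => ‖m₁ k l‖ₑ) (A₂ : Adm r s₁ s₂ fun k l => ‖m₂ k l‖ₑ)
    (hΦ : Measurable fun p : Space × Space => Φ p.1 p.2)
    (hm₁ : Measurable fun p : Space × Space => m₁ p.1 p.2)
    (hm₂ : Measurable fun p : Space × Space => m₂ p.1 p.2)
    (ha : Bdd s₁ a) (hb : Bdd s₂ b) (h : ∀ k l, m k l = m₁ k l + m₂ k l) :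
    ∀ᵐ k, ∀ᵐ t : ℝ, bil Φ m a b t k = bil Φ m₁ a b t k + bil Φ m₂ a b t k := by
  filter_upwards [bil_integrand_integrable_time A₁ hΦ hm₁ ha hb,
    bil_integrand_integrable_time A₂ hΦ hm₂ ha hb] with k h1 h2
  filter_upwards [ae_integrable_slice h1, ae_integrable_slice h2] with t i1 i2
  unfold bil
  rw [← integral_add i1 i2]
  congr 1; ext l
  rw [h]; ring

/-- The part of a symbol where the phase is small. -/
def lowSymbol (Φ : Space → Space → ℝ) (m : Space → Space → ℂ) (κ : ℝ) (k l : Space) : ℂ :=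
  if |Φ k l| ≤ jb l ^ (2 * κ) then m k l else 0

/-- The part of a symbol where the phase `Φ` is large, divided by `iΦ`. -/
def highSymbol (Φ : Space → Space → ℝ) (m : Space → Space → ℂ) (κ : ℝ) (k l : Space) : ℂ :=
  if |Φ k l| ≤ jb l ^ (2 * κ) then 0 else m k l / (Complex.I * Φ k l)

section

variable (hΦ : Measurable fun p : Space × Space => Φ p.1 p.2)
  (hm : Measurable fun p : Space × Space => m p.1 p.2)

include hΦ

theorem measurableSet_phase_le (κ : ℝ) :
    MeasurableSet {p : Space × Space | |Φ p.1 p.2| ≤ jb p.2 ^ (2 * κ)} := by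
  have h1 : Measurable fun p : Space × Space => |Φ p.1 p.2| := by
    simpa [Real.norm_eq_abs] using hΦ.norm
  have h2 : Measurable fun p : Space × Space => jb p.2 ^ (2 * κ) := by
    have := measurable_jb
    fun_prop
  exact measurableSet_le h1 h2

include hm

theorem measurable_lowSymbol (κ : ℝ) :
    Measurable fun p : Space × Space => lowSymbol Φ m κ p.1 p.2 :=
  Measurable.ite (measurableSet_phase_le hΦ κ) hm measurable_const

theorem measurable_highSymbol (κ : ℝ) :
    Measurable fun p : Space × Space => highSymbol Φ m κ p.1 p.2 :=
  Measurable.ite (measurableSet_phase_le hΦ κ) measurable_const (by fun_prop)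

end

theorem symbol_eq (κ : ℝ) (k l : Space) :
    m k l = Complex.I * Φ k l * highSymbol Φ m κ k l + lowSymbol Φ m κ k l := by
  unfold highSymbol lowSymbol
  split_ifs with h
  · simp
  · have h0 : (Φ k l : ℂ) ≠ 0 := by
      intro h0
      apply h
      rw [Complex.ofReal_eq_zero.mp h0, abs_zero]
      have := jb_pos l
      positivity
    have := Complex.I_ne_zero
    field_simp
    ring

theorem norm_highSymbol_mul_le (κ : ℝ) (k l : Space) :
    ‖Complex.I * Φ k l * highSymbol Φ m κ k l‖ ≤ ‖m k l‖ := by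
  by_cases h : |Φ k l| ≤ jb l ^ (2 * κ)
  · simp [highSymbol, h]
  · have := symbol_eq (Φ := Φ) (m := m) κ k l
    have h2 : lowSymbol Φ m κ k l = 0 := by simp [lowSymbol, h]
    rw [h2, add_zero] at this
    rw [← this]

/-- The angle between two frequencies, in the form `⟨ξ⟩⟨η⟩ ∓ ξ·η = θ² ⟨ξ⟩⟨η⟩`. -/
def angle (s : ℝ) (k l : Space) : ℝ := Real.sqrt (dl s k l / (jb k * jb l))

theorem angle_nonneg (s : ℝ) (k l : Space) : 0 ≤ angle s k l := Real.sqrt_nonneg _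

section

variable {s₀ s₁ s₂ A p q : ℝ} (h0 : s₀ ^ 2 = 1) (h1 : s₁ ^ 2 = 1) (h2 : s₂ ^ 2 = 1) (hA : 0 ≤ A)
  (hmb : ∀ k l, ‖m k l‖ ≤ A * angle (s₁ * s₂) k l * (jb k ^ p * jb l ^ q))

include h1 h2 in
theorem angle_le (k l : Space) : angle (s₁ * s₂) k l ≤ 2 := by
  unfold angle
  rw [Real.sqrt_le_left (by norm_num)]
  have hk := jb_pos k
  have hl := jb_pos l
  rw [div_le_iff₀ (by positivity)]
  have := dl_le (s := s₁ * s₂) (by rw [mul_pow, h1, h2, one_mul]) k l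
  have : 0 < jb k * jb l := by positivity
  linarith

include h1 h2 hA hmb

theorem norm_symbol_le (k l : Space) : ‖m k l‖ ≤ 2 * A * (jb k ^ p * jb l ^ q) := by
  refine (hmb k l).trans ?_
  have hk := jb_pos k
  have hl := jb_pos l
  rw [mul_comm 2 A]
  gcongr
  exact angle_le h1 h2 k l

include h0

/-- On |Φ| ≤ ⟨η⟩^{2κ} the angle is at most 2⟨η⟩^κ(⟨ξ⟩^{-1/2}+⟨η⟩^{-1/2}): half a derivative is
gained at the price of κ on the second frequency. -/
theorem norm_lowSymbol_le (κ : ℝ) (k l : Space) : ‖lowSymbol (ph s₀ s₁ s₂) m κ k l‖ ≤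
    2 * A * (jb k ^ (p - 1 / 2) * jb l ^ (q + κ) + jb k ^ p * jb l ^ (q + κ - 1 / 2)) := by
  have hk := jb_pos k
  have hl := jb_pos l
  unfold lowSymbol
  split_ifs with h
  · refine (hmb k l).trans ?_
    have ht := theta_small (one_le_jb k) (one_le_jb l) (by positivity : 0 < jb l ^ (2 * κ))
      (dl_le_ph h0 h1 h2 k l) h
    rw [← Real.rpow_mul hl.le] at ht
    calc _ ≤ A * (2 * jb l ^ (2 * κ * (1 / 2)) *
          (jb k ^ (-(1 / 2) : ℝ) + jb l ^ (-(1 / 2) : ℝ))) * (jb k ^ p * jb l ^ q) := by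
          gcongr
          exact ht
      _ = _ := by
          rw [Real.rpow_sub hk, Real.rpow_add hl, Real.rpow_sub hl, Real.rpow_add hl,
            Real.rpow_neg hk.le, Real.rpow_neg hl.le]
          have : 2 * κ * (1 / 2) = κ := by ring
          rw [this]
          field_simp
  · rw [norm_zero]; positivity

/-- On |Φ| > ⟨η⟩^{2κ} dividing by Φ gains the half derivative of the angle and in addition κ
derivatives on the second frequency. -/
theorem norm_highSymbol_le (κ : ℝ) (k l : Space) : ‖highSymbol (ph s₀ s₁ s₂) m κ k l‖ ≤
    2 * A * (jb k ^ (p - 1 / 2) * jb l ^ (q - κ) + jb k ^ p * jb l ^ (q - κ - 1 / 2)) := by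
  have hk := jb_pos k
  have hl := jb_pos l
  unfold highSymbol
  split_ifs with h
  · rw [norm_zero]; positivity
  · push Not at h
    have hK : 0 < jb l ^ (2 * κ) := by positivity
    have ht := theta_div (one_le_jb k) (one_le_jb l) hK (dl_le_ph h0 h1 h2 k l) h.le
    rw [← Real.rpow_mul hl.le] at ht
    rw [norm_div, norm_mul, Complex.norm_I, one_mul, Complex.norm_real, Real.norm_eq_abs]
    calc _ ≤ A * angle (s₁ * s₂) k l * (jb k ^ p * jb l ^ q) / |ph s₀ s₁ s₂ k l| := by
          gcongr
          exact hmb k l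
      _ = A * (angle (s₁ * s₂) k l / |ph s₀ s₁ s₂ k l|) * (jb k ^ p * jb l ^ q) := by ring
      _ ≤ A * (2 * jb l ^ (2 * κ * -(1 / 2)) *
          (jb k ^ (-(1 / 2) : ℝ) + jb l ^ (-(1 / 2) : ℝ))) * (jb k ^ p * jb l ^ q) := by
          gcongr
          exact ht
      _ = _ := by
          have : 2 * κ * -(1 / 2) = -κ := by ring
          rw [this, Real.rpow_sub hk, Real.rpow_sub hl, Real.rpow_sub hl, Real.rpow_sub hl,
            Real.rpow_neg hk.le, Real.rpow_neg hl.le, Real.rpow_neg hl.le]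
          field_simp

/-- What remains of m|Φ|^{3/4}/|Φ| is θ|Φ|^{-1/4}, worth a quarter derivative wherever the threshold
is placed. -/
theorem norm_highSymbol_mul_rpow_le (κ : ℝ) (k l : Space) :
    ‖highSymbol (ph s₀ s₁ s₂) m κ k l‖ * |ph s₀ s₁ s₂ k l| ^ (3 / 4 : ℝ) ≤
    4 * A * (jb k ^ (p - 1 / 4) * jb l ^ q + jb k ^ p * jb l ^ (q - 1 / 4)) := by
  have hk := jb_pos k
  have hl := jb_pos l
  unfold highSymbol
  split_ifs with h
  · rw [norm_zero, zero_mul]; positivity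
  · push Not at h
    have hK : 0 < jb l ^ (2 * κ) := by positivity
    have hP : 0 < |ph s₀ s₁ s₂ k l| := hK.trans h
    have hs : (s₁ * s₂) ^ 2 = 1 := by rw [mul_pow, h1, h2, one_mul]
    -- With η = 0 the power of the phase is 3/4 - 1 = -1/4.
    have ht := theta_holder (η := 0) (one_le_jb k) (one_le_jb l) (one_le_dl hs k l) (dl_le hs k l)
      le_rfl (by norm_num) (dl_le_ph h0 h1 h2 k l)
    rw [norm_div, norm_mul, Complex.norm_I, one_mul, Complex.norm_real, Real.norm_eq_abs]
    have e : |ph s₀ s₁ s₂ k l| ^ (-(1 / 4) + 0 : ℝ) =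
        |ph s₀ s₁ s₂ k l| ^ (3 / 4 : ℝ) / |ph s₀ s₁ s₂ k l| := by
      rw [eq_div_iff hP.ne']
      nth_rw 2 [← Real.rpow_one |ph s₀ s₁ s₂ k l|]
      rw [← Real.rpow_add hP]
      norm_num
    calc _ ≤ A * angle (s₁ * s₂) k l * (jb k ^ p * jb l ^ q) / |ph s₀ s₁ s₂ k l| *
            |ph s₀ s₁ s₂ k l| ^ (3 / 4 : ℝ) := by
          gcongr
          exact hmb k l
      _ = A * (angle (s₁ * s₂) k l * |ph s₀ s₁ s₂ k l| ^ (-(1 / 4) + 0 : ℝ)) *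
          (jb k ^ p * jb l ^ q) := by rw [e]; ring
      _ ≤ A * (4 * (jb k ^ (-(1 / 4) + 0 : ℝ) + jb l ^ (-(1 / 4) + 0 : ℝ))) *
          (jb k ^ p * jb l ^ q) :=
          mul_le_mul_of_nonneg_right (mul_le_mul_of_nonneg_left ht hA) (by positivity)
      _ = _ := by
          rw [add_zero, Real.rpow_sub hk, Real.rpow_sub hl,
            Real.rpow_neg hk.le, Real.rpow_neg hl.le]
          field_simp

end

/-- The weights for which both parts of an angular gain are admissible. -/
structure Pair (r s₁ s₂ p q : ℝ) : Prop where
  left : Expo (-r) (s₁ - p + 1 / 2) (s₂ - q)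
  right : Expo (-r) (s₁ - p) (s₂ - q + 1 / 2)

theorem Pair.adm {r s₁ s₂ p q C : ℝ} {N : Space → Space → ℂ} (h : Pair r s₁ s₂ p q)
    (hN : ∀ k l, ‖N k l‖ ≤ C * (jb k ^ (p - 1 / 2) * jb l ^ q + jb k ^ p * jb l ^ (q - 1 / 2))) :
    Adm r s₁ s₂ fun k l => ‖N k l‖ₑ := by
  have e1 : Expo (-r) (s₁ - (p - 1 / 2)) (s₂ - q) := by convert h.left using 1; ring
  have e2 : Expo (-r) (s₁ - p) (s₂ - (q - 1 / 2)) := by convert h.right using 1; ring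
  refine Adm.of_bound (C := C) (Adm.of_expo_wt e1) (Adm.of_expo_wt e2) fun k l => ?_
  rw [← ofReal_norm]
  exact ENNReal.ofReal_le_ofReal (hN k l)

/-- Integration by parts in time where the phase is large. The hypotheses `hlow`, `hleft`, `hright`
place the low-phase part and the two terms with differentiated inputs in H^r, `hG` places the
boundary term in H^{rG}, and `hH₁`, `hH₂` give its fractional regularity in time. The last two are
stated through `Adm`, since the endpoint product law must be admitted there. `hall`, with any order
r₀ whatever, only ensures that the integrals converge. -/
theorem normal_form {σ₀ σ₁ σ₂ A p q κ r r₀ rG s₁ s₂ s₁' s₂' : ℝ}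
    (h0 : σ₀ ^ 2 = 1) (h1 : σ₁ ^ 2 = 1) (h2 : σ₂ ^ 2 = 1) (hA : 0 ≤ A)
    (hm : Measurable fun p : Space × Space => m p.1 p.2)
    (hmb : ∀ k l, ‖m k l‖ ≤ A * angle (σ₁ * σ₂) k l * (jb k ^ p * jb l ^ q))
    (ha : Bdd s₁ a) (hb : Bdd s₂ b) (ha' : Bdd s₁' a') (hb' : Bdd s₂' b')
    (hda : Deriv a a') (hdb : Deriv b b')
    (hr : r ≤ rG) (hlow : Pair r s₁ s₂ p (q + κ)) (hG : Pair rG s₁ s₂ p (q - κ))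
    (hleft : Pair r s₁' s₂ p (q - κ)) (hright : Pair r s₁ s₂' p (q - κ))
    (hall : Expo (-r₀) (s₁ - p) (s₂ - q))
    (hH₁ : Adm r s₁ s₂ fun k l => wt (p - 1 / 4) k * wt q l)
    (hH₂ : Adm r s₁ s₂ fun k l => wt p k * wt (q - 1 / 4) l) :
    ∃ G G' P' : ℝ → Space → ℂ, Deriv G G' ∧ HT r G ∧ Bdd rG G ∧ Bdd r P' ∧
      ∀ᵐ k, ∀ᵐ t, bil (ph σ₀ σ₁ σ₂) m a b t k = G' t k + P' t k := by
  have hΦ := measurable_ph σ₀ σ₁ σ₂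
  set n := highSymbol (ph σ₀ σ₁ σ₂) m κ with hn
  have mn : Measurable fun p : Space × Space => n p.1 p.2 := measurable_highSymbol hΦ hm κ
  have ml : Measurable fun p : Space × Space => lowSymbol (ph σ₀ σ₁ σ₂) m κ p.1 p.2 :=
    measurable_lowSymbol hΦ hm κ
  have bn := norm_highSymbol_le h0 h1 h2 hA hmb κ
  have AG : Adm rG s₁ s₂ fun k l => ‖n k l‖ₑ := hG.adm bn
  have A1 : Adm r s₁' s₂ fun k l => ‖n k l‖ₑ := hleft.adm bn
  have A2 : Adm r s₁ s₂' fun k l => ‖n k l‖ₑ := hright.adm bn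
  have AL : Adm r s₁ s₂ fun k l => ‖lowSymbol (ph σ₀ σ₁ σ₂) m κ k l‖ₑ :=
    hlow.adm (norm_lowSymbol_le h0 h1 h2 hA hmb κ)
  have AI : Adm r₀ s₁ s₂ fun k l => ‖Complex.I * ph σ₀ σ₁ σ₂ k l * n k l‖ₑ := by
    refine Adm.of_bound_single (Adm.of_expo_wt hall) (C := 2 * A) fun k l => ?_
    rw [← ofReal_norm]
    exact ENNReal.ofReal_le_ofReal ((norm_highSymbol_mul_le κ k l).trans
      (norm_symbol_le h1 h2 hA hmb k l))
  have AH : Adm r s₁ s₂ fun k l => ‖n k l‖ₑ * ENNReal.ofReal (|ph σ₀ σ₁ σ₂ k l| ^ (3 / 4 : ℝ)) := by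
    refine Adm.of_bound hH₁ hH₂ (C := 4 * A) fun k l => ?_
    rw [← ofReal_norm, ← ENNReal.ofReal_mul (norm_nonneg _)]
    exact ENNReal.ofReal_le_ofReal (norm_highSymbol_mul_rpow_le h0 h1 h2 hA hmb κ k l)
  have mI : Measurable fun p : Space × Space => Complex.I * ph σ₀ σ₁ σ₂ p.1 p.2 * n p.1 p.2 := by
    fun_prop
  -- The boundary term has the symbol n = m/(iΦ); the remainder is the low-phase part minus the two
  -- terms in which ∂_t falls on an input.
  refine ⟨bil (ph σ₀ σ₁ σ₂) n a b, _,
    fun t k => bil (ph σ₀ σ₁ σ₂) (lowSymbol (ph σ₀ σ₁ σ₂) m κ) a b t k -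
      (bil (ph σ₀ σ₁ σ₂) n a' b t k + bil (ph σ₀ σ₁ σ₂) n a b' t k),
    Deriv.bil hΦ mn ha hb ha' hb' hda hdb AG AI A1 A2,
    HT.bil hΦ mn ha hb ha' hb' hda hdb (AG.mono hr le_rfl le_rfl fun _ _ => le_rfl) AH A1 A2,
    AG.bdd hΦ mn ha hb,
    (AL.bdd hΦ ml ha hb).sub ((A1.bdd hΦ mn ha' hb).add (A2.bdd hΦ mn ha hb')), ?_⟩
  -- Splitting the integral only needs convergence, so both parts may be placed at the worse of the
  -- two orders.
  have e1 : Adm (min r r₀) s₁ s₂ fun k l => ‖Complex.I * ph σ₀ σ₁ σ₂ k l * n k l‖ₑ :=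
    AI.mono (min_le_right _ _) le_rfl le_rfl fun _ _ => le_rfl
  have e2 : Adm (min r r₀) s₁ s₂ fun k l => ‖lowSymbol (ph σ₀ σ₁ σ₂) m κ k l‖ₑ :=
    AL.mono (min_le_left _ _) le_rfl le_rfl fun _ _ => le_rfl
  filter_upwards [bil_add_symbol e1 e2 hΦ mI ml ha hb (symbol_eq κ)] with k hk
  filter_upwards [hk] with t ht
  rw [ht]
  ring

end

section


/-! ### Schwartz functions as test functions -/

section

variable {E : Type*} [NormedAddCommGroup E] [InnerProductSpace ℝ E] [FiniteDimensional ℝ E]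
  [MeasurableSpace E] [BorelSpace E]

theorem ae_eq_of_integral_schwartz {f g : E → ℂ} (hf : LocallyIntegrable f)
    (hg : LocallyIntegrable g)
    (h : ∀ η : 𝓢(E, ℂ), ∫ x, f x * η x = ∫ x, g x * η x) : f =ᵐ[volume] g := by
  refine ae_eq_of_integral_contDiff_smul_eq hf hg fun ρ hρ hc => ?_
  have hc' : HasCompactSupport fun x => (ρ x : ℂ) := hc.comp_left Complex.ofReal_zero
  have hd : ContDiff ℝ (⊤ : ℕ∞) fun x => (ρ x : ℂ) := Complex.ofRealCLM.contDiff.comp hρ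
  have := h (hc'.toSchwartzMap hd)
  simpa [mul_comm] using this

theorem integral_fourier_mul_schwartz {f : E → ℂ} (hf : Integrable f) (η : 𝓢(E, ℂ)) :
    ∫ x, 𝓕 f x * η x = ∫ x, f x * 𝓕 η x := by
  have := VectorFourier.integral_fourierIntegral_smul_eq_flip (e := Real.fourierChar)
    (L := innerₗ E) (μ := volume) (ν := volume) (f := f) (g := (η : E → ℂ))
    Real.continuous_fourierChar continuous_inner hf η.integrable
  simpa [SchwartzMap.fourier_coe, Real.fourier_eq, VectorFourier.fourierIntegral] using! this

theorem continuous_fourier {f : E → ℂ} (hf : Integrable f) : Continuous (𝓕 f) :=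
  VectorFourier.fourierIntegral_continuous (e := Real.fourierChar)
    (L := innerₗ E) Real.continuous_fourierChar continuous_inner hf

theorem Lp.integral_fourier_mul (F : Lp ℂ 2 (volume : Measure E)) (η : 𝓢(E, ℂ)) :
    ∫ x, (𝓕 F : Lp ℂ 2 (volume : Measure E)) x * η x = ∫ x, F x * 𝓕 η x := by
  have h := congrArg (fun T : 𝓢'(E, ℂ) => T η) (Lp.fourier_toTemperedDistribution_eq F)
  simp only [TemperedDistribution.fourier_apply, Lp.toTemperedDistribution_apply, smul_eq_mul] at h
  simp_rw [mul_comm _ (η _), mul_comm _ (𝓕 η _)]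
  exact h.symm

/-- Plancherel for the Fourier integral. It is identified with the L² Fourier transform by testing
both against Schwartz functions. -/
theorem lintegral_fourier_sq {f : E → ℂ} (hf : Integrable f) (h2 : MemLp f 2) :
    ∫⁻ x, ‖𝓕 f x‖ₑ ^ 2 = ∫⁻ x, ‖f x‖ₑ ^ 2 := by
  set F := h2.toLp f
  have e : (𝓕 F : Lp ℂ 2 (volume : Measure E)) =ᵐ[volume] 𝓕 f := by
    refine ae_eq_of_integral_schwartz ((Lp.memLp _).locallyIntegrable (by norm_num))
      (continuous_fourier hf).locallyIntegrable fun η => ?_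
    rw [Lp.integral_fourier_mul, integral_fourier_mul_schwartz hf]
    refine integral_congr_ae ?_
    filter_upwards [h2.coeFn_toLp] with x hx
    rw [hx]
  have key : ∀ G : Lp ℂ 2 (volume : Measure E), ∫⁻ x, ‖G x‖ₑ ^ 2 = ‖G‖ₑ ^ 2 := by
    intro G
    rw [Lp.enorm_def, eLpNorm_eq_lintegral_rpow_enorm_toReal (by simp) (by simp)]
    rw [← ENNReal.rpow_natCast, ← ENNReal.rpow_mul]
    simp
  have h3 := key (𝓕 F)
  have h4 := key F
  have h5 : ‖(𝓕 F : Lp ℂ 2 (volume : Measure E))‖ₑ = ‖F‖ₑ := by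
    rw [← ofReal_norm, Lp.norm_fourier_eq, ofReal_norm]
  rw [h5, ← h4] at h3
  calc _ = ∫⁻ x, ‖(𝓕 F : Lp ℂ 2 (volume : Measure E)) x‖ₑ ^ 2 :=
        lintegral_congr_ae (e.mono fun x hx => by simp only [hx])
    _ = ∫⁻ x, ‖F x‖ₑ ^ 2 := h3
    _ = _ := lintegral_congr_ae (h2.coeFn_toLp.mono fun x hx => by simp only [F, hx])

end

/-! ### Fractional derivatives in time and the Fourier transform -/

/-- The converse of `lintegral_incr_osc_le` for |x| ≥ 1: for δ ≤ 1/|x| one has |e^{iδx}-1| =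
2|sin(δx/2)| ≥ δ|x|/2, and these δ lie in (0, 1]. -/
theorem rpow_le_lintegral_osc {x : ℝ} (hx : 1 ≤ |x|) : ENNReal.ofReal (|x| ^ (3 / 2 : ℝ)) ≤
    2 * ∫⁻ δ : ℝ, ‖Complex.exp (δ * x * Complex.I) - 1‖ₑ ^ 2 ∂incrMeasure := by
  have hx0 : 0 < |x| := one_pos.trans_le hx
  have hc : 0 < |x|⁻¹ := inv_pos.mpr hx0
  rw [lintegral_incrMeasure (by fun_prop), ← lintegral_const_mul' _ _ (by simp)]
  have hsub : Set.Ioc (0:ℝ) |x|⁻¹ ⊆ Set.Ioc 0 1 := Set.Ioc_subset_Ioc_right (inv_le_one_of_one_le₀ hx)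
  refine le_trans ?_ (lintegral_mono_set hsub)
  calc _ ≤ ∫⁻ δ in Set.Ioc 0 |x|⁻¹, ENNReal.ofReal (2 * (4 / 16 * |x| ^ 2)) *
          ENNReal.ofReal (δ ^ (-(1 / 2) : ℝ)) := by
        rw [lintegral_const_mul' _ _ ENNReal.ofReal_ne_top, lintegral_Ioc_rpow hc (by norm_num),
            ← ENNReal.ofReal_mul (by positivity)]
        apply ENNReal.ofReal_le_ofReal
        have e : |x| ^ (3 / 2 : ℝ) = |x| ^ 2 * (|x|⁻¹) ^ (1 / 2 : ℝ) := by
          rw [Real.inv_rpow hx0.le, ← Real.rpow_neg hx0.le, ← Real.rpow_natCast,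
            ← Real.rpow_add hx0]
          norm_num
        rw [e]; norm_num
        have : 0 ≤ |x| ^ 2 * (|x|⁻¹) ^ (1 / 2 : ℝ) := by positivity
        simp only [sq_abs] at *
        linarith
    _ ≤ _ := by
        apply setLIntegral_mono (by fun_prop) fun δ hδ => ?_
        have e2 : (2 : ℝ≥0∞) = ENNReal.ofReal 2 := by norm_num
        have h0 := Real.rpow_nonneg hδ.1.le (-(5 / 2) : ℝ)
        rw [← ofReal_norm, ← ENNReal.ofReal_pow (norm_nonneg _), e2,
          ← ENNReal.ofReal_mul h0, ← ENNReal.ofReal_mul (by positivity),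
          ← ENNReal.ofReal_mul (by positivity)]
        apply ENNReal.ofReal_le_ofReal
        have e : δ ^ (-(1 / 2) : ℝ) = δ ^ (-(5 / 2) : ℝ) * δ ^ 2 := by
          rw [← Real.rpow_natCast, ← Real.rpow_add hδ.1]; norm_num
        have hle : δ * |x| ≤ 1 := by
          have := mul_le_mul_of_nonneg_right hδ.2 hx0.le
          rwa [inv_mul_cancel₀ hx0.ne'] at this
        have key : 1 / 2 * (δ * |x|) ≤ ‖Complex.exp (δ * x * Complex.I) - 1‖ := by
          have e3 : ((δ : ℂ) * x * Complex.I) = Complex.I * ((δ * x : ℝ) : ℂ) := by push_cast; ring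
          rw [e3, Complex.norm_exp_I_mul_ofReal_sub_one, norm_mul, Real.norm_eq_abs, Real.norm_eq_abs]
          have e4 : |Real.sin (δ * x / 2)| = |Real.sin (|δ * x / 2|)| := by
            rcases abs_choice (δ * x / 2) with h | h <;> rw [h]
            rw [Real.sin_neg, abs_neg]
          have e5 : |δ * x / 2| = δ * |x| / 2 := by
            rw [abs_div, abs_mul, abs_of_pos hδ.1]; norm_num
          rw [e4, e5]
          have hy0 : 0 ≤ δ * |x| / 2 := by have := hδ.1; positivity
          have hpi := Real.pi_gt_three
          have hpi4 := Real.pi_le_four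
          have := Real.mul_le_sin hy0 (by linarith)
          have h2 : 1 / 2 * (δ * |x| / 2) ≤ 2 / Real.pi * (δ * |x| / 2) := by
            gcongr ?_ * _
            rw [le_div_iff₀ (by positivity)]; linarith
          have hx2 : 0 ≤ 1 / 2 * (δ * |x| / 2) := by positivity
          rw [abs_of_nonneg (hx2.trans (h2.trans this)), abs_of_pos (by norm_num : (0 : ℝ) < 2)]
          linarith
        calc 2 * (4 / 16 * |x| ^ 2) * δ ^ (-(1 / 2) : ℝ) =
              2 * (δ ^ (-(5 / 2) : ℝ) * (1 / 2 * (δ * |x|)) ^ 2) := by rw [e]; ring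
          _ ≤ _ := by
            have := hδ.1
            gcongr

theorem one_add_sq_rpow_le_osc (x : ℝ) : ENNReal.ofReal ((1 + x ^ 2) ^ (3 / 4 : ℝ)) ≤
    4 + 4 * ∫⁻ δ : ℝ, ‖Complex.exp (δ * x * Complex.I) - 1‖ₑ ^ 2 ∂incrMeasure := by
  have h2 : (2 : ℝ) ^ (3 / 4 : ℝ) ≤ 2 := by
    calc _ ≤ (2:ℝ) ^ (1:ℝ) := Real.rpow_le_rpow_of_exponent_le (by norm_num) (by norm_num)
      _ = 2 := Real.rpow_one _
  have e2 : (2 : ℝ≥0∞) = ENNReal.ofReal 2 := by norm_num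
  rcases le_total 1 |x| with hx | hx
  · have hx0 : 0 < |x| := one_pos.trans_le hx
    have h1 : (1 + x ^ 2) ^ (3 / 4 : ℝ) ≤ 2 * |x| ^ (3 / 2 : ℝ) := by
      calc _ ≤ (2 * |x| ^ 2) ^ (3 / 4 : ℝ) := by
            gcongr
            rw [← sq_abs]
            nlinarith
        _ = 2 ^ (3 / 4 : ℝ) * |x| ^ (3 / 2 : ℝ) := by
            rw [Real.mul_rpow (by norm_num) (by positivity), ← Real.rpow_natCast,
              ← Real.rpow_mul hx0.le]
            norm_num
        _ ≤ _ := by gcongr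
    calc _ ≤ 2 * ENNReal.ofReal (|x| ^ (3 / 2 : ℝ)) := by
          rw [e2, ← ENNReal.ofReal_mul (by norm_num)]
          exact ENNReal.ofReal_le_ofReal h1
      _ ≤ 2 * (2 * ∫⁻ δ : ℝ, ‖Complex.exp (δ * x * Complex.I) - 1‖ₑ ^ 2 ∂incrMeasure) := by
          gcongr
          exact rpow_le_lintegral_osc hx
      _ = 4 * ∫⁻ δ : ℝ, ‖Complex.exp (δ * x * Complex.I) - 1‖ₑ ^ 2 ∂incrMeasure := by
          rw [← mul_assoc]; norm_num
      _ ≤ _ := le_add_self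
  · calc _ ≤ (4 : ℝ≥0∞) := by
          have e4 : (4 : ℝ≥0∞) = ENNReal.ofReal 4 := by norm_num
          rw [e4]
          apply ENNReal.ofReal_le_ofReal
          calc _ ≤ (2 : ℝ) ^ (3 / 4 : ℝ) := by
                gcongr
                rw [← sq_abs]
                nlinarith [abs_nonneg x]
            _ ≤ 4 := by linarith
      _ ≤ _ := le_self_add

theorem fourier_comp_add (g : ℝ → ℂ) (δ τ : ℝ) :
    𝓕 (fun t => g (t + δ)) τ = Complex.exp (δ * (2 * Real.pi * τ : ℝ) * Complex.I) * 𝓕 g τ := by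
  rw [Real.fourier_real_eq, Real.fourier_real_eq, ← integral_const_mul,
    ← integral_add_right_eq_self _ (-δ)]
  congr 1; ext t
  rw [Circle.smul_def, Circle.smul_def, Real.fourierChar_apply, Real.fourierChar_apply, smul_eq_mul,
    smul_eq_mul, ← mul_assoc, ← Complex.exp_add]
  congr 2
  · push_cast; ring
  · ring_nf

/-- Translation by δ multiplies the Fourier transform by e^{2πiδτ}; Plancherel applied to g(·+δ)-g
and integrated over δ recovers |2πτ|^{3/2} for |2πτ| ≥ 1. Bounded τ are covered by the L² norm of g.
-/
theorem lintegral_fourier_weight_le {g : ℝ → ℂ} (h1 : Integrable g)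
    (h2 : MemLp g 2) :
    ∫⁻ τ : ℝ, ENNReal.ofReal ((1 + (2 * Real.pi * τ) ^ 2) ^ (3 / 4 : ℝ)) * ‖𝓕 g τ‖ₑ ^ 2 ≤
      4 * (∫⁻ t, ‖g t‖ₑ ^ 2) + 4 * ∫⁻ δ, ∫⁻ t, ‖g (t + δ) - g t‖ₑ ^ 2 ∂volume ∂incrMeasure := by
  have mF : Measurable (𝓕 g) := (continuous_fourier h1).measurable
  have key : ∀ δ, ∫⁻ t, ‖g (t + δ) - g t‖ₑ ^ 2 = ∫⁻ τ : ℝ,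
      ‖Complex.exp (δ * (2 * Real.pi * τ : ℝ) * Complex.I) - 1‖ₑ ^ 2 * ‖𝓕 g τ‖ₑ ^ 2 := by
    intro δ
    have i1 : Integrable fun t => g (t + δ) := h1.comp_add_right δ
    have i2 : MemLp (fun t => g (t + δ)) 2 :=
      h2.comp_measurePreserving (measurePreserving_add_right volume δ)
    have hP := lintegral_fourier_sq (i1.sub h1) (i2.sub h2)
    simp only [Pi.sub_apply] at hP
    rw [← hP]
    congr 1; ext τ
    have e : 𝓕 ((fun t => g (t + δ)) - g) τ = 𝓕 (fun t => g (t + δ)) τ - 𝓕 g τ := by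
      rw [Real.fourier_real_eq, Real.fourier_real_eq, Real.fourier_real_eq, ← integral_sub]
      · congr 1; ext t; simp [smul_sub]
      · exact (Real.fourierIntegral_convergent_iff (V := ℝ) τ).2 i1 |>.congr (by simp [mul_comm])
      · exact (Real.fourierIntegral_convergent_iff (V := ℝ) τ).2 h1 |>.congr (by simp [mul_comm])
    rw [e, fourier_comp_add, ← mul_pow, ← enorm_mul]
    congr 2; ring
  calc _ ≤ ∫⁻ τ : ℝ, (4 * ‖𝓕 g τ‖ₑ ^ 2 + 4 * ∫⁻ δ : ℝ,
        ‖Complex.exp (δ * (2 * Real.pi * τ : ℝ) * Complex.I) - 1‖ₑ ^ 2 * ‖𝓕 g τ‖ₑ ^ 2 ∂incrMeasure) := by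
        refine lintegral_mono fun τ => ?_
        rw [lintegral_mul_const _ (by fun_prop), ← mul_assoc, ← add_mul]
        gcongr
        exact one_add_sq_rpow_le_osc _
    _ = _ := by
        rw [lintegral_add_left (by fun_prop), lintegral_const_mul' _ _ (by simp),
          lintegral_fourier_sq h1 h2, lintegral_const_mul' _ _ (by simp)]
        simp_rw [key]
        rw [lintegral_lintegral_swap (by fun_prop)]

end

section


/-! ### Space-time as a product -/

/-- `(t, x) ↦ embed t x` as a measurable equivalence. -/
def stEquiv : ℝ × Space ≃ᵐ Spacetime :=
  ((MeasurableEquiv.refl ℝ).prodCongr (MeasurableEquiv.toLp 2 (Fin 2 → ℝ)).symm).trans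
    ((MeasurableEquiv.piFinSuccAbove (fun _ : Fin 3 => ℝ) 0).symm.trans
      (MeasurableEquiv.toLp 2 (Fin 3 → ℝ)))

theorem stEquiv_apply (p : ℝ × Space) : stEquiv p = embed p.1 p.2 := by
  ext i
  fin_cases i <;> rfl

theorem measurePreserving_stEquiv :
    MeasurePreserving stEquiv (volume.prod volume) (volume : Measure Spacetime) := by
  have h1 : MeasurePreserving ((MeasurableEquiv.refl ℝ).prodCongr
      (MeasurableEquiv.toLp 2 (Fin 2 → ℝ)).symm) (volume.prod (volume : Measure Space))
      ((volume : Measure ℝ).prod (volume : Measure (Fin 2 → ℝ))) :=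
    (MeasurePreserving.id volume).prod (EuclideanSpace.volume_preserving_symm_measurableEquiv_toLp _)
  have h2 := (volume_preserving_piFinSuccAbove (fun _ : Fin 3 => ℝ) 0).symm
  have h3 := (EuclideanSpace.volume_preserving_symm_measurableEquiv_toLp (Fin 3)).symm
  exact (h3.comp h2).comp h1

@[simp] theorem embed_zero_apply (t : ℝ) (x : Space) : embed t x 0 = t := rfl

@[simp] theorem spatial_embed (t : ℝ) (x : Space) : spatial (embed t x) = x := by
  ext i; fin_cases i <;> rfl

theorem inner_embed (t τ : ℝ) (x k : Space) :
    inner ℝ (embed t x) (embed τ k) = t * τ + inner ℝ x k := by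
  simp [embed, PiLp.inner_apply, Fin.sum_univ_three, Fin.sum_univ_two]
  ring

theorem norm_embed_sq (t : ℝ) (x : Space) : ‖embed t x‖ ^ 2 = t ^ 2 + ‖x‖ ^ 2 := by
  rw [← real_inner_self_eq_norm_sq, inner_embed, real_inner_self_eq_norm_sq]; ring

theorem abs_le_norm_embed (t : ℝ) (x : Space) : |t| ≤ ‖embed t x‖ := by
  apply abs_le_of_sq_le_sq _ (norm_nonneg _)
  rw [norm_embed_sq]; nlinarith [sq_nonneg ‖x‖]

theorem norm_le_norm_embed (t : ℝ) (x : Space) : ‖x‖ ≤ ‖embed t x‖ := by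
  apply (sq_le_sq₀ (norm_nonneg _) (norm_nonneg _)).mp
  rw [norm_embed_sq]; nlinarith [sq_nonneg t]

theorem continuous_embed : Continuous fun p : ℝ × Space => embed p.1 p.2 := by
  unfold embed
  refine (PiLp.continuous_toLp 2 _).comp (continuous_pi fun i => ?_)
  fin_cases i <;> simp <;> fun_prop

theorem continuous_spatial : Continuous spatial := by
  unfold spatial
  refine (PiLp.continuous_toLp 2 _).comp (continuous_pi fun i => ?_)
  fin_cases i <;> simp <;> fun_prop

theorem lintegral_spacetime (f : Spacetime → ℝ≥0∞) :
    ∫⁻ p, f p = ∫⁻ q : ℝ × Space, f (embed q.1 q.2) ∂(volume.prod volume) := by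
  rw [← measurePreserving_stEquiv.lintegral_comp_emb stEquiv.measurableEmbedding]
  simp_rw [stEquiv_apply]

theorem integral_spacetime (f : Spacetime → ℂ) :
    ∫ p, f p = ∫ q : ℝ × Space, f (embed q.1 q.2) ∂(volume.prod volume) := by
  rw [← measurePreserving_stEquiv.integral_comp stEquiv.measurableEmbedding]
  simp_rw [stEquiv_apply]

theorem integrable_spacetime {f : Spacetime → ℂ} (hf : Integrable f) :
    Integrable (fun q : ℝ × Space => f (embed q.1 q.2)) (volume.prod volume) := by
  have := measurePreserving_stEquiv.integrable_comp_emb stEquiv.measurableEmbedding (g := f)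
  refine (this.mpr hf).congr (Filter.Eventually.of_forall fun q => ?_)
  simp [stEquiv_apply]

/-! ### Decay of Schwartz functions on space-time -/

theorem exists_decay (θ : 𝓢(Spacetime, ℂ)) : ∃ C : ℝ, 0 ≤ C ∧ ∀ τ k,
    ‖θ (embed τ k)‖ ≤ C * (1 + ‖τ‖) ^ (-2 : ℝ) * (1 + ‖k‖) ^ (-3 : ℝ) := by
  obtain ⟨C, hC⟩ : ∃ C : ℝ, ∀ x, (1 + ‖x‖) ^ 5 * ‖θ x‖ ≤ C := by
    refine ⟨2 ^ 5 * ((Finset.Iic (5, 0)).sup fun m => SchwartzMap.seminorm ℂ m.1 m.2) θ,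
      fun x => ?_⟩
    have := SchwartzMap.one_add_le_sup_seminorm_apply (𝕜 := ℂ) (m := (5, 0)) (k := 5) (n := 0) le_rfl
      le_rfl θ x
    rwa [norm_iteratedFDeriv_zero] at this
  have hC0 : 0 ≤ C := le_trans (by positivity) (hC 0)
  refine ⟨C, hC0, fun τ k => ?_⟩
  have h1 : (1 + ‖τ‖) ^ 2 * (1 + ‖k‖) ^ 3 ≤ (1 + ‖embed τ k‖) ^ 5 := by
    calc _ ≤ (1 + ‖embed τ k‖) ^ 2 * (1 + ‖embed τ k‖) ^ 3 := by
          have := abs_le_norm_embed τ k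
          have := norm_le_norm_embed τ k
          rw [Real.norm_eq_abs]
          gcongr
      _ = _ := by ring
  have h2 : (1 + ‖τ‖) ^ 2 * (1 + ‖k‖) ^ 3 * ‖θ (embed τ k)‖ ≤ C :=
    (mul_le_mul_of_nonneg_right h1 (norm_nonneg _)).trans (hC _)
  have e1 : (1 + ‖τ‖) ^ (-2 : ℝ) = ((1 + ‖τ‖) ^ 2)⁻¹ := by
    rw [Real.rpow_neg (by positivity)]; norm_cast
  have e2 : (1 + ‖k‖) ^ (-3 : ℝ) = ((1 + ‖k‖) ^ 3)⁻¹ := by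
    rw [Real.rpow_neg (by positivity)]; norm_cast
  rw [e1, e2, ← div_eq_mul_inv, ← div_eq_mul_inv, le_div_iff₀ (by positivity),
    le_div_iff₀ (by positivity)]
  linarith

/-- The Fourier transform in time of a Schwartz function on space-time. -/
def timeFourier (θ : 𝓢(Spacetime, ℂ)) (t : ℝ) (k : Space) : ℂ := 𝓕 (fun τ => θ (embed τ k)) t

theorem integrable_time (θ : 𝓢(Spacetime, ℂ)) (k : Space) : Integrable fun τ => θ (embed τ k) := by
  obtain ⟨C, hC, h⟩ := exists_decay θ
  have h1 : Integrable fun τ : ℝ => (1 + ‖τ‖) ^ (-2 : ℝ) :=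
    integrable_one_add_norm (by simp)
  refine ((h1.const_mul C).mul_const ((1 + ‖k‖) ^ (-3 : ℝ))).mono' ?_
    (Filter.Eventually.of_forall fun τ => h τ k)
  exact (θ.continuous.comp (continuous_embed.comp (by fun_prop :
    Continuous fun τ : ℝ => (τ, k)))).aestronglyMeasurable

theorem norm_timeFourier_le (θ : 𝓢(Spacetime, ℂ)) : ∃ C : ℝ, 0 ≤ C ∧ ∀ t k,
    ‖timeFourier θ t k‖ ≤ C * (1 + ‖k‖) ^ (-3 : ℝ) := by
  obtain ⟨C, hC, h⟩ := exists_decay θ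
  have h1 : Integrable fun τ : ℝ => (1 + ‖τ‖) ^ (-2 : ℝ) :=
    integrable_one_add_norm (by simp)
  refine ⟨C * ∫ τ : ℝ, (1 + ‖τ‖) ^ (-2 : ℝ), by positivity, fun t k => ?_⟩
  unfold timeFourier
  rw [Real.fourier_real_eq]
  refine (norm_integral_le_integral_norm _).trans ?_
  simp_rw [Circle.norm_smul]
  calc _ ≤ ∫ τ : ℝ, C * (1 + ‖τ‖) ^ (-2 : ℝ) * (1 + ‖k‖) ^ (-3 : ℝ) :=
        integral_mono (integrable_time θ k).norm
          ((h1.const_mul C).mul_const _) fun τ => h τ k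
    _ = _ := by rw [integral_mul_const, integral_const_mul]

theorem continuous_timeFourier (θ : 𝓢(Spacetime, ℂ)) :
    Continuous fun p : ℝ × Space => timeFourier θ p.1 p.2 := by
  obtain ⟨C, hC, h⟩ := exists_decay θ
  have h1 : Integrable fun τ : ℝ => (1 + ‖τ‖) ^ (-2 : ℝ) :=
    integrable_one_add_norm (by simp)
  unfold timeFourier
  simp_rw [Real.fourier_real_eq]
  have hc : Continuous fun q : (ℝ × Space) × ℝ =>
      Real.fourierChar (-(q.2 * q.1.1)) • θ (embed q.2 q.1.2) := by
    have h2 : Continuous fun q : (ℝ × Space) × ℝ => θ (embed q.2 q.1.2) :=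
      θ.continuous.comp (continuous_embed.comp (by fun_prop :
        Continuous fun q : (ℝ × Space) × ℝ => (q.2, q.1.2)))
    have h3 := Real.continuous_fourierChar
    exact (h3.comp (by fun_prop)).smul h2
  refine continuous_of_dominated (bound := fun τ => C * (1 + ‖τ‖) ^ (-2 : ℝ)) ?_ ?_
    (h1.const_mul C) ?_
  · intro p
    exact (hc.comp (by fun_prop : Continuous fun τ : ℝ => (p, τ))).aestronglyMeasurable
  · intro p
    refine Filter.Eventually.of_forall fun τ => ?_
    rw [Circle.norm_smul]
    refine (h τ p.2).trans ?_
    have : (1 + ‖p.2‖) ^ (-3 : ℝ) ≤ 1 :=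
      Real.rpow_le_one_of_one_le_of_nonpos (by linarith [norm_nonneg p.2]) (by norm_num)
    exact mul_le_of_le_one_right (by positivity) this
  · exact Filter.Eventually.of_forall fun τ => hc.comp (by fun_prop : Continuous fun p : ℝ × Space => (p, τ))

theorem continuous_timeFourier_slice (θ : 𝓢(Spacetime, ℂ)) (t : ℝ) :
    Continuous (timeFourier θ t) := by
  have h : Continuous ((fun p : ℝ × Space => timeFourier θ p.1 p.2) ∘ fun k : Space => (t, k)) :=
    (continuous_timeFourier θ).comp (by fun_prop)
  exact h

theorem integrable_timeFourier (θ : 𝓢(Spacetime, ℂ)) (t : ℝ) : Integrable (timeFourier θ t) := by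
  obtain ⟨C, hC, h⟩ := norm_timeFourier_le θ
  have h1 : Integrable fun k : Space => (1 + ‖k‖) ^ (-3 : ℝ) :=
    integrable_one_add_norm (by simp; norm_num)
  exact (h1.const_mul C).mono' (continuous_timeFourier_slice θ t).aestronglyMeasurable
    (Filter.Eventually.of_forall fun k => h t k)

theorem fourier_timeFourier (θ : 𝓢(Spacetime, ℂ)) (t : ℝ) :
    𝓕 (timeFourier θ t) = slice t (𝓕 θ) := by
  ext x
  rw [slice_apply, SchwartzMap.fourier_coe, Real.fourier_eq, Real.fourier_eq, integral_spacetime]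
  have hi : Integrable (fun q : ℝ × Space =>
      Real.fourierChar (-inner ℝ (embed q.1 q.2) (embed t x)) • θ (embed q.1 q.2))
      (volume.prod volume) :=
    integrable_spacetime (f := fun p => Real.fourierChar (-inner ℝ p (embed t x)) • θ p)
      ((Real.fourierIntegral_convergent_iff _).2 θ.integrable)
  rw [integral_prod_symm _ hi]
  congr 1; ext k
  unfold timeFourier
  rw [Real.fourier_real_eq, Circle.smul_def, ← integral_smul]
  congr 1; ext τ
  simp only [inner_embed, neg_add, AddChar.map_add_eq_mul, Circle.smul_def, Circle.coe_mul,
    smul_eq_mul]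
  ring

/-- Undoing the space-time transform in time alone leaves the spatial inverse transform of the time
slice. This allows a pairing with 𝓕⁻ψ to be read at each fixed time. -/
theorem timeFourier_fourierInv (ψ : 𝓢(Spacetime, ℂ)) (t : ℝ) :
    timeFourier (𝓕⁻ ψ) t = 𝓕⁻ (slice t ψ) := by
  have hF := fourier_timeFourier (𝓕⁻ ψ) t
  rw [FourierInvPair.fourier_fourierInv_eq] at hF
  have := Continuous.fourierInv_fourier_eq (continuous_timeFourier_slice (𝓕⁻ ψ) t) (integrable_timeFourier (𝓕⁻ ψ) t)
    (by rw [hF]; exact (slice t ψ).integrable)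
  rw [← this, hF, SchwartzMap.fourierInv_coe]

end

section


/-! ### Cut-off in time -/

/-- A Lipschitz cut-off function that is `1` on `[-R, R]` and `0` off `[-R-1, R+1]`. -/
def cut (R t : ℝ) : ℝ := max 0 (min 1 (R + 1 - |t|))

theorem continuous_cut (R : ℝ) : Continuous (cut R) := by unfold cut; fun_prop

theorem abs_cut_le (R t : ℝ) : |cut R t| ≤ 1 := by
  unfold cut
  rw [abs_of_nonneg (le_max_left _ _)]
  exact max_le zero_le_one (min_le_left _ _)

theorem cut_eq_one {R t : ℝ} (h : |t| ≤ R) : cut R t = 1 := by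
  unfold cut
  rw [min_eq_left (by linarith), max_eq_right zero_le_one]

theorem cut_eq_zero {R t : ℝ} (h : R + 1 ≤ |t|) : cut R t = 0 := by
  unfold cut
  exact max_eq_left ((min_le_right _ _).trans (by linarith))

theorem abs_cut_sub_le (R t δ : ℝ) : |cut R (t + δ) - cut R t| ≤ |δ| := by
  unfold cut
  refine (abs_max_sub_max_le_max _ _ _ _).trans ?_
  refine max_le (by simp) ((abs_min_sub_min_le_max _ _ _ _).trans (max_le (by simp) ?_))
  have : R + 1 - |t + δ| - (R + 1 - |t|) = |t| - |t + δ| := by ring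
  rw [this]
  refine (abs_abs_sub_abs_le _ _).trans ?_
  rw [sub_add_cancel_left, abs_neg]

/-- The cut-off is bounded by 1 and Lipschitz, so its increments contribute δ², which is integrable
against δ^{-5/2}. -/
theorem HT.cut {s : ℝ} {h : ℝ → Space → ℂ} (hh : HT s h) (R : ℝ) :
    HT s fun t k => (CSH.cut R t : ℂ) * h t k := by
  obtain ⟨hb, C, hC, hi⟩ := hh
  obtain ⟨D, hD, hd⟩ := hb.bound
  have mc := (continuous_cut R).measurable
  refine ⟨hb.mul_unit (m := fun t _ => (CSH.cut R t : ℂ)) (by fun_prop)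
    (fun t k => by rw [Complex.norm_real]; exact abs_cut_le R t), 2 * (C + D * 2), by finiteness,
    fun t => ?_⟩
  calc _ ≤ ∫⁻ δ : ℝ, 2 * (wn s (fun k => ‖h (t + δ) k - h t k‖ₑ) + D * ENNReal.ofReal δ ^ 2)
          ∂incrMeasure := by
        refine lintegral_mono_ae ?_
        filter_upwards [ae_incrMeasure] with δ hδ
        have := hb.meas_slice t
        have := hb.meas_slice (t + δ)
        refine (wn_mono (G := fun k => ‖h (t + δ) k - h t k‖ₑ + ENNReal.ofReal δ * ‖h t k‖ₑ)
          le_rfl fun k => ?_).trans ((wn_add_le (by fun_prop)).trans ?_)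
        · have e : (CSH.cut R (t + δ) : ℂ) * h (t + δ) k - CSH.cut R t * h t k =
            CSH.cut R (t + δ) * (h (t + δ) k - h t k) +
              ((CSH.cut R (t + δ) - CSH.cut R t : ℝ) : ℂ) * h t k := by push_cast; ring
          rw [e]
          refine (enorm_add_le _ _).trans ?_
          rw [enorm_mul, enorm_mul]
          gcongr
          · refine mul_le_of_le_one_left' ?_
            rw [← ofReal_norm, Complex.norm_real]
            exact ENNReal.ofReal_le_one.mpr (abs_cut_le R _)
          · rw [← ofReal_norm, Complex.norm_real]
            refine ENNReal.ofReal_le_ofReal ((abs_cut_sub_le R t δ).trans ?_)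
            rw [abs_of_nonneg hδ]
        · rw [wn_const_mul (by simp), mul_comm D]
          gcongr
          exact hd t
    _ ≤ _ := by
        rw [lintegral_const_mul' _ _ (by simp), lintegral_add_left (hb.measurable_wn_incr t),
          lintegral_const_mul' _ _ hD]
        gcongr
        · exact hi t
        · exact lintegral_incr_sq_le

/-! ### The space-time Fourier transform -/

section

variable {s R : ℝ} {H : ℝ → Space → ℂ}

theorem lintegral_time_lt_top (hH : HT s H) (h0 : ∀ t k, R ≤ |t| → H t k = 0) :
    ∫⁻ t, wn s (fun k => ‖H t k‖ₑ) < ∞ := by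
  obtain ⟨C, hC, hb⟩ := hH.bdd.bound
  calc _ ≤ ∫⁻ t, (Set.Icc (-R) R).indicator (fun _ => C) t := by
        refine lintegral_mono fun t => ?_
        by_cases ht : t ∈ Set.Icc (-R) R
        · rw [Set.indicator_of_mem ht]; exact hb t
        · have : R ≤ |t| := by
            by_contra hlt
            exact ht (abs_le.mp (not_le.mp hlt).le)
          simp [wn, h0 t _ this]
    _ < ∞ := by
        rw [lintegral_indicator measurableSet_Icc]
        simp [ENNReal.mul_lt_top_iff, hC.lt_top]

theorem lintegral_time_incr_lt_top (hH : HT s H) (h0 : ∀ t k, R ≤ |t| → H t k = 0) :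
    ∫⁻ t : ℝ, ∫⁻ δ : ℝ, wn s (fun k => ‖H (t + δ) k - H t k‖ₑ) ∂incrMeasure < ∞ := by
  obtain ⟨C, hC, hb⟩ := hH.incr
  calc _ ≤ ∫⁻ t, (Set.Icc (-R - 1) (R + 1)).indicator (fun _ => C) t := by
        refine lintegral_mono fun t => ?_
        by_cases ht : t ∈ Set.Icc (-R - 1) (R + 1)
        · rw [Set.indicator_of_mem ht]; exact hb t
        · have h1 : R + 1 < |t| := by
            by_contra hlt
            have := abs_le.mp (not_lt.mp hlt)
            exact ht ⟨by linarith, this.2⟩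
          rw [Set.indicator_of_notMem ht]
          refine (lintegral_eq_zero_of_ae_eq_zero ?_).le
          refine (withDensity_absolutelyContinuous _ _).ae_le ?_
          refine (ae_restrict_iff' measurableSet_Ioc).mpr (Filter.Eventually.of_forall fun δ hδ => ?_)
          -- As δ ≤ 1, both t and t + δ lie outside the support once |t| > R + 1.
          have h2 : R ≤ |t + δ| := by
            have := abs_sub_abs_le_abs_sub t (-δ)
            rw [abs_neg, sub_neg_eq_add, abs_of_pos hδ.1] at this
            linarith [hδ.2]
          simp [wn, h0 t _ (by linarith), h0 _ _ h2]
    _ < ∞ := by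
        rw [lintegral_indicator measurableSet_Icc]
        simp [ENNReal.mul_lt_top_iff, hC.lt_top]

theorem measurable_time_slice (hH : HT s H) (k : Space) : Measurable fun t => H t k :=
  hH.bdd.meas.comp (measurable_id.prodMk measurable_const)

theorem integrable_memLp_time (hH : HT s H) (h0 : ∀ t k, R ≤ |t| → H t k = 0) :
    ∀ᵐ k, Integrable (fun t => H t k) ∧ MemLp (fun t => H t k) 2 := by
  have hm := hH.bdd.meas
  have hw := measurable_wt s
  have h1 := lintegral_time_lt_top hH h0
  unfold wn at h1
  rw [lintegral_lintegral_swap (by fun_prop)] at h1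
  have h2 := ae_lt_top (Measurable.lintegral_prod_right'
    (f := fun p : Space × ℝ => (wt s p.1 * ‖H p.2 p.1‖ₑ) ^ 2)
    (by
      have : Measurable fun p : Space × ℝ => H p.2 p.1 := hm.comp measurable_swap
      fun_prop)) h1.ne
  filter_upwards [h2, hH.bdd.intervalIntegrable] with k hk hint
  constructor
  · have h3 : IntegrableOn (fun t => H t k) (Set.Ioc (-|R|) |R|) :=
      (intervalIntegrable_iff_integrableOn_Ioc_of_le (by linarith [abs_nonneg R])).mp (hint _ _)
    refine (integrableOn_iff_integrable_of_support_subset fun t ht => ?_).mp h3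
    by_contra hn
    apply ht
    apply h0
    by_contra hlt
    have := abs_lt.mp ((not_le.mp hlt).trans_le (le_abs_self R))
    exact hn ⟨this.1, this.2.le⟩
  · refine ⟨(measurable_time_slice hH k).aestronglyMeasurable, ?_⟩
    rw [eLpNorm_eq_lintegral_rpow_enorm_toReal (by simp) (by simp)]
    apply ENNReal.rpow_lt_top_of_nonneg (by simp)
    simp_rw [mul_pow] at hk
    rw [lintegral_const_mul' _ _ (by have := wt_ne_top s k; finiteness)] at hk
    have hw0 : wt s k ^ 2 ≠ 0 := pow_ne_zero _ (wt_pos s k).ne'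
    rcases ENNReal.mul_lt_top_iff.mp hk with h | h | h
    · simpa using h.2.ne
    · exact absurd h hw0
    · simp [h]

theorem measurable_comp_swap {f : ℝ → Space → ℂ} (hm : Measurable fun p : ℝ × Space => f p.1 p.2) :
    Measurable fun p : Space × ℝ => f p.2 p.1 := hm.comp measurable_swap

theorem lintegral_wn_time {H : ℝ → Space → ℂ} (hm : Measurable fun p : ℝ × Space => H p.1 p.2) :
    ∫⁻ t, wn s (fun k => ‖H t k‖ₑ) = ∫⁻ k, wt s k ^ 2 * ∫⁻ t, ‖H t k‖ₑ ^ 2 := by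
  have hw := measurable_wt s
  unfold wn
  rw [lintegral_lintegral_swap (by fun_prop)]
  congr 1; ext k
  simp_rw [mul_pow]
  rw [lintegral_const_mul' _ _ (by have := wt_ne_top s k; finiteness)]

theorem measurable_wn_incr (hm : Measurable fun p : ℝ × Space => H p.1 p.2) :
    Measurable fun p : ℝ × ℝ => wn s (fun k => ‖H (p.1 + p.2) k - H p.1 k‖ₑ) := by
  unfold wn
  have hw := measurable_wt s
  have a1 : Measurable fun q : (ℝ × ℝ) × Space => H (q.1.1 + q.1.2) q.2 :=
    hm.comp ((measurable_fst.fst.add measurable_fst.snd).prodMk measurable_snd)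
  have a2 : Measurable fun q : (ℝ × ℝ) × Space => H q.1.1 q.2 :=
    hm.comp (measurable_fst.fst.prodMk measurable_snd)
  exact Measurable.lintegral_prod_right'
    (f := fun q : (ℝ × ℝ) × Space => (wt s q.2 * ‖H (q.1.1 + q.1.2) q.2 - H q.1.1 q.2‖ₑ) ^ 2)
    (by fun_prop)

theorem measurable_lintegral_incr (hm : Measurable fun p : ℝ × Space => H p.1 p.2) :
    Measurable fun p : ℝ × Space => ∫⁻ t : ℝ, ‖H (t + p.1) p.2 - H t p.2‖ₑ ^ 2 := by
  have m3 : Measurable fun q : (ℝ × Space) × ℝ => H (q.2 + q.1.1) q.1.2 :=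
    hm.comp ((measurable_snd.add measurable_fst.fst).prodMk measurable_fst.snd)
  have m4 : Measurable fun q : (ℝ × Space) × ℝ => H q.2 q.1.2 :=
    hm.comp (measurable_snd.prodMk measurable_fst.snd)
  exact Measurable.lintegral_prod_right'
    (f := fun q : (ℝ × Space) × ℝ => ‖H (q.2 + q.1.1) q.1.2 - H q.2 q.1.2‖ₑ ^ 2) (by fun_prop)

theorem lintegral_wn_incr (hm : Measurable fun p : ℝ × Space => H p.1 p.2) :
    ∫⁻ t : ℝ, ∫⁻ δ : ℝ, wn s (fun k => ‖H (t + δ) k - H t k‖ₑ) ∂incrMeasure =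
      ∫⁻ k, wt s k ^ 2 *
        ∫⁻ δ : ℝ, ∫⁻ t : ℝ, ‖H (t + δ) k - H t k‖ₑ ^ 2 ∂volume ∂incrMeasure := by
  rw [lintegral_lintegral_swap (measurable_wn_incr hm).aemeasurable]
  have d1 : ∀ δ : ℝ, ∫⁻ t : ℝ, wn s (fun k => ‖H (t + δ) k - H t k‖ₑ) =
      ∫⁻ k, wt s k ^ 2 * ∫⁻ t : ℝ, ‖H (t + δ) k - H t k‖ₑ ^ 2 := by
    intro δ
    have a1 : Measurable fun q : ℝ × Space => H (q.1 + δ) q.2 :=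
      hm.comp ((measurable_fst.add_const δ).prodMk measurable_snd)
    exact lintegral_wn_time (H := fun t k => H (t + δ) k - H t k) (a1.sub hm)
  simp_rw [d1]
  have hw := measurable_wt s
  have m5 := measurable_lintegral_incr hm
  rw [lintegral_lintegral_swap (by fun_prop)]
  congr 1; ext k
  rw [lintegral_const_mul' _ _ (by have := wt_ne_top s k; finiteness)]

/-- The bound of `HT` is uniform in time; compact support turns it into an integral over time, and
the one-dimensional estimate is applied at each frequency. -/
theorem lintegral_freq_lt_top (hH : HT s H) (h0 : ∀ t k, R ≤ |t| → H t k = 0) :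
    ∫⁻ k, wt s k ^ 2 * ∫⁻ τ : ℝ, ENNReal.ofReal ((1 + (2 * Real.pi * τ) ^ 2) ^ (3 / 4 : ℝ)) *
      ‖𝓕 (fun t => H t k) τ‖ₑ ^ 2 < ∞ := by
  have hm := hH.bdd.meas
  have hw := measurable_wt s
  have hm2 := measurable_comp_swap hm
  have m1 : Measurable fun k => ∫⁻ t, ‖H t k‖ₑ ^ 2 :=
    Measurable.lintegral_prod_right' (f := fun p : Space × ℝ => ‖H p.2 p.1‖ₑ ^ 2) (by fun_prop)
  have f1 := lintegral_time_lt_top hH h0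
  have f2 := lintegral_time_incr_lt_top hH h0
  rw [lintegral_wn_time hm] at f1
  rw [lintegral_wn_incr hm] at f2
  calc _ ≤ ∫⁻ k, (4 * (wt s k ^ 2 * ∫⁻ t, ‖H t k‖ₑ ^ 2) +
        4 * (wt s k ^ 2 * ∫⁻ δ : ℝ, ∫⁻ t : ℝ, ‖H (t + δ) k - H t k‖ₑ ^ 2 ∂volume ∂incrMeasure)) := by
        refine lintegral_mono_ae ?_
        filter_upwards [integrable_memLp_time hH h0] with k hk
        refine (mul_le_mul_right (lintegral_fourier_weight_le hk.1 hk.2) _).trans ?_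
        rw [mul_add, mul_left_comm, mul_left_comm _ (4 : ℝ≥0∞)]
    _ < ∞ := by
        rw [lintegral_add_left (by fun_prop), lintegral_const_mul' _ _ (by simp),
          lintegral_const_mul' _ _ (by simp)]
        finiteness

/-- The space-time Fourier transform of `e^{iσt⟨ξ⟩} H`. -/
def stFourier (σ : ℤˣ) (H : ℝ → Space → ℂ) (p : Spacetime) : ℂ :=
  𝓕 (fun t => H t (spatial p)) (p 0 - ((σ : ℤ) : ℝ) * jb (spatial p) / (2 * Real.pi))

theorem stFourier_embed (σ : ℤˣ) (τ : ℝ) (k : Space) : stFourier σ H (embed τ k) =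
    𝓕 (fun t => H t k) (τ - ((σ : ℤ) : ℝ) * jb k / (2 * Real.pi)) := by
  simp [stFourier]

theorem measurable_fourier_time (hm : Measurable fun p : ℝ × Space => H p.1 p.2) :
    Measurable fun p : ℝ × Space => 𝓕 (fun t => H t p.2) p.1 := by
  simp_rw [Real.fourier_real_eq, Circle.smul_def]
  have h1 : Measurable fun q : (ℝ × Space) × ℝ => H q.2 q.1.2 :=
    hm.comp (measurable_snd.prodMk measurable_fst.snd)
  have h2 : Measurable fun x : ℝ => (Real.fourierChar x : ℂ) :=
    (continuous_subtype_val.comp Real.continuous_fourierChar).measurable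
  have h3 : Measurable fun q : (ℝ × Space) × ℝ =>
      (Real.fourierChar (-(q.2 * q.1.1)) : ℂ) * H q.2 q.1.2 :=
    (h2.comp (measurable_snd.mul measurable_fst.fst).neg).mul h1
  exact (StronglyMeasurable.integral_prod_right' (f := fun q : (ℝ × Space) × ℝ =>
      (Real.fourierChar (-(q.2 * q.1.1)) : ℂ) * H q.2 q.1.2) h3.stronglyMeasurable).measurable

theorem measurable_stFourier (hm : Measurable fun p : ℝ × Space => H p.1 p.2) (σ : ℤˣ) :
    Measurable (stFourier σ H) := by
  have h := measurable_fourier_time hm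
  have h2 : Measurable fun p : Spacetime => (p 0 - ((σ : ℤ) : ℝ) * jb (spatial p) / (2 * Real.pi)) := by
    have := continuous_spatial.measurable
    have := measurable_jb
    fun_prop
  have h3 := h.comp (h2.prodMk continuous_spatial.measurable)
  exact h3

end

end

/-! ### From regularity of the profile to the spaces X^{s,3/4} -/

section


section

variable {s R : ℝ} {H : ℝ → Space → ℂ}

theorem sq_unit_sign (σ : ℤˣ) : (((σ : ℤ) : ℝ)) ^ 2 = 1 := by
  rcases Int.units_eq_one_or σ with h | h <;> simp [h]

/-- The profile uses the phase of ⟨∇⟩ while the weight of X^{s,b} uses |ξ|. Since 0 ≤ ⟨ξ⟩-|ξ| ≤ 1,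
replacing one by the other changes the weight only by a constant. -/
theorem weight_sq_le (σ : ℤˣ) (s τ : ℝ) (k : Space) :
    weight σ s (3 / 4) (embed (τ + ((σ : ℤ) : ℝ) * jb k / (2 * Real.pi)) k) ^ 2 ≤
      3 * ((jb k ^ s) ^ 2 * (1 + (2 * Real.pi * τ) ^ 2) ^ (3 / 4 : ℝ)) := by
  have hk := jb_pos k
  have hn := norm_nonneg ((2 * Real.pi) • k)
  have hpi := Real.pi_pos
  unfold weight
  rw [spatial_embed, jb_rpow, embed_zero_apply, mul_pow, ← Real.rpow_natCast (_ ^ ((3:ℝ) / 4 / 2)),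
    ← Real.rpow_mul (by positivity)]
  set y := ‖(2 * Real.pi) • k‖ with hy
  have h1 : jb k ^ 2 = 1 + y ^ 2 := by rw [jb_sq, ← norm_fq_sq]
  have h2 : y ≤ jb k := by nlinarith
  have h3 : jb k - y ≤ 1 := by nlinarith
  have hσ := sq_unit_sign σ
  set r : ℝ := ((σ : ℤ) : ℝ)
  have e : -(2 * Real.pi * (τ + r * jb k / (2 * Real.pi))) + r * y =
      -(2 * Real.pi * τ) - r * (jb k - y) := by field_simp; ring
  rw [e]
  have h4 : 1 + (-(2 * Real.pi * τ) - r * (jb k - y)) ^ 2 ≤ 3 * (1 + (2 * Real.pi * τ) ^ 2) := by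
    have : (r * (jb k - y)) ^ 2 ≤ 1 := by
      rw [mul_pow, hσ, one_mul]; nlinarith
    nlinarith [sq_nonneg (2 * Real.pi * τ - r * (jb k - y))]
  have h5 : (1 + (-(2 * Real.pi * τ) - r * (jb k - y)) ^ 2) ^ (3 / 4 / 2 * ((2 : ℕ) : ℝ)) ≤
      3 * (1 + (2 * Real.pi * τ) ^ 2) ^ (3 / 4 : ℝ) := by
    have e3 : (3 / 4 / 2 * ((2 : ℕ) : ℝ)) = 3 / 4 := by norm_num
    rw [e3]
    calc _ ≤ (3 * (1 + (2 * Real.pi * τ) ^ 2)) ^ (3 / 4 : ℝ) := by gcongr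
      _ = 3 ^ (3 / 4 : ℝ) * (1 + (2 * Real.pi * τ) ^ 2) ^ (3 / 4 : ℝ) :=
          Real.mul_rpow (by norm_num) (by positivity)
      _ ≤ _ := by
          gcongr
          calc (3 : ℝ) ^ (3 / 4 : ℝ) ≤ 3 ^ (1 : ℝ) :=
                Real.rpow_le_rpow_of_exponent_le (by norm_num) (by norm_num)
            _ = 3 := Real.rpow_one _
  calc _ ≤ (jb k ^ s) ^ 2 * (3 * (1 + (2 * Real.pi * τ) ^ 2) ^ (3 / 4 : ℝ)) := by gcongr
    _ = _ := by ring

theorem continuous_weight (σ : ℤˣ) (s b : ℝ) : Continuous (weight σ s b) := by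
  have h := continuous_spatial
  unfold weight
  refine Continuous.mul (Continuous.rpow_const (by fun_prop) fun p => Or.inl (by positivity))
    (Continuous.rpow_const (by fun_prop) fun p => Or.inl (by positivity))

theorem one_le_weight (σ : ℤˣ) {s b : ℝ} (hs : 0 ≤ s) (hb : 0 ≤ b) (p : Spacetime) :
    1 ≤ weight σ s b p := by
  unfold weight
  refine one_le_mul_of_one_le_of_one_le ?_ ?_
  · exact Real.one_le_rpow (by nlinarith [sq_nonneg ‖(2 * Real.pi) • spatial p‖]) (by linarith)
  · exact Real.one_le_rpow (by
      nlinarith [sq_nonneg (-(2 * Real.pi * p 0) + ((σ : ℤ) : ℝ) * ‖(2 * Real.pi) • spatial p‖)])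
      (by linarith)

theorem memLp_weight_stFourier (σ : ℤˣ) (hH : HT s H) (h0 : ∀ t k, R ≤ |t| → H t k = 0) :
    MemLp (fun p => (weight σ s (3 / 4) p : ℂ) * stFourier σ H p) 2 := by
  have mF := measurable_stFourier hH.bdd.meas σ
  have mw := (continuous_weight σ s (3 / 4)).measurable
  refine ⟨by fun_prop, ?_⟩
  rw [eLpNorm_eq_lintegral_rpow_enorm_toReal (by simp) (by simp)]
  apply ENNReal.rpow_lt_top_of_nonneg (by simp)
  apply ne_of_lt
  have e2 : (2 : ℝ≥0∞).toReal = ((2 : ℕ) : ℝ) := by simp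
  simp_rw [e2, ENNReal.rpow_natCast]
  have mG : Measurable fun p : Spacetime => ‖(weight σ s (3 / 4) p : ℂ) * stFourier σ H p‖ₑ ^ 2 := by
    fun_prop
  have me := continuous_embed.measurable
  have mG2 : Measurable fun q : ℝ × Space =>
      ‖(weight σ s (3 / 4) (embed q.1 q.2) : ℂ) * stFourier σ H (embed q.1 q.2)‖ₑ ^ 2 := mG.comp me
  rw [lintegral_spacetime, lintegral_prod_symm _ mG2.aemeasurable]
  refine lt_of_le_of_lt ?_ (ENNReal.mul_lt_top (a := 3) (by simp) (lintegral_freq_lt_top hH h0))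
  rw [← lintegral_const_mul' _ _ (by simp)]
  refine lintegral_mono fun k => ?_
  -- The translation in τ moves the characteristic surface to τ = 0.
  rw [← lintegral_add_right_eq_self _ (((σ : ℤ) : ℝ) * jb k / (2 * Real.pi))]
  have hwt : wt s k ^ 2 ≠ ∞ := by have := wt_ne_top s k; finiteness
  rw [← lintegral_const_mul' _ _ hwt, ← lintegral_const_mul' _ _ (by simp)]
  refine lintegral_mono fun τ => ?_
  simp only [stFourier_embed, add_sub_cancel_right]
  rw [enorm_mul, mul_pow, ← mul_assoc, ← mul_assoc]
  gcongr
  have hk := jb_pos k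
  have e3 : (3 : ℝ≥0∞) = ENNReal.ofReal 3 := by norm_num
  rw [wt, ← ofReal_norm, Complex.norm_real, Real.norm_eq_abs, ← ENNReal.ofReal_pow (abs_nonneg _),
    ← ENNReal.ofReal_pow (by positivity), e3, ← ENNReal.ofReal_mul (by norm_num),
    ← ENNReal.ofReal_mul (by positivity), sq_abs]
  apply ENNReal.ofReal_le_ofReal
  rw [mul_assoc]
  exact weight_sq_le σ s τ k

theorem memLp_stFourier (hs : 0 ≤ s) (σ : ℤˣ) (hH : HT s H) (h0 : ∀ t k, R ≤ |t| → H t k = 0) :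
    MemLp (stFourier σ H) 2 := by
  refine (memLp_weight_stFourier σ hH h0).mono
    (measurable_stFourier hH.bdd.meas σ).aestronglyMeasurable (Filter.Eventually.of_forall fun p => ?_)
  have h1 := one_le_weight σ hs (by norm_num : (0 : ℝ) ≤ 3 / 4) p
  rw [norm_mul, Complex.norm_real, Real.norm_eq_abs, abs_of_pos (by linarith)]
  exact le_mul_of_one_le_left (norm_nonneg _) h1

theorem fourier_modulate (c : ℝ) (g : ℝ → ℂ) (τ : ℝ) :
    𝓕 g (τ - c / (2 * Real.pi)) = 𝓕 (fun t : ℝ => Complex.exp (t * c * Complex.I) * g t) τ := by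
  have hpi := Real.pi_pos
  rw [Real.fourier_real_eq, Real.fourier_real_eq]
  congr 1; ext t
  rw [Circle.smul_def, Circle.smul_def, Real.fourierChar_apply, Real.fourierChar_apply, smul_eq_mul,
    smul_eq_mul, ← mul_assoc, ← Complex.exp_add]
  congr 2
  push_cast
  have : (Real.pi : ℂ) ≠ 0 := by exact_mod_cast hpi.ne'
  field_simp
  ring

theorem fourier_flip {f g : ℝ → ℂ} (hf : Integrable f) (hg : Integrable g) :
    ∫ x, 𝓕 f x * g x = ∫ x, f x * 𝓕 g x := by
  have := VectorFourier.integral_fourierIntegral_smul_eq_flip (e := Real.fourierChar)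
    (L := innerₗ ℝ) (μ := volume) (ν := volume) (f := f) (g := g)
    Real.continuous_fourierChar continuous_inner hf hg
  simpa [Real.fourier_eq, VectorFourier.fourierIntegral, mul_comm] using! this

/-- The function `e^{iσt⟨ξ⟩} H`. -/
def wave (σ : ℤˣ) (H : ℝ → Space → ℂ) (t : ℝ) (k : Space) : ℂ :=
  Complex.exp (t * (((σ : ℤ) : ℝ) * jb k : ℝ) * Complex.I) * H t k

theorem norm_wave (σ : ℤˣ) (t : ℝ) (k : Space) : ‖wave σ H t k‖ = ‖H t k‖ := by
  rw [wave, norm_mul, norm_osc, one_mul]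

theorem measurable_wave (hm : Measurable fun p : ℝ × Space => H p.1 p.2) (σ : ℤˣ) :
    Measurable fun p : ℝ × Space => wave σ H p.1 p.2 := by
  have := measurable_jb
  unfold wave
  fun_prop

theorem Bdd.wave {σ : ℤˣ} (hH : Bdd s H) : Bdd s (wave σ H) :=
  hH.of_le (measurable_wave hH.meas σ) fun t k => (norm_wave σ t k).le

theorem lintegral_decay_sq_lt_top {C : ℝ} (hC : 0 ≤ C) :
    ∫⁻ k : Space, ENNReal.ofReal (C * (1 + ‖k‖) ^ (-3 : ℝ)) ^ 2 < ∞ := by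
  have hi : Integrable fun k : Space => C ^ 2 * (1 + ‖k‖) ^ (-3 : ℝ) :=
    (integrable_one_add_norm (by simp; norm_num)).const_mul _
  refine lt_of_le_of_lt (lintegral_mono fun k => ?_) hi.lintegral_lt_top
  rw [← ENNReal.ofReal_pow (by positivity)]
  apply ENNReal.ofReal_le_ofReal
  have h2 : (1 + ‖k‖) ^ (-3 : ℝ) ≤ 1 :=
    Real.rpow_le_one_of_one_le_of_nonpos (by linarith [norm_nonneg k]) (by norm_num)
  have h3 : 0 ≤ (1 + ‖k‖) ^ (-3 : ℝ) := by positivity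
  calc _ = C ^ 2 * ((1 + ‖k‖) ^ (-3 : ℝ) * (1 + ‖k‖) ^ (-3 : ℝ)) := by ring
    _ ≤ _ := by gcongr; exact mul_le_of_le_one_left h3 h2

theorem lintegral_wave_mul_le (hH : Bdd s H) (hs : 0 ≤ s) (h0 : ∀ t k, R ≤ |t| → H t k = 0)
    (σ : ℤˣ) {P : ℝ → Space → ℂ} {C : ℝ} (hC : 0 ≤ C)
    (hP : ∀ t k, ‖P t k‖ ≤ C * (1 + ‖k‖) ^ (-3 : ℝ)) :
    ∃ D : ℝ≥0∞, D ≠ ∞ ∧ ∀ t, ∫⁻ k, ‖wave σ H t k * P t k‖ₑ ≤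
      (Set.Icc (-R) R).indicator (fun _ => D) t := by
  obtain ⟨B, hB, hb⟩ := hH.bound
  have h1 := lintegral_decay_sq_lt_top hC
  refine ⟨1 + B * ∫⁻ k : Space, ENNReal.ofReal (C * (1 + ‖k‖) ^ (-3 : ℝ)) ^ 2, by finiteness,
    fun t => ?_⟩
  by_cases ht : t ∈ Set.Icc (-R) R
  · rw [Set.indicator_of_mem ht]
    refine (enorm_le_one_add_sq _).trans ?_
    gcongr
    have m1 := hH.meas_slice t
    calc _ ≤ (∫⁻ k, ‖H t k‖ₑ * ENNReal.ofReal (C * (1 + ‖k‖) ^ (-3 : ℝ))) ^ 2 := by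
          gcongr with k
          rw [enorm_mul, ← ofReal_norm, norm_wave, ofReal_norm, ← ofReal_norm (P t k)]
          gcongr
          exact hP t k
      _ ≤ (∫⁻ k, ‖H t k‖ₑ ^ 2) * ∫⁻ k : Space, ENNReal.ofReal (C * (1 + ‖k‖) ^ (-3 : ℝ)) ^ 2 :=
          lintegral_mul_sq_le (by fun_prop) (by fun_prop)
      _ ≤ _ := by
          gcongr
          refine le_trans ?_ (hb t)
          unfold wn
          gcongr with k
          refine le_mul_of_one_le_left zero_le ?_
          rw [← wt_zero k]
          exact wt_mono hs k
  · have : R ≤ |t| := by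
      by_contra hlt
      exact ht (abs_le.mp (not_le.mp hlt).le)
    simp [wave, h0 t _ this]

theorem integrable_wave_mul (hH : Bdd s H) (hs : 0 ≤ s) (h0 : ∀ t k, R ≤ |t| → H t k = 0)
    (σ : ℤˣ) {P : ℝ → Space → ℂ} {C : ℝ} (hC : 0 ≤ C)
    (hP : ∀ t k, ‖P t k‖ ≤ C * (1 + ‖k‖) ^ (-3 : ℝ))
    (hm : Measurable fun p : ℝ × Space => P p.1 p.2) :
    Integrable (fun p : ℝ × Space => wave σ H p.1 p.2 * P p.1 p.2) (volume.prod volume) := by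
  obtain ⟨D, hD, h⟩ := lintegral_wave_mul_le hH hs h0 σ hC hP
  have mW := measurable_wave hH.meas σ
  have mP : Measurable fun p : ℝ × Space => wave σ H p.1 p.2 * P p.1 p.2 := mW.mul hm
  refine ⟨mP.aestronglyMeasurable, ?_⟩
  unfold HasFiniteIntegral
  rw [lintegral_prod _ mP.enorm.aemeasurable]
  refine lt_of_le_of_lt (lintegral_mono h) ?_
  rw [lintegral_indicator measurableSet_Icc, lintegral_const]
  have : (volume.restrict (Set.Icc (-R) R)) Set.univ < ∞ := by simp
  finiteness

theorem fourier_flip_wave (σ : ℤˣ) (hm : Measurable fun p : ℝ × Space => H p.1 p.2) {k : Space}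
    (hk : Integrable fun t => H t k) (θ : 𝓢(Spacetime, ℂ)) :
    ∫ τ, stFourier σ H (embed τ k) * θ (embed τ k) =
      ∫ t, wave σ H t k * timeFourier θ t k := by
  simp_rw [stFourier_embed, fourier_modulate]
  refine fourier_flip ?_ (integrable_time θ k)
  refine hk.norm.mono' ?_ (Filter.Eventually.of_forall fun t => (norm_wave σ t k).le)
  have h := (measurable_wave hm σ).comp (measurable_id.prodMk measurable_const :
    Measurable fun t : ℝ => (t, k))
  exact h.aestronglyMeasurable

/-- The Fourier transform in time is moved from the profile to the test function at each frequency.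
The compact support in time supplies the integrability for the exchange of the integrals. -/
theorem integral_stFourier_mul (hs : 0 ≤ s) (σ : ℤˣ) (hH : HT s H)
    (h0 : ∀ t k, R ≤ |t| → H t k = 0) (θ : 𝓢(Spacetime, ℂ)) :
    ∫ p, stFourier σ H p * θ p = ∫ t, ∫ k, wave σ H t k * timeFourier θ t k := by
  have hint : Integrable fun p => stFourier σ H p * θ p :=
    (memLp_stFourier hs σ hH h0).integrable_mul (θ.memLp 2)
  rw [integral_spacetime, integral_prod_symm _ (integrable_spacetime hint)]
  have e1 : ∀ᵐ k, ∫ τ, stFourier σ H (embed τ k) * θ (embed τ k) =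
      ∫ t, wave σ H t k * timeFourier θ t k := by
    filter_upwards [integrable_memLp_time hH h0] with k hk
    exact fourier_flip_wave σ hH.bdd.meas hk.1 θ
  rw [integral_congr_ae e1]
  obtain ⟨C, hC, hθ⟩ := norm_timeFourier_le θ
  have hi := integrable_wave_mul hH.bdd hs h0 σ hC hθ (continuous_timeFourier θ).measurable
  exact (integral_integral_swap hi).symm

end

/-- A function of time with a profile of regularity `3/4` in time is in `X^{s,3/4}`. -/
theorem memXOn_of_HT {σ : ℤˣ} {s : ℝ} (hs : 0 ≤ s) {I : Set ℝ} (hIm : MeasurableSet I)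
    (hI : Bornology.IsBounded I) {u : ℝ → 𝓢'(Space, ℂ)} {h : ℝ → Space → ℂ} (hh : HT s h)
    (hu : ∀ᵐ t, t ∈ I → ∀ η : 𝓢(Space, ℂ), u t η = ∫ k, wave σ h t k * 𝓕⁻ η k) :
    MemXOn σ s (3 / 4) I u := by
  obtain ⟨R, hR⟩ : ∃ R, ∀ t ∈ I, |t| ≤ R := by
    obtain ⟨R, hR⟩ := hI.exists_norm_le
    exact ⟨R, hR⟩
  set H : ℝ → Space → ℂ := fun t k => (cut R t : ℂ) * h t k with hHdef
  have hH : HT s H := hh.cut R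
  have h0 : ∀ t k, R + 1 ≤ |t| → H t k = 0 := fun t k ht => by simp [H, cut_eq_zero ht]
  have hL := memLp_stFourier hs σ hH h0
  set F := hL.toLp _ with hF
  refine ⟨𝓕⁻ (F : 𝓢'(Spacetime, ℂ)), ⟨stFourier σ H, memLp_weight_stFourier σ hH h0, fun ψ => ?_⟩,
    fun ψ hψ => ?_⟩
  · rw [FourierInvPair.fourier_fourierInv_eq, Lp.toTemperedDistribution_apply]
    refine integral_congr_ae ?_
    filter_upwards [hL.coeFn_toLp] with p hp
    rw [hp, smul_eq_mul, mul_comm]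
  · have e1 : (𝓕⁻ (F : 𝓢'(Spacetime, ℂ))) ψ = ∫ p, stFourier σ H p * 𝓕⁻ ψ p := by
      rw [TemperedDistribution.fourierInv_apply, Lp.toTemperedDistribution_apply]
      refine integral_congr_ae ?_
      filter_upwards [hL.coeFn_toLp] with p hp
      rw [hp, smul_eq_mul, mul_comm]
    rw [e1, integral_stFourier_mul hs σ hH h0, ← setIntegral_eq_integral_of_forall_compl_eq_zero (s := I)]
    · refine setIntegral_congr_ae hIm ?_
      filter_upwards [hu] with t ht htI
      rw [ht htI, timeFourier_fourierInv]
      congr 1; ext k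
      simp only [wave, H, cut_eq_one (hR t htI), Complex.ofReal_one, one_mul]
    · intro t ht
      -- Times outside I do not contribute, so the values of the extended wave there are irrelevant.
      have : slice t ψ = 0 := by
        ext x
        rw [slice_apply]
        by_contra hne
        exact ht (interior_subset (hψ.2 (subset_tsupport _ hne)))
      have h2 : 𝓕⁻ (slice t ψ) = 0 := by rw [this, FourierTransform.fourierInv_zero]
      rw [timeFourier_fourierInv, h2]
      simp

end

section


/-! ### Square-integrable functions and their Fourier transforms -/

section

variable {E : Type*} [NormedAddCommGroup E] [InnerProductSpace ℝ E] [FiniteDimensional ℝ E]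
  [MeasurableSpace E] [BorelSpace E]

theorem Lp.integral_fourierInv_mul (F : Lp ℂ 2 (volume : Measure E)) (η : 𝓢(E, ℂ)) :
    ∫ x, (𝓕⁻ F : Lp ℂ 2 (volume : Measure E)) x * η x = ∫ x, F x * 𝓕⁻ η x := by
  have h := congrArg (fun T : 𝓢'(E, ℂ) => T η) (Lp.fourierInv_toTemperedDistribution_eq F)
  simp only [TemperedDistribution.fourierInv_apply, Lp.toTemperedDistribution_apply,
    smul_eq_mul] at h
  simp_rw [mul_comm _ (η _), mul_comm _ (𝓕⁻ η _)]
  exact h.symm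

theorem Lp.integral_mul_eq_inner (A B : Lp ℂ 2 (volume : Measure E)) :
    ∫ x, A x * B x = inner ℂ (star A) B := by
  rw [L2.inner_def]
  refine integral_congr_ae ?_
  filter_upwards [Lp.coeFn_star A] with x hx
  rw [hx]
  simp [mul_comm]

/-- Both sides are continuous in B, so it is enough to take Schwartz functions, for which this is
the definition of the transform of a tempered distribution. -/
theorem Lp.integral_fourier_mul_fourier (A B : Lp ℂ 2 (volume : Measure E)) :
    ∫ x, (𝓕 A : Lp ℂ 2 (volume : Measure E)) x * B x =
      ∫ x, A x * (𝓕 B : Lp ℂ 2 (volume : Measure E)) x := by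
  simp_rw [Lp.integral_mul_eq_inner]
  refine DenseRange.induction_on (p := fun B : Lp ℂ 2 (volume : Measure E) =>
      inner ℂ (star (𝓕 A : Lp ℂ 2 (volume : Measure E))) B =
      inner ℂ (star A) (𝓕 B : Lp ℂ 2 (volume : Measure E)))
    (SchwartzMap.denseRange_toLpCLM (p := 2) ENNReal.ofNat_ne_top) B ?_ fun η => ?_
  · exact isClosed_eq (by fun_prop) ((continuous_const).inner
      (Lp.fourierTransformₗᵢ E ℂ).continuous)
  · rw [← Lp.integral_mul_eq_inner, ← Lp.integral_mul_eq_inner, SchwartzMap.toLpCLM_apply,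
      SchwartzMap.toLp_fourier_eq]
    have e1 := Lp.integral_fourier_mul A η
    rw [integral_congr_ae (g := fun x => (𝓕 A : Lp ℂ 2 (volume : Measure E)) x * η x)
      (by filter_upwards [SchwartzMap.coeFn_toLp η 2 volume] with x hx; rw [hx]), e1]
    refine integral_congr_ae ?_
    filter_upwards [SchwartzMap.coeFn_toLp (𝓕 η) 2 volume] with x hx
    rw [hx]

theorem integral_fourierInv_mul_schwartz {f : E → ℂ} (hf : Integrable f) (η : 𝓢(E, ℂ)) :
    ∫ x, 𝓕⁻ f x * η x = ∫ x, f x * 𝓕⁻ η x := by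
  have h1 : ∫ x, 𝓕⁻ f x * η x = ∫ x, 𝓕 (fun y => f (-y)) x * η x := by
    congr 1; ext x
    rw [Real.fourierInv_eq_fourier_comp_neg]
  rw [h1, integral_fourier_mul_schwartz hf.comp_neg, ← integral_neg_eq_self]
  congr 1; ext x
  rw [neg_neg, SchwartzMap.fourierInv_coe, SchwartzMap.fourier_coe, Real.fourierInv_eq_fourier_neg]

theorem continuous_fourierInv {f : E → ℂ} (hf : Integrable f) : Continuous (𝓕⁻ f) := by
  rw [Real.fourierInv_eq_fourier_comp_neg]
  exact continuous_fourier hf.comp_neg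

theorem Lp.fourierInv_ae_eq {w : E → ℂ} (hw : Integrable w) (hw2 : MemLp w 2) :
    (𝓕⁻ (hw2.toLp w) : Lp ℂ 2 (volume : Measure E)) =ᵐ[volume] 𝓕⁻ w := by
  refine ae_eq_of_integral_schwartz ((Lp.memLp _).locallyIntegrable (by norm_num))
    (continuous_fourierInv hw).locallyIntegrable fun η => ?_
  rw [Lp.integral_fourierInv_mul, integral_fourierInv_mul_schwartz hw]
  refine integral_congr_ae ?_
  filter_upwards [hw2.coeFn_toLp] with x hx
  rw [hx]

end

/-- `F` is the Fourier transform of the square-integrable function `f`. -/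
structure PF (f F : Space → ℂ) : Prop where
  left : MemLp f 2
  right : MemLp F 2
  meas : Measurable F
  eq : ∀ η : 𝓢(Space, ℂ), ∫ x, f x * η x = ∫ k, F k * 𝓕⁻ η k

/-- `F` is the Fourier transform of the function `f`, in the sense of tempered distributions. -/
structure WF (f F : Space → ℂ) : Prop where
  loc : LocallyIntegrable f
  left : ∀ η : 𝓢(Space, ℂ), Integrable fun x => f x * η x
  right : ∀ η : 𝓢(Space, ℂ), Integrable fun k => F k * η k
  eq : ∀ η : 𝓢(Space, ℂ), ∫ x, f x * η x = ∫ k, F k * 𝓕⁻ η k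

variable {f g F G : Space → ℂ}

theorem PF.wf (h : PF f F) : WF f F where
  loc := h.left.locallyIntegrable (by norm_num)
  left η := h.left.integrable_mul (η.memLp 2)
  right η := h.right.integrable_mul (η.memLp 2)
  eq := h.eq

theorem WF.add (h : WF f F) (h' : WF g G) : WF (fun x => f x + g x) fun k => F k + G k where
  loc := h.loc.add h'.loc
  left η := by simp_rw [add_mul]; exact (h.left η).add (h'.left η)
  right η := by simp_rw [add_mul]; exact (h.right η).add (h'.right η)
  eq η := by
    simp_rw [add_mul]
    rw [integral_add (h.left η) (h'.left η), integral_add (h.right _) (h'.right _), h.eq, h'.eq]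

theorem WF.const_mul (h : WF f F) (c : ℂ) : WF (fun x => c * f x) fun k => c * F k where
  loc := h.loc.smul c
  left η := by simp_rw [mul_assoc]; exact (h.left η).const_mul c
  right η := by simp_rw [mul_assoc]; exact (h.right η).const_mul c
  eq η := by
    simp_rw [mul_assoc]
    rw [integral_const_mul, integral_const_mul, h.eq]

theorem WF.sub (h : WF f F) (h' : WF g G) : WF (fun x => f x - g x) fun k => F k - G k := by
  have := h.add (h'.const_mul (-1))
  simpa [sub_eq_add_neg] using this

theorem WF.zero : WF (fun _ => 0) fun _ => 0 where
  loc := locallyIntegrable_zero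
  left η := by simp
  right η := by simp
  eq η := by simp

theorem WF.sum {ι : Type*} {f F : ι → Space → ℂ} (S : Finset ι) (h : ∀ i ∈ S, WF (f i) (F i)) :
    WF (fun x => ∑ i ∈ S, f i x) fun k => ∑ i ∈ S, F i k := by
  classical
  induction S using Finset.induction_on with
  | empty => simpa using WF.zero
  | insert i S hi ih =>
    simp_rw [Finset.sum_insert hi]
    exact (h i (Finset.mem_insert_self i S)).add
      (ih fun j hj => h j (Finset.mem_insert_of_mem hj))

theorem PF.const_mul (h : PF f F) (c : ℂ) : PF (fun x => c * f x) fun k => c * F k :=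
  ⟨h.left.const_mul c, h.right.const_mul c, h.meas.const_mul c, (h.wf.const_mul c).eq⟩

/-- A locally integrable function with a square-integrable transform tests like the L² inverse
transform, hence agrees with it almost everywhere. In this way products of L² functions are
recognised as L² functions. -/
theorem WF.toPF (h : WF f F) (hF : MemLp F 2) (hm : Measurable F) : PF f F := by
  have e : f =ᵐ[volume] (𝓕⁻ (hF.toLp F) : Lp ℂ 2 (volume : Measure Space)) := by
    refine ae_eq_of_integral_schwartz h.loc ((Lp.memLp _).locallyIntegrable (by norm_num))
      fun η => ?_
    rw [Lp.integral_fourierInv_mul, h.eq]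
    refine integral_congr_ae ?_
    filter_upwards [hF.coeFn_toLp] with x hx
    rw [hx]
  exact ⟨(memLp_congr_ae e).mpr (Lp.memLp _), hF, hm, h.eq⟩

/-- Parseval against w in L¹ ∩ L², more general than Schwartz functions: in `PF.mul` the role of w
is played by g times a Schwartz function. -/
theorem PF.integral_mul (h : PF f F) {w : Space → ℂ} (hw : Integrable w) (hw2 : MemLp w 2) :
    ∫ x, f x * w x = ∫ k, F k * 𝓕⁻ w k := by
  have e1 : (𝓕 (h.left.toLp f) : Lp ℂ 2 (volume : Measure Space)) =ᵐ[volume] F := by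
    refine ae_eq_of_integral_schwartz ((Lp.memLp _).locallyIntegrable (by norm_num))
      (h.right.locallyIntegrable (by norm_num)) fun η => ?_
    rw [Lp.integral_fourier_mul]
    have := h.eq (𝓕 η)
    rw [FourierPair.fourierInv_fourier_eq] at this
    rw [← this]
    refine integral_congr_ae ?_
    filter_upwards [h.left.coeFn_toLp] with x hx
    rw [hx]
  have e2 := Lp.fourierInv_ae_eq hw hw2
  have e3 := Lp.integral_fourier_mul_fourier (h.left.toLp f) (𝓕⁻ (hw2.toLp w))
  rw [FourierInvPair.fourier_fourierInv_eq] at e3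
  calc _ = ∫ x, h.left.toLp f x * hw2.toLp w x := by
        refine integral_congr_ae ?_
        filter_upwards [h.left.coeFn_toLp, hw2.coeFn_toLp] with x hx hx'
        rw [hx, hx']
    _ = _ := e3.symm
    _ = _ := by
        refine integral_congr_ae ?_
        filter_upwards [e1, e2] with x hx hx'
        rw [hx, hx']

/-- The convolution of two functions. -/
def conv (F G : Space → ℂ) (k : Space) : ℂ := ∫ l, F l * G (k - l)

/-- The Schwartz function `e^{2πi x·k} η`. -/
def modulate (k : Space) (η : 𝓢(Space, ℂ)) : 𝓢(Space, ℂ) :=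
  𝓕 (SchwartzMap.compSubConstCLM ℂ (-k) (𝓕⁻ η))

theorem modulate_apply (k : Space) (η : 𝓢(Space, ℂ)) (x : Space) :
    modulate k η x = Real.fourierChar (inner ℝ x k) • η x := by
  have e : η x = 𝓕 (𝓕⁻ η) x := by rw [FourierInvPair.fourier_fourierInv_eq]
  rw [e, modulate, SchwartzMap.fourier_coe, SchwartzMap.fourier_coe, Real.fourier_eq, Real.fourier_eq]
  have e2 : ∫ y, Real.fourierChar (-inner ℝ y x) • (𝓕⁻ η) y =
      ∫ y, Real.fourierChar (-inner ℝ (y + k) x) • (𝓕⁻ η) (y + k) :=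
    (integral_add_right_eq_self (fun y => Real.fourierChar (-inner ℝ y x) • (𝓕⁻ η) y) k).symm
  rw [e2, Circle.smul_def, ← integral_smul]
  congr 1; ext y
  rw [SchwartzMap.compSubConstCLM_apply, sub_neg_eq_add, ← Circle.smul_def, smul_smul,
    ← AddChar.map_add_eq_mul, inner_add_left, real_inner_comm x k]
  congr 2
  ring

theorem fourierInv_modulate (k l : Space) (η : 𝓢(Space, ℂ)) :
    𝓕⁻ (modulate k η) l = 𝓕⁻ η (l + k) := by
  rw [modulate, FourierPair.fourierInv_fourier_eq, SchwartzMap.compSubConstCLM_apply, sub_neg_eq_add]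

/-- Evaluating at the frequency k amounts to testing g against η modulated by k. -/
theorem PF.fourierInv_mul (h : PF g G) (η : 𝓢(Space, ℂ)) (k : Space) :
    𝓕⁻ (fun x => g x * η x) k = ∫ l, G l * 𝓕⁻ η (l + k) := by
  have := h.eq (modulate k η)
  simp_rw [fourierInv_modulate] at this
  rw [← this, Real.fourierInv_eq]
  congr 1; ext x
  rw [modulate_apply, mul_smul_comm]

theorem integrable_conv_schwartz (hF : MemLp F 2) (hG : MemLp G 2) (mF : Measurable F)
    (mG : Measurable G) (η : 𝓢(Space, ℂ)) :
    Integrable (fun p : Space × Space => F p.2 * G (p.1 - p.2) * η p.1) (volume.prod volume) := by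
  have mη := η.continuous.measurable
  have m1 : Measurable fun p : Space × Space => F p.2 * G (p.1 - p.2) * η p.1 := by fun_prop
  refine ⟨m1.aestronglyMeasurable, ?_⟩
  have key : ∀ H : Space → ℂ, MemLp H 2 → ∫⁻ x, ‖H x‖ₑ ^ 2 < ∞ := by
    intro H hH
    have := lintegral_rpow_enorm_lt_top_of_eLpNorm_lt_top (by simp) (by simp) hH.2
    simpa using this
  have hF2 := key F hF
  have hG2 := key G hG
  unfold HasFiniteIntegral
  rw [lintegral_prod _ m1.enorm.aemeasurable]
  calc _ ≤ ∫⁻ k, (1 + (∫⁻ x, ‖F x‖ₑ ^ 2) * ∫⁻ x, ‖G x‖ₑ ^ 2) * ‖η k‖ₑ := by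
        refine lintegral_mono fun k => ?_
        simp_rw [enorm_mul]
        rw [lintegral_mul_const _ (by fun_prop)]
        gcongr
        refine (enorm_le_one_add_sq _).trans ?_
        gcongr
        refine (lintegral_mul_sq_le (by fun_prop) (by fun_prop)).trans ?_
        rw [lintegral_sub_left_eq_self (fun x => ‖G x‖ₑ ^ 2) k]
    _ < ∞ := by
        have : ∫⁻ k, ‖η k‖ₑ < ∞ := η.integrable.2
        rw [lintegral_const_mul _ (by fun_prop)]
        finiteness

theorem PF.memLp_mul (h : PF f F) (η : 𝓢(Space, ℂ)) : MemLp (fun x => f x * η x) 2 := by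
  have := (η.memLp ⊤ (volume : Measure Space)).mul h.left (r := 2)
  exact this

theorem PF.mul (h : PF f F) (h' : PF g G) : WF (fun x => f x * g x) (conv F G) where
  loc := (h.left.integrable_mul h'.left).locallyIntegrable
  left η := by
    simp_rw [mul_assoc]
    exact h.left.integrable_mul (h'.memLp_mul η)
  right η := by
    have := (integrable_conv_schwartz h.right h'.right h.meas h'.meas η).integral_prod_left
    simp_rw [integral_mul_const] at this
    exact this
  eq η := by
    have w1 : Integrable fun x => g x * η x := h'.left.integrable_mul (η.memLp 2)
    have w2 := h'.memLp_mul η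
    have e := h.integral_mul w1 w2
    simp_rw [← mul_assoc] at e
    rw [e]
    simp_rw [h'.fourierInv_mul, conv, ← integral_mul_const, ← integral_const_mul]
    have e2 : ∀ k, ∫ l, F k * (G l * 𝓕⁻ η (l + k)) = ∫ l, F k * G (l - k) * 𝓕⁻ η l := by
      intro k
      rw [← integral_sub_right_eq_self _ k]
      simp [mul_assoc]
    simp_rw [e2]
    exact integral_integral_swap
      (integrable_conv_schwartz h.right h'.right h.meas h'.meas (𝓕⁻ η)).swap

/-- The complex conjugate of a Schwartz function. -/
def conjS (η : 𝓢(Space, ℂ)) : 𝓢(Space, ℂ) :=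
  SchwartzMap.postcompCLM (Complex.conjCLE : ℂ →L[ℝ] ℂ) η

theorem conjS_apply (η : 𝓢(Space, ℂ)) (x : Space) : conjS η x = (starRingEnd ℂ) (η x) := rfl

theorem fourierInv_conjS (η : 𝓢(Space, ℂ)) (k : Space) :
    𝓕⁻ (conjS η) k = (starRingEnd ℂ) (𝓕⁻ η (-k)) := by
  rw [SchwartzMap.fourierInv_coe, SchwartzMap.fourierInv_coe, Real.fourierInv_eq, Real.fourierInv_eq,
    ← integral_conj]
  congr 1; ext x
  rw [conjS_apply, Circle.smul_def, Circle.smul_def, smul_eq_mul, smul_eq_mul, map_mul,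
    inner_neg_right, AddChar.map_neg_eq_inv, Circle.coe_inv_eq_conj, Complex.conj_conj]

theorem PF.conj (h : PF f F) :
    PF (fun x => (starRingEnd ℂ) (f x)) fun k => (starRingEnd ℂ) (F (-k)) where
  left := h.left.star
  right := (h.right.comp_measurePreserving (Measure.measurePreserving_neg volume)).star
  meas := Complex.continuous_conj.measurable.comp (h.meas.comp measurable_neg)
  eq η := by
    have := congrArg (starRingEnd ℂ) (h.eq (conjS η))
    rw [← integral_conj, ← integral_conj] at this
    simp only [map_mul, conjS_apply, Complex.conj_conj, fourierInv_conjS] at this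
    rw [this, ← integral_neg_eq_self]
    simp

/-! ### Tempered distributions given by functions of the frequency -/

/-- `F` represents the Fourier transform of the distribution `T`. -/
def RepT (T : 𝓢'(Space, ℂ)) (F : Space → ℂ) : Prop :=
  ∀ η : 𝓢(Space, ℂ), T η = ∫ k, F k * 𝓕⁻ η k

theorem RepT.toFn {T : 𝓢'(Space, ℂ)} (h : RepT T F) (hF : MemLp F 2) (hm : Measurable F) :
    PF (toFn T) F := by
  have hex : ∃ f : Lp ℂ 2 (volume : Measure Space), (f : 𝓢'(Space, ℂ)) = T := by
    refine ⟨𝓕⁻ (hF.toLp F), ?_⟩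
    ext η
    rw [← Lp.fourierInv_toTemperedDistribution_eq, TemperedDistribution.fourierInv_apply,
      Lp.toTemperedDistribution_apply, h η]
    refine integral_congr_ae ?_
    filter_upwards [hF.coeFn_toLp] with x hx
    rw [hx, smul_eq_mul, mul_comm]
  have e : CSH.toFn T = hex.choose := by rw [CSH.toFn, dif_pos hex]
  have hs := hex.choose_spec
  refine ⟨by rw [e]; exact Lp.memLp _, hF, hm, fun η => ?_⟩
  rw [← h η, e]
  conv_rhs => rw [← hs]
  rw [Lp.toTemperedDistribution_apply]
  congr 1; ext x
  rw [smul_eq_mul, mul_comm]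

theorem RepT.add {T S : 𝓢'(Space, ℂ)} (h : RepT T F) (h' : RepT S G) (hF : MemLp F 2)
    (hG : MemLp G 2) : RepT (T + S) fun k => F k + G k := by
  intro η
  have i1 : Integrable fun k => F k * 𝓕⁻ η k := hF.integrable_mul ((𝓕⁻ η).memLp 2)
  have i2 : Integrable fun k => G k * 𝓕⁻ η k := hG.integrable_mul ((𝓕⁻ η).memLp 2)
  simp_rw [add_mul]
  rw [integral_add i1 i2, ← h η, ← h' η]
  rfl

theorem RepT.smul {T : 𝓢'(Space, ℂ)} (h : RepT T F) (c : ℂ) : RepT (c • T) fun k => c * F k := by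
  intro η
  simp_rw [mul_assoc]
  rw [integral_const_mul, ← h η]
  rfl

theorem RepT.sub {T S : 𝓢'(Space, ℂ)} (h : RepT T F) (h' : RepT S G) (hF : MemLp F 2)
    (hG : MemLp G 2) : RepT (T - S) fun k => F k - G k := by
  intro η
  have i1 : Integrable fun k => F k * 𝓕⁻ η k := hF.integrable_mul ((𝓕⁻ η).memLp 2)
  have i2 : Integrable fun k => G k * 𝓕⁻ η k := hG.integrable_mul ((𝓕⁻ η).memLp 2)
  simp_rw [sub_mul]
  rw [integral_sub i1 i2, ← h η, ← h' η]
  rfl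

theorem japSymbol_eq (s : ℝ) (k : Space) : japSymbol s k = ((jb k ^ s : ℝ) : ℂ) := by
  rw [japSymbol, jb_rpow]

theorem RepT.jap {T : 𝓢'(Space, ℂ)} (h : RepT T F) (s : ℝ) :
    RepT (CSH.jap s T) fun k => ((jb k ^ s : ℝ) : ℂ) * F k := by
  intro η
  rw [CSH.jap, TemperedDistribution.fourierMultiplierCLM_apply_apply, h,
    FourierPair.fourierInv_fourier_eq]
  congr 1; ext k
  rw [SchwartzMap.smulLeftCLM_apply_apply (japSymbol_hasTemperateGrowth s), japSymbol_eq, smul_eq_mul]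
  ring

theorem RepT.lineDeriv {T : 𝓢'(Space, ℂ)} (h : RepT T F) (j : Fin 2) :
    RepT (∂_{eSp j} T) fun k => (Complex.I * fq k j) * F k := by
  intro η
  have ht : (fun k : Space => inner ℝ k (eSp j)).HasTemperateGrowth := by fun_prop
  rw [TemperedDistribution.lineDerivOp_apply_apply, h, FourierTransform.fourierInv_neg,
    SchwartzMap.fourierInv_lineDerivOp_eq]
  congr 1; ext k
  rw [neg_apply, smul_apply, SchwartzMap.smulLeftCLM_apply_apply ht]
  have : inner ℝ k (eSp j) = k j := by rw [eSp, EuclideanSpace.inner_single_right]; simp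
  rw [this]
  simp [fq]
  ring

theorem fourierInv_japS (s : ℝ) (η : 𝓢(Space, ℂ)) (k : Space) :
    𝓕⁻ (japS s η) k = ((jb k ^ s : ℝ) : ℂ) * 𝓕⁻ η k := by
  have hneg : ∀ (θ : 𝓢(Space, ℂ)), 𝓕⁻ θ k = 𝓕 θ (-k) := by
    intro θ
    rw [SchwartzMap.fourierInv_coe, SchwartzMap.fourier_coe, Real.fourierInv_eq_fourier_neg]
  rw [hneg, japS, SchwartzMap.fourierMultiplierCLM_apply, FourierInvPair.fourier_fourierInv_eq,
    SchwartzMap.smulLeftCLM_apply_apply (japSymbol_hasTemperateGrowth s), japSymbol_eq, jb_neg, hneg,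
    smul_eq_mul]

end

section


/-! ### Jointly measurable representatives -/

/-- A sequence of bump functions that shrinks to the origin. -/
def shrinkBump (n : ℕ) : ContDiffBump (0 : Space) :=
  ⟨1 / (n + 1), 2 / (n + 1), by positivity, by gcongr; norm_num⟩

theorem shrinkBump_rOut (n : ℕ) : (shrinkBump n).rOut = 2 / ((n : ℝ) + 1) := rfl

theorem shrinkBump_rIn (n : ℕ) : (shrinkBump n).rIn = 1 / ((n : ℝ) + 1) := rfl

theorem memLp_bump (n : ℕ) (k : Space) :
    MemLp (fun l => ((shrinkBump n).normed volume (k - l) : ℂ)) 2 volume := by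
  have hc : Continuous fun l => ((shrinkBump n).normed volume (k - l) : ℂ) :=
    Complex.continuous_ofReal.comp ((shrinkBump n).continuous_normed.comp (by fun_prop))
  have hs : HasCompactSupport fun l => (shrinkBump n).normed volume (k - l) :=
    (shrinkBump n).hasCompactSupport_normed.comp_homeomorph (Homeomorph.subLeft k)
  exact hc.memLp_of_hasCompactSupport (hs.comp_left Complex.ofReal_zero)

theorem convolution_bump_eq_inner (n : ℕ) (k : Space) (w : Lp ℂ 2 (volume : Measure Space)) :
    (convolution ((shrinkBump n).normed volume) w (ContinuousLinearMap.lsmul ℝ ℝ) volume) k =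
      inner ℂ (star ((memLp_bump n k).toLp _)) w := by
  rw [← Lp.integral_mul_eq_inner, convolution_def, ← integral_sub_left_eq_self _ _ k]
  refine integral_congr_ae ?_
  filter_upwards [(memLp_bump n k).coeFn_toLp] with l hl
  rw [hl]
  simp

/-- An L²-valued curve has no canonical values at points. Its mollifications are continuous in the
frequency and measurable in time, hence jointly measurable, and converge almost everywhere to the
given class at each time; their limit is the representative. -/
theorem exists_measurable_rep {I : Set ℝ} (hI : MeasurableSet I)
    {γ : ℝ → Lp ℂ 2 (volume : Measure Space)} (hγ : ContinuousOn γ I) :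
    ∃ U : ℝ → Space → ℂ, (Measurable fun p : ℝ × Space => U p.1 p.2) ∧
      (∀ t ∈ I, U t =ᵐ[volume] γ t) ∧ ∀ t ∉ I, ∀ k, U t k = 0 := by
  classical
  set V : ℕ → Space → ℝ → ℂ := fun n k t => I.piecewise (fun t =>
    inner ℂ (star ((memLp_bump n k).toLp _)) (γ t)) (fun _ => 0) t with hV
  have mV : ∀ n, Measurable fun p : Space × ℝ => V n p.1 p.2 := by
    intro n
    -- A function that is continuous in one variable and measurable in the other is jointly
    -- measurable.
    refine measurable_uncurry_of_continuous_of_measurable (u := V n) (fun t => ?_) fun k => ?_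
    · by_cases ht : t ∈ I
      · have : (fun k => V n k t) = convolution ((shrinkBump n).normed volume) (γ t)
            (ContinuousLinearMap.lsmul ℝ ℝ) volume := by
          ext k
          rw [convolution_bump_eq_inner]
          simp [V, ht]
        rw [this]
        exact (shrinkBump n).hasCompactSupport_normed.continuous_convolution_left _
          (shrinkBump n).continuous_normed ((Lp.memLp (γ t)).locallyIntegrable (by norm_num))
      · have : (fun k => V n k t) = fun _ => 0 := by ext k; simp [V, ht]
        rw [this]; exact continuous_const
    · exact ContinuousOn.measurable_piecewise (continuousOn_const.inner hγ) continuousOn_const hI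
  have mV' : ∀ n, Measurable fun p : ℝ × Space => V n p.2 p.1 := fun n => (mV n).comp measurable_swap
  refine ⟨fun t k => Filter.limUnder Filter.atTop fun n => V n k t, ?_, fun t ht => ?_, fun t ht k => ?_⟩
  · exact (StronglyMeasurable.limUnder (l := Filter.atTop)
      (f := fun n (p : ℝ × Space) => V n p.2 p.1) fun n => (mV' n).stronglyMeasurable).measurable
  · have h1 : Filter.Tendsto (fun n => (shrinkBump n).rOut) Filter.atTop (nhds 0) := by
      simp_rw [shrinkBump_rOut]
      have := (tendsto_one_div_add_atTop_nhds_zero_nat (𝕜 := ℝ)).const_mul 2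
      simpa [div_eq_mul_inv] using this
    have h2 : ∀ᶠ n in Filter.atTop, (shrinkBump n).rOut ≤ 2 * (shrinkBump n).rIn :=
      Filter.Eventually.of_forall fun n => by
        rw [shrinkBump_rOut, shrinkBump_rIn]
        apply le_of_eq; ring
    filter_upwards [ContDiffBump.ae_convolution_tendsto_right_of_locallyIntegrable (μ := volume) h1 h2
      ((Lp.memLp (γ t)).locallyIntegrable (by norm_num))] with k hk
    refine Filter.Tendsto.limUnder_eq (hk.congr fun n => ?_)
    rw [convolution_bump_eq_inner]
    simp [V, ht]
  · have : (fun n => V n k t) = fun _ => 0 := by ext n; simp [V, ht]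
    simp only [this]
    exact tendsto_const_nhds.limUnder_eq

theorem repT_Lp (f : Lp ℂ 2 (volume : Measure Space)) :
    RepT (f : 𝓢'(Space, ℂ)) (𝓕 f : Lp ℂ 2 (volume : Measure Space)) := by
  intro η
  rw [Lp.integral_fourier_mul, FourierInvPair.fourier_fourierInv_eq, Lp.toTemperedDistribution_apply]
  congr 1; ext x
  rw [smul_eq_mul, mul_comm]

theorem jap_neg_jap (s : ℝ) (T : 𝓢'(Space, ℂ)) : jap (-s) (jap s T) = T := by
  rw [jap, jap, TemperedDistribution.fourierMultiplierCLM_fourierMultiplierCLM_apply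
    (japSymbol_hasTemperateGrowth s) (japSymbol_hasTemperateGrowth (-s))]
  have : japSymbol s * japSymbol (-s) = fun _ => 1 := by
    ext k
    rw [Pi.mul_apply, japSymbol_eq, japSymbol_eq, ← Complex.ofReal_mul, ← Real.rpow_add (jb_pos k)]
    simp
  rw [this]
  simp

theorem RepT.congr {T : 𝓢'(Space, ℂ)} {F G : Space → ℂ} (h : RepT T F) (e : F =ᵐ[volume] G) :
    RepT T G := by
  intro η
  rw [h η]
  refine integral_congr_ae ?_
  filter_upwards [e] with k hk
  rw [hk]

theorem memLp_iff_lintegral {F : Space → ℂ} (hm : Measurable F) :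
    MemLp F 2 ↔ ∫⁻ k, ‖F k‖ₑ ^ 2 < ∞ := by
  rw [MemLp, and_iff_right hm.aestronglyMeasurable,
    eLpNorm_lt_top_iff_lintegral_rpow_enorm_lt_top (by simp) (by simp)]
  simp

theorem lintegral_Lp_sq (G : Lp ℂ 2 (volume : Measure Space)) : ∫⁻ x, ‖G x‖ₑ ^ 2 = ‖G‖ₑ ^ 2 := by
  rw [Lp.enorm_def, eLpNorm_eq_lintegral_rpow_enorm_toReal (by simp) (by simp),
    ← ENNReal.rpow_natCast, ← ENNReal.rpow_mul]
  simp

/-- A function with values in `H^s` on the side of the frequencies. -/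
theorem MemCH.exists_rep {s : ℝ} {I : Set ℝ} (hI : MeasurableSet I) {u : ℝ → 𝓢'(Space, ℂ)}
    (hu : MemCH s I u) : ∃ U : ℝ → Space → ℂ, Bdd s U ∧ (∀ t ∈ I, RepT (u t) (U t)) ∧
      (∀ t ∉ I, ∀ k, U t k = 0) ∧
      ∀ η : 𝓢(Space, ℂ), ContinuousOn (fun t => ∫ k, U t k * 𝓕⁻ η k) I := by
  obtain ⟨g, hg, ⟨C, hC⟩, hgu⟩ := hu
  have hγ : ContinuousOn (fun t => (𝓕 (g t) : Lp ℂ 2 (volume : Measure Space))) I :=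
    (Lp.fourierTransformₗᵢ Space ℂ).continuous.comp_continuousOn hg
  obtain ⟨U, mU, hU, hU0⟩ := exists_measurable_rep hI hγ
  have b0 : Bdd 0 U := by
    refine ⟨mU, ENNReal.ofReal C ^ 2, by finiteness, fun t => ?_⟩
    unfold wn
    simp_rw [wt_zero, one_mul]
    by_cases ht : t ∈ I
    · rw [lintegral_congr_ae (g := fun k => ‖(𝓕 (g t) : Lp ℂ 2 (volume : Measure Space)) k‖ₑ ^ 2)
        (by filter_upwards [hU t ht] with k hk; rw [hk]), lintegral_Lp_sq, ← ofReal_norm,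
        Lp.norm_fourier_eq]
      gcongr
      exact hC t ht
    · simp [hU0 t ht]
  refine ⟨fun t k => ((jb k ^ (-s) : ℝ) : ℂ) * U t k, ?_, fun t ht => ?_, fun t ht k => by
    simp only [hU0 t ht, mul_zero], fun η => ?_⟩
  · have := b0.mul_symbol (r := -s) (C := 1) (m := fun _ k => ((jb k ^ (-s) : ℝ) : ℂ))
      (by have := measurable_jb; fun_prop) fun t k => by
        rw [Complex.norm_real, Real.norm_eq_abs, abs_of_pos (Real.rpow_pos_of_pos (jb_pos k) _),
          one_mul]
    simpa using this
  · have h1 := ((repT_Lp (g t)).congr (hU t ht).symm).jap (-s)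
    rwa [← hgu t ht, jap_neg_jap] at h1
  · set w : Lp ℂ 2 (volume : Measure Space) := ((𝓕⁻ (japS (-s) η)).memLp 2 volume).toLp _ with hw
    have hc : ContinuousOn (fun t => inner ℂ (star w) (𝓕 (g t) : Lp ℂ 2 (volume : Measure Space))) I :=
      continuousOn_const.inner hγ
    refine hc.congr fun t ht => ?_
    simp only
    rw [← Lp.integral_mul_eq_inner]
    refine integral_congr_ae ?_
    filter_upwards [hU t ht, ((𝓕⁻ (japS (-s) η)).memLp 2 volume).coeFn_toLp] with k h1 h2
    rw [h1, hw, h2, fourierInv_japS]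
    ring

end

section


/-! ### Compactly supported test functions determine a distribution -/

theorem jb_le_norm (y : Space) : jb y ≤ 8 * (1 + ‖y‖) := by
  unfold jb
  rw [Real.sqrt_le_left (by positivity), norm_smul]
  have hpi := Real.pi_le_four
  have hpi0 := Real.pi_pos
  rw [Real.norm_eq_abs, abs_of_pos (by positivity)]
  have h1 : 2 * Real.pi * ‖y‖ ≤ 8 * ‖y‖ := by gcongr; linarith
  have h2 : 0 ≤ 2 * Real.pi * ‖y‖ := by positivity
  nlinarith [norm_nonneg y]

theorem schwartz_decay (θ : 𝓢(Space, ℂ)) (M : ℝ) : ∃ C : ℝ, 0 ≤ C ∧ ∀ y, ‖θ y‖ ≤ C * jb y ^ (-M) := by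
  obtain ⟨n, hn⟩ := exists_nat_ge M
  set D := 2 ^ n * ((Finset.Iic (n, 0)).sup fun m => SchwartzMap.seminorm ℂ m.1 m.2) θ with hD
  have hC : ∀ x, (1 + ‖x‖) ^ n * ‖θ x‖ ≤ D := by
    intro x
    have := SchwartzMap.one_add_le_sup_seminorm_apply (𝕜 := ℂ) (m := (n, 0)) (k := n) (n := 0) le_rfl
      le_rfl θ x
    rwa [norm_iteratedFDeriv_zero] at this
  have hD0 : 0 ≤ D := le_trans (by positivity) (hC 0)
  refine ⟨8 ^ n * D, by positivity, fun y => ?_⟩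
  have hy := jb_pos y
  have h1 : jb y ^ M ≤ 8 ^ n * (1 + ‖y‖) ^ n := by
    calc _ ≤ jb y ^ (n : ℝ) := Real.rpow_le_rpow_of_exponent_le (one_le_jb y) hn
      _ = jb y ^ n := Real.rpow_natCast _ _
      _ ≤ (8 * (1 + ‖y‖)) ^ n := by gcongr; exact jb_le_norm y
      _ = _ := mul_pow _ _ _
  rw [Real.rpow_neg hy.le, ← div_eq_mul_inv, le_div_iff₀ (by positivity)]
  calc _ ≤ ‖θ y‖ * (8 ^ n * (1 + ‖y‖) ^ n) := by gcongr
    _ = 8 ^ n * ((1 + ‖y‖) ^ n * ‖θ y‖) := by ring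
    _ ≤ _ := by gcongr; exact hC y

theorem wn_lt_top_of_decay {r M C : ℝ} (hM : r + 1 < M) {θ : Space → ℂ} (hC : 0 ≤ C)
    (h : ∀ y, ‖θ y‖ ≤ C * jb y ^ (-M)) : wn r (fun k => ‖θ k‖ₑ) < ∞ := by
  have h1 := lintegral_wt_sq_lt_top (p := M - r) (by linarith)
  calc _ ≤ ∫⁻ k, ENNReal.ofReal C ^ 2 * wt (-(M - r)) k ^ 2 := by
        refine lintegral_mono fun k => ?_
        rw [← mul_pow]
        refine pow_le_pow_left' ?_ 2
        have : -(M - r) = r + -M := by ring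
        rw [this, wt_add, mul_left_comm]
        gcongr
        show ‖θ k‖ₑ ≤ _
        rw [wt, ← ENNReal.ofReal_mul hC, ← ofReal_norm]
        exact ENNReal.ofReal_le_ofReal (h k)
    _ < ∞ := by
        rw [lintegral_const_mul' _ _ (by finiteness)]
        finiteness

theorem wn_schwartz_lt_top (θ : 𝓢(Space, ℂ)) (r : ℝ) : wn r (fun k => ‖θ k‖ₑ) < ∞ := by
  obtain ⟨C, hC, h⟩ := schwartz_decay θ (r + 2)
  exact wn_lt_top_of_decay (by linarith) hC h

theorem lintegral_pair_sq_le {r : ℝ} {F G : Space → ℝ≥0∞} (hF : Measurable F) (hG : Measurable G) :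
    (∫⁻ k, F k * G k) ^ 2 ≤ wn r F * wn (-r) G := by
  have h1 := measurable_wt r
  have h2 := measurable_wt (-r)
  refine le_trans (le_of_eq ?_) (lintegral_mul_sq_le (f := fun k => wt r k * F k)
    (g := fun k => wt (-r) k * G k) (by fun_prop) (by fun_prop))
  congr 2; ext k
  calc F k * G k = (wt r k * wt (-r) k) * (F k * G k) := by rw [wt_mul_neg, one_mul]
    _ = _ := by ring

theorem lintegral_pair_le {r : ℝ} {F G : Space → ℝ≥0∞} (hF : Measurable F) (hG : Measurable G) :
    ∫⁻ k, F k * G k ≤ 1 + wn r F * wn (-r) G :=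
  (CSH.enorm_le_one_add_sq _).trans (by gcongr; exact lintegral_pair_sq_le hF hG)

theorem integrable_mul_schwartz {r : ℝ} {W : Space → ℂ} (hW : Measurable W)
    (hr : wn r (fun k => ‖W k‖ₑ) < ∞) {θ : Space → ℂ} (mθ : Measurable θ)
    (hθ : wn (-r) (fun k => ‖θ k‖ₑ) < ∞) :
    Integrable fun k => W k * θ k := by
  refine ⟨(hW.mul mθ).aestronglyMeasurable, ?_⟩
  unfold HasFiniteIntegral
  simp_rw [enorm_mul]
  have h1 := lintegral_pair_le (r := r) (F := fun k => ‖W k‖ₑ) (G := fun k => ‖θ k‖ₑ) hW.enorm mθ.enorm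
  have h2 : 1 + wn r (fun k => ‖W k‖ₑ) * wn (-r) (fun k => ‖θ k‖ₑ) < ∞ := by finiteness
  exact lt_of_le_of_lt h1 h2

/-- A smooth cut-off function on space, as a Schwartz function. -/
def spaceBump : ContDiffBump (0 : Space) := ⟨1, 2, one_pos, one_lt_two⟩

/-- The function `ζ(x/n) η(x)`, for a cut-off function `ζ`. -/
def cutSchwartz (n : ℕ) (η : 𝓢(Space, ℂ)) : 𝓢(Space, ℂ) :=
  HasCompactSupport.toSchwartzMap (f := fun x => (spaceBump ((1 / ((n : ℝ) + 1)) • x) : ℂ) * η x)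
    (by
      have h1 : HasCompactSupport fun x : Space => spaceBump ((1 / ((n : ℝ) + 1)) • x) :=
        spaceBump.hasCompactSupport.comp_smul (by positivity)
      exact (h1.comp_left (g := ((↑) : ℝ → ℂ)) Complex.ofReal_zero).mul_right)
    (by
      have h1 : ContDiff ℝ (⊤ : ℕ∞) fun x : Space => spaceBump ((1 / ((n : ℝ) + 1)) • x) :=
        spaceBump.contDiff.comp (by fun_prop)
      exact (Complex.ofRealCLM.contDiff.comp h1).mul (η.smooth _))

theorem cutSchwartz_apply (n : ℕ) (η : 𝓢(Space, ℂ)) (x : Space) :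
    cutSchwartz n η x = (spaceBump ((1 / ((n : ℝ) + 1)) • x) : ℂ) * η x := rfl

theorem hasCompactSupport_cutSchwartz (n : ℕ) (η : 𝓢(Space, ℂ)) :
    HasCompactSupport (cutSchwartz n η) := by
  have h1 : HasCompactSupport fun x : Space => spaceBump ((1 / ((n : ℝ) + 1)) • x) :=
    spaceBump.hasCompactSupport.comp_smul (by positivity)
  exact (h1.comp_left (g := ((↑) : ℝ → ℂ)) Complex.ofReal_zero).mul_right

/-- The Fourier transform of the cut-off function. -/
def bumpFreq : 𝓢(Space, ℂ) :=
  𝓕⁻ (HasCompactSupport.toSchwartzMap (f := fun x => (spaceBump x : ℂ))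
    (spaceBump.hasCompactSupport.comp_left (g := ((↑) : ℝ → ℂ)) Complex.ofReal_zero)
    (Complex.ofRealCLM.contDiff.comp spaceBump.contDiff))

theorem fourier_bumpFreq (x : Space) : 𝓕 bumpFreq x = (spaceBump x : ℂ) := by
  rw [bumpFreq, FourierInvPair.fourier_fourierInv_eq]
  rfl

theorem integral_bumpFreq : ∫ l, bumpFreq l = 1 := by
  have h := fourier_bumpFreq 0
  rw [SchwartzMap.fourier_coe, Real.fourier_eq] at h
  have h1 : spaceBump 0 = 1 := spaceBump.one_of_mem_closedBall (by simp [spaceBump])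
  simpa [h1] using h

/-- Multiplication by ζ(x/(n+1)) averages the translates of 𝓕⁻η by l/(n+1) against the transform of
ζ, which has total integral ζ(0) = 1. Hence the convergence to 𝓕⁻η. -/
theorem fourierInv_cutSchwartz (n : ℕ) (η : 𝓢(Space, ℂ)) (k : Space) :
    𝓕⁻ (cutSchwartz n η) k = ∫ l, bumpFreq l * 𝓕⁻ η (k - (1 / ((n : ℝ) + 1)) • l) := by
  have hi : Integrable (Function.uncurry fun x l : Space =>
      Real.fourierChar (inner ℝ x (k - (1 / ((n : ℝ) + 1)) • l)) • (bumpFreq l * η x))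
      (volume.prod volume) := by
    have h1 := η.integrable.mul_prod bumpFreq.integrable (μ := volume) (ν := volume)
    refine h1.norm.mono' ?_ (Filter.Eventually.of_forall fun p => ?_)
    · have c1 := Real.continuous_fourierChar
      have c2 := η.continuous
      have c3 := bumpFreq.continuous
      apply Continuous.aestronglyMeasurable
      unfold Function.uncurry
      exact (c1.comp (by fun_prop)).smul (by fun_prop)
    · simp only [Function.uncurry, Circle.norm_smul, norm_mul]
      rw [mul_comm]
  calc _ = ∫ x, ∫ l, Real.fourierChar (inner ℝ x (k - (1 / ((n : ℝ) + 1)) • l)) •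
        (bumpFreq l * η x) := by
        rw [SchwartzMap.fourierInv_coe, Real.fourierInv_eq]
        congr 1; ext x
        rw [cutSchwartz_apply, ← fourier_bumpFreq, SchwartzMap.fourier_coe, Real.fourier_eq,
          ← integral_mul_const, Circle.smul_def, ← integral_smul]
        congr 1; ext l
        rw [← Circle.smul_def, smul_mul_assoc, smul_smul, ← AddChar.map_add_eq_mul, inner_sub_right,
          inner_smul_right, inner_smul_right, real_inner_comm x l, sub_eq_add_neg]
    _ = ∫ l, ∫ x, Real.fourierChar (inner ℝ x (k - (1 / ((n : ℝ) + 1)) • l)) •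
        (bumpFreq l * η x) := integral_integral_swap hi
    _ = _ := by
        congr 1; ext l
        rw [SchwartzMap.fourierInv_coe, Real.fourierInv_eq, ← integral_const_mul]
        congr 1; ext x
        rw [mul_smul_comm]

theorem jb_rpow_le {M : ℝ} (hM : 0 ≤ M) (n : ℕ) (k l : Space) :
    jb k ^ M ≤ 2 ^ M * (jb (k - (1 / ((n : ℝ) + 1)) • l) ^ M * jb l ^ M) := by
  set y := k - (1 / ((n : ℝ) + 1)) • l with hy
  have h1 : jb ((1 / ((n : ℝ) + 1)) • l) ≤ jb l := by
    unfold jb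
    apply Real.sqrt_le_sqrt
    rw [smul_comm, norm_smul (1 / ((n : ℝ) + 1))]
    have h2 : ‖1 / ((n : ℝ) + 1)‖ ≤ 1 := by
      rw [Real.norm_eq_abs, abs_of_pos (by positivity), div_le_one (by positivity)]
      have : (0 : ℝ) ≤ n := Nat.cast_nonneg n
      linarith
    gcongr
    exact mul_le_of_le_one_left (norm_nonneg _) h2
  have h3 : jb k ≤ 2 * (jb y * jb l) := by
    have := jb_add_le y ((1 / ((n : ℝ) + 1)) • l)
    rw [hy, sub_add_cancel, ← hy] at this
    have := one_le_jb y
    have := one_le_jb l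
    nlinarith
  have := jb_pos k
  have := jb_pos y
  have := jb_pos l
  rw [← Real.mul_rpow (by positivity) (by positivity), ← Real.mul_rpow (by positivity) (by positivity)]
  gcongr

/-- The translations have length at most |l|, so ⟨k⟩^M costs only ⟨l⟩^M, which the Schwartz function
`bumpFreq` absorbs. The bound is uniform in n and serves as a majorant. -/
theorem norm_fourierInv_cutSchwartz_le (η : 𝓢(Space, ℂ)) {M : ℝ} (hM : 0 ≤ M) :
    ∃ C : ℝ, 0 ≤ C ∧ ∀ (n : ℕ) (k : Space), ‖𝓕⁻ (cutSchwartz n η) k‖ ≤ C * jb k ^ (-M) := by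
  obtain ⟨C, hC, hη⟩ := schwartz_decay (𝓕⁻ η) M
  have hi : Integrable fun l => ‖bumpFreq l‖ * jb l ^ M := by
    obtain ⟨D, hD, hb⟩ := schwartz_decay bumpFreq (M + 4)
    have h1 := lintegral_wt_sq_lt_top (p := 2) (by norm_num)
    have m1 := measurable_jb
    have m2 := bumpFreq.continuous.measurable
    refine ⟨(by fun_prop : Measurable _).aestronglyMeasurable, ?_⟩
    unfold HasFiniteIntegral
    refine lt_of_le_of_lt ?_ (ENNReal.mul_lt_top (ENNReal.ofReal_lt_top (r := D)) h1)
    rw [← lintegral_const_mul' _ _ (by simp)]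
    refine lintegral_mono fun l => ?_
    have hl := jb_pos l
    rw [wt, ← ENNReal.ofReal_pow (by positivity), ← ENNReal.ofReal_mul hD, ← ofReal_norm]
    apply ENNReal.ofReal_le_ofReal
    rw [norm_mul, norm_norm, Real.norm_eq_abs, abs_of_pos (by positivity)]
    calc _ ≤ D * jb l ^ (-(M + 4)) * jb l ^ M := by gcongr; exact hb l
      _ = _ := by
        rw [mul_assoc, ← Real.rpow_add hl, ← Real.rpow_natCast, ← Real.rpow_mul hl.le]
        congr 2
        push_cast; ring
  refine ⟨2 ^ M * C * ∫ l, ‖bumpFreq l‖ * jb l ^ M, ?_, fun n k => ?_⟩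
  · have : 0 ≤ ∫ l, ‖bumpFreq l‖ * jb l ^ M :=
      integral_nonneg fun l => by have := jb_pos l; positivity
    positivity
  rw [fourierInv_cutSchwartz]
  refine (norm_integral_le_integral_norm _).trans ?_
  rw [mul_right_comm, ← integral_const_mul]
  have hk := jb_pos k
  refine integral_mono_of_nonneg (Filter.Eventually.of_forall fun l => norm_nonneg _)
    (hi.const_mul _) (Filter.Eventually.of_forall fun l => ?_)
  set y := k - (1 / ((n : ℝ) + 1)) • l with hy
  have hy0 := jb_pos y
  have hl0 := jb_pos l
  have h1 : jb y ^ (-M) ≤ 2 ^ M * jb l ^ M * jb k ^ (-M) := by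
    rw [Real.rpow_neg hk.le, Real.rpow_neg hy0.le, ← div_eq_mul_inv, le_div_iff₀ (by positivity),
      ← div_eq_inv_mul, div_le_iff₀ (by positivity)]
    calc _ ≤ _ := jb_rpow_le hM n k l
      _ = _ := by rw [← hy]; ring
  calc ‖bumpFreq l * 𝓕⁻ η y‖ ≤ ‖bumpFreq l‖ * (C * jb y ^ (-M)) := by
        rw [norm_mul]; gcongr; exact hη y
    _ ≤ ‖bumpFreq l‖ * (C * (2 ^ M * jb l ^ M * jb k ^ (-M))) := by gcongr
    _ = _ := by ring

theorem tendsto_fourierInv_cutSchwartz (η : 𝓢(Space, ℂ)) (k : Space) :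
    Filter.Tendsto (fun n => 𝓕⁻ (cutSchwartz n η) k) Filter.atTop (nhds (𝓕⁻ η k)) := by
  simp_rw [fourierInv_cutSchwartz]
  have e : 𝓕⁻ η k = ∫ l, bumpFreq l * 𝓕⁻ η k := by
    rw [integral_mul_const, integral_bumpFreq, one_mul]
  rw [e]
  obtain ⟨C, hC, hη⟩ := schwartz_decay (𝓕⁻ η) 0
  refine tendsto_integral_of_dominated_convergence (fun l => ‖bumpFreq l‖ * C) (fun n => ?_)
    (bumpFreq.integrable.norm.mul_const _) (fun n => Filter.Eventually.of_forall fun l => ?_)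
    (Filter.Eventually.of_forall fun l => ?_)
  · have c2 := (𝓕⁻ η).continuous
    have c3 := bumpFreq.continuous
    exact (by fun_prop : Continuous _).aestronglyMeasurable
  · rw [norm_mul]
    gcongr
    simpa using hη (k - (1 / ((n : ℝ) + 1)) • l)
  · refine Filter.Tendsto.const_mul _ ?_
    have c2 : Continuous fun c : ℝ => 𝓕⁻ η (k - c • l) := by
      have := (𝓕⁻ η).continuous
      fun_prop
    have := (c2.tendsto 0).comp (tendsto_one_div_add_atTop_nhds_zero_nat (𝕜 := ℝ))
    simpa [Function.comp_def] using this

/-- The test functions of the system have compact support in space, while duality uses all Schwartz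
functions. Truncations ζ(x/(n+1))η and dominated convergence on the frequency side bridge the gap.
-/
theorem ae_eq_zero_of_compactSupport {r : ℝ} {W : Space → ℂ} (hW : Measurable W)
    (hr : wn r (fun k => ‖W k‖ₑ) < ∞)
    (h0 : ∀ η : 𝓢(Space, ℂ), HasCompactSupport η → ∫ k, W k * 𝓕⁻ η k = 0) : W =ᵐ[volume] 0 := by
  have h1 : ∀ η : 𝓢(Space, ℂ), ∫ k, W k * 𝓕⁻ η k = 0 := by
    intro η
    -- Decay of an order above 1 - r puts the majorant into the space dual to that of W.
    set M := |r| + 2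
    obtain ⟨C, hC, hη⟩ := norm_fourierInv_cutSchwartz_le η (M := M) (by positivity)
    have mj := measurable_jb
    have hd : wn (-r) (fun k => ‖((C * jb k ^ (-M) : ℝ) : ℂ)‖ₑ) < ∞ :=
      wn_lt_top_of_decay (r := -r) (M := M) (C := C) (by have := neg_abs_le r; linarith) hC
        fun y => by
          have := jb_pos y
          rw [Complex.norm_real, Real.norm_eq_abs, abs_of_nonneg (by positivity)]
    have hb := (integrable_mul_schwartz hW hr (by fun_prop) hd).norm
    refine tendsto_nhds_unique (f := fun n => ∫ k, W k * 𝓕⁻ (cutSchwartz n η) k) (l := Filter.atTop) ?_ ?_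
    · refine tendsto_integral_of_dominated_convergence _ (fun n => ?_) hb
        (fun n => Filter.Eventually.of_forall fun k => ?_) (Filter.Eventually.of_forall fun k => ?_)
      · exact (hW.mul (𝓕⁻ (cutSchwartz n η)).continuous.measurable).aestronglyMeasurable
      · have := jb_pos k
        rw [norm_mul, norm_mul, Complex.norm_real, Real.norm_eq_abs, abs_of_nonneg (by positivity)]
        gcongr
        exact hη n k
      · exact (tendsto_fourierInv_cutSchwartz η k).const_mul _
    · simp_rw [h0 _ (hasCompactSupport_cutSchwartz _ η)]
      exact tendsto_const_nhds
  have hl : LocallyIntegrable W volume := by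
    set M := |r| + 2
    have mj := measurable_jb
    have hd : wn (-r) (fun k => ‖((jb k ^ (-M) : ℝ) : ℂ)‖ₑ) < ∞ :=
      wn_lt_top_of_decay (r := -r) (M := M) (C := 1) (by have := neg_abs_le r; linarith) zero_le_one
        fun y => by
          have := jb_pos y
          rw [Complex.norm_real, Real.norm_eq_abs, abs_of_nonneg (by positivity), one_mul]
    have h2 := (integrable_mul_schwartz hW hr (by fun_prop) hd).locallyIntegrable
    have hc : Continuous fun k => ((jb k ^ M : ℝ) : ℂ) :=
      Complex.continuous_ofReal.comp (continuous_jb.rpow_const fun k => Or.inl (jb_pos k).ne')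
    rw [← locallyIntegrableOn_univ] at h2 ⊢
    have h3 := h2.mul_continuousOn hc.continuousOn isOpen_univ.isLocallyClosed
    refine h3.congr (Filter.Eventually.of_forall fun k => ?_)
    have hk := jb_pos k
    have : (jb k ^ (-M) : ℝ) * jb k ^ M = 1 := by
      rw [← Real.rpow_add hk, neg_add_cancel, Real.rpow_zero]
    simp only [mul_assoc, ← Complex.ofReal_mul, this, Complex.ofReal_one, mul_one]
  refine ae_eq_of_integral_schwartz hl (locallyIntegrable_const 0) fun θ => ?_
  have := h1 (𝓕 θ)
  rw [FourierPair.fourierInv_fourier_eq] at this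
  simpa using this

end

section


/-! ### Weak derivatives in time -/

theorem integrable_test_mul {g : ℝ → ℝ} {x : ℝ → ℂ} {J : Set ℝ} (hg : Continuous g)
    (hc : HasCompactSupport g) (hs : tsupport g ⊆ J) (hx : ContinuousOn x J) :
    Integrable fun t => (g t : ℂ) * x t := by
  have h1 : IntegrableOn (fun t => (g t : ℂ) * x t) (tsupport g) :=
    ((Complex.continuous_ofReal.comp hg).continuousOn.mul (hx.mono hs)).integrableOn_compact hc
  refine (integrableOn_iff_integrable_of_support_subset fun t ht => subset_tsupport g ?_).mp h1
  intro h
  apply ht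
  simp [h]

theorem hasDerivAt_test {χ : ℝ → ℝ} (hχ : ContDiff ℝ (⊤ : ℕ∞) χ) (t : ℝ) :
    HasDerivAt (fun t => (χ t : ℂ)) ((deriv χ t : ℝ) : ℂ) t :=
  ((hχ.differentiable (by simp)) t).hasDerivAt.ofReal_comp

theorem continuous_deriv_test {χ : ℝ → ℝ} (hχ : ContDiff ℝ (⊤ : ℕ∞) χ) : Continuous (deriv χ) :=
  hχ.continuous_deriv (by simp)

theorem prim_test {χ : ℝ → ℝ} (hχ : ContDiff ℝ (⊤ : ℕ∞) χ) :
    Prim (fun t => (χ t : ℂ)) fun t => ((deriv χ t : ℝ) : ℂ) :=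
  Prim.of_hasDerivAt (hasDerivAt_test hχ) (Complex.continuous_ofReal.comp (continuous_deriv_test hχ))

theorem Prim.integral_test {Y y : ℝ → ℂ} (h : Prim Y y) {χ : ℝ → ℝ} (hχ : ContDiff ℝ (⊤ : ℕ∞) χ)
    (hc : HasCompactSupport χ) :
    Integrable (fun t => ((deriv χ t : ℝ) : ℂ) * Y t + χ t * y t) ∧
      ∫ t, (((deriv χ t : ℝ) : ℂ) * Y t + χ t * y t) = 0 := by
  obtain ⟨n, hn⟩ : ∃ n : ℝ, tsupport χ ⊆ Set.Ioo (-n) n := by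
    obtain ⟨n, hn⟩ := hc.isCompact.isBounded.subset_ball_lt 0 0
    exact ⟨n, by simpa [Real.ball_eq_Ioo] using hn.2⟩
  have hp := (prim_test hχ).mul h
  have hs : Function.support (fun t => ((deriv χ t : ℝ) : ℂ) * Y t + χ t * y t) ⊆ Set.Ioo (-n) n := by
    intro t ht
    by_contra hcon
    have h1 : t ∉ tsupport χ := fun h => hcon (hn h)
    have h2 : t ∉ tsupport (deriv χ) := fun h => h1 (tsupport_deriv_subset h)
    apply ht
    simp [image_eq_zero_of_notMem_tsupport h1, image_eq_zero_of_notMem_tsupport h2]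
  have hs' := hs.trans Set.Ioo_subset_Ioc_self
  constructor
  · rw [← integrableOn_iff_integrable_of_support_subset hs']
    exact (hp.int (-n) n).1
  · rw [← intervalIntegral.integral_eq_integral_of_support_subset hs', ← hp.eq,
      image_eq_zero_of_notMem_tsupport fun h => lt_irrefl _ (hn h).2,
      image_eq_zero_of_notMem_tsupport fun h => lt_irrefl _ (hn h).1]
    simp

/-- The primitive vanishes to the left of the support of g, and to the right because g has mean
zero. -/
theorem exists_primitive_test {α β : ℝ} {g : ℝ → ℝ} (hg : ContDiff ℝ (⊤ : ℕ∞) g)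
    (hc : HasCompactSupport g) (hs : tsupport g ⊆ Set.Ioo α β) (h0 : ∫ t, g t = 0) :
    ∃ χ : ℝ → ℝ, ContDiff ℝ (⊤ : ℕ∞) χ ∧ HasCompactSupport χ ∧ tsupport χ ⊆ Set.Ioo α β ∧
      deriv χ = g := by
  rcases (tsupport g).eq_empty_or_nonempty with he | hne
  · refine ⟨fun _ => 0, contDiff_const, HasCompactSupport.zero, by simp [tsupport], ?_⟩
    ext t
    rw [image_eq_zero_of_notMem_tsupport (f := g) (by simp [he])]
    simp
  set a := sInf (tsupport g)
  set b := sSup (tsupport g)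
  have ha : a ∈ Set.Ioo α β := hs (hc.isCompact.sInf_mem hne)
  have hb : b ∈ Set.Ioo α β := hs (hc.isCompact.sSup_mem hne)
  have hab : ∀ t ∈ tsupport g, t ∈ Set.Icc a b := fun t ht =>
    ⟨csInf_le hc.isCompact.bddBelow ht, le_csSup hc.isCompact.bddAbove ht⟩
  have hz : ∀ t ∉ Set.Icc a b, g t = 0 := fun t ht =>
    image_eq_zero_of_notMem_tsupport fun h => ht (hab t h)
  set a' := (α + a) / 2 with ha'
  have h1 : α < a' ∧ a' < a := by constructor <;> linarith [ha.1]
  set χ := fun t => ∫ r in a'..t, g r with hχ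
  have hi := hg.continuous.intervalIntegrable (μ := volume)
  have hd : ∀ t, HasDerivAt χ (g t) t := fun t =>
    intervalIntegral.integral_hasDerivAt_right (hi _ _)
      (hg.continuous.stronglyMeasurableAtFilter _ _) hg.continuous.continuousAt
  have hde : deriv χ = g := funext fun t => (hd t).deriv
  have hsup : Function.support χ ⊆ Set.Icc a b := by
    intro t ht
    by_contra hcon
    apply ht
    rcases lt_or_ge t a with h | h
    · show ∫ r in a'..t, g r = 0
      rw [intervalIntegral.integral_congr (g := fun _ => 0), intervalIntegral.integral_zero]
      intro r hr
      refine hz r fun hr' => ?_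
      have := hr.2.trans (sup_le h1.2.le h.le)
      have h3 : r = a := le_antisymm this hr'.1
      rcases le_total a' t with h4 | h4
      · rw [Set.uIcc_of_le h4] at hr; linarith [hr.2]
      · rw [Set.uIcc_of_ge h4] at hr; linarith [hr.2]
    · have h4 : b < t := by
        by_contra h5
        exact hcon ⟨h, not_lt.mp h5⟩
      show ∫ r in a'..t, g r = 0
      rw [intervalIntegral.integral_eq_integral_of_support_subset, h0]
      intro r hr
      have : r ∈ Set.Icc a b := by
        by_contra h6
        exact hr (hz r h6)
      exact ⟨by linarith [this.1], by linarith [this.2]⟩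
  have hts : tsupport χ ⊆ Set.Icc a b := closure_minimal hsup isClosed_Icc
  refine ⟨χ, ?_, HasCompactSupport.of_support_subset_isCompact isCompact_Icc hsup, fun t ht => ?_, hde⟩
  · rw [contDiff_infty_iff_deriv, hde]
    exact ⟨fun t => (hd t).differentiableAt, hg⟩
  · have := hts ht
    exact ⟨lt_of_lt_of_le ha.1 this.1, lt_of_le_of_lt this.2 hb.2⟩

/-- The lemma of du Bois-Reymond: x - Y has zero weak derivative. Continuity of x turns equality
almost everywhere into equality at every time, so the value at c makes sense as an initial value. -/
theorem eq_primitive_of_weak {α β c : ℝ} (hc : c ∈ Set.Ioo α β) {x Y y : ℝ → ℂ}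
    (hx : ContinuousOn x (Set.Ioo α β)) (hY : Prim Y y)
    (h : ∀ χ : ℝ → ℝ, ContDiff ℝ (⊤ : ℕ∞) χ → HasCompactSupport χ → tsupport χ ⊆ Set.Ioo α β →
      ∫ t, (((deriv χ t : ℝ) : ℂ) * x t + χ t * y t) = 0) {t : ℝ} (ht : t ∈ Set.Ioo α β) :
    x t - x c = Y t - Y c := by
  set z := fun t => x t - Y t with hz
  have zc : ContinuousOn z (Set.Ioo α β) := hx.sub hY.continuous.continuousOn
  have h1 : ∀ χ : ℝ → ℝ, ContDiff ℝ (⊤ : ℕ∞) χ → HasCompactSupport χ → tsupport χ ⊆ Set.Ioo α β →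
      ∫ t, ((deriv χ t : ℝ) : ℂ) * z t = 0 := by
    intro χ hχ hcs hs
    obtain ⟨i1, e1⟩ := hY.integral_test hχ hcs
    have i2 := integrable_test_mul (continuous_deriv_test hχ) hcs.deriv
      (tsupport_deriv_subset.trans hs) zc
    have := h χ hχ hcs hs
    have e : (fun t => ((deriv χ t : ℝ) : ℂ) * x t + χ t * y t) =
        fun t => ((deriv χ t : ℝ) : ℂ) * z t + (((deriv χ t : ℝ) : ℂ) * Y t + χ t * y t) := by
      ext t; simp only [hz]; ring
    rwa [e, integral_add i2 i1, e1, add_zero] at this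
  obtain ⟨ρ, hρ1, hρ2, hρ3, hρ4⟩ : ∃ ρ : ℝ → ℝ, ContDiff ℝ (⊤ : ℕ∞) ρ ∧ HasCompactSupport ρ ∧
      tsupport ρ ⊆ Set.Ioo α β ∧ ∫ t, ρ t = 1 := by
    obtain ⟨ε, hε, hb⟩ := Metric.isOpen_iff.mp isOpen_Ioo c hc
    let f : ContDiffBump c := ⟨ε / 4, ε / 2, by positivity, by linarith⟩
    refine ⟨f.normed volume, f.contDiff_normed, f.hasCompactSupport_normed, ?_, f.integral_normed⟩
    rw [f.tsupport_normed_eq]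
    exact (Metric.closedBall_subset_ball (by show ε / 2 < ε; linarith)).trans hb
  have iρ := integrable_test_mul hρ1.continuous hρ2 hρ3 zc
  set C := ∫ t, (ρ t : ℂ) * z t with hC
  have h2 : ∀ᵐ t, t ∈ Set.Ioo α β → z t - C = 0 := by
    refine isOpen_Ioo.ae_eq_zero_of_integral_contDiff_smul_eq_zero
      ((zc.sub continuousOn_const).locallyIntegrableOn measurableSet_Ioo) fun g hg hgc hgs => ?_
    set m := ∫ t, g t
    have ig : Integrable g := hg.continuous.integrable_of_hasCompactSupport hgc
    have iρ' : Integrable ρ := hρ1.continuous.integrable_of_hasCompactSupport hρ2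
    have igz := integrable_test_mul hg.continuous hgc hgs zc
    have hsub : tsupport (fun t => g t - m * ρ t) ⊆ tsupport g ∪ tsupport ρ := by
      refine closure_minimal (fun t ht => ?_) ((isClosed_tsupport g).union (isClosed_tsupport ρ))
      by_contra hcon
      rw [Set.mem_union, not_or] at hcon
      apply ht
      simp [image_eq_zero_of_notMem_tsupport hcon.1, image_eq_zero_of_notMem_tsupport hcon.2]
    -- Subtracting m times the normalised bump ρ gives mean zero, hence an admissible test function
    -- as a primitive.
    obtain ⟨χ, c1, c2, c3, c4⟩ := exists_primitive_test (g := fun t => g t - m * ρ t)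
      (hg.sub (contDiff_const.mul hρ1))
      ((hgc.isCompact.union hρ2.isCompact).of_isClosed_subset (isClosed_tsupport _) hsub)
      (hsub.trans (Set.union_subset hgs hρ3))
      (by rw [integral_sub ig (iρ'.const_mul _), integral_const_mul, hρ4, mul_one, sub_self])
    have h3 := h1 χ c1 c2 c3
    rw [c4] at h3
    have e : (fun t => ((g t - m * ρ t : ℝ) : ℂ) * z t) =
        fun t => (g t : ℂ) * z t - m * ((ρ t : ℂ) * z t) := by
      ext t; push_cast; ring
    rw [e, integral_sub igz (iρ.const_mul _), integral_const_mul, ← hC] at h3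
    have e2 : (fun t => g t • (z t - C)) = fun t => (g t : ℂ) * z t - (g t : ℂ) * C := by
      ext t; rw [Complex.real_smul]; ring
    have ig' : Integrable fun t => (g t : ℂ) * C := ig.ofReal.mul_const _
    rw [e2, integral_sub igz ig', integral_mul_const,
      show (∫ t, (g t : ℂ)) = (m : ℂ) from integral_ofReal]
    exact h3
  have h3 : Set.EqOn z (fun _ => C) (Set.Ioo α β) := by
    refine Measure.eqOn_open_of_ae_eq (μ := volume) ?_ isOpen_Ioo zc continuousOn_const
    rw [Filter.EventuallyEq, ae_restrict_iff' measurableSet_Ioo]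
    filter_upwards [h2] with t ht ht' using sub_eq_zero.mp (ht ht')
  have h4 := (h3 ht).trans (h3 hc).symm
  simp only [hz] at h4
  linear_combination h4

/-! ### Pairing of a bounded family with a test function -/

theorem Bdd.enorm_pairing_le {r : ℝ} {a : ℝ → Space → ℂ} (h : Bdd r a) (θ : 𝓢(Space, ℂ)) :
    ∃ C : ℝ≥0∞, C ≠ ∞ ∧ ∀ t, ∫⁻ k, ‖a t k * θ k‖ₑ ≤ C := by
  obtain ⟨D, hD, hb⟩ := h.bound
  refine ⟨1 + D * wn (-r) (fun k => ‖θ k‖ₑ), ?_, fun t => ?_⟩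
  · have := (wn_schwartz_lt_top θ (-r)).ne
    finiteness
  · simp_rw [enorm_mul]
    refine (lintegral_pair_le (r := r) (h.meas_slice t).enorm θ.continuous.measurable.enorm).trans ?_
    gcongr
    exact hb t

theorem Bdd.measurable_pair {r : ℝ} {a : ℝ → Space → ℂ} (h : Bdd r a) (θ : 𝓢(Space, ℂ)) :
    Measurable fun p : ℝ × Space => a p.1 p.2 * θ p.2 :=
  h.meas.mul (θ.continuous.measurable.comp measurable_snd)

theorem Bdd.integrable_pair {r : ℝ} {a : ℝ → Space → ℂ} (h : Bdd r a) (θ : 𝓢(Space, ℂ)) (t : ℝ) :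
    Integrable fun k => a t k * θ k := by
  obtain ⟨C, hC, hb⟩ := h.enorm_pairing_le θ
  exact ⟨((h.meas_slice t).mul θ.continuous.measurable).aestronglyMeasurable,
    (hb t).trans_lt hC.lt_top⟩

theorem Bdd.integrable_pair_prod {r : ℝ} {a : ℝ → Space → ℂ} (h : Bdd r a) (θ : 𝓢(Space, ℂ))
    {T : Set ℝ} (hT : volume T ≠ ∞) :
    Integrable (Function.uncurry fun t k => a t k * θ k) ((volume.restrict T).prod volume) := by
  obtain ⟨C, hC, hb⟩ := h.enorm_pairing_le θ
  have hm := h.measurable_pair θ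
  refine ⟨hm.aestronglyMeasurable, ?_⟩
  unfold HasFiniteIntegral
  refine (lintegral_prod _ hm.enorm.aemeasurable).trans_lt ?_
  calc _ ≤ ∫⁻ t in T, C := lintegral_mono fun t => hb t
    _ < ∞ := by rw [lintegral_const, Measure.restrict_apply_univ]; finiteness

theorem Bdd.integrable_pairing {r : ℝ} {a : ℝ → Space → ℂ} (h : Bdd r a) (θ : 𝓢(Space, ℂ))
    {T : Set ℝ} (hT : volume T ≠ ∞) : IntegrableOn (fun t => ∫ k, a t k * θ k) T :=
  (h.integrable_pair_prod θ hT).integral_prod_left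

theorem Bdd.prim_pairing {r : ℝ} {y : ℝ → Space → ℂ} (hy : Bdd r y) (θ : 𝓢(Space, ℂ)) (c : ℝ) :
    Prim (fun t => ∫ k, (∫ s in c..t, y s k) * θ k) fun t => ∫ k, y t k * θ k := by
  have h1 : ∀ s t, IntervalIntegrable (fun t => ∫ k, y t k * θ k) volume s t := fun s t =>
    ⟨hy.integrable_pairing θ (by simp), hy.integrable_pairing θ (by simp)⟩
  have h2 := Prim.of_integral h1 0 c
  have e : (fun t => ∫ k, (∫ s in c..t, y s k) * θ k) =
      fun t => 0 + ∫ s in c..t, ∫ k, y s k * θ k := by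
    ext t
    rw [zero_add, intervalIntegral_integral_swap]
    · congr 1; ext k
      rw [intervalIntegral.integral_mul_const]
    · exact hy.integrable_pair_prod θ (by simp [Set.uIoc])
  rw [e]
  exact h2

/-! ### Weak solutions of ordinary differential equations -/

theorem Bdd.measurable_primitive {r : ℝ} {y : ℝ → Space → ℂ} (hy : Bdd r y) (c : ℝ) :
    Measurable fun p : ℝ × Space => ∫ s in c..p.1, y s p.2 := by
  have hm := hy.meas
  have hm1 : Measurable fun q : (ℝ × Space) × ℝ => y q.2 q.1.2 :=
    hm.comp (measurable_snd.prodMk (measurable_snd.comp measurable_fst))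
  have key : ∀ u v : ℝ × Space → ℝ, Measurable u → Measurable v →
      Measurable fun p : ℝ × Space => ∫ s in Set.Ioc (u p) (v p), y s p.2 := by
    intro u v hu hv
    have hS : MeasurableSet {q : (ℝ × Space) × ℝ | u q.1 < q.2 ∧ q.2 ≤ v q.1} :=
      (measurableSet_lt (hu.comp measurable_fst) measurable_snd).inter
        (measurableSet_le measurable_snd (hv.comp measurable_fst))
    have e : (fun p : ℝ × Space => ∫ s in Set.Ioc (u p) (v p), y s p.2) = fun p => ∫ s,
        {q : (ℝ × Space) × ℝ | u q.1 < q.2 ∧ q.2 ≤ v q.1}.indicator (fun q => y q.2 q.1.2) (p, s) := by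
      ext p
      rw [← integral_indicator measurableSet_Ioc]
      rfl
    rw [e]
    exact (StronglyMeasurable.integral_prod_right'
      (hm1.indicator hS).stronglyMeasurable).measurable
  exact (key (fun _ => c) Prod.fst measurable_const measurable_fst).sub
    (key Prod.fst (fun _ => c) measurable_fst measurable_const)

theorem Bdd.deriv_primitive {r : ℝ} {y : ℝ → Space → ℂ} (hy : Bdd r y) (B : Space → ℂ) (c : ℝ) :
    Deriv (fun t k => B k + ∫ s in c..t, y s k) y := by
  filter_upwards [hy.intervalIntegrable] with k hk
  exact Prim.of_integral hk _ c

theorem Bdd.wn_primitive_lt_top {r : ℝ} {y : ℝ → Space → ℂ} (hy : Bdd r y) (c t : ℝ) :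
    wn r (fun k => ‖∫ s in c..t, y s k‖ₑ) < ∞ := by
  obtain ⟨C, hC, h⟩ := (hy.deriv_primitive 0 c).diff_bound hy
  rcases le_total c t with hct | hct
  · have := h c (t - c) (by linarith)
    simp only [Pi.zero_apply, zero_add, add_sub_cancel, intervalIntegral.integral_same, sub_zero] at this
    exact this.trans_lt (by finiteness)
  · have := h t (c - t) (by linarith)
    simp only [Pi.zero_apply, zero_add, add_sub_cancel, intervalIntegral.integral_same, zero_sub,
      enorm_neg] at this
    exact this.trans_lt (by finiteness)

theorem Bdd.wn_lt_top {r : ℝ} {x : ℝ → Space → ℂ} (hx : Bdd r x) (t : ℝ) :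
    wn r (fun k => ‖x t k‖ₑ) < ∞ := by
  obtain ⟨C, hC, h⟩ := hx.bound
  exact (h t).trans_lt hC.lt_top

theorem wn_sub_lt_top {r : ℝ} {F G : Space → ℂ} (mF : Measurable F)
    (hF : wn r (fun k => ‖F k‖ₑ) < ∞) (hG : wn r (fun k => ‖G k‖ₑ) < ∞) :
    wn r (fun k => ‖F k - G k‖ₑ) < ∞ := by
  refine ((wn_mono le_rfl fun k => enorm_sub_le).trans (wn_add_le (by fun_prop))).trans_lt ?_
  finiteness

/-- The scalar statement is applied to the pairing with each test function; at a fixed time the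
pairings with compactly supported η determine the function of the frequency. -/
theorem Bdd.eq_primitive_of_weak {α β c r : ℝ} (hc : c ∈ Set.Ioo α β) {x y : ℝ → Space → ℂ}
    (hx : Bdd r x) (hy : Bdd r y)
    (hcont : ∀ η : 𝓢(Space, ℂ), ContinuousOn (fun t => ∫ k, x t k * 𝓕⁻ η k) (Set.Ioo α β))
    (h : ∀ χ : ℝ → ℝ, ContDiff ℝ (⊤ : ℕ∞) χ → HasCompactSupport χ → tsupport χ ⊆ Set.Ioo α β →
      ∀ η : 𝓢(Space, ℂ), HasCompactSupport η →
      ∫ t, (((deriv χ t : ℝ) : ℂ) * (∫ k, x t k * 𝓕⁻ η k) + χ t * ∫ k, y t k * 𝓕⁻ η k) = 0)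
    {t : ℝ} (ht : t ∈ Set.Ioo α β) : ∀ᵐ k, x t k = x c k + ∫ s in c..t, y s k := by
  have mp : Measurable fun k => ∫ s in c..t, y s k :=
    (hy.measurable_primitive c).comp measurable_prodMk_left
  have mx := hx.meas_slice t
  have mc := hx.meas_slice c
  have w1 := wn_sub_lt_top mx (hx.wn_lt_top t) (hx.wn_lt_top c)
  have w2 := wn_sub_lt_top (mx.sub mc) w1 (hy.wn_primitive_lt_top c t)
  have := ae_eq_zero_of_compactSupport (r := r) (W := fun k => x t k - x c k - ∫ s in c..t, y s k)
    (by fun_prop) w2 fun η hη => by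
      have h1 := CSH.eq_primitive_of_weak hc (hcont η) (hy.prim_pairing (𝓕⁻ η) c)
        (fun χ h1 h2 h3 => h χ h1 h2 h3 η hη) ht
      have i1 := hx.integrable_pair (𝓕⁻ η) t
      have i2 := hx.integrable_pair (𝓕⁻ η) c
      have i3 := integrable_mul_schwartz mp (hy.wn_primitive_lt_top c t)
        (𝓕⁻ η).continuous.measurable (wn_schwartz_lt_top (𝓕⁻ η) (-r))
      simp_rw [sub_mul]
      have i12 : Integrable fun k => x t k * 𝓕⁻ η k - x c k * 𝓕⁻ η k := i1.sub i2
      rw [integral_sub i12 i3, integral_sub i1 i2, h1]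
      simp
  filter_upwards [this] with k hk
  simp only [Pi.zero_apply] at hk
  linear_combination hk

end

section


/-! ### Primitives that are bounded on an interval -/

theorem Bdd.indicator {s : ℝ} {a : ℝ → Space → ℂ} (h : Bdd s a) {J : Set ℝ} (hJ : MeasurableSet J) :
    Bdd s fun t k => J.indicator (fun t => a t k) t := by
  refine h.of_le ?_ fun t k => norm_indicator_le_norm_self _ _
  exact h.meas.indicator (hJ.preimage measurable_fst)

/-- Fatou's lemma; it carries a bound from an open interval to its end points. -/
theorem wn_le_of_tendsto {s : ℝ} {F : ℕ → Space → ℂ} {G : Space → ℂ} {C : ℝ≥0∞}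
    (hF : ∀ n, Measurable (F n)) (hC : ∀ n, wn s (fun k => ‖F n k‖ₑ) ≤ C)
    (h : ∀ᵐ k, Filter.Tendsto (fun n => F n k) Filter.atTop (nhds (G k))) :
    wn s (fun k => ‖G k‖ₑ) ≤ C := by
  have e : wn s (fun k => ‖G k‖ₑ) =
      ∫⁻ k, Filter.liminf (fun n => (wt s k * ‖F n k‖ₑ) ^ 2) Filter.atTop := by
    refine lintegral_congr_ae ?_
    filter_upwards [h] with k hk
    have h1 : Filter.Tendsto (fun n => (wt s k * ‖F n k‖ₑ) ^ 2) Filter.atTop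
        (nhds ((wt s k * ‖G k‖ₑ) ^ 2)) :=
      ((ENNReal.continuous_pow 2).tendsto _).comp
        (ENNReal.Tendsto.const_mul ((continuous_enorm.tendsto _).comp hk) (Or.inr (wt_ne_top s k)))
    exact h1.liminf_eq.symm
  rw [e]
  refine (lintegral_liminf_le fun n => ?_).trans ?_
  · have := hF n
    fun_prop
  · refine Filter.liminf_le_of_frequently_le' (Filter.Frequently.of_forall fun n => ?_)
    exact hC n

/-- A primitive of a family that vanishes off an interval, if it is bounded on this interval. -/
theorem Bdd.primitive {s r α β c : ℝ} (hc : c ∈ Set.Ioo α β) {B : Space → ℂ} (hB : Measurable B)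
    {z : ℝ → Space → ℂ} (hz : Bdd r z) {C : ℝ≥0∞} (hC : C ≠ ∞)
    (hb : ∀ t ∈ Set.Ioo α β, wn s (fun k => ‖B k + ∫ q in c..t, z q k‖ₑ) ≤ C) :
    Bdd s fun t k => B k + ∫ q in c..t, (Set.Ioo α β).indicator (fun q => z q k) q := by
  have hz' := hz.indicator (J := Set.Ioo α β) measurableSet_Ioo
  have hm : Measurable fun p : ℝ × Space =>
      B p.2 + ∫ q in c..p.1, (Set.Ioo α β).indicator (fun q => z q p.2) q :=
    (hB.comp measurable_snd).add (hz'.measurable_primitive c)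
  have hin : ∀ t ∈ Set.Ioo α β, ∀ k,
      ∫ q in c..t, (Set.Ioo α β).indicator (fun q => z q k) q = ∫ q in c..t, z q k := by
    intro t ht k
    refine intervalIntegral.integral_congr fun q hq => ?_
    exact Set.indicator_of_mem (Set.OrdConnected.uIcc_subset Set.ordConnected_Ioo hc ht hq) _
  refine ⟨hm, C, hC, fun t => ?_⟩
  -- The derivative vanishes off the interval, so the primitive at t equals that at the nearest
  -- point of [α, β], which is a limit of points of the interval.
  set t' := max α (min t β) with ht'
  have hcl : t' ∈ closure (Set.Ioo α β) := by
    rw [closure_Ioo (hc.1.trans hc.2).ne]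
    exact ⟨le_max_left _ _, max_le (hc.1.trans hc.2).le (min_le_right _ _)⟩
  obtain ⟨τ, hτ, hlim⟩ := mem_closure_iff_seq_limit.mp hcl
  have hval : ∀ k, (∀ x y, IntervalIntegrable
      (fun q => (Set.Ioo α β).indicator (fun q => z q k) q) volume x y) →
      ∫ q in c..t, (Set.Ioo α β).indicator (fun q => z q k) q =
        ∫ q in c..t', (Set.Ioo α β).indicator (fun q => z q k) q := by
    intro k hk
    by_cases hte : t' = t
    · rw [hte]
    rw [← sub_eq_zero, intervalIntegral.integral_interval_sub_left (hk _ _) (hk _ _)]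
    rw [intervalIntegral.integral_congr (g := fun _ => 0), intervalIntegral.integral_zero]
    intro q hq
    refine Set.indicator_of_notMem (fun hq' => ?_) _
    rcases lt_or_ge t α with h1 | h1
    · have : t' = α := by rw [ht', max_eq_left]; exact (min_le_left _ _).trans h1.le
      rw [this, Set.uIcc_of_ge h1.le] at hq
      exact absurd hq.2 (not_le.mpr hq'.1)
    rcases lt_or_ge β t with h2 | h2
    · have : t' = β := by rw [ht', min_eq_right h2.le, max_eq_right (hc.1.trans hc.2).le]
      rw [this, Set.uIcc_of_le h2.le] at hq
      exact absurd hq.1 (not_le.mpr hq'.2)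
    · have : t' = t := by rw [ht', min_eq_left h2, max_eq_right h1]
      exact absurd this hte
  refine wn_le_of_tendsto (F := fun n k => B k +
    ∫ q in c..τ n, (Set.Ioo α β).indicator (fun q => z q k) q) (fun n => ?_) (fun n => ?_) ?_
  · exact hm.comp measurable_prodMk_left
  · simp_rw [hin _ (hτ n)]
    exact hb _ (hτ n)
  · filter_upwards [hz'.intervalIntegrable] with k hk
    rw [hval k hk]
    exact ((intervalIntegral.continuous_primitive hk c).tendsto _).comp hlim |>.const_add _

/-! ### Profiles of solutions of half-wave equations -/

/-- Identities known at each time off a null set of frequencies become identities at almost every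
frequency for almost every time, as the calculus of primitives requires. -/
theorem ae_ae_swap {p : ℝ → Space → Prop} (hp : MeasurableSet {q : ℝ × Space | p q.1 q.2})
    {J : Set ℝ} (hJ : MeasurableSet J) (h : ∀ t ∈ J, ∀ᵐ k, p t k) : ∀ᵐ k, ∀ᵐ t, t ∈ J → p t k := by
  have hS : MeasurableSet {q : ℝ × Space | q.1 ∈ J → p q.1 q.2} := by
    have : {q : ℝ × Space | q.1 ∈ J → p q.1 q.2} = (Prod.fst ⁻¹' J)ᶜ ∪ {q | p q.1 q.2} := by
      ext q; simp [imp_iff_not_or]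
    rw [this]
    exact (hJ.preimage measurable_fst).compl.union hp
  have h1 : ∀ᵐ q ∂((volume : Measure ℝ).prod (volume : Measure Space)), q.1 ∈ J → p q.1 q.2 := by
    rw [Measure.ae_prod_iff_ae_ae hS]
    refine Filter.Eventually.of_forall fun t => ?_
    by_cases ht : t ∈ J
    · filter_upwards [h t ht] with k hk _ using hk
    · exact Filter.Eventually.of_forall fun k hk => absurd hk ht
  have h2 := Measure.ae_ae_comm (μ := (volume : Measure ℝ)) (ν := (volume : Measure Space))
    (p := fun t k => t ∈ J → p t k) hS
  rw [Measure.ae_prod_iff_ae_ae hS] at h1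
  exact h2.mp h1

/-- Variation of constants: multiplication by e^{-iσt⟨ξ⟩} removes the term iσ⟨ξ⟩U and leaves only
the source. Freezing f outside the interval gives a family on all of ℝ, bounded in H^s since the
factor is unimodular, although the source is controlled only in H^r. -/
theorem exists_profile {s r α β c : ℝ} {σ : ℤˣ} (hc : c ∈ Set.Ioo α β) {U z : ℝ → Space → ℂ}
    (hU : Bdd s U) (hz : Bdd r z)
    (h : ∀ t ∈ Set.Ioo α β, ∀ᵐ k, U t k = U c k +
      ∫ q in c..t, (Complex.I * ((σ : ℤ) : ℂ) * jb k * U q k + z q k)) :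
    ∃ f : ℝ → Space → ℂ, Bdd s f ∧
      Deriv f (fun t k => (Set.Ioo α β).indicator (fun t => wave (-σ) z t k) t) ∧
      ∀ t ∈ Set.Ioo α β, ∀ᵐ k, U t k = wave σ f t k := by
  have mj := measurable_jb
  have hE : Bdd (min (s - 1) r) fun q k => Complex.I * ((σ : ℤ) : ℂ) * jb k * U q k + z q k := by
    refine Bdd.add ((hU.mul_symbol (r := 1) (C := 1) (by fun_prop) fun t k => ?_).mono
      (min_le_left _ _)) (hz.mono (min_le_right _ _))
    have hj := jb_pos k
    rcases Int.units_eq_one_or σ with h | h <;> simp [h, abs_of_pos hj]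
  set E := fun q k => Complex.I * ((σ : ℤ) : ℂ) * jb k * U q k + z q k with hEdef
  set Ũ : ℝ → Space → ℂ := fun t k => U c k + ∫ q in c..t, E q k with hŨ
  have mŨ : Measurable fun p : ℝ × Space => Ũ p.1 p.2 :=
    ((hU.meas_slice c).comp measurable_snd).add (hE.measurable_primitive c)
  have hw := hz.wave (σ := -σ)
  have hw0 := hU.wave (σ := -σ)
  have hsgn : (((-σ : ℤˣ) : ℤ) : ℝ) = -((σ : ℤ) : ℝ) := by push_cast; rfl
  have h1 : ∀ᵐ k, ∀ᵐ t, t ∈ Set.Ioo α β → U t k = Ũ t k :=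
    ae_ae_swap (measurableSet_eq_fun hU.meas mŨ) measurableSet_Ioo h
  have h2 : ∀ᵐ k, ∀ t ∈ Set.Ioo α β,
      wave (-σ) Ũ t k = wave (-σ) U c k + ∫ q in c..t, wave (-σ) z q k := by
    filter_upwards [h1, hE.deriv_primitive (U c) c, hw.intervalIntegrable] with k hk hp hi t ht
    have hp' := (Prim.cexp ((((-σ : ℤˣ) : ℤ) : ℝ) * jb k)).mul hp
    have h3 := hp'.eq c t
    have h4 : (∫ q in c..t, wave (-σ) z q k) = ∫ r in c..t,
        (Complex.I * (((((-σ : ℤˣ) : ℤ) : ℝ) * jb k : ℝ) : ℂ) *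
          Complex.exp (r * (((((-σ : ℤˣ) : ℤ) : ℝ) * jb k : ℝ) : ℂ) * Complex.I) * Ũ r k +
        Complex.exp (r * (((((-σ : ℤˣ) : ℤ) : ℝ) * jb k : ℝ) : ℂ) * Complex.I) * E r k) := by
      refine intervalIntegral.integral_congr_ae ?_
      filter_upwards [hk] with q hq hq'
      have hm : q ∈ Set.Ioo α β :=
        Set.OrdConnected.uIcc_subset Set.ordConnected_Ioo hc ht (Set.uIoc_subset_uIcc hq')
      rw [← hq hm, hEdef, wave, hsgn]
      push_cast
      ring
    rw [h4, ← h3]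
    simp only [wave, intervalIntegral.integral_same, add_zero, hŨ]
    push_cast
    ring_nf
  have hinv : ∀ (g : ℝ → Space → ℂ) t k, wave σ (wave (-σ) g) t k = g t k := by
    intro g t k
    rw [wave, wave, ← mul_assoc, ← Complex.exp_add, hsgn]
    simp
  have hin : ∀ t ∈ Set.Ioo α β, ∀ k, ∫ q in c..t,
      (Set.Ioo α β).indicator (fun q => wave (-σ) z q k) q = ∫ q in c..t, wave (-σ) z q k := by
    intro t ht k
    refine intervalIntegral.integral_congr fun q hq => ?_
    exact Set.indicator_of_mem (Set.OrdConnected.uIcc_subset Set.ordConnected_Ioo hc ht hq) _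
  obtain ⟨C, hC, hb⟩ := hw0.bound
  refine ⟨fun t k => wave (-σ) U c k +
      ∫ q in c..t, (Set.Ioo α β).indicator (fun q => wave (-σ) z q k) q,
    Bdd.primitive hc (hw0.meas_slice c) hw hC fun t ht => ?_,
    (hw.indicator measurableSet_Ioo).deriv_primitive _ c, fun t ht => ?_⟩
  · refine (wn_mono_ae ?_).trans (hb t)
    filter_upwards [h2, h t ht] with k hk hk'
    have e : U t k = Ũ t k := hk'
    rw [← hk t ht, wave, wave, e]
  · filter_upwards [h2, h t ht] with k hk hk'
    rw [hk', wave, hin t ht, ← hk t ht]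
    exact (hinv Ũ t k).symm

end

section


/-! ### Tensor products as test functions -/

theorem spatial_eq_add (p : Spacetime) : embed (p 0) (spatial p) = p := by
  ext i; fin_cases i <;> rfl

theorem spatial_coord (p : Spacetime) (j : Fin 2) : spatial p j = p j.succ := by
  fin_cases j <;> rfl

/-- The spatial part, as a continuous linear map. -/
def spatialL : Spacetime →L[ℝ] Space :=
  LinearMap.toContinuousLinearMap
    { toFun := spatial
      map_add' := fun x y => by ext i; simp [spatial_coord]
      map_smul' := fun c x => by ext i; simp [spatial_coord] }

/-- The time, as a continuous linear map. -/
def timeL : Spacetime →L[ℝ] ℝ :=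
  LinearMap.toContinuousLinearMap
    { toFun := fun p => p 0
      map_add' := fun x y => by simp
      map_smul' := fun c x => by simp }

theorem timeL_apply (p : Spacetime) : timeL p = p 0 := rfl

theorem spatialL_apply (p : Spacetime) : spatialL p = spatial p := rfl

theorem spatial_eST_zero : spatial (eST 0) = 0 := by
  ext j; fin_cases j <;> simp [spatial, eST]

theorem spatial_eST_succ (j : Fin 2) : spatial (eST j.succ) = eSp j := by
  ext i; fin_cases i <;> fin_cases j <;> simp [spatial, eST, eSp]

theorem hasFDerivAt_tensor {χ : ℝ → ℝ} (hχ : ContDiff ℝ (⊤ : ℕ∞) χ) (η : 𝓢(Space, ℂ)) (p : Spacetime) :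
    HasFDerivAt (fun p : Spacetime => (χ (p 0) : ℂ) * η (spatial p))
      ((χ (p 0) : ℂ) • ((fderiv ℝ η (spatial p)).comp spatialL) +
        (η (spatial p)) • ((ContinuousLinearMap.toSpanSingleton ℝ ((deriv χ (p 0) : ℝ) : ℂ)).comp timeL)) p := by
  have h1 : HasFDerivAt (fun p : Spacetime => (χ (p 0) : ℂ))
      ((ContinuousLinearMap.toSpanSingleton ℝ ((deriv χ (p 0) : ℝ) : ℂ)).comp timeL) p :=
    (hasDerivAt_test hχ (p 0)).hasFDerivAt.comp p (f := fun p : Spacetime => p 0) timeL.hasFDerivAt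
  have h2 : HasFDerivAt (fun p : Spacetime => η (spatial p)) ((fderiv ℝ η (spatial p)).comp spatialL) p :=
    HasFDerivAt.comp p (f := spatial) (η.differentiableAt.hasFDerivAt) spatialL.hasFDerivAt
  exact h1.mul h2

theorem exists_tensor_test {I : Set ℝ} {χ : ℝ → ℝ} (hχ : ContDiff ℝ (⊤ : ℕ∞) χ)
    (hc : HasCompactSupport χ) (hs : tsupport χ ⊆ interior I) {η : 𝓢(Space, ℂ)}
    (hη : HasCompactSupport η) :
    ∃ ψ : 𝓢(Spacetime, ℂ), IsTest I ψ ∧ (∀ t, slice t ψ = (χ t : ℂ) • η) ∧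
      (∀ t, slice t (∂_{eST 0} ψ) = ((deriv χ t : ℝ) : ℂ) • η) ∧
      ∀ (j : Fin 2) t, slice t (∂_{eST j.succ} ψ) = (χ t : ℂ) • ∂_{eSp j} η := by
  have hsub : Function.support (fun p : Spacetime => (χ (p 0) : ℂ) * η (spatial p)) ⊆
      {p | p 0 ∈ tsupport χ ∧ spatial p ∈ tsupport η} := by
    intro p hp
    constructor
    · by_contra hcon
      exact hp (by simp [image_eq_zero_of_notMem_tsupport hcon])
    · by_contra hcon
      exact hp (by simp [image_eq_zero_of_notMem_tsupport hcon])
  have hcl : IsClosed {p : Spacetime | p 0 ∈ tsupport χ ∧ spatial p ∈ tsupport η} :=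
    ((isClosed_tsupport χ).preimage timeL.continuous).inter
      ((isClosed_tsupport η).preimage spatialL.continuous)
  have hts : tsupport (fun p : Spacetime => (χ (p 0) : ℂ) * η (spatial p)) ⊆
      {p | p 0 ∈ tsupport χ ∧ spatial p ∈ tsupport η} := closure_minimal hsub hcl
  have hcpt : HasCompactSupport fun p : Spacetime => (χ (p 0) : ℂ) * η (spatial p) := by
    have he : Continuous fun q : ℝ × Space => embed q.1 q.2 := by
      have : (fun q : ℝ × Space => embed q.1 q.2) =
          fun q => (EuclideanSpace.equiv (Fin 3) ℝ).symm ![q.1, q.2 0, q.2 1] := by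
        ext q i; fin_cases i <;> rfl
      rw [this]
      refine (EuclideanSpace.equiv (Fin 3) ℝ).symm.continuous.comp ?_
      refine continuous_pi fun i => ?_
      fin_cases i <;> simp <;> fun_prop
    refine ((hc.isCompact.prod hη.isCompact).image he).of_isClosed_subset (isClosed_tsupport _)
      (hts.trans fun p hp => ⟨(p 0, spatial p), ⟨hp.1, hp.2⟩, spatial_eq_add p⟩)
  have hsm : ContDiff ℝ (⊤ : ℕ∞) fun p : Spacetime => (χ (p 0) : ℂ) * η (spatial p) :=
    (Complex.ofRealCLM.contDiff.comp (hχ.comp timeL.contDiff)).mul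
      ((η.smooth _).comp spatialL.contDiff)
  refine ⟨hcpt.toSchwartzMap hsm, ⟨hcpt, fun p hp => hs (hts hp).1⟩, fun t => ?_, fun t => ?_,
    fun j t => ?_⟩
  · ext x
    rw [slice_apply]
    show (χ ((embed t x) 0) : ℂ) * η (spatial (embed t x)) = χ t * η x
    rw [embed_zero_apply, spatial_embed]
  · ext x
    rw [slice_apply, SchwartzMap.lineDerivOp_apply_eq_fderiv]
    show fderiv ℝ (fun p : Spacetime => (χ (p 0) : ℂ) * η (spatial p)) (embed t x) (eST 0) =
      ((deriv χ t : ℝ) : ℂ) * η x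
    rw [(hasFDerivAt_tensor hχ η _).fderiv]
    simp [spatialL_apply, timeL_apply, spatial_eST_zero]
    simp [eST, mul_comm]
  · ext x
    rw [slice_apply, SchwartzMap.lineDerivOp_apply_eq_fderiv]
    show fderiv ℝ (fun p : Spacetime => (χ (p 0) : ℂ) * η (spatial p)) (embed t x) (eST j.succ) =
      (χ t : ℂ) * (∂_{eSp j} η) x
    rw [(hasFDerivAt_tensor hχ η _).fderiv, SchwartzMap.lineDerivOp_apply_eq_fderiv]
    simp [spatialL_apply, timeL_apply, spatial_eST_succ]
    right; simp [eST]

end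

section


/-! ### Bilinear operators at a fixed time -/

/-- The bilinear operator with the symbol `m`, on the side of the frequencies. -/
def cm (m : Space → Space → ℂ) (F G : Space → ℂ) (k : Space) : ℂ :=
  ∫ l, m l (k - l) * (F l * G (k - l))

theorem cm_one (F G : Space → ℂ) : cm (fun _ _ => 1) F G = conv F G := by
  ext k; simp [cm, conv]

theorem bil_zero (m : Space → Space → ℂ) (a b : ℝ → Space → ℂ) (t : ℝ) :
    bil (fun _ _ => 0) m a b t = cm m (a t) (b t) := by
  ext k; simp [cm, bil]

/-- The three free evolutions combine to e^{itΦ} because the output frequency is l + (k - l). This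
is where the resonance function comes from. -/
theorem wave_cm {m : Space → Space → ℂ} {f g : ℝ → Space → ℂ} (σ₀ σ₁ σ₂ : ℤˣ) (t : ℝ) (k : Space) :
    wave (-σ₀) (fun t => cm m (wave σ₁ f t) (wave σ₂ g t)) t k =
      bil (ph ((σ₀ : ℤ) : ℝ) ((σ₁ : ℤ) : ℝ) ((σ₂ : ℤ) : ℝ)) m f g t k := by
  rw [wave, cm, bil, ← integral_const_mul]
  congr 1; ext l
  have hsgn : (((-σ₀ : ℤˣ) : ℤ) : ℝ) = -((σ₀ : ℤ) : ℝ) := by push_cast; rfl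
  have e : ∀ x y z : ℂ, Complex.exp x * (m l (k - l) * (Complex.exp y * f t l *
      (Complex.exp z * g t (k - l)))) =
      Complex.exp (x + y + z) * m l (k - l) * (f t l * g t (k - l)) := by
    intro x y z
    rw [Complex.exp_add, Complex.exp_add]; ring
  rw [wave, wave, e, ph, hsgn, add_sub_cancel]
  congr 3
  push_cast; ring

theorem ae_sub_left {p : Space → Prop} (h : ∀ᵐ l, p l) (k : Space) : ∀ᵐ l, p (k - l) :=
  (Measure.measurePreserving_sub_left volume k).quasiMeasurePreserving.ae h

theorem cm_congr {m : Space → Space → ℂ} {F G F' G' : Space → ℂ} (hF : F =ᵐ[volume] F')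
    (hG : G =ᵐ[volume] G') : cm m F G = cm m F' G' := by
  ext k
  refine integral_congr_ae ?_
  filter_upwards [hF, ae_sub_left hG k] with l h1 h2
  rw [h1, h2]

theorem conv_congr {F G F' G' : Space → ℂ} (hF : F =ᵐ[volume] F')
    (hG : G =ᵐ[volume] G') : conv F G = conv F' G' := by
  rw [← cm_one, ← cm_one, cm_congr hF hG]

section

variable {m : Space → Space → ℂ} {a b a' b' : ℝ → Space → ℂ} {r s s₁ s₂ p q C : ℝ}

theorem Adm.of_symbol (h : Expo (-r) (s₁ - p) (s₂ - q))
    (hmb : ∀ k l, ‖m k l‖ ≤ C * (jb k ^ p * jb l ^ q)) : Adm r s₁ s₂ fun k l => ‖m k l‖ₑ :=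
  Adm.of_bound_single (Adm.of_expo_wt h) fun k l => by
    rw [← ofReal_norm]; exact ENNReal.ofReal_le_ofReal (hmb k l)

theorem Bdd.cm (hm : Measurable fun p : Space × Space => m p.1 p.2)
    (hmb : ∀ k l, ‖m k l‖ ≤ C * (jb k ^ p * jb l ^ q)) (h : Expo (-r) (s₁ - p) (s₂ - q))
    (ha : Bdd s₁ a) (hb : Bdd s₂ b) : Bdd r fun t => cm m (a t) (b t) := by
  have := (Adm.of_symbol h hmb).bdd (Φ := fun _ _ => 0) measurable_const hm ha hb
  simpa only [← bil_zero] using this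

theorem Bdd.integrable_cm (hm : Measurable fun p : Space × Space => m p.1 p.2)
    (hmb : ∀ k l, ‖m k l‖ ≤ C * (jb k ^ p * jb l ^ q)) (h : Expo (-r) (s₁ - p) (s₂ - q))
    (ha : Bdd s₁ a) (hb : Bdd s₂ b) (t : ℝ) :
    ∀ᵐ k, Integrable fun l => m l (k - l) * (a t l * b t (k - l)) := by
  have := bil_integrand_integrable (Adm.of_symbol h hmb) (Φ := fun _ _ => 0) measurable_const hm
    ha hb t
  simpa using this

theorem Bdd.conv (h : Expo (-r) s₁ s₂) (ha : Bdd s₁ a) (hb : Bdd s₂ b) :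
    Bdd r fun t => conv (a t) (b t) := by
  have := Bdd.cm (m := fun _ _ => 1) (C := 1) (p := 0) (q := 0) (r := r) measurable_const (by simp)
    (by simpa using h) ha hb
  simpa only [cm_one] using this

theorem Bdd.integrable_conv (h : Expo (-r) s₁ s₂) (ha : Bdd s₁ a) (hb : Bdd s₂ b) (t : ℝ) :
    ∀ᵐ k, Integrable fun l => a t l * b t (k - l) := by
  have := Bdd.integrable_cm (m := fun _ _ => 1) (C := 1) (p := 0) (q := 0) (r := r)
    measurable_const (by simp) (by simpa using h) ha hb t
  simpa using this

theorem Deriv.conv {r₁ r₂ s₁' s₂' : ℝ} (h : Expo (-r) s₁ s₂) (h₁ : Expo (-r₁) s₁' s₂)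
    (h₂ : Expo (-r₂) s₁ s₂') (ha : Bdd s₁ a) (hb : Bdd s₂ b) (ha' : Bdd s₁' a') (hb' : Bdd s₂' b')
    (hda : Deriv a a') (hdb : Deriv b b') :
    Deriv (fun t => CSH.conv (a t) (b t)) fun t k =>
      CSH.conv (a' t) (b t) k + CSH.conv (a t) (b' t) k := by
  have A1 : ∀ {ρ x y : ℝ}, Expo (-ρ) x y → Adm ρ x y fun _ _ => ‖(1 : ℂ)‖ₑ := fun h =>
    Adm.of_symbol (C := 1) (p := 0) (q := 0) (m := fun _ _ => 1) (by simpa using h) (by simp)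
  have A0 : Adm r s₁ s₂ fun k l => ‖Complex.I * ((0 : ℝ) : ℂ) * 1‖ₑ :=
    Adm.of_symbol (C := 0) (p := 0) (q := 0) (m := fun _ _ => Complex.I * ((0 : ℝ) : ℂ) * 1)
      (by simpa using h) (by simp)
  have := Deriv.bil (Φ := fun _ _ => 0) (m := fun _ _ => 1) measurable_const measurable_const
    ha hb ha' hb' hda hdb (A1 h) A0 (A1 h₁) (A1 h₂)
  simp only [bil_zero, cm_one] at this
  have e : ∀ t k, CSH.cm (fun _ _ => Complex.I * ((0 : ℝ) : ℂ) * 1) (a t) (b t) k = 0 := by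
    intro t k; simp [CSH.cm]
  simp only [e, zero_add] at this
  have e2 : CSH.bil (fun _ _ => 0) (fun _ _ => 1) a b = fun t => CSH.conv (a t) (b t) := by
    funext t; rw [bil_zero, cm_one]
  rwa [e2] at this

end

/-! ### Complex conjugation -/

/-- The Fourier transform of the complex conjugate. -/
def conjF (F : Space → ℂ) (k : Space) : ℂ := (starRingEnd ℂ) (F (-k))

theorem conjF_congr {F G : Space → ℂ} (h : F =ᵐ[volume] G) : conjF F =ᵐ[volume] conjF G := by
  filter_upwards [(Measure.measurePreserving_neg (volume : Measure Space)).quasiMeasurePreserving.ae h]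
    with k hk
  simp only [conjF]
  rw [hk]

theorem Bdd.conj {s : ℝ} {a : ℝ → Space → ℂ} (h : Bdd s a) : Bdd s fun t => conjF (a t) := by
  obtain ⟨C, hC, hb⟩ := h.bound
  refine ⟨?_, C, hC, fun t => le_trans (le_of_eq ?_) (hb t)⟩
  · have h1 := h.meas.comp (measurable_fst.prodMk measurable_snd.neg)
    exact Complex.continuous_conj.measurable.comp h1
  · rw [wn, wn, ← lintegral_neg_eq_self]
    congr 1; ext k
    rw [conjF, neg_neg, wt_neg, ← ofReal_norm, ← ofReal_norm, Complex.norm_conj]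

theorem Prim.conj {u u' : ℝ → ℂ} (h : Prim u u') :
    Prim (fun t => (starRingEnd ℂ) (u t)) fun t => (starRingEnd ℂ) (u' t) := by
  have z : Prim (fun _ : ℝ => (0 : ℝ)) fun _ => 0 := ⟨by simp, by simp⟩
  have := h.re.of_re_im (z.sub h.im)
  convert this using 1 <;>
  · ext t; apply Complex.ext <;> simp

theorem Deriv.conj {a a' : ℝ → Space → ℂ} (h : Deriv a a') :
    Deriv (fun t => conjF (a t)) fun t => conjF (a' t) := by
  filter_upwards [(Measure.measurePreserving_neg (volume : Measure Space)).quasiMeasurePreserving.ae h]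
    with k hk
  exact hk.conj

/-- Conjugation reverses the sign of a half wave; the bracket is even, so the reflection of the
frequency does no harm. -/
theorem wave_conjF (σ : ℤˣ) (f : ℝ → Space → ℂ) (t : ℝ) (k : Space) :
    wave σ (fun t => conjF (f t)) t k = conjF (wave (-σ) f t) k := by
  have hsgn : (((-σ : ℤˣ) : ℤ) : ℝ) = -((σ : ℤ) : ℝ) := by push_cast; rfl
  rw [wave, conjF, conjF, wave, map_mul, ← Complex.exp_conj, jb_neg, hsgn]
  congr 2
  simp

/-! ### Bounded families -/

theorem Bdd.memLp {s : ℝ} {a : ℝ → Space → ℂ} (h : Bdd s a) (hs : 0 ≤ s) (t : ℝ) :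
    MemLp (a t) 2 := by
  rw [memLp_iff_lintegral (h.meas_slice t)]
  have := (h.mono hs).wn_lt_top t
  simpa only [wn, wt_zero, one_mul] using this

/-- Multiplication by a power of `⟨ξ⟩`. -/
theorem Bdd.jb_mul {s : ℝ} {a : ℝ → Space → ℂ} (h : Bdd s a) (r : ℝ) :
    Bdd (s - r) fun t k => ((jb k ^ r : ℝ) : ℂ) * a t k := by
  have := measurable_jb
  refine h.mul_symbol (C := 1) (by fun_prop) fun t k => ?_
  rw [Complex.norm_real, Real.norm_eq_abs, abs_of_pos (Real.rpow_pos_of_pos (jb_pos k) _), one_mul]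

/-- The given identity holds, at each time, off a null set that depends on the time. Redefining the
family by its primitive removes this dependence and extends it beyond the interval. -/
theorem exists_deriv_version {s r α β c : ℝ} (hc : c ∈ Set.Ioo α β) {x y : ℝ → Space → ℂ}
    (hx : Bdd s x) (hy : Bdd r y)
    (h : ∀ t ∈ Set.Ioo α β, ∀ᵐ k, x t k = x c k + ∫ q in c..t, y q k) :
    ∃ x' : ℝ → Space → ℂ, Bdd s x' ∧
      Deriv x' (fun t k => (Set.Ioo α β).indicator (fun t => y t k) t) ∧
      ∀ t ∈ Set.Ioo α β, x t =ᵐ[volume] x' t := by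
  obtain ⟨C, hC, hb⟩ := hx.bound
  refine ⟨fun t k => x c k + ∫ q in c..t, (Set.Ioo α β).indicator (fun t => y t k) q,
    Bdd.primitive hc (hx.meas_slice c) hy hC fun t ht => ?_,
    (hy.indicator measurableSet_Ioo).deriv_primitive _ c, fun t ht => ?_⟩
  · refine le_trans (le_of_eq ?_) (hb t)
    refine lintegral_congr_ae ?_
    filter_upwards [h t ht] with k hk
    rw [hk]
  · filter_upwards [h t ht] with k hk
    rw [hk]
    congr 1
    refine intervalIntegral.integral_congr fun q hq => ?_
    exact (Set.indicator_of_mem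
      (Set.OrdConnected.uIcc_subset Set.ordConnected_Ioo hc ht hq) fun t => y t k).symm

/-! ### Splittings of the derivative of a profile -/

/-- On `J`, the family `h` is the sum of a derivative of a regular family and a regular family. -/
def Split (J : Set ℝ) (r rG : ℝ) (h : ℝ → Space → ℂ) : Prop :=
  ∃ G G' P' : ℝ → Space → ℂ, Deriv G G' ∧ HT r G ∧ Bdd rG G ∧ Bdd r P' ∧
    ∀ᵐ k, ∀ᵐ t, t ∈ J → h t k = G' t k + P' t k

section

variable {J : Set ℝ} {r rG : ℝ} {h h' : ℝ → Space → ℂ}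

theorem Split.of_bdd (hh : Bdd r h) : Split J r rG h :=
  ⟨fun _ _ => 0, fun _ _ => 0, h, Deriv.zero, HT.zero r, Bdd.zero rG, hh, by simp⟩

theorem Split.add (H : Split J r rG h) (H' : Split J r rG h') :
    Split J r rG fun t k => h t k + h' t k := by
  obtain ⟨G, G', P', h1, h2, h3, h4, h5⟩ := H
  obtain ⟨K, K', Q', k1, k2, k3, k4, k5⟩ := H'
  refine ⟨_, _, _, h1.add k1, h2.add k2, h3.add k3, h4.add k4, ?_⟩
  filter_upwards [h5, k5] with k e1 e2
  filter_upwards [e1, e2] with t f1 f2 ht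
  rw [f1 ht, f2 ht]; ring

theorem Split.sum {ι : Type*} {h : ι → ℝ → Space → ℂ} (S : Finset ι)
    (H : ∀ i ∈ S, Split J r rG (h i)) : Split J r rG fun t k => ∑ i ∈ S, h i t k := by
  classical
  induction S using Finset.induction_on with
  | empty => simpa using Split.of_bdd (Bdd.zero r)
  | insert i S hi ih =>
    simp only [Finset.sum_insert hi]
    exact (H i (by simp)).add (ih fun j hj => H j (by simp [hj]))

theorem Split.congr (H : Split J r rG h) (e : ∀ᵐ k, ∀ᵐ t, t ∈ J → h' t k = h t k) :
    Split J r rG h' := by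
  obtain ⟨G, G', P', h1, h2, h3, h4, h5⟩ := H
  refine ⟨G, G', P', h1, h2, h3, h4, ?_⟩
  filter_upwards [h5, e] with k e1 e2
  filter_upwards [e1, e2] with t f1 f2 ht
  rw [f2 ht, f1 ht]

theorem Split.mul_symbol {p C : ℝ} {m : Space → ℂ} (H : Split J r rG h) (hm : Measurable m)
    (hb : ∀ k, ‖m k‖ ≤ C * jb k ^ p) : Split J (r - p) (rG - p) fun t k => m k * h t k := by
  obtain ⟨G, G', P', h1, h2, h3, h4, h5⟩ := H
  have hm' : Measurable fun p : ℝ × Space => m p.2 := hm.comp measurable_snd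
  refine ⟨_, _, _, h1.const_mul m, h2.mul_symbol hm hb, h3.mul_symbol (m := fun _ => m) hm' fun _ => hb,
    h4.mul_symbol (m := fun _ => m) hm' fun _ => hb, ?_⟩
  filter_upwards [h5] with k e1
  filter_upwards [e1] with t f1 ht
  rw [f1 ht]; ring

/-- Subtracting the boundary term G from the profile leaves a family with derivative P', bounded in
H^r. So the profile is Lipschitz in H^r up to G. -/
theorem Split.profile {s α β c : ℝ} (hc : c ∈ Set.Ioo α β) {g : ℝ → Space → ℂ} (hg : Bdd s g)
    (hd : Deriv g fun t k => (Set.Ioo α β).indicator (fun t => h t k) t) (hs : s ≤ rG)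
    (H : Split (Set.Ioo α β) r rG h) :
    ∃ gs gs' G : ℝ → Space → ℂ, Bdd s gs ∧ Deriv gs gs' ∧ Bdd r gs' ∧ HT r G ∧ Bdd rG G ∧
      ∀ t ∈ Set.Ioo α β, ∀ᵐ k, g t k = gs t k + G t k := by
  obtain ⟨G, G', P', h1, h2, h3, h4, h5⟩ := H
  have hx : Bdd s fun t k => g t k - G t k := hg.sub (h3.mono hs)
  obtain ⟨gs, b1, b2, b3⟩ := exists_deriv_version hc hx h4 fun t ht => by
    filter_upwards [hd, h1, h5, h4.intervalIntegrable] with k d1 d2 d3 d4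
    have e1 := d1.eq c t
    have e2 := d2.eq c t
    have e3 : ∫ q in c..t, (Set.Ioo α β).indicator (fun t => h t k) q =
        ∫ q in c..t, (G' q k + P' q k) := by
      refine intervalIntegral.integral_congr_ae ?_
      filter_upwards [d3] with q hq hq'
      have hm : q ∈ Set.Ioo α β :=
        Set.OrdConnected.uIcc_subset Set.ordConnected_Ioo hc ht (Set.uIoc_subset_uIcc hq')
      rw [Set.indicator_of_mem hm, hq hm]
    rw [e3, intervalIntegral.integral_add (d2.int _ _) (d4 _ _), ← e2] at e1
    linear_combination e1
  refine ⟨gs, _, G, b1, b2, h4.indicator measurableSet_Ioo, h2, h3, fun t ht => ?_⟩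
  filter_upwards [b3 t ht] with k hk
  rw [← hk]; ring

end

end

section


/-! ### The nonlinearities on the side of the frequencies -/

theorem sum_units {M : Type*} [AddCommMonoid M] (f : ℤˣ → M) : ∑ σ, f σ = f 1 + f (-1) := by
  have : (Finset.univ : Finset ℤˣ) = {1, -1} := rfl
  rw [this, Finset.sum_pair (by decide)]

/-- The symbol of `-i∂_ν`, where `∂_0` acts as `iσ⟨∇⟩`. -/
def dsym (σ : ℤˣ) (ν : Fin 3) (k : Space) : ℝ := ![((σ : ℤ) : ℝ) * jb k, fq k 0, fq k 1] ν

theorem measurable_dsym (σ : ℤˣ) (ν : Fin 3) : Measurable (dsym σ ν) := by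
  have h1 := measurable_jb
  have h2 := measurable_fq
  fin_cases ν
  · exact h1.const_mul _
  · exact h2 0
  · exact h2 1

theorem abs_unit_mul (σ : ℤˣ) (x : ℝ) : |((σ : ℤ) : ℝ) * x| = |x| :=
  abs_mul_of_sq (sq_unit_sign σ) x

theorem abs_dsym_le (σ : ℤˣ) (ν : Fin 3) (k : Space) : |dsym σ ν k| ≤ jb k := by
  fin_cases ν
  · exact (abs_unit_mul σ _).le.trans (abs_of_pos (jb_pos k)).le
  · exact abs_fq_le_jb k 0
  · exact abs_fq_le_jb k 1

theorem dsym_neg (σ : ℤˣ) (ν : Fin 3) (k : Space) : dsym σ ν (-k) = -dsym (-σ) ν k := by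
  fin_cases ν <;> simp [dsym, jb_neg, fq_neg]

/-- The Fourier transform of `u_+ + u_-`. -/
def totF (U : ℤˣ → ℝ → Space → ℂ) (t : ℝ) (k : Space) : ℂ := ∑ σ, U σ t k

/-- The Fourier transform of the first derivatives. -/
def gradF (U : ℤˣ → ℝ → Space → ℂ) (ν : Fin 3) (t : ℝ) (k : Space) : ℂ :=
  ∑ σ, Complex.I * dsym σ ν k * U σ t k

theorem bdd_dsym {s : ℝ} {a : ℝ → Space → ℂ} (h : Bdd s a) (σ : ℤˣ) (ν : Fin 3) :
    Bdd (s - 1) fun t k => Complex.I * dsym σ ν k * a t k := by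
  have := measurable_dsym σ ν
  refine h.mul_symbol (C := 1) (by fun_prop) fun t k => ?_
  rw [norm_mul, Complex.norm_I, Complex.norm_real, Real.norm_eq_abs, one_mul, one_mul, Real.rpow_one]
  exact abs_dsym_le σ ν k

section

variable {U : ℤˣ → ℝ → Space → ℂ} {s : ℝ}

theorem bdd_totF (h : ∀ σ, Bdd s (U σ)) : Bdd s (totF U) := Bdd.sum _ fun σ _ => h σ

theorem bdd_gradF (h : ∀ σ, Bdd s (U σ)) (ν : Fin 3) : Bdd (s - 1) (gradF U ν) :=
  Bdd.sum _ fun σ _ => bdd_dsym (h σ) σ ν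

end

/-- `U_±` are the Fourier transforms of `u_±` on `I`, and they are bounded with values in `H^s`. -/
structure HalfRep (I : Set ℝ) (s : ℝ) (u : ℤˣ → ℝ → 𝓢'(Space, ℂ)) (U : ℤˣ → ℝ → Space → ℂ) :
    Prop where
  bdd : ∀ σ, Bdd s (U σ)
  rep : ∀ σ, ∀ t ∈ I, RepT (u σ t) (U σ t)
  cont : ∀ σ, ∀ η : 𝓢(Space, ℂ), ContinuousOn (fun t => ∫ k, U σ t k * 𝓕⁻ η k) I

section

variable {I : Set ℝ} {s t : ℝ} {u : ℤˣ → ℝ → 𝓢'(Space, ℂ)} {U : ℤˣ → ℝ → Space → ℂ}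

theorem HalfRep.total (h : HalfRep I s u U) (hs : 0 ≤ s) (ht : t ∈ I) :
    RepT (CSH.total u t) (totF U t) := by
  have := (h.rep 1 t ht).add (h.rep (-1) t ht) ((h.bdd 1).memLp hs t) ((h.bdd (-1)).memLp hs t)
  refine this.congr (Filter.Eventually.of_forall fun k => ?_)
  rw [totF, sum_units]

theorem HalfRep.grad (h : HalfRep I s u U) (hs : 0 ≤ s) (ht : t ∈ I) (ν : Fin 3) :
    RepT (CSH.grad u t ν) (gradF U ν t) := by
  have h2 : ∀ j : Fin 2, RepT (∂_{eSp j} (CSH.total u t)) (gradF U j.succ t) := fun j => by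
    refine ((h.total hs ht).lineDeriv j).congr (Filter.Eventually.of_forall fun k => ?_)
    simp only [totF, gradF, sum_units]
    fin_cases j <;> simp [dsym] <;> ring
  fin_cases ν
  · have h1 := (((h.rep 1 t ht).sub (h.rep (-1) t ht) ((h.bdd 1).memLp hs t)
      ((h.bdd (-1)).memLp hs t)).jap 1).smul Complex.I
    refine h1.congr (Filter.Eventually.of_forall fun k => ?_)
    simp [gradF, dsym]
    ring
  · exact h2 0
  · exact h2 1

theorem HalfRep.total_pf (h : HalfRep I s u U) (hs : 0 ≤ s) (ht : t ∈ I) :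
    PF (toFn (CSH.total u t)) (totF U t) :=
  (h.total hs ht).toFn ((bdd_totF h.bdd).memLp hs t) ((bdd_totF h.bdd).meas_slice t)

theorem HalfRep.grad_pf (h : HalfRep I s u U) (hs : 1 ≤ s) (ht : t ∈ I) (ν : Fin 3) :
    PF (toFn (CSH.grad u t ν)) (gradF U ν t) :=
  (h.grad (by linarith) ht ν).toFn ((bdd_gradF h.bdd ν).memLp (by linarith) t)
    ((bdd_gradF h.bdd ν).meas_slice t)

end

/-- The Fourier transform of `|φ|²`. -/
def sqF (U : ℤˣ → ℝ → Space → ℂ) (t : ℝ) : Space → ℂ := conv (conjF (totF U t)) (totF U t)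

/-- The Fourier transform of `|φ|^{2n} φ`. -/
def powF (U : ℤˣ → ℝ → Space → ℂ) : ℕ → ℝ → Space → ℂ
  | 0 => totF U
  | n + 1 => fun t => conv (powF U n t) (sqF U t)

/-- The Fourier transform of `Q_{νρ}(φ̄, φ)`. -/
def QF (U : ℤˣ → ℝ → Space → ℂ) (ν ρ : Fin 3) (t : ℝ) (k : Space) : ℂ :=
  conv (conjF (gradF U ν t)) (gradF U ρ t) k - conv (conjF (gradF U ρ t)) (gradF U ν t) k

/-- The Fourier transform of `A^ρ |φ|²`. -/
def cubicF (UA : Fin 3 → ℤˣ → ℝ → Space → ℂ) (U : ℤˣ → ℝ → Space → ℂ) (ρ : Fin 3) (t : ℝ)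
    (k : Space) : ℂ := metric ρ * conv (totF (UA ρ) t) (sqF U t) k

/-- The Fourier transform of `2i A_μ ∂^μ φ`. -/
def roughF (UA : Fin 3 → ℤˣ → ℝ → Space → ℂ) (U : ℤˣ → ℝ → Space → ℂ) (t : ℝ) (k : Space) : ℂ :=
  2 * Complex.I * ∑ μ, conv (totF (UA μ) t) (fun k => metric μ * gradF U μ t k) k

/-- The Fourier transform of `A_μ A^μ φ - φ V'(|φ|²) + φ`. -/
def mildF (V : Polynomial ℝ) (UA : Fin 3 → ℤˣ → ℝ → Space → ℂ) (U : ℤˣ → ℝ → Space → ℂ)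
    (t : ℝ) (k : Space) : ℂ :=
  ∑ μ, metric μ * conv (totF (UA μ) t) (conv (totF (UA μ) t) (totF U t)) k -
    ∑ n ∈ Finset.range (V.derivative.natDegree + 1), (V.derivative.coeff n : ℂ) * powF U n t k +
    totF U t k

/-- The Fourier transform of the function part of `M_μ`. -/
def MF (κ : ℝ) (UA : Fin 3 → ℤˣ → ℝ → Space → ℂ) (U : ℤˣ → ℝ → Space → ℂ) (μ : Fin 3) (t : ℝ)
    (k : Space) : ℂ :=
  -(κ⁻¹ : ℝ) * ∑ ν, ∑ ρ, (eps μ ν ρ * (metric ν * metric ρ) : ℝ) * (-Complex.I * QF U ν ρ t k) +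
    totF (UA μ) t k

theorem bdd_mul_metric {s : ℝ} {a : ℝ → Space → ℂ} (h : Bdd s a) (μ : Fin 3) :
    Bdd s fun t k => (metric μ : ℂ) * a t k := h.const_mul _

section

variable {UA : Fin 3 → ℤˣ → ℝ → Space → ℂ} {U : ℤˣ → ℝ → Space → ℂ} {δ : ℝ}

/-- H¹ just fails to be an algebra in two dimensions, so products are kept in all H^{1-δ}. With two
factors in H^{1-δ/4} the exponents sum to 1 + δ/2. -/
theorem Bdd.conv_one {a b : ℝ → Space → ℂ} (ha : ∀ δ, 0 < δ → δ ≤ 1 → Bdd (1 - δ) a)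
    (hb : ∀ δ, 0 < δ → δ ≤ 1 → Bdd (1 - δ) b) (h0 : 0 < δ) (h1 : δ ≤ 1) :
    Bdd (1 - δ) fun t => CSH.conv (a t) (b t) :=
  Bdd.conv (by constructor <;> linarith) (ha (δ / 4) (by linarith) (by linarith))
    (hb (δ / 4) (by linarith) (by linarith))

theorem bdd_sqF (h : ∀ σ, Bdd 1 (U σ)) (h0 : 0 < δ) (h1 : δ ≤ 1) : Bdd (1 - δ) (sqF U) :=
  Bdd.conv_one (fun δ h0 _ => (bdd_totF h).conj.mono (by linarith))
    (fun δ h0 _ => (bdd_totF h).mono (by linarith)) h0 h1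

theorem bdd_powF (h : ∀ σ, Bdd 1 (U σ)) (n : ℕ) : ∀ δ, 0 < δ → δ ≤ 1 → Bdd (1 - δ) (powF U n) := by
  induction n with
  | zero => exact fun δ h0 _ => (bdd_totF h).mono (by linarith)
  | succ n ih => exact fun δ h0 h1 => Bdd.conv_one ih (fun δ h0 h1 => bdd_sqF h h0 h1) h0 h1

theorem bdd_QF (h : ∀ σ, Bdd 1 (U σ)) (ν ρ : Fin 3) (h0 : 0 < δ) : Bdd (-1 - δ) (QF U ν ρ) := by
  have hg := bdd_gradF h
  exact (Bdd.conv (by constructor <;> linarith) (hg ν).conj (hg ρ)).sub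
    (Bdd.conv (by constructor <;> linarith) (hg ρ).conj (hg ν))

theorem bdd_cubicF (hA : ∀ μ σ, Bdd (1 / 2) (UA μ σ)) (h : ∀ σ, Bdd 1 (U σ)) (ρ : Fin 3)
    (h0 : 0 < δ) (h1 : δ ≤ 1) : Bdd (1 / 2 - δ) (cubicF UA U ρ) :=
  bdd_mul_metric (Bdd.conv (by constructor <;> linarith) (bdd_totF (hA ρ))
    (bdd_sqF h (δ := δ / 2) (by linarith) (by linarith))) ρ

theorem bdd_roughF (hA : ∀ μ σ, Bdd (1 / 2) (UA μ σ)) (h : ∀ σ, Bdd 1 (U σ)) (h0 : 0 < δ) :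
    Bdd (-1 / 2 - δ) (roughF UA U) :=
  (Bdd.sum _ fun μ _ => Bdd.conv (by constructor <;> linarith) (bdd_totF (hA μ))
    (bdd_mul_metric (bdd_gradF h μ) μ)).const_mul _

theorem bdd_conv_tot (hA : ∀ μ σ, Bdd (1 / 2) (UA μ σ)) (h : ∀ σ, Bdd 1 (U σ)) (μ : Fin 3)
    (h0 : 0 < δ) : Bdd (1 / 2 - δ) fun t => conv (totF (UA μ) t) (totF U t) :=
  Bdd.conv (by constructor <;> linarith) (bdd_totF (hA μ)) (bdd_totF h)

theorem bdd_mildF (V : Polynomial ℝ) (hA : ∀ μ σ, Bdd (1 / 2) (UA μ σ)) (h : ∀ σ, Bdd 1 (U σ))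
    (h0 : 0 < δ) (h1 : δ ≤ 1) : Bdd (-δ) (mildF V UA U) := by
  refine ((Bdd.sum _ fun μ _ => bdd_mul_metric (Bdd.conv ?_ (bdd_totF (hA μ))
    (bdd_conv_tot hA h μ (δ := δ / 2) (by linarith))) μ).sub ?_).add ?_
  · constructor <;> linarith
  · exact Bdd.sum _ fun n _ => ((bdd_powF h n 1 one_pos le_rfl).mono (by linarith)).const_mul _
  · exact (bdd_totF h).mono (by linarith)

theorem bdd_MF (κ : ℝ) (hA : ∀ μ σ, Bdd (1 / 2) (UA μ σ)) (h : ∀ σ, Bdd 1 (U σ)) (μ : Fin 3)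
    (h0 : 0 < δ) : Bdd (-1 - δ) (MF κ UA U μ) :=
  ((Bdd.sum _ fun ν _ => Bdd.sum _ fun ρ _ =>
    ((bdd_QF h ν ρ h0).const_mul _).const_mul _).const_mul _).add
      ((bdd_totF (hA μ)).mono (by linarith))

variable {I : Set ℝ} {t : ℝ} {A : Fin 3 → ℤˣ → ℝ → 𝓢'(Space, ℂ)} {φ : ℤˣ → ℝ → 𝓢'(Space, ℂ)}

theorem pf_sq (h : HalfRep I 1 φ U) (ht : t ∈ I) :
    PF (fun x => ((‖toFn (total φ t) x‖ ^ 2 : ℝ) : ℂ)) (sqF U t) := by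
  have h1 := h.total_pf (by norm_num) ht
  have hb := bdd_sqF h.bdd (δ := 1) one_pos le_rfl
  have h2 := (h1.conj.mul h1).toPF (hb.memLp (by norm_num) t) (hb.meas_slice t)
  have e : (fun x => ((‖toFn (total φ t) x‖ ^ 2 : ℝ) : ℂ)) =
      fun x => (starRingEnd ℂ) (toFn (total φ t) x) * toFn (total φ t) x := by
    ext x; rw [Complex.conj_mul']; push_cast; rfl
  rw [e]
  exact h2

theorem pf_pow (h : HalfRep I 1 φ U) (ht : t ∈ I) (n : ℕ) :
    PF (fun x => toFn (total φ t) x * ((‖toFn (total φ t) x‖ ^ 2 : ℝ) : ℂ) ^ n) (powF U n t) := by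
  induction n with
  | zero =>
    simp only [pow_zero, mul_one]
    exact h.total_pf (by norm_num) ht
  | succ n ih =>
    have hb := bdd_powF h.bdd (n + 1) 1 one_pos le_rfl
    have h1 := (ih.mul (pf_sq h ht)).toPF (hb.memLp (by norm_num) t) (hb.meas_slice t)
    have e : (fun x => toFn (total φ t) x * ((‖toFn (total φ t) x‖ ^ 2 : ℝ) : ℂ) ^ (n + 1)) =
        fun x => toFn (total φ t) x * ((‖toFn (total φ t) x‖ ^ 2 : ℝ) : ℂ) ^ n *
          ((‖toFn (total φ t) x‖ ^ 2 : ℝ) : ℂ) := by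
      ext x; rw [pow_succ, mul_assoc]
    rw [e]
    exact h1

theorem wf_nullQ (h : HalfRep I 1 φ U) (ht : t ∈ I) (ν ρ : Fin 3) :
    WF (nullQ φ t ν ρ) (QF U ν ρ t) :=
  ((h.grad_pf le_rfl ht ν).conj.mul (h.grad_pf le_rfl ht ρ)).sub
    ((h.grad_pf le_rfl ht ρ).conj.mul (h.grad_pf le_rfl ht ν))

theorem nullQ_im (φ : ℤˣ → ℝ → 𝓢'(Space, ℂ)) (t : ℝ) (ν ρ : Fin 3) (x : Space) :
    ((nullQ φ t ν ρ x).im : ℂ) = -Complex.I * nullQ φ t ν ρ x := by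
  apply Complex.ext
  · simp
  · simp [nullQ]; ring

theorem wf_fnM (κ : ℝ) (hA : ∀ μ, HalfRep I (1 / 2) (A μ) (UA μ)) (h : HalfRep I 1 φ U)
    (ht : t ∈ I) (μ : Fin 3) : WF (fnM κ A φ μ t) (MF κ UA U μ t) := by
  have h1 := ((WF.sum Finset.univ fun ν _ => WF.sum Finset.univ fun ρ _ =>
    ((wf_nullQ h ht ν ρ).const_mul (-Complex.I)).const_mul
      ((eps μ ν ρ * (metric ν * metric ρ) : ℝ) : ℂ)).const_mul (-(κ⁻¹ : ℝ) : ℂ)).add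
        ((hA μ).total_pf (by norm_num) ht).wf
  have e : fnM κ A φ μ t = fun x => -((κ⁻¹ : ℝ) : ℂ) * ∑ ν, ∑ ρ,
      ((eps μ ν ρ * (metric ν * metric ρ) : ℝ) : ℂ) * (-Complex.I * nullQ φ t ν ρ x) +
        toFn (total (A μ) t) x := by
    ext x
    rw [fnM]
    congr 2
    refine Finset.sum_congr rfl fun ν _ => Finset.sum_congr rfl fun ρ _ => ?_
    rw [← nullQ_im]
    push_cast; ring
  rw [e]
  exact h1

theorem wf_cubic (hA : ∀ μ, HalfRep I (1 / 2) (A μ) (UA μ)) (h : HalfRep I 1 φ U)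
    (ht : t ∈ I) (ρ : Fin 3) : WF (cubic A φ t ρ) (cubicF UA U ρ t) := by
  have h1 := (((hA ρ).total_pf (by norm_num) ht).mul (pf_sq h ht)).const_mul (metric ρ : ℂ)
  have e : cubic A φ t ρ = fun x => (metric ρ : ℂ) * (toFn (total (A ρ) t) x *
      ((‖toFn (total φ t) x‖ ^ 2 : ℝ) : ℂ)) := by
    ext x; rw [cubic, mul_assoc]
  rw [e]
  exact h1

theorem pf_A_phi (hA : ∀ μ, HalfRep I (1 / 2) (A μ) (UA μ)) (h : HalfRep I 1 φ U)
    (ht : t ∈ I) (μ : Fin 3) : PF (fun x => toFn (total (A μ) t) x * toFn (total φ t) x)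
      (conv (totF (UA μ) t) (totF U t)) := by
  have hb := bdd_conv_tot (fun μ => (hA μ).bdd) h.bdd μ (δ := 1 / 2) (by norm_num)
  exact (((hA μ).total_pf (by norm_num) ht).mul (h.total_pf (by norm_num) ht)).toPF
    (hb.memLp (by norm_num) t) (hb.meas_slice t)

theorem wf_fnN (V : Polynomial ℝ) (hA : ∀ μ, HalfRep I (1 / 2) (A μ) (UA μ)) (h : HalfRep I 1 φ U)
    (ht : t ∈ I) : WF (fnN V A φ t) fun k => roughF UA U t k + mildF V UA U t k := by
  have w1 := (WF.sum Finset.univ fun μ _ => ((hA μ).total_pf (by norm_num) ht).mul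
    ((h.grad_pf le_rfl ht μ).const_mul (metric μ : ℂ))).const_mul (2 * Complex.I)
  have w2 := WF.sum Finset.univ fun μ _ =>
    (((hA μ).total_pf (by norm_num) ht).mul (pf_A_phi hA h ht μ)).const_mul (metric μ : ℂ)
  have w3 := WF.sum (Finset.range (V.derivative.natDegree + 1)) fun n _ =>
    (pf_pow h ht n).wf.const_mul (V.derivative.coeff n : ℂ)
  have w4 := (h.total_pf (by norm_num) ht).wf
  have w := w1.add ((w2.sub w3).add w4)
  have e : fnN V A φ t = fun x => 2 * Complex.I * ∑ μ, toFn (total (A μ) t) x *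
      ((metric μ : ℂ) * toFn (grad φ t μ) x) + (∑ μ, (metric μ : ℂ) * (toFn (total (A μ) t) x *
        (toFn (total (A μ) t) x * toFn (total φ t) x)) -
      ∑ n ∈ Finset.range (V.derivative.natDegree + 1), (V.derivative.coeff n : ℂ) *
        (toFn (total φ t) x * ((‖toFn (total φ t) x‖ ^ 2 : ℝ) : ℂ) ^ n) + toFn (total φ t) x) := by
    ext x
    have e1 : (∑ μ, (metric μ : ℂ) * toFn (total (A μ) t) x ^ 2) * toFn (total φ t) x =
        ∑ μ, (metric μ : ℂ) * (toFn (total (A μ) t) x *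
          (toFn (total (A μ) t) x * toFn (total φ t) x)) := by
      rw [Finset.sum_mul]
      exact Finset.sum_congr rfl fun μ _ => by ring
    have e2 : toFn (total φ t) x * ((V.derivative.eval (‖toFn (total φ t) x‖ ^ 2) : ℝ) : ℂ) =
        ∑ n ∈ Finset.range (V.derivative.natDegree + 1), (V.derivative.coeff n : ℂ) *
        (toFn (total φ t) x * ((‖toFn (total φ t) x‖ ^ 2 : ℝ) : ℂ) ^ n) := by
      rw [Polynomial.eval_eq_sum_range, Complex.ofReal_sum, Finset.mul_sum]
      exact Finset.sum_congr rfl fun n _ => by push_cast; ring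
    rw [fnN, e1, e2]
    ring
  rw [e]
  exact w

end

end

section


/-! ### The half-wave system on the side of the frequencies -/

/-- `ψ` behaves like the tensor product `χ ⊗ η`. -/
structure IsTensor (χ : ℝ → ℝ) (η : 𝓢(Space, ℂ)) (ψ : 𝓢(Spacetime, ℂ)) : Prop where
  slice : ∀ t, slice t ψ = (χ t : ℂ) • η
  time : ∀ t, CSH.slice t (∂_{eST 0} ψ) = ((deriv χ t : ℝ) : ℂ) • η
  space : ∀ (j : Fin 2) t, CSH.slice t (∂_{eST j.succ} ψ) = (χ t : ℂ) • ∂_{eSp j} η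

theorem Bdd.integrable_test_pairing {r : ℝ} {a : ℝ → Space → ℂ} (h : Bdd r a) (θ : 𝓢(Space, ℂ))
    {g : ℝ → ℝ} (hg : Continuous g) (hc : HasCompactSupport g) :
    Integrable fun t => (g t : ℂ) * ∫ k, a t k * θ k := by
  have h1 := (h.integrable_pairing θ (T := tsupport g) hc.isCompact.measure_lt_top.ne).continuousOn_mul
    (Complex.continuous_ofReal.comp hg).continuousOn hc.isCompact
  refine (integrableOn_iff_integrable_of_support_subset fun t ht => subset_tsupport g ?_).mp h1
  intro h
  apply ht
  simp [h]

theorem setIntegral_test {I : Set ℝ} {χ : ℝ → ℝ} (hs : tsupport χ ⊆ I) (p q : ℝ → ℂ) :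
    ∫ t in I, (((deriv χ t : ℝ) : ℂ) * p t + χ t * q t) =
      ∫ t, (((deriv χ t : ℝ) : ℂ) * p t + χ t * q t) := by
  refine setIntegral_eq_integral_of_forall_compl_eq_zero fun t ht => ?_
  have h1 : t ∉ tsupport χ := fun h => ht (hs h)
  have h2 : t ∉ tsupport (deriv χ) := fun h => h1 (tsupport_deriv_subset h)
  simp [image_eq_zero_of_notMem_tsupport h1, image_eq_zero_of_notMem_tsupport h2]

section

variable {I : Set ℝ} {χ : ℝ → ℝ} {η : 𝓢(Space, ℂ)} {ψ : 𝓢(Spacetime, ℂ)}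

theorem SolvesHalfWave.tensor {σ : ℤˣ} {u : ℝ → 𝓢'(Space, ℂ)} {U : ℝ → Space → ℂ}
    {F : 𝓢(Spacetime, ℂ) → ℂ} (hI : MeasurableSet I) (hu : SolvesHalfWave I σ u F)
    (hrep : ∀ t ∈ I, RepT (u t) (U t)) (hψ : IsTest I ψ) (hT : IsTensor χ η ψ)
    (hs : tsupport χ ⊆ I) :
    ∫ t, (((deriv χ t : ℝ) : ℂ) * (∫ k, U t k * 𝓕⁻ η k) +
      χ t * ∫ k, (Complex.I * ((σ : ℤ) : ℂ) * jb k * U t k) * 𝓕⁻ η k) =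
        Complex.I * ((σ : ℤ) : ℂ) * (1 / 2) * F ψ := by
  rw [← setIntegral_test hs, mul_assoc, mul_assoc, ← mul_assoc ((σ : ℤ) : ℂ), ← hu ψ hψ,
    ← integral_const_mul]
  refine setIntegral_congr_fun hI fun t ht => ?_
  beta_reduce
  rw [hT.slice, hT.time, map_smul, map_smul, hrep t ht, (hrep t ht).jap 1]
  simp only [smul_eq_mul, Real.rpow_one]
  have e : ∫ k, (Complex.I * ((σ : ℤ) : ℂ) * jb k * U t k) * 𝓕⁻ η k =
      Complex.I * ((σ : ℤ) : ℂ) * ∫ k, (jb k * U t k) * 𝓕⁻ η k := by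
    rw [← integral_const_mul]
    congr 1; ext k; ring
  rw [e]
  linear_combination (((deriv χ t : ℝ) : ℂ) * ∫ k, U t k * 𝓕⁻ η k) * Complex.I_mul_I

theorem WF.pairing {f F : Space → ℂ} (h : WF f F) (c : ℂ) (η : 𝓢(Space, ℂ)) :
    ∫ x, f x * japS (-1) (c • η) x = c * ∫ k, (((jb k ^ (-1 : ℝ) : ℝ) : ℂ) * F k) * 𝓕⁻ η k := by
  rw [h.eq, ← integral_const_mul]
  congr 1; ext k
  rw [fourierInv_japS, FourierTransform.fourierInv_smul, smul_apply, smul_eq_mul]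
  ring

theorem fourierInv_lineDeriv (η : 𝓢(Space, ℂ)) (j : Fin 2) (k : Space) :
    𝓕⁻ (∂_{eSp j} η) k = -(Complex.I * fq k j) * 𝓕⁻ η k := by
  have ht : (fun k : Space => inner ℝ k (eSp j)).HasTemperateGrowth := by fun_prop
  rw [SchwartzMap.fourierInv_lineDerivOp_eq, smul_apply,
    SchwartzMap.smulLeftCLM_apply_apply ht]
  have : inner ℝ k (eSp j) = k j := by rw [eSp, EuclideanSpace.inner_single_right]; simp
  rw [this]
  simp [fq]
  ring

end

section

variable {I : Set ℝ} {α β c : ℝ}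

/-- Multiplied by -i the half-wave equation reads ∂_t u = iσ⟨∇⟩u - (iσ/2)F. Tensor products χ ⊗ η
are sufficient as test functions, and `hF` asks for the source only on these. -/
theorem half_wave_ode (hI : MeasurableSet I) (hJ : Set.Ioo α β ⊆ interior I)
    (hc : c ∈ Set.Ioo α β) {s r : ℝ} {σ : ℤˣ} {u : ℝ → 𝓢'(Space, ℂ)} {U z : ℝ → Space → ℂ}
    {F : 𝓢(Spacetime, ℂ) → ℂ} (hu : SolvesHalfWave I σ u F) (hrep : ∀ t ∈ I, RepT (u t) (U t))
    (hU : Bdd s U) (hcont : ∀ η : 𝓢(Space, ℂ), ContinuousOn (fun t => ∫ k, U t k * 𝓕⁻ η k) I)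
    (hz : Bdd r z)
    (hF : ∀ (χ : ℝ → ℝ) (η : 𝓢(Space, ℂ)) (ψ : 𝓢(Spacetime, ℂ)), ContDiff ℝ (⊤ : ℕ∞) χ →
      HasCompactSupport χ → tsupport χ ⊆ Set.Ioo α β → IsTensor χ η ψ →
      F ψ = ∫ t, (χ t : ℂ) * ∫ k, z t k * 𝓕⁻ η k) {t : ℝ} (ht : t ∈ Set.Ioo α β) :
    ∀ᵐ k, U t k = U c k + ∫ q in c..t, (Complex.I * ((σ : ℤ) : ℂ) * jb k * U q k +
      -(Complex.I * ((σ : ℤ) : ℂ) * (1 / 2)) * z q k) := by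
  have b1 : Bdd (s - 1) fun t k => Complex.I * ((σ : ℤ) : ℂ) * jb k * U t k := by
    have := (hU.jb_mul 1).const_mul (Complex.I * ((σ : ℤ) : ℂ))
    simpa only [Real.rpow_one, mul_assoc] using this
  have b2 := hz.const_mul (-(Complex.I * ((σ : ℤ) : ℂ) * (1 / 2)))
  set ρ := min (s - 1) r
  have b1' := b1.mono (min_le_left (s - 1) r)
  have b2' := b2.mono (min_le_right (s - 1) r)
  refine (hU.mono (show ρ ≤ s by have := min_le_left (s - 1) r; linarith)).eq_primitive_of_weak hc
    (b1'.add b2') (fun η => (hcont η).mono (hJ.trans interior_subset)) (fun χ h1 h2 h3 η hη => ?_) ht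
  obtain ⟨ψ, k1, k2, k3, k4⟩ := exists_tensor_test h1 h2 (h3.trans hJ) hη
  have e := hu.tensor hI hrep k1 ⟨k2, k3, k4⟩ (h3.trans (hJ.trans interior_subset))
  rw [hF χ η ψ h1 h2 h3 ⟨k2, k3, k4⟩] at e
  have i1 := (hU.integrable_test_pairing (𝓕⁻ η) (continuous_deriv_test h1) h2.deriv).add
    (b1.integrable_test_pairing (𝓕⁻ η) h1.continuous h2)
  have i2 := b2.integrable_test_pairing (𝓕⁻ η) h1.continuous h2
  have e2 : ∫ t, (χ t : ℂ) * ∫ k, (-(Complex.I * ((σ : ℤ) : ℂ) * (1 / 2)) * z t k) * 𝓕⁻ η k =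
      -(Complex.I * ((σ : ℤ) : ℂ) * (1 / 2)) * ∫ t, (χ t : ℂ) * ∫ k, z t k * 𝓕⁻ η k := by
    rw [← integral_const_mul]
    congr 1; ext t
    have : ∫ k, (-(Complex.I * ((σ : ℤ) : ℂ) * (1 / 2)) * z t k) * 𝓕⁻ η k =
        -(Complex.I * ((σ : ℤ) : ℂ) * (1 / 2)) * ∫ k, z t k * 𝓕⁻ η k := by
      rw [← integral_const_mul]
      congr 1; ext k; ring
    rw [this]; ring
  have e3 : (fun t => ((deriv χ t : ℝ) : ℂ) * (∫ k, U t k * 𝓕⁻ η k) + χ t * ∫ k,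
      (Complex.I * ((σ : ℤ) : ℂ) * jb k * U t k + -(Complex.I * ((σ : ℤ) : ℂ) * (1 / 2)) * z t k) *
        𝓕⁻ η k) = fun t => (((deriv χ t : ℝ) : ℂ) * (∫ k, U t k * 𝓕⁻ η k) +
      χ t * ∫ k, (Complex.I * ((σ : ℤ) : ℂ) * jb k * U t k) * 𝓕⁻ η k) +
      χ t * ∫ k, (-(Complex.I * ((σ : ℤ) : ℂ) * (1 / 2)) * z t k) * 𝓕⁻ η k := by
    ext t
    simp_rw [add_mul]
    rw [integral_add (b1.integrable_pair _ t) (b2.integrable_pair _ t)]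
    ring
  rw [e3]
  refine (integral_add i1 i2).trans ?_
  rw [e2]
  refine (congrArg (· + _) e).trans ?_
  ring

/-- The sources of the two signs are opposite and cancel in the sum. The time derivative of the
total field is thus explicit and loses only one derivative in space. -/
theorem total_ode (hI : MeasurableSet I) (hJ : Set.Ioo α β ⊆ interior I)
    (hc : c ∈ Set.Ioo α β) {s : ℝ} {u : ℤˣ → ℝ → 𝓢'(Space, ℂ)} {U : ℤˣ → ℝ → Space → ℂ}
    {F : 𝓢(Spacetime, ℂ) → ℂ} (hu : ∀ σ, SolvesHalfWave I σ (u σ) F) (hU : HalfRep I s u U)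
    {t : ℝ} (ht : t ∈ Set.Ioo α β) :
    ∀ᵐ k, totF U t k = totF U c k + ∫ q in c..t, gradF U 0 q k := by
  refine ((bdd_totF hU.bdd).mono (by linarith : s - 1 ≤ s)).eq_primitive_of_weak hc
    (bdd_gradF hU.bdd 0) (fun η => ?_) (fun χ h1 h2 h3 η hη => ?_) ht
  · have e : (fun t => ∫ k, totF U t k * 𝓕⁻ η k) = fun t => ∑ σ, ∫ k, U σ t k * 𝓕⁻ η k := by
      ext t
      simp_rw [totF, Finset.sum_mul]
      exact integral_finsetSum _ fun σ _ => (hU.bdd σ).integrable_pair _ t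
    rw [e]
    exact (continuousOn_finsetSum _ fun σ _ => hU.cont σ η).mono (hJ.trans interior_subset)
  · obtain ⟨ψ, k1, k2, k3, k4⟩ := exists_tensor_test h1 h2 (h3.trans hJ) hη
    have b1 : ∀ σ, Bdd (s - 1) fun t k => Complex.I * (((σ : ℤˣ) : ℤ) : ℂ) * jb k * U σ t k := by
      intro σ
      have := ((hU.bdd σ).jb_mul 1).const_mul (Complex.I * ((σ : ℤ) : ℂ))
      simpa only [Real.rpow_one, mul_assoc] using this
    have e := fun σ => (hu σ).tensor hI (hU.rep σ) k1 ⟨k2, k3, k4⟩ (h3.trans (hJ.trans interior_subset))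
    have i1 := fun σ => ((hU.bdd σ).integrable_test_pairing (𝓕⁻ η) (continuous_deriv_test h1)
      h2.deriv).add ((b1 σ).integrable_test_pairing (𝓕⁻ η) h1.continuous h2)
    have e3 : (fun t => ((deriv χ t : ℝ) : ℂ) * (∫ k, totF U t k * 𝓕⁻ η k) + χ t * ∫ k,
        gradF U 0 t k * 𝓕⁻ η k) = fun t => ∑ σ, (((deriv χ t : ℝ) : ℂ) * (∫ k, U σ t k * 𝓕⁻ η k) +
        χ t * ∫ k, (Complex.I * ((σ : ℤ) : ℂ) * jb k * U σ t k) * 𝓕⁻ η k) := by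
      ext t
      have g1 : ∫ k, totF U t k * 𝓕⁻ η k = ∑ σ, ∫ k, U σ t k * 𝓕⁻ η k := by
        simp_rw [totF, Finset.sum_mul]
        exact integral_finsetSum _ fun σ _ => (hU.bdd σ).integrable_pair _ t
      have g2 : ∫ k, gradF U 0 t k * 𝓕⁻ η k =
          ∑ σ : ℤˣ, ∫ k, (Complex.I * ((σ : ℤ) : ℂ) * jb k * U σ t k) * 𝓕⁻ η k := by
        rw [← integral_finsetSum _ fun σ _ => (b1 σ).integrable_pair _ t]
        congr 1; ext k
        rw [gradF, Finset.sum_mul]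
        refine Finset.sum_congr rfl fun σ _ => ?_
        simp [dsym, mul_assoc]
      rw [g1, g2, Finset.mul_sum, Finset.mul_sum, ← Finset.sum_add_distrib]
    rw [e3]
    refine (integral_finsetSum _ fun σ _ => i1 σ).trans ?_
    refine (Finset.sum_congr rfl fun σ _ => e σ).trans ?_
    rw [sum_units]
    simp

end

/-! ### The equations of the system -/

section

variable {UA : Fin 3 → ℤˣ → ℝ → Space → ℂ} {U : ℤˣ → ℝ → Space → ℂ} {δ : ℝ}
  {I : Set ℝ} {α β c : ℝ} {A : Fin 3 → ℤˣ → ℝ → 𝓢'(Space, ℂ)} {φ : ℤˣ → ℝ → 𝓢'(Space, ℂ)}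

theorem japInvN_tensor (V : Polynomial ℝ) (hI : MeasurableSet I)
    (hA : ∀ μ, HalfRep I (1 / 2) (A μ) (UA μ)) (h : HalfRep I 1 φ U) {χ : ℝ → ℝ}
    {η : 𝓢(Space, ℂ)} {ψ : 𝓢(Spacetime, ℂ)} (hs : tsupport χ ⊆ I) (hT : IsTensor χ η ψ) :
    japInvN V I A φ ψ = ∫ t, (χ t : ℂ) * ∫ k, (((jb k ^ (-1 : ℝ) : ℝ) : ℂ) *
      (roughF UA U t k + mildF V UA U t k)) * 𝓕⁻ η k := by
  have e := setIntegral_test hs (fun _ => 0) fun t => ∫ k, (((jb k ^ (-1 : ℝ) : ℝ) : ℂ) *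
      (roughF UA U t k + mildF V UA U t k)) * 𝓕⁻ η k
  simp only [mul_zero, zero_add] at e
  rw [← e, japInvN]
  refine setIntegral_congr_fun hI fun t ht => ?_
  beta_reduce
  rw [hT.slice, (wf_fnN V hA h ht).pairing]

/-- The part of `⟨∇⟩^{-1} M_μ` that is a time derivative. -/
def timeF (κ : ℝ) (C : Fin 3 → ℝ → Space → ℂ) (μ : Fin 3) (t : ℝ) (k : Space) : ℂ :=
  ∑ ρ, ((-2 * κ⁻¹ * eps μ 0 ρ : ℝ) : ℂ) * (((jb k ^ (-1 : ℝ) : ℝ) : ℂ) * C ρ t k)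

/-- The part of `⟨∇⟩^{-1} M_μ` that consists of spatial derivatives. -/
def spaceF (κ : ℝ) (C : Fin 3 → ℝ → Space → ℂ) (μ : Fin 3) (t : ℝ) (k : Space) : ℂ :=
  ∑ ρ, ∑ j : Fin 2, ((-2 * κ⁻¹ * eps μ j.succ ρ : ℝ) : ℂ) *
    ((Complex.I * dsym 1 j.succ k) * (((jb k ^ (-1 : ℝ) : ℝ) : ℂ) * C ρ t k))

theorem bdd_timeF {r : ℝ} (κ : ℝ) {C : Fin 3 → ℝ → Space → ℂ} (h : ∀ ρ, Bdd r (C ρ)) (μ : Fin 3) :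
    Bdd (r + 1) (timeF κ C μ) := by
  refine Bdd.sum _ fun ρ _ => Bdd.const_mul ?_ _
  have := (h ρ).jb_mul (-1)
  rwa [sub_neg_eq_add] at this

theorem bdd_spaceF {r : ℝ} (κ : ℝ) {C : Fin 3 → ℝ → Space → ℂ} (h : ∀ ρ, Bdd r (C ρ)) (μ : Fin 3) :
    Bdd r (spaceF κ C μ) := by
  refine Bdd.sum _ fun ρ _ => Bdd.sum _ fun j _ => Bdd.const_mul ?_ _
  have := bdd_dsym ((h ρ).jb_mul (-1)) 1 j.succ
  simpa using this

theorem deriv_timeF (κ : ℝ) {C C' : Fin 3 → ℝ → Space → ℂ} (h : ∀ ρ, Deriv (C ρ) (C' ρ))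
    (μ : Fin 3) : Deriv (timeF κ C μ) (timeF κ C' μ) :=
  Deriv.sum _ fun ρ _ => ((h ρ).const_mul fun k => ((jb k ^ (-1 : ℝ) : ℝ) : ℂ)).const_mul
    fun _ => ((-2 * κ⁻¹ * eps μ 0 ρ : ℝ) : ℂ)

theorem Deriv.integral_test {s r : ℝ} {x y : ℝ → Space → ℂ} (hd : Deriv x y) (hx : Bdd s x)
    (hy : Bdd r y) {χ : ℝ → ℝ} (h1 : ContDiff ℝ (⊤ : ℕ∞) χ) (h2 : HasCompactSupport χ)
    (θ : 𝓢(Space, ℂ)) :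
    ∫ t, (((deriv χ t : ℝ) : ℂ) * (∫ k, x t k * θ k) + χ t * ∫ k, y t k * θ k) = 0 := by
  have hp : Prim (fun t => ∫ k, x t k * θ k) fun t => ∫ k, y t k * θ k := by
    have h3 := hy.prim_pairing θ 0
    refine ⟨h3.int, fun s t => ?_⟩
    rw [← h3.eq]
    have e : ∀ t, ∫ k, x t k * θ k =
        (∫ k, x 0 k * θ k) + ∫ k, (∫ q in (0:ℝ)..t, y q k) * θ k := by
      intro t
      have i1 : Integrable fun k => (∫ q in (0:ℝ)..t, y q k) * θ k := integrable_mul_schwartz ((hy.measurable_primitive 0).comp measurable_prodMk_left)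
        (hy.wn_primitive_lt_top 0 t) θ.continuous.measurable (wn_schwartz_lt_top θ (-r))
      rw [← integral_add (hx.integrable_pair θ 0) i1]
      refine integral_congr_ae ?_
      filter_upwards [hd] with k hk
      rw [← hk.eq]; ring
    rw [e t, e s]; ring
  exact (hp.integral_test h1 h2).2

theorem bdd_MF_jb (κ : ℝ) (hA : ∀ μ σ, Bdd (1 / 2) (UA μ σ)) (h : ∀ σ, Bdd 1 (U σ)) (μ : Fin 3)
    (h0 : 0 < δ) : Bdd (-δ) fun t k => ((jb k ^ (-1 : ℝ) : ℝ) : ℂ) * MF κ UA U μ t k := by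
  have := (bdd_MF κ hA h μ h0).jb_mul (-1)
  have e : -1 - δ - -1 = -δ := by ring
  rwa [e] at this

theorem integral_japInvM_slice (κ : ℝ) (hA : ∀ μ, HalfRep I (1 / 2) (A μ) (UA μ))
    (h : HalfRep I 1 φ U) {χ : ℝ → ℝ}
    {η : 𝓢(Space, ℂ)} {ψ : 𝓢(Spacetime, ℂ)} (hT : IsTensor χ η ψ)
    (μ : Fin 3) {t : ℝ} (ht : t ∈ I) :
    (∫ x, fnM κ A φ μ t x * japS (-1) (slice t ψ) x) -
      2 * (κ⁻¹ : ℝ) * ∑ ν, ∑ ρ, (eps μ ν ρ : ℂ) *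
        ∫ x, cubic A φ t ρ x * (metric ν * japS (-1) (slice t (∂_{eST ν} ψ)) x) =
    ((deriv χ t : ℝ) : ℂ) * (∫ k, timeF κ (cubicF UA U) μ t k * 𝓕⁻ η k) +
      χ t * ∫ k, (((jb k ^ (-1 : ℝ) : ℝ) : ℂ) * MF κ UA U μ t k + spaceF κ (cubicF UA U) μ t k) *
        𝓕⁻ η k := by
  have hAb := fun μ => (hA μ).bdd
  have bC : ∀ ρ, Bdd (-1 / 2) (cubicF UA U ρ) := fun ρ =>
    (bdd_cubicF hAb h.bdd ρ (δ := 1) one_pos le_rfl).mono (by norm_num)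
  have bCj : ∀ ρ, Bdd _ fun t k => ((jb k ^ (-1 : ℝ) : ℝ) : ℂ) * cubicF UA U ρ t k :=
    fun ρ => (bC ρ).jb_mul (-1)
  have e0 : ∀ ρ, ∫ x, cubic A φ t ρ x * (metric 0 * japS (-1) (slice t (∂_{eST 0} ψ)) x) =
      ((deriv χ t : ℝ) : ℂ) * ∫ k, (((jb k ^ (-1 : ℝ) : ℝ) : ℂ) * cubicF UA U ρ t k) * 𝓕⁻ η k := by
    intro ρ
    rw [← (wf_cubic hA h ht ρ).pairing, hT.time]
    simp [metric]
  have ej : ∀ (j : Fin 2) ρ,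
      ∫ x, cubic A φ t ρ x * (metric j.succ * japS (-1) (slice t (∂_{eST j.succ} ψ)) x) =
      χ t * ∫ k, ((Complex.I * dsym 1 j.succ k) *
        (((jb k ^ (-1 : ℝ) : ℝ) : ℂ) * cubicF UA U ρ t k)) * 𝓕⁻ η k := by
    intro j ρ
    have h1 := (wf_cubic hA h ht ρ).pairing (χ t : ℂ) (∂_{eSp j} η)
    rw [hT.space]
    have e1 : ∫ x, cubic A φ t ρ x * (metric j.succ * japS (-1) ((χ t : ℂ) • ∂_{eSp j} η) x) =
        -∫ x, cubic A φ t ρ x * japS (-1) ((χ t : ℂ) • ∂_{eSp j} η) x := by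
      rw [← integral_neg]
      congr 1; ext x
      simp [metric]
    rw [e1, h1, ← mul_neg, ← integral_neg]
    congr 2; ext k
    rw [fourierInv_lineDeriv]
    have : dsym 1 j.succ k = fq k j := by fin_cases j <;> simp [dsym]
    rw [this]; ring
  have eT : ∫ k, timeF κ (cubicF UA U) μ t k * 𝓕⁻ η k = ∑ ρ, ((-2 * κ⁻¹ * eps μ 0 ρ : ℝ) : ℂ) *
      ∫ k, (((jb k ^ (-1 : ℝ) : ℝ) : ℂ) * cubicF UA U ρ t k) * 𝓕⁻ η k := by
    simp_rw [timeF, Finset.sum_mul, mul_assoc]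
    rw [integral_finsetSum _ fun ρ _ => ?_]
    · refine Finset.sum_congr rfl fun ρ _ => ?_
      rw [integral_const_mul]
    · have := ((bCj ρ).integrable_pair (𝓕⁻ η) t).const_mul ((-2 * κ⁻¹ * eps μ 0 ρ : ℝ) : ℂ)
      simpa only [mul_assoc] using this
  have eS : ∫ k, spaceF κ (cubicF UA U) μ t k * 𝓕⁻ η k = ∑ ρ, ∑ j : Fin 2,
      ((-2 * κ⁻¹ * eps μ j.succ ρ : ℝ) : ℂ) * ∫ k, ((Complex.I * dsym 1 j.succ k) *
        (((jb k ^ (-1 : ℝ) : ℝ) : ℂ) * cubicF UA U ρ t k)) * 𝓕⁻ η k := by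
    have hi : ∀ ρ (j : Fin 2), Integrable fun k => ((-2 * κ⁻¹ * eps μ j.succ ρ : ℝ) : ℂ) *
        (((Complex.I * dsym 1 j.succ k) * (((jb k ^ (-1 : ℝ) : ℝ) : ℂ) * cubicF UA U ρ t k)) *
          𝓕⁻ η k) := fun ρ j =>
      ((bdd_dsym (bCj ρ) 1 j.succ).integrable_pair (𝓕⁻ η) t).const_mul _
    have e : (fun k => spaceF κ (cubicF UA U) μ t k * 𝓕⁻ η k) = fun k => ∑ ρ, ∑ j : Fin 2,
        ((-2 * κ⁻¹ * eps μ j.succ ρ : ℝ) : ℂ) * (((Complex.I * dsym 1 j.succ k) *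
        (((jb k ^ (-1 : ℝ) : ℝ) : ℂ) * cubicF UA U ρ t k)) * 𝓕⁻ η k) := by
      ext k
      rw [spaceF, Finset.sum_mul]
      refine Finset.sum_congr rfl fun ρ _ => ?_
      rw [Finset.sum_mul]
      exact Finset.sum_congr rfl fun j _ => mul_assoc _ _ _
    rw [e, integral_finsetSum _ fun ρ _ => integrable_finsetSum _ fun j _ => hi ρ j]
    refine Finset.sum_congr rfl fun ρ _ => ?_
    rw [integral_finsetSum _ fun j _ => hi ρ j]
    exact Finset.sum_congr rfl fun j _ => integral_const_mul _ _
  simp_rw [add_mul]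
  rw [integral_add ((bdd_MF_jb κ hAb h.bdd μ one_pos).integrable_pair _ t)
    ((bdd_spaceF κ bC μ).integrable_pair _ t), eT, eS, hT.slice, (wf_fnM κ hA h ht μ).pairing,
    Fin.sum_univ_succ]
  simp_rw [e0, ej]
  rw [Finset.sum_comm (s := (Finset.univ : Finset (Fin 2)))]
  simp only [Fin.sum_univ_two, Fin.sum_univ_three]
  push_cast
  ring

end

end

section


section

variable {UA : Fin 3 → ℤˣ → ℝ → Space → ℂ} {U : ℤˣ → ℝ → Space → ℂ} {δ : ℝ}
  {I : Set ℝ} {α β c : ℝ} {A : Fin 3 → ℤˣ → ℝ → 𝓢'(Space, ℂ)} {φ : ℤˣ → ℝ → 𝓢'(Space, ℂ)}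

/-! ### Profiles of the solution -/

/-- The Leibniz rule for A|φ|², with ∂_tA in H^{-1/2} and ∂_tφ in L² from `total_ode`. The
derivative lies in H^{-1/2-δ}, which ⟨∇⟩^{-1} raises to H^{1/2-δ}. -/
theorem exists_cubic_version {κ : ℝ} {V : Polynomial ℝ} (hI : MeasurableSet I)
    (hJ : Set.Ioo α β ⊆ interior I) (hc : c ∈ Set.Ioo α β)
    (hA : ∀ μ, HalfRep I (1 / 2) (A μ) (UA μ)) (h : HalfRep I 1 φ U)
    (hsol : SolvesHalfWaveSystem κ V I A φ) (ρ : Fin 3) (h0 : 0 < δ) (h1 : δ ≤ 1) :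
    ∃ C C' : ℝ → Space → ℂ, Bdd (1 / 2 - δ) C ∧ Deriv C C' ∧ Bdd (-1 / 2 - δ) C' ∧
      ∀ t ∈ Set.Ioo α β, cubicF UA U ρ t =ᵐ[volume] C t := by
  obtain ⟨X, X1, X2, X3⟩ := exists_deriv_version hc (bdd_totF (hA ρ).bdd) (bdd_gradF (hA ρ).bdd 0)
    fun t ht => total_ode hI hJ hc (hsol.1 ρ) (hA ρ) ht
  obtain ⟨Y, Y1, Y2, Y3⟩ := exists_deriv_version hc (bdd_totF h.bdd) (bdd_gradF h.bdd 0)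
    fun t ht => total_ode hI hJ hc hsol.2 h ht
  have X' := (bdd_gradF (hA ρ).bdd 0).indicator (J := Set.Ioo α β) measurableSet_Ioo
  have Y' := (bdd_gradF h.bdd 0).indicator (J := Set.Ioo α β) measurableSet_Ioo
  have s1 : Bdd (1 - δ / 2) fun t => conv (conjF (Y t)) (Y t) :=
    Bdd.conv (by constructor <;> linarith) Y1.conj Y1
  have s2 := Deriv.conv (r := 1 - δ / 2) (r₁ := -δ / 2) (r₂ := -δ / 2)
    (by constructor <;> linarith) (by constructor <;> linarith)
    (by constructor <;> linarith) Y1.conj Y1 Y'.conj Y' Y2.conj Y2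
  have s3 := (Bdd.conv (r := -δ / 2) (by constructor <;> linarith) Y'.conj Y1).add
    (Bdd.conv (r := -δ / 2) (by constructor <;> linarith) Y1.conj Y')
  have c1 : Bdd (1 / 2 - δ) fun t => conv (X t) (conv (conjF (Y t)) (Y t)) :=
    Bdd.conv (by constructor <;> linarith) X1 s1
  have c2 := Deriv.conv (r := 1 / 2 - δ) (r₁ := -1 / 2 - δ) (r₂ := -1 / 2 - δ)
    (by constructor <;> linarith) (by constructor <;> linarith)
    (by constructor <;> linarith) X1 s1 X' s3 X2 s2
  have c3 := (Bdd.conv (r := -1 / 2 - δ) (by constructor <;> linarith) X' s1).add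
    (Bdd.conv (r := -1 / 2 - δ) (by constructor <;> linarith) X1 s3)
  refine ⟨_, _, bdd_mul_metric c1 ρ, c2.const_mul fun _ => (metric ρ : ℂ), bdd_mul_metric c3 ρ,
    fun t ht => Filter.Eventually.of_forall fun k => ?_⟩
  rw [cubicF, sqF, conv_congr (X3 t ht) (Filter.EventuallyEq.refl _ _),
    conv_congr (conjF_congr (Y3 t ht)) (Y3 t ht)]

/-- The time derivative in the cubic term, which the weak form puts on χ, is brought back to A^ρ|φ|²
by parts; afterwards the source is a bounded family tested against χ. -/
theorem japInvM_tensor (κ : ℝ) (hI : MeasurableSet I) (hJ : Set.Ioo α β ⊆ I)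
    (hA : ∀ μ, HalfRep I (1 / 2) (A μ) (UA μ)) (h : HalfRep I 1 φ U) {C C' : Fin 3 → ℝ → Space → ℂ}
    {r r' : ℝ} (hC : ∀ ρ, Bdd r (C ρ)) (hC' : ∀ ρ, Bdd r' (C' ρ)) (hd : ∀ ρ, Deriv (C ρ) (C' ρ))
    (e : ∀ ρ, ∀ t ∈ Set.Ioo α β, cubicF UA U ρ t =ᵐ[volume] C ρ t) {χ : ℝ → ℝ}
    {η : 𝓢(Space, ℂ)} {ψ : 𝓢(Spacetime, ℂ)} (hχ : ContDiff ℝ (⊤ : ℕ∞) χ)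
    (hcs : HasCompactSupport χ) (hs : tsupport χ ⊆ Set.Ioo α β)
    (hT : IsTensor χ η ψ) (μ : Fin 3) :
    japInvM κ I A φ μ ψ = ∫ t, (χ t : ℂ) * ∫ k, (((jb k ^ (-1 : ℝ) : ℝ) : ℂ) * MF κ UA U μ t k +
      (spaceF κ (cubicF UA U) μ t k - timeF κ C' μ t k)) * 𝓕⁻ η k := by
  have hAb := fun μ => (hA μ).bdd
  have bC : ∀ ρ, Bdd (-1 / 2) (cubicF UA U ρ) := fun ρ =>
    (bdd_cubicF hAb h.bdd ρ (δ := 1) one_pos le_rfl).mono (by norm_num)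
  have b1 := bdd_MF_jb κ hAb h.bdd μ one_pos
  have b2 := bdd_spaceF κ bC μ
  have b3 := bdd_timeF κ hC' μ
  have b4 := bdd_timeF κ hC μ
  have e1 : japInvM κ I A φ μ ψ = ∫ t, (((deriv χ t : ℝ) : ℂ) * (∫ k, timeF κ C μ t k * 𝓕⁻ η k) +
      χ t * ∫ k, (((jb k ^ (-1 : ℝ) : ℝ) : ℂ) * MF κ UA U μ t k + spaceF κ (cubicF UA U) μ t k) *
        𝓕⁻ η k) := by
    rw [← setIntegral_test (hs.trans hJ), japInvM]
    refine setIntegral_congr_fun hI fun t ht => ?_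
    beta_reduce
    rw [integral_japInvM_slice κ hA h hT μ ht]
    by_cases htJ : t ∈ Set.Ioo α β
    · congr 2
      refine integral_congr_ae ?_
      filter_upwards [ae_all_iff.mpr fun ρ => e ρ t htJ] with k hk
      simp only [timeF, hk]
    · have h2 : t ∉ tsupport (deriv χ) := fun h => htJ (hs (tsupport_deriv_subset h))
      simp [image_eq_zero_of_notMem_tsupport h2]
  have e2 := Deriv.integral_test (deriv_timeF κ hd μ) b4 b3 hχ hcs (𝓕⁻ η)
  have i1 := (b4.integrable_test_pairing (𝓕⁻ η) (continuous_deriv_test hχ) hcs.deriv).add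
    (b3.integrable_test_pairing (𝓕⁻ η) hχ.continuous hcs)
  have b12 := (b1.mono (min_le_left _ (-1 / 2 : ℝ))).add (b2.mono (min_le_right (-1 : ℝ) _))
  have i2 := (b4.integrable_test_pairing (𝓕⁻ η) (continuous_deriv_test hχ) hcs.deriv).add
    (b12.integrable_test_pairing (𝓕⁻ η) hχ.continuous hcs)
  rw [e1, ← sub_zero (∫ t, _), ← e2]
  refine (integral_sub i2 i1).symm.trans ?_
  congr 1; ext t
  simp only [Pi.add_apply, ← add_sub_assoc, sub_mul]
  rw [integral_sub (b12.integrable_pair _ t) (b3.integrable_pair _ t)]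
  ring

/-- All cubic terms go into R, of order 1/2 - δ, far better than the 1/4 that is needed. Only the
null form in `MF` requires further work. R is chosen before the sign, since both half waves have the
same source. -/
theorem exists_profile_A {κ : ℝ} {V : Polynomial ℝ} (hI : MeasurableSet I)
    (hJ : Set.Ioo α β ⊆ interior I) (hc : c ∈ Set.Ioo α β)
    (hA : ∀ μ, HalfRep I (1 / 2) (A μ) (UA μ)) (h : HalfRep I 1 φ U)
    (hsol : SolvesHalfWaveSystem κ V I A φ) (μ : Fin 3) (h0 : 0 < δ) (h1 : δ ≤ 1) :
    ∃ R : ℝ → Space → ℂ, Bdd (1 / 2 - δ) R ∧ ∀ σ : ℤˣ, ∃ f : ℝ → Space → ℂ, Bdd (1 / 2) f ∧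
      Deriv f (fun t k => (Set.Ioo α β).indicator (fun t => wave (-σ) (fun t k =>
        -(Complex.I * ((σ : ℤ) : ℂ) * (1 / 2)) *
          (((jb k ^ (-1 : ℝ) : ℝ) : ℂ) * MF κ UA U μ t k + R t k)) t k) t) ∧
      ∀ t ∈ Set.Ioo α β, ∀ᵐ k, UA μ σ t k = wave σ f t k := by
  have hAb := fun μ => (hA μ).bdd
  have hJ' := hJ.trans interior_subset
  choose C C' C1 C2 C3 C4 using fun ρ =>
    exists_cubic_version hI hJ hc hA h hsol ρ h0 h1
  have b2 := bdd_spaceF κ (fun ρ => bdd_cubicF hAb h.bdd ρ h0 h1) μ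
  have b3 := (bdd_timeF κ C3 μ)
  have bR : Bdd (1 / 2 - δ) fun t k => spaceF κ (cubicF UA U) μ t k - timeF κ C' μ t k :=
    b2.sub (b3.mono (by linarith))
  have bz := ((bdd_MF_jb κ hAb h.bdd μ one_pos).mono (le_refl (-1))).add
    (bR.mono (by linarith : (-1 : ℝ) ≤ 1 / 2 - δ))
  refine ⟨_, bR, fun σ => ?_⟩
  exact exists_profile hc ((hA μ).bdd σ) (bz.const_mul _) fun t ht =>
    half_wave_ode hI hJ hc (hsol.1 μ σ) ((hA μ).rep σ) ((hA μ).bdd σ) ((hA μ).cont σ) bz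
      (fun χ η ψ k1 k2 k3 k4 => japInvM_tensor κ hI hJ' hA h C1 C3 C2 C4 k1 k2 k3 k4 μ) ht

theorem exists_profile_phi {κ : ℝ} {V : Polynomial ℝ} (hI : MeasurableSet I)
    (hJ : Set.Ioo α β ⊆ interior I) (hc : c ∈ Set.Ioo α β)
    (hA : ∀ μ, HalfRep I (1 / 2) (A μ) (UA μ)) (h : HalfRep I 1 φ U)
    (hsol : SolvesHalfWaveSystem κ V I A φ) (σ : ℤˣ) : ∃ f : ℝ → Space → ℂ, Bdd 1 f ∧
      Deriv f (fun t k => (Set.Ioo α β).indicator (fun t => wave (-σ) (fun t k =>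
        -(Complex.I * ((σ : ℤ) : ℂ) * (1 / 2)) *
          (((jb k ^ (-1 : ℝ) : ℝ) : ℂ) * (roughF UA U t k + mildF V UA U t k))) t k) t) ∧
      ∀ t ∈ Set.Ioo α β, ∀ᵐ k, U σ t k = wave σ f t k := by
  have hAb := fun μ => (hA μ).bdd
  have hJ' := hJ.trans interior_subset
  have bz := ((bdd_roughF hAb h.bdd one_pos).add
    ((bdd_mildF V hAb h.bdd one_pos le_rfl).mono (by norm_num))).jb_mul (-1)
  exact exists_profile hc (h.bdd σ) (bz.const_mul _) fun t ht =>
    half_wave_ode hI hJ hc (hsol.2 σ) (h.rep σ) (h.bdd σ) (h.cont σ) bz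
      (fun χ η ψ k1 k2 k3 k4 => japInvN_tensor V hI hA h (k3.trans hJ') k4) ht

/-- The Lorenz gauge condition on the side of the frequencies. -/
theorem LorenzGauge.freq (hgauge : LorenzGauge I A) (hA : ∀ μ, HalfRep I (1 / 2) (A μ) (UA μ))
    {t : ℝ} (ht : t ∈ I) : ∀ᵐ k, ∑ μ, (metric μ : ℂ) * gradF (UA μ) μ t k = 0 := by
  have hb : Bdd (1 / 2 - 1) fun t k => ∑ μ, (metric μ : ℂ) * gradF (UA μ) μ t k :=
    Bdd.sum _ fun μ _ => bdd_mul_metric (bdd_gradF (hA μ).bdd μ) μ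
  refine ae_eq_zero_of_compactSupport (hb.meas_slice t) (hb.wn_lt_top t) fun η _ => ?_
  have h1 := congrArg (fun T : 𝓢'(Space, ℂ) => T η) (hgauge t ht)
  have h2 : ∑ μ, (metric μ : ℂ) * (grad (A μ) t μ) η = 0 := by
    have e : (∑ μ, metric μ • grad (A μ) t μ) η = ∑ μ, (metric μ : ℂ) * (grad (A μ) t μ) η := by
      simp only [Fin.sum_univ_three]
      have : ∀ (a : ℝ) (T : 𝓢'(Space, ℂ)), (a • T) η = (a : ℂ) * T η := fun a T => by
        rw [← Complex.real_smul]; rfl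
      rw [← this, ← this, ← this]
      rfl
    rw [← e]
    exact h1
  simp_rw [Finset.sum_mul]
  rw [integral_finsetSum _ fun μ _ =>
    (bdd_mul_metric (bdd_gradF (hA μ).bdd μ) μ).integrable_pair (𝓕⁻ η) t, ← h2]
  refine Finset.sum_congr rfl fun μ _ => ?_
  rw [(hA μ).grad (by norm_num) ht μ η, ← integral_const_mul]
  congr 1; ext k; ring

end

end

section


/-! ### Null symbols -/

theorem angle_sq {s : ℝ} (hs : s ^ 2 = 1) (k l : Space) :
    angle s k l ^ 2 * (jb k * jb l) = dl s k l := by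
  have h1 := one_le_dl hs k l
  have := jb_pos k
  have := jb_pos l
  rw [angle, Real.sq_sqrt (by positivity), div_mul_cancel₀ _ (by positivity)]

theorem abs_le_of_null {s x : ℝ} (hs : s ^ 2 = 1) {k l : Space}
    (h : x ^ 2 ≤ 2 * (jb k * jb l) * dl s k l) : |x| ≤ 2 * angle s k l * (jb k * jb l) := by
  have h1 := angle_nonneg s k l
  have := jb_pos k
  have := jb_pos l
  refine abs_le_of_sq_le_sq ?_ (by positivity)
  rw [← angle_sq hs] at h
  have h2 : 0 ≤ (angle s k l * (jb k * jb l)) ^ 2 := by positivity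
  nlinarith

theorem sign_mul_sq (σ₁ σ₂ : ℤˣ) : (((σ₁ : ℤ) : ℝ) * ((σ₂ : ℤ) : ℝ)) ^ 2 = 1 := by
  rw [mul_pow, sq_unit_sign, sq_unit_sign, one_mul]

/-- The symbol of the null form that involves `A_0`. -/
def symTime (σ₁ σ₂ : ℤˣ) (k l : Space) : ℂ :=
  ((((σ₂ : ℤ) : ℝ) * (dl (((σ₁ : ℤ) : ℝ) * ((σ₂ : ℤ) : ℝ)) k l / jb k) : ℝ) : ℂ)

/-- The symbol of the null form that involves the curl of `A`. -/
def symCurl (k l : Space) : ℂ := ((wd k l / jb k : ℝ) : ℂ)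

/-- The symbol of the null form `Q_{νρ}`. -/
def symQ (ν ρ : Fin 3) (σ₁ σ₂ : ℤˣ) (k l : Space) : ℂ :=
  (-(dsym σ₁ ν k * dsym σ₂ ρ l - dsym σ₁ ρ k * dsym σ₂ ν l) : ℝ)

/-- The symbol of the part of `A_j ∂_j φ` that is smoothed by two derivatives on `A_j`. -/
def symMild (j : Fin 2) (k l : Space) : ℂ := ((fq l j / jb k ^ 2 : ℝ) : ℂ)

theorem measurable_symTime (σ₁ σ₂ : ℤˣ) :
    Measurable fun p : Space × Space => symTime σ₁ σ₂ p.1 p.2 := by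
  have h1 := measurable_dl (((σ₁ : ℤ) : ℝ) * ((σ₂ : ℤ) : ℝ))
  have h2 := measurable_jb
  unfold symTime
  fun_prop

theorem measurable_symCurl : Measurable fun p : Space × Space => symCurl p.1 p.2 := by
  have h2 := measurable_jb
  have h3 := measurable_fq
  unfold symCurl wd
  fun_prop

theorem measurable_symQ (ν ρ : Fin 3) (σ₁ σ₂ : ℤˣ) :
    Measurable fun p : Space × Space => symQ ν ρ σ₁ σ₂ p.1 p.2 := by
  have h := measurable_dsym
  unfold symQ
  fun_prop

theorem measurable_symMild (j : Fin 2) : Measurable fun p : Space × Space => symMild j p.1 p.2 := by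
  have h2 := measurable_jb
  have h3 := measurable_fq
  unfold symMild
  fun_prop

/-- This symbol is even quadratic in the angle; one factor is given up through θ ≤ 2 to match the
other null forms. -/
theorem norm_symTime_le (σ₁ σ₂ : ℤˣ) (k l : Space) : ‖symTime σ₁ σ₂ k l‖ ≤
    2 * angle (((σ₁ : ℤ) : ℝ) * ((σ₂ : ℤ) : ℝ)) k l * (jb k ^ (0 : ℝ) * jb l ^ (1 : ℝ)) := by
  have hs := sign_mul_sq σ₁ σ₂
  have h1 := angle_nonneg (((σ₁ : ℤ) : ℝ) * ((σ₂ : ℤ) : ℝ)) k l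
  have h2 := angle_le (sq_unit_sign σ₁) (sq_unit_sign σ₂) k l
  have hk := jb_pos k
  have hl := jb_pos l
  rw [symTime, Complex.norm_real, Real.norm_eq_abs, abs_unit_mul, ← angle_sq hs, Real.rpow_zero,
    Real.rpow_one, one_mul]
  set θ := angle (((σ₁ : ℤ) : ℝ) * ((σ₂ : ℤ) : ℝ)) k l
  have e : θ ^ 2 * (jb k * jb l) / jb k = θ * θ * jb l := by field_simp
  rw [e, abs_of_nonneg (by positivity)]
  gcongr

theorem norm_symCurl_le (σ₁ σ₂ : ℤˣ) (k l : Space) : ‖symCurl k l‖ ≤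
    2 * angle (((σ₁ : ℤ) : ℝ) * ((σ₂ : ℤ) : ℝ)) k l * (jb k ^ (0 : ℝ) * jb l ^ (1 : ℝ)) := by
  have hs := sign_mul_sq σ₁ σ₂
  have hk := jb_pos k
  have h1 := abs_le_of_null hs (wd_sq_le hs k l)
  rw [symCurl, Complex.norm_real, Real.norm_eq_abs, abs_div, abs_of_pos hk, Real.rpow_zero,
    Real.rpow_one, one_mul, div_le_iff₀ hk]
  linarith

/-- Three types of pairs: equal indices give 0, one time index is covered by `null_sq_le`, and two
spatial indices give the determinant `wd`. -/
theorem abs_null_le (ν ρ : Fin 3) (σ₁ σ₂ : ℤˣ) (k l : Space) :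
    |dsym σ₁ ν k * dsym σ₂ ρ l - dsym σ₁ ρ k * dsym σ₂ ν l| ≤
      2 * angle (((σ₁ : ℤ) : ℝ) * ((σ₂ : ℤ) : ℝ)) k l * (jb k * jb l) := by
  have hs := sign_mul_sq σ₁ σ₂
  have e : ∀ j : Fin 2, dsym σ₁ 0 k * dsym σ₂ j.succ l - dsym σ₁ j.succ k * dsym σ₂ 0 l =
      ((σ₁ : ℤ) : ℝ) * jb k * fq l j - ((σ₂ : ℤ) : ℝ) * jb l * fq k j := by
    intro j
    fin_cases j <;> simp [dsym] <;> ring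
  have h0 : ∀ j : Fin 2, |dsym σ₁ 0 k * dsym σ₂ j.succ l - dsym σ₁ j.succ k * dsym σ₂ 0 l| ≤
      2 * angle (((σ₁ : ℤ) : ℝ) * ((σ₂ : ℤ) : ℝ)) k l * (jb k * jb l) := fun j =>
    abs_le_of_null hs (by
      rw [e]; exact null_sq_le (sq_unit_sign σ₁) (sq_unit_sign σ₂) k l j)
  have h1 : |dsym σ₁ 1 k * dsym σ₂ 2 l - dsym σ₁ 2 k * dsym σ₂ 1 l| ≤
      2 * angle (((σ₁ : ℤ) : ℝ) * ((σ₂ : ℤ) : ℝ)) k l * (jb k * jb l) :=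
    abs_le_of_null hs (wd_sq_le hs k l)
  have hz : 0 ≤ 2 * angle (((σ₁ : ℤ) : ℝ) * ((σ₂ : ℤ) : ℝ)) k l * (jb k * jb l) :=
    (abs_nonneg _).trans h1
  fin_cases ν <;> fin_cases ρ
  · simpa using hz
  · exact h0 0
  · exact h0 1
  · exact (abs_sub_comm _ _).le.trans (h0 0)
  · simpa [mul_comm] using hz
  · exact h1
  · exact (abs_sub_comm _ _).le.trans (h0 1)
  · exact (abs_sub_comm _ _).le.trans h1
  · simpa [mul_comm] using hz

theorem norm_symQ_le (ν ρ : Fin 3) (σ₁ σ₂ : ℤˣ) (k l : Space) : ‖symQ ν ρ σ₁ σ₂ k l‖ ≤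
    2 * angle (((σ₁ : ℤ) : ℝ) * ((σ₂ : ℤ) : ℝ)) k l * (jb k ^ (1 : ℝ) * jb l ^ (1 : ℝ)) := by
  rw [symQ, Complex.norm_real, Real.norm_eq_abs, abs_neg, Real.rpow_one, Real.rpow_one]
  exact abs_null_le ν ρ σ₁ σ₂ k l

theorem norm_symMild_le (j : Fin 2) (k l : Space) :
    ‖symMild j k l‖ ≤ 1 * (jb k ^ (-2 : ℝ) * jb l ^ (1 : ℝ)) := by
  have hk := jb_pos k
  rw [symMild, Complex.norm_real, Real.norm_eq_abs, abs_div, abs_of_pos (by positivity : 0 < jb k ^ 2),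
    one_mul, Real.rpow_one, Real.rpow_neg hk.le, div_eq_inv_mul, Real.rpow_two]
  gcongr
  exact abs_fq_le_jb l j

/-- A null symbol is bounded by the weights. -/
theorem norm_le_of_angle {m : Space → Space → ℂ} {σ₁ σ₂ : ℤˣ} {p q : ℝ}
    (hm : ∀ k l, ‖m k l‖ ≤
      2 * angle (((σ₁ : ℤ) : ℝ) * ((σ₂ : ℤ) : ℝ)) k l * (jb k ^ p * jb l ^ q)) (k l : Space) :
    ‖m k l‖ ≤ 4 * (jb k ^ p * jb l ^ q) := by
  have h2 := angle_le (sq_unit_sign σ₁) (sq_unit_sign σ₂) k l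
  have hk := jb_pos k
  have hl := jb_pos l
  refine (hm k l).trans ?_
  gcongr
  linarith

theorem Split.congr_time {J : Set ℝ} {r rG s s' : ℝ} {h h' : ℝ → Space → ℂ} (H : Split J r rG h)
    (hJ : MeasurableSet J) (mh : Bdd s h) (mh' : Bdd s' h') (e : ∀ t ∈ J, ∀ᵐ k, h' t k = h t k) :
    Split J r rG h' :=
  H.congr (ae_ae_swap (measurableSet_eq_fun mh'.meas mh.meas) hJ e)

section

variable {a b a' b' : ℝ → Space → ℂ} {m : Space → Space → ℂ} {J : Set ℝ}

theorem split_bil_mixed (σ₀ σ₁ σ₂ : ℤˣ) {β : ℝ} (hβ : 0 < β) (hβ' : β ≤ 1 / 4)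
    (hm : Measurable fun p : Space × Space => m p.1 p.2)
    (hmb : ∀ k l, ‖m k l‖ ≤
      2 * angle (((σ₁ : ℤ) : ℝ) * ((σ₂ : ℤ) : ℝ)) k l * (jb k ^ (0 : ℝ) * jb l ^ (1 : ℝ)))
    (ha : Bdd (1 / 2) a) (hb : Bdd 1 b) (ha' : Bdd (-(β / 8)) a') (hb' : Bdd (1 / 2 - β / 8) b')
    (hda : Deriv a a') (hdb : Deriv b b') :
    Split J (-1 / 4 - β) (1 / 4 + β / 4)
      (bil (ph ((σ₀ : ℤ) : ℝ) ((σ₁ : ℤ) : ℝ) ((σ₂ : ℤ) : ℝ)) m a b) := by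
  -- The low-phase part needs κ < 1/4 + β and the boundary term in H^{1/4+β/4} needs κ > 1/4 + β/4;
  -- the terms with derivatives allow slightly less. The value chosen is between the two bounds, and
  -- the loss β makes all product laws strict.
  obtain ⟨G, G', P', h1, h2, h3, h4, h5⟩ := normal_form (κ := 1 / 4 + β / 2) (r := -1 / 4 - β)
    (rG := 1 / 4 + β / 4) (r₀ := -1) (sq_unit_sign σ₀) (sq_unit_sign σ₁) (sq_unit_sign σ₂)
    zero_le_two hm hmb ha hb ha' hb' hda hdb (by linarith)
    ⟨by constructor <;> linarith, by constructor <;> linarith⟩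
    ⟨by constructor <;> linarith, by constructor <;> linarith⟩
    ⟨by constructor <;> linarith, by constructor <;> linarith⟩
    ⟨by constructor <;> linarith, by constructor <;> linarith⟩
    (by constructor <;> linarith)
    (Adm.of_expo_wt (by constructor <;> linarith)) (Adm.of_expo_wt (by constructor <;> linarith))
  refine ⟨G, G', P', h1, h2, h3, h4, ?_⟩
  filter_upwards [h5] with k hk
  filter_upwards [hk] with t ht _ using ht

theorem split_bil_Q (σ₀ σ₁ σ₂ : ℤˣ)
    (hm : Measurable fun p : Space × Space => m p.1 p.2)
    (hmb : ∀ k l, ‖m k l‖ ≤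
      2 * angle (((σ₁ : ℤ) : ℝ) * ((σ₂ : ℤ) : ℝ)) k l * (jb k ^ (1 : ℝ) * jb l ^ (1 : ℝ)))
    (ha : Bdd 1 a) (hb : Bdd 1 b) (ha' : Bdd (3 / 4 - 1 / 16) a') (hb' : Bdd (3 / 4 - 1 / 16) b')
    (hda : Deriv a a') (hdb : Deriv b b') :
    Split J (-3 / 4) (-1 / 2)
      (bil (ph ((σ₀ : ℤ) : ℝ) ((σ₁ : ℤ) : ℝ) ((σ₂ : ℤ) : ℝ)) m a b) := by
  -- After the derivatives of the null form are used up, a quarter of decay on one input and 3/4 on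
  -- the output remain. The total is exactly 1, so the endpoint law is needed.
  have A1 : Adm (-3 / 4) 1 1 fun k l => wt (1 - 1 / 4) k * wt 1 l := by
    have := (Adm.endpoint_left (a := 1 / 4) (b := 3 / 4) (by norm_num) (by norm_num)
      (by norm_num)).weights (a := 1) (b := 1)
    refine this.mono (by norm_num) (by norm_num) (by norm_num) fun k l => le_of_eq ?_
    rw [sub_eq_add_neg, wt_add]; ring
  have A2 : Adm (-3 / 4) 1 1 fun k l => wt 1 k * wt (1 - 1 / 4) l := by
    have := (Adm.endpoint_right (a := 1 / 4) (b := 3 / 4) (by norm_num) (by norm_num)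
      (by norm_num)).weights (a := 1) (b := 1)
    refine this.mono (by norm_num) (by norm_num) (by norm_num) fun k l => le_of_eq ?_
    rw [sub_eq_add_neg, wt_add]; ring
  -- Low phases need κ < 1/4, and inputs with derivatives in H^{11/16} need κ > 1/16.
  obtain ⟨G, G', P', h1, h2, h3, h4, h5⟩ := normal_form (κ := 1 / 8) (r := -3 / 4)
    (rG := -1 / 2) (r₀ := -2) (sq_unit_sign σ₀) (sq_unit_sign σ₁) (sq_unit_sign σ₂)
    zero_le_two hm hmb ha hb ha' hb' hda hdb (by norm_num)
    ⟨by constructor <;> norm_num, by constructor <;> norm_num⟩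
    ⟨by constructor <;> norm_num, by constructor <;> norm_num⟩
    ⟨by constructor <;> norm_num, by constructor <;> norm_num⟩
    ⟨by constructor <;> norm_num, by constructor <;> norm_num⟩
    (by constructor <;> norm_num) A1 A2
  refine ⟨G, G', P', h1, h2, h3, h4, ?_⟩
  filter_upwards [h5] with k hk
  filter_upwards [hk] with t ht _ using ht

end

end

section


/-! ### The null structure of the nonlinearities -/

/-- The Fourier transform of `⟨∇⟩^{-1} (∂_1 A_2 - ∂_2 A_1)`, up to a factor. -/
def curlF (UA : Fin 3 → ℤˣ → ℝ → Space → ℂ) (σ : ℤˣ) (t : ℝ) (k : Space) : ℂ :=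
  ((fq k 0 / jb k : ℝ) : ℂ) * UA 2 σ t k - ((fq k 1 / jb k : ℝ) : ℂ) * UA 1 σ t k

theorem norm_fq_div_le (j : Fin 2) (k : Space) :
    ‖((fq k j / jb k : ℝ) : ℂ)‖ ≤ 1 * jb k ^ (0 : ℝ) := by
  rw [Complex.norm_real, Real.norm_eq_abs, abs_div, abs_of_pos (jb_pos k), Real.rpow_zero, one_mul,
    div_le_one (jb_pos k)]
  exact abs_fq_le_jb k j

theorem measurable_fq_div (j : Fin 2) : Measurable fun k : Space => ((fq k j / jb k : ℝ) : ℂ) := by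
  have h2 := measurable_jb
  have h3 := measurable_fq j
  fun_prop

theorem bdd_fq_div {s : ℝ} {a : ℝ → Space → ℂ} (h : Bdd s a) (j : Fin 2) :
    Bdd s fun t k => ((fq k j / jb k : ℝ) : ℂ) * a t k := by
  have := h.mul_symbol (m := fun _ k => ((fq k j / jb k : ℝ) : ℂ)) (r := 0) (C := 1)
    ((measurable_fq_div j).comp measurable_snd) fun _ => norm_fq_div_le j
  simpa using this

section

variable {UA : Fin 3 → ℤˣ → ℝ → Space → ℂ} {U : ℤˣ → ℝ → Space → ℂ} {t : ℝ}

theorem bdd_curlF {s : ℝ} (hA : ∀ μ σ, Bdd s (UA μ σ)) (σ : ℤˣ) : Bdd s (curlF UA σ) :=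
  (bdd_fq_div (hA 2 σ) 0).sub (bdd_fq_div (hA 1 σ) 1)

/-- The part of `2i A_μ ∂^μ φ` that is smoothed by the gauge condition. -/
def restF (UA : Fin 3 → ℤˣ → ℝ → Space → ℂ) (U : ℤˣ → ℝ → Space → ℂ) (t : ℝ) (k : Space) : ℂ :=
  ∑ j : Fin 2, 2 * cm (symMild j) (totF (UA j.succ) t) (totF U t) k

theorem bdd_restF (hA : ∀ μ σ, Bdd (1 / 2) (UA μ σ)) (h : ∀ σ, Bdd 1 (U σ)) : Bdd 0 (restF UA U) :=
  Bdd.sum _ fun j _ => (Bdd.cm (measurable_symMild j) (norm_symMild_le j)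
    (by constructor <;> norm_num) (bdd_totF (hA j.succ)) (bdd_totF h)).const_mul 2

/-- The spatial part is decomposed as |ξ|²(η·A) = (ξ·η)(ξ·A) + (ξ∧η)(ξ∧A). By the gauge condition
ξ·A = ⟨ξ⟩(A_{0,+}-A_{0,-}), so the first term joins A_0∂_0φ and forms the symbol σ₂(⟨η⟩ - σ₁σ₂
ξ·η/⟨ξ⟩); the second is the curl term. As |ξ|² = ⟨ξ⟩² - 1, dividing by ⟨ξ⟩² leaves the rest
(η·A)/⟨ξ⟩², which is smoother. -/
theorem null_identity (a : Fin 3 → ℤˣ → ℂ) (u : ℤˣ → ℂ) (k l : Space)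
    (hg : Complex.I * jb k * (a 0 1 - a 0 (-1)) =
      Complex.I * fq k 0 * (a 1 1 + a 1 (-1)) + Complex.I * fq k 1 * (a 2 1 + a 2 (-1))) :
    2 * Complex.I * ∑ μ, (∑ σ, a μ σ) * (metric μ * ∑ σ, Complex.I * dsym σ μ l * u σ) =
      ∑ σ₁, ∑ σ₂, (-2 * (symTime σ₁ σ₂ k l * (a 0 σ₁ * u σ₂)) +
        2 * (symCurl k l * ((((fq k 0 / jb k : ℝ) : ℂ) * a 2 σ₁ -
          ((fq k 1 / jb k : ℝ) : ℂ) * a 1 σ₁) * u σ₂))) +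
      ∑ j : Fin 2, 2 * (symMild j k l * ((∑ σ, a j.succ σ) * ∑ σ, u σ)) := by
  have hj : (jb k : ℂ) ≠ 0 := by exact_mod_cast (jb_pos k).ne'
  have hsq : (jb k : ℂ) ^ 2 = 1 + ((fq k 0 : ℂ) ^ 2 + (fq k 1 : ℂ) ^ 2) := by
    exact_mod_cast congrArg (fun x : ℝ => (x : ℂ)) (jb_sq k)
  have hg' : (jb k : ℂ) * (a 0 1 - a 0 (-1)) = fq k 0 * (a 1 1 + a 1 (-1)) + fq k 1 * (a 2 1 + a 2 (-1)) := by
    have := congrArg (fun z => -Complex.I * z) hg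
    simp only [mul_add, ← mul_assoc, neg_mul, Complex.I_mul_I] at this
    linear_combination this
  have hm1 : (((-1 : ℤˣ) : ℤ) : ℝ) = -1 := by simp
  have h1 : (((1 : ℤˣ) : ℤ) : ℝ) = 1 := by simp
  have ht : ∀ σ₁ σ₂ : ℤˣ, (symTime σ₁ σ₂ k l : ℂ) = ((σ₂ : ℤ) : ℝ) *
      (jb l - (((σ₁ * σ₂ : ℤˣ) : ℤ) : ℝ) * ip k l * (jb k : ℂ)⁻¹) := fun σ₁ σ₂ => by
    simp only [symTime, dl]
    push_cast
    field_simp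
  have key : (a 1 1 + a 1 (-1)) * fq l 0 + (a 2 1 + a 2 (-1)) * fq l 1 =
      ip k l * (a 0 1 - a 0 (-1)) * (jb k : ℂ)⁻¹ +
      wd k l * (fq k 0 * (a 2 1 + a 2 (-1)) - fq k 1 * (a 1 1 + a 1 (-1))) * (jb k : ℂ)⁻¹ ^ 2 +
      ((a 1 1 + a 1 (-1)) * fq l 0 + (a 2 1 + a 2 (-1)) * fq l 1) * (jb k : ℂ)⁻¹ ^ 2 := by
    simp only [ip, wd]
    push_cast
    field_simp
    linear_combination ((a 1 1 + a 1 (-1)) * fq l 0 + (a 2 1 + a 2 (-1)) * fq l 1) * hsq -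
      (fq k 0 * fq l 0 + fq k 1 * fq l 1) * hg'
  have m0 : metric 0 = 1 := by simp [metric]
  have m1 : metric 1 = -1 := by simp [metric]
  have m2 : metric 2 = -1 := by simp [metric]
  have d0 : ∀ σ : ℤˣ, dsym σ 0 l = ((σ : ℤ) : ℝ) * jb l := fun _ => rfl
  have d1 : ∀ σ : ℤˣ, dsym σ 1 l = fq l 0 := fun _ => rfl
  have d2 : ∀ σ : ℤˣ, dsym σ 2 l = fq l 1 := fun _ => rfl
  have s0 : (Fin.succ 0 : Fin 3) = 1 := rfl
  have s1 : (Fin.succ 1 : Fin 3) = 2 := rfl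
  simp only [sum_units, Fin.sum_univ_three, Fin.sum_univ_two, ht, symCurl, symMild, m0, m1, m2, d0,
    d1, d2, s0, s1, mul_one, neg_mul_neg, one_mul, h1, hm1, div_eq_mul_inv]
  push_cast
  linear_combination (exp := 1) (2 * (u 1 + u (-1))) * key + 2 * ((a 0 1 + a 0 (-1)) * jb l * (u 1 - u (-1)) -
    ((a 1 1 + a 1 (-1)) * fq l 0 + (a 2 1 + a 2 (-1)) * fq l 1) * (u 1 + u (-1))) * Complex.I_sq

end

end

/-! ### Null form identities for the convolution integrals -/

section


/-- `f` is integrable, with integral `v`. -/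
def HasInt (f : Space → ℂ) (v : ℂ) : Prop := Integrable f ∧ ∫ l, f l = v

theorem HasInt.add {f g : Space → ℂ} {v w : ℂ} (hf : HasInt f v) (hg : HasInt g w) :
    HasInt (fun l => f l + g l) (v + w) :=
  ⟨hf.1.add hg.1, by rw [integral_add hf.1 hg.1, hf.2, hg.2]⟩

theorem HasInt.sub {f g : Space → ℂ} {v w : ℂ} (hf : HasInt f v) (hg : HasInt g w) :
    HasInt (fun l => f l - g l) (v - w) :=
  ⟨hf.1.sub hg.1, by rw [integral_sub hf.1 hg.1, hf.2, hg.2]⟩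

theorem HasInt.const_mul {f : Space → ℂ} {v : ℂ} (hf : HasInt f v) (c : ℂ) :
    HasInt (fun l => c * f l) (c * v) :=
  ⟨hf.1.const_mul c, by rw [integral_const_mul, hf.2]⟩

theorem HasInt.sum {ι : Type*} {f : ι → Space → ℂ} {v : ι → ℂ} (S : Finset ι)
    (h : ∀ i ∈ S, HasInt (f i) (v i)) : HasInt (fun l => ∑ i ∈ S, f i l) (∑ i ∈ S, v i) :=
  ⟨integrable_finsetSum _ fun i hi => (h i hi).1, by
    rw [integral_finsetSum _ fun i hi => (h i hi).1]
    exact Finset.sum_congr rfl fun i hi => (h i hi).2⟩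

theorem HasInt.eq_of_ae {f g : Space → ℂ} {v w : ℂ} (hf : HasInt f v) (hg : HasInt g w)
    (e : f =ᵐ[volume] g) : v = w := by
  rw [← hf.2, ← hg.2]
  exact integral_congr_ae e

section

variable {m : Space → Space → ℂ} {a b : ℝ → Space → ℂ} {r s₁ s₂ p q C : ℝ}

theorem Bdd.hasInt_cm (hm : Measurable fun p : Space × Space => m p.1 p.2)
    (hmb : ∀ k l, ‖m k l‖ ≤ C * (jb k ^ p * jb l ^ q)) (h : Expo (-r) (s₁ - p) (s₂ - q))
    (ha : Bdd s₁ a) (hb : Bdd s₂ b) (t : ℝ) :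
    ∀ᵐ k, HasInt (fun l => m l (k - l) * (a t l * b t (k - l))) (CSH.cm m (a t) (b t) k) := by
  filter_upwards [Bdd.integrable_cm hm hmb h ha hb t] with k hk using ⟨hk, rfl⟩

theorem Bdd.hasInt_conv (h : Expo (-r) s₁ s₂) (ha : Bdd s₁ a) (hb : Bdd s₂ b) (t : ℝ) :
    ∀ᵐ k, HasInt (fun l => a t l * b t (k - l)) (CSH.conv (a t) (b t) k) := by
  filter_upwards [Bdd.integrable_conv h ha hb t] with k hk using ⟨hk, rfl⟩

end

section

variable {UA : Fin 3 → ℤˣ → ℝ → Space → ℂ} {U : ℤˣ → ℝ → Space → ℂ} {t : ℝ}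

theorem gauge_freq {k : Space} (h : ∑ μ, (metric μ : ℂ) * gradF (UA μ) μ t k = 0) :
    Complex.I * jb k * (UA 0 1 t k - UA 0 (-1) t k) =
      Complex.I * fq k 0 * (UA 1 1 t k + UA 1 (-1) t k) +
        Complex.I * fq k 1 * (UA 2 1 t k + UA 2 (-1) t k) := by
  have d0 : ∀ σ : ℤˣ, dsym σ 0 k = ((σ : ℤ) : ℝ) * jb k := fun _ => rfl
  have d1 : ∀ σ : ℤˣ, dsym σ 1 k = fq k 0 := fun _ => rfl
  have d2 : ∀ σ : ℤˣ, dsym σ 2 k = fq k 1 := fun _ => rfl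
  simp only [Fin.sum_univ_three, gradF, sum_units, d0, d1, d2, metric] at h
  simp at h
  linear_combination h

/-- The null structure of `2i A_μ ∂^μ φ` in the Lorenz gauge. -/
theorem roughF_eq (hA : ∀ μ σ, Bdd (1 / 2) (UA μ σ)) (h : ∀ σ, Bdd 1 (U σ))
    (hg : ∀ᵐ k, ∑ μ, (metric μ : ℂ) * gradF (UA μ) μ t k = 0) :
    ∀ᵐ k, roughF UA U t k = ∑ σ₁, ∑ σ₂, (-2 * cm (symTime σ₁ σ₂) (UA 0 σ₁ t) (U σ₂ t) k +
      2 * cm symCurl (curlF UA σ₁ t) (U σ₂ t) k) + restF UA U t k := by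
  have i1 : ∀ μ : Fin 3, ∀ᵐ k, HasInt _ _ := fun μ =>
    Bdd.hasInt_conv (r := -1) (by constructor <;> norm_num) (bdd_totF (hA μ))
      (bdd_mul_metric (bdd_gradF h μ) μ) t
  have i2 : ∀ σ₁ σ₂ : ℤˣ, ∀ᵐ k, HasInt _ _ := fun σ₁ σ₂ =>
    Bdd.hasInt_cm (r := -1) (measurable_symTime σ₁ σ₂) (norm_le_of_angle (norm_symTime_le σ₁ σ₂))
      (by constructor <;> norm_num) (hA 0 σ₁) (h σ₂) t
  have i3 : ∀ σ₁ σ₂ : ℤˣ, ∀ᵐ k, HasInt _ _ := fun σ₁ σ₂ =>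
    Bdd.hasInt_cm (r := -1) measurable_symCurl (norm_le_of_angle (norm_symCurl_le σ₁ σ₂))
      (by constructor <;> norm_num) (bdd_curlF hA σ₁) (h σ₂) t
  have i4 : ∀ j : Fin 2, ∀ᵐ k, HasInt _ _ := fun j =>
    Bdd.hasInt_cm (r := -1) (measurable_symMild j) (norm_symMild_le j)
      (by constructor <;> norm_num) (bdd_totF (hA j.succ)) (bdd_totF h) t
  filter_upwards [ae_all_iff.2 i1, ae_all_iff.2 fun σ₁ => ae_all_iff.2 (i2 σ₁),
    ae_all_iff.2 fun σ₁ => ae_all_iff.2 (i3 σ₁), ae_all_iff.2 i4] with k h1 h2 h3 h4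
  refine ((HasInt.sum Finset.univ fun μ _ => h1 μ).const_mul (2 * Complex.I)).eq_of_ae
    ((HasInt.sum Finset.univ fun σ₁ _ => HasInt.sum Finset.univ fun σ₂ _ =>
      ((h2 σ₁ σ₂).const_mul (-2)).add ((h3 σ₁ σ₂).const_mul 2)).add
        (HasInt.sum Finset.univ fun j _ => (h4 j).const_mul 2)) ?_
  filter_upwards [hg] with l hl
  exact null_identity (fun μ σ => UA μ σ t l) (fun σ => U σ t (k - l)) l (k - l) (gauge_freq hl)

/-- The null structure of `Q_{νρ}(φ̄, φ)`. -/
theorem QF_eq (h : ∀ σ, Bdd 1 (U σ)) (ν ρ : Fin 3) (t : ℝ) :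
    ∀ᵐ k, QF U ν ρ t k =
      ∑ σ₁, ∑ σ₂, cm (symQ ν ρ σ₁ σ₂) (conjF (U (-σ₁) t)) (U σ₂ t) k := by
  have i1 : ∀ ν ρ : Fin 3, ∀ᵐ k, HasInt _ _ := fun ν ρ =>
    Bdd.hasInt_conv (r := -5 / 4) (by constructor <;> norm_num) (bdd_gradF h ν).conj
      (bdd_gradF h ρ) t
  have i2 : ∀ σ₁ σ₂ : ℤˣ, ∀ᵐ k, HasInt _ _ := fun σ₁ σ₂ =>
    Bdd.hasInt_cm (r := -5 / 4) (measurable_symQ ν ρ σ₁ σ₂) (norm_le_of_angle (norm_symQ_le ν ρ σ₁ σ₂))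
      (by constructor <;> norm_num) (h (-σ₁)).conj (h σ₂) t
  filter_upwards [i1 ν ρ, i1 ρ ν, ae_all_iff.2 fun σ₁ => ae_all_iff.2 (i2 σ₁)] with k h1 h2 h3
  refine (h1.sub h2).eq_of_ae (HasInt.sum Finset.univ fun σ₁ _ => HasInt.sum Finset.univ
    fun σ₂ _ => h3 σ₁ σ₂) (Filter.Eventually.of_forall fun l => ?_)
  simp only [conjF, gradF, sum_units, symQ, neg_neg, dsym_neg, map_add, map_mul, Complex.conj_I,
    Complex.conj_ofReal]
  push_cast
  linear_combination ((dsym (-1) ν l * (starRingEnd ℂ) (U 1 t (-l)) +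
      dsym 1 ν l * (starRingEnd ℂ) (U (-1) t (-l))) *
        (dsym 1 ρ (k - l) * U 1 t (k - l) + dsym (-1) ρ (k - l) * U (-1) t (k - l)) -
    (dsym (-1) ρ l * (starRingEnd ℂ) (U 1 t (-l)) +
      dsym 1 ρ l * (starRingEnd ℂ) (U (-1) t (-l))) *
        (dsym 1 ν (k - l) * U 1 t (k - l) + dsym (-1) ν (k - l) * U (-1) t (k - l))) *
    Complex.I_sq
end

end

/-! ### Regularity of φ -/

section


theorem Split.const_mul {J : Set ℝ} {r rG : ℝ} {h : ℝ → Space → ℂ} (H : Split J r rG h) (c : ℂ) :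
    Split J r rG fun t k => c * h t k := by
  have := H.mul_symbol (m := fun _ => c) (C := ‖c‖) (p := 0) measurable_const (by simp)
  simpa using this

theorem norm_half_jb_le (σ : ℤˣ) (k : Space) :
    ‖-(Complex.I * ((σ : ℤ) : ℂ) * (1 / 2)) * ((jb k ^ (-1 : ℝ) : ℝ) : ℂ)‖ ≤
      1 * jb k ^ (-1 : ℝ) := by
  have h0 := Real.rpow_pos_of_pos (jb_pos k) (-1)
  have h1 : ‖((σ : ℤ) : ℂ)‖ = 1 := by rcases Int.units_eq_one_or σ with rfl | rfl <;> simp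
  rw [norm_mul, Complex.norm_real, Real.norm_eq_abs, abs_of_pos h0]
  refine mul_le_mul_of_nonneg_right ?_ h0.le
  rw [norm_neg, norm_mul, norm_mul, h1]
  norm_num

theorem wave_congr {σ : ℤˣ} {f g : ℝ → Space → ℂ} {t : ℝ} {k : Space} (h : f t k = g t k) :
    wave σ f t k = wave σ g t k := by
  simp only [wave, h]

theorem curlF_congr {UA UB : Fin 3 → ℤˣ → ℝ → Space → ℂ} {σ : ℤˣ} {t : ℝ}
    (h : ∀ μ, ∀ᵐ k, UA μ σ t k = wave σ (UB μ σ) t k) :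
    curlF UA σ t =ᵐ[volume] wave σ (curlF UB σ) t := by
  filter_upwards [h 1, h 2] with k h1 h2
  simp only [curlF, h1, h2, wave]
  ring

theorem deriv_curlF {UA UA' : Fin 3 → ℤˣ → ℝ → Space → ℂ} {σ : ℤˣ}
    (h : ∀ μ, Deriv (UA μ σ) (UA' μ σ)) : Deriv (curlF UA σ) (curlF UA' σ) :=
  ((h 2).const_mul _).sub ((h 1).const_mul _)

section

variable {UA : Fin 3 → ℤˣ → ℝ → Space → ℂ} {U : ℤˣ → ℝ → Space → ℂ} {γ : ℝ}
  {I : Set ℝ} {α β c : ℝ} {A : Fin 3 → ℤˣ → ℝ → 𝓢'(Space, ℂ)} {φ : ℤˣ → ℝ → 𝓢'(Space, ℂ)}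

/-- The bilinear expression that `2i A_μ ∂^μ φ` becomes for the profiles of the solution. -/
def roughBil (σ : ℤˣ) (F : Fin 3 → ℤˣ → ℝ → Space → ℂ) (G : ℤˣ → ℝ → Space → ℂ) (t : ℝ)
    (k : Space) : ℂ :=
  ∑ σ₁ : ℤˣ, ∑ σ₂ : ℤˣ, (-2 * bil (ph ((σ : ℤ) : ℝ) ((σ₁ : ℤ) : ℝ) ((σ₂ : ℤ) : ℝ))
    (symTime σ₁ σ₂) (F 0 σ₁) (G σ₂) t k +
      2 * bil (ph ((σ : ℤ) : ℝ) ((σ₁ : ℤ) : ℝ) ((σ₂ : ℤ) : ℝ)) symCurl (curlF F σ₁) (G σ₂) t k)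

theorem bdd_roughBil (σ : ℤˣ) {F : Fin 3 → ℤˣ → ℝ → Space → ℂ} {G : ℤˣ → ℝ → Space → ℂ}
    (hF : ∀ μ σ, Bdd (1 / 2) (F μ σ)) (hG : ∀ σ, Bdd 1 (G σ)) : Bdd (-1) (roughBil σ F G) := by
  refine Bdd.sum _ fun σ₁ _ => Bdd.sum _ fun σ₂ _ => Bdd.add ?_ ?_
  · exact ((Adm.of_symbol (r := -1) (s₁ := 1 / 2) (s₂ := 1) (by constructor <;> norm_num)
      (norm_le_of_angle (norm_symTime_le σ₁ σ₂))).bdd (measurable_ph _ _ _)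
        (measurable_symTime σ₁ σ₂) (hF 0 σ₁) (hG σ₂)).const_mul _
  · exact ((Adm.of_symbol (r := -1) (s₁ := 1 / 2) (s₂ := 1) (by constructor <;> norm_num)
      (norm_le_of_angle (norm_symCurl_le σ₁ σ₂))).bdd (measurable_ph _ _ _)
        measurable_symCurl (bdd_curlF hF σ₁) (hG σ₂)).const_mul _

theorem split_roughBil {J : Set ℝ} (σ : ℤˣ) {F F' : Fin 3 → ℤˣ → ℝ → Space → ℂ}
    {G G' : ℤˣ → ℝ → Space → ℂ} (h0 : 0 < γ) (h1 : γ ≤ 1 / 4)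
    (hF : ∀ μ σ, Bdd (1 / 2) (F μ σ)) (hG : ∀ σ, Bdd 1 (G σ))
    (hF' : ∀ μ σ, Bdd (-(γ / 8)) (F' μ σ)) (hG' : ∀ σ, Bdd (1 / 2 - γ / 8) (G' σ))
    (hdF : ∀ μ σ, Deriv (F μ σ) (F' μ σ)) (hdG : ∀ σ, Deriv (G σ) (G' σ)) :
    Split J (-1 / 4 - γ) (1 / 4 + γ / 4) (roughBil σ F G) :=
  Split.sum _ fun σ₁ _ => Split.sum _ fun σ₂ _ =>
    ((split_bil_mixed σ σ₁ σ₂ h0 h1 (measurable_symTime σ₁ σ₂) (norm_symTime_le σ₁ σ₂)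
      (hF 0 σ₁) (hG σ₂) (hF' 0 σ₁) (hG' σ₂) (hdF 0 σ₁) (hdG σ₂)).const_mul _).add
    ((split_bil_mixed σ σ₁ σ₂ h0 h1 measurable_symCurl (norm_symCurl_le σ₁ σ₂)
      (bdd_curlF hF σ₁) (hG σ₂) (bdd_curlF hF' σ₁) (hG' σ₂) (deriv_curlF fun μ => hdF μ σ₁)
      (hdG σ₂)).const_mul _)

/-- The null structure of `roughF_eq`, rewritten for the profiles; `wave_cm` supplies the phases.
The smoother part stays in terms of the solution itself. -/
theorem wave_roughF {t : ℝ} (σ : ℤˣ) {F : Fin 3 → ℤˣ → ℝ → Space → ℂ} {G : ℤˣ → ℝ → Space → ℂ}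
    (hA : ∀ μ σ, Bdd (1 / 2) (UA μ σ)) (h : ∀ σ, Bdd 1 (U σ))
    (hg : ∀ᵐ k, ∑ μ, (metric μ : ℂ) * gradF (UA μ) μ t k = 0)
    (hF : ∀ μ σ, ∀ᵐ k, UA μ σ t k = wave σ (F μ σ) t k)
    (hG : ∀ σ, ∀ᵐ k, U σ t k = wave σ (G σ) t k) :
    ∀ᵐ k, wave (-σ) (roughF UA U) t k = roughBil σ F G t k + wave (-σ) (restF UA U) t k := by
  filter_upwards [roughF_eq hA h hg] with k hk
  have e1 : ∀ σ₁ σ₂ : ℤˣ, cm (symTime σ₁ σ₂) (UA 0 σ₁ t) (U σ₂ t) =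
      cm (symTime σ₁ σ₂) (wave σ₁ (F 0 σ₁) t) (wave σ₂ (G σ₂) t) := fun σ₁ σ₂ =>
    cm_congr (hF 0 σ₁) (hG σ₂)
  have e2 : ∀ σ₁ σ₂ : ℤˣ, cm symCurl (curlF UA σ₁ t) (U σ₂ t) =
      cm symCurl (wave σ₁ (curlF F σ₁) t) (wave σ₂ (G σ₂) t) := fun σ₁ σ₂ =>
    cm_congr (curlF_congr fun μ => hF μ σ₁) (hG σ₂)
  simp only [roughBil, ← wave_cm]
  simp only [wave, hk, e1, e2]
  simp only [mul_add, Finset.mul_sum]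
  congr 1
  refine Finset.sum_congr rfl fun σ₁ _ => Finset.sum_congr rfl fun σ₂ _ => ?_
  ring

/-- The null forms are split at order -1/4 - γ with a boundary term of order 1/4 + γ/4; the
remaining terms are of order -γ/8 or better. ⟨∇⟩^{-1} adds 1 to each order, which gives 3/4 - γ and
5/4 + γ/4. The separate bound for G at the higher order is kept for the estimate of A. -/
theorem exists_HT_phi {κ : ℝ} {V : Polynomial ℝ} (hI : MeasurableSet I)
    (hJ : Set.Ioo α β ⊆ interior I) (hc : c ∈ Set.Ioo α β)
    (hA : ∀ μ, HalfRep I (1 / 2) (A μ) (UA μ)) (h : HalfRep I 1 φ U)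
    (hgauge : LorenzGauge I A)
    (hsol : SolvesHalfWaveSystem κ V I A φ) (h0 : 0 < γ) (h1 : γ ≤ 1 / 4) (σ : ℤˣ) :
    ∃ gs gs' G : ℝ → Space → ℂ, Bdd 1 gs ∧ Deriv gs gs' ∧ Bdd (3 / 4 - γ) gs' ∧
      HT (3 / 4 - γ) G ∧ Bdd (5 / 4 + γ / 4) G ∧
      ∀ t ∈ Set.Ioo α β, ∀ᵐ k, U σ t k = wave σ (fun t k => gs t k + G t k) t k := by
  choose R hR F hF hdF eF using fun μ =>
    exists_profile_A hI hJ hc hA h hsol μ (δ := γ / 8) (by linarith) (by linarith)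
  choose G hG hdG eG using exists_profile_phi hI hJ hc hA h hsol
  have bA : ∀ μ σ, Bdd (1 / 2) (UA μ σ) := fun μ => (hA μ).bdd
  have bm := bdd_mildF V bA h.bdd (δ := γ / 8) (by linarith) (by linarith)
  have br := bdd_roughF bA h.bdd (δ := γ / 8) (by linarith)
  -- The derivatives of the profiles enter with their a priori orders, -γ/8 for A and 1/2 - γ/8 for
  -- φ, from the plain product laws.
  have S := split_roughBil (J := Set.Ioo α β) σ h0 h1 hF hG
    (fun μ σ => (Bdd.wave (σ := -σ) (((bdd_MF_jb κ bA h.bdd μ (δ := γ / 8) (by linarith)).add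
      ((hR μ).mono (by linarith))).const_mul (-(Complex.I * ((σ : ℤ) : ℂ) * (1 / 2))))).indicator
        measurableSet_Ioo)
    (fun σ => ((Bdd.wave (σ := -σ) ((((br.add (bm.mono (by linarith))).jb_mul (-1)).const_mul
      (-(Complex.I * ((σ : ℤ) : ℂ) * (1 / 2)))))).mono (by linarith)).indicator
        measurableSet_Ioo) hdF hdG
  have b1 := Bdd.wave (σ := -σ) (bdd_restF bA h.bdd)
  have b2 := Bdd.wave (σ := -σ) bm
  have S2 := ((S.add (Split.of_bdd (b1.mono (by linarith)))).add
    (Split.of_bdd (b2.mono (by linarith)))).mul_symbol (p := -1) (C := 1)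
      (m := fun k => -(Complex.I * ((σ : ℤ) : ℂ) * (1 / 2)) * ((jb k ^ (-1 : ℝ) : ℝ) : ℂ))
      (by have := measurable_jb; fun_prop) (norm_half_jb_le σ)
  have bT := ((bdd_roughBil σ hF hG).add (b1.mono (by norm_num))).add (b2.mono (by linarith))
  have bT' := Bdd.wave (σ := -σ) ((((br.add (bm.mono (by linarith))).jb_mul (-1)).const_mul
    (-(Complex.I * ((σ : ℤ) : ℂ) * (1 / 2)))))
  have bT2 := (bT.jb_mul (-1)).const_mul (-(Complex.I * ((σ : ℤ) : ℂ) * (1 / 2)))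
  simp only [← mul_assoc] at bT2
  have S3 := S2.congr_time measurableSet_Ioo bT2 bT' fun t ht => by
    filter_upwards [wave_roughF σ bA h.bdd (hgauge.freq hA (interior_subset (hJ ht)))
      (fun μ σ => eF μ σ t ht) fun σ => eG σ t ht] with k hk
    simp only [wave] at hk ⊢
    linear_combination (-(Complex.I * ((σ : ℤ) : ℂ) * (1 / 2)) *
      ((jb k ^ (-1 : ℝ) : ℝ) : ℂ)) * hk
  obtain ⟨gs, gs', G', a1, a2, a3, a4, a5, a6⟩ := S3.profile hc (hG σ) (hdG σ) (by linarith)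
  exact ⟨gs, gs', G', a1, a2, a3.mono (by linarith), a4.mono (by linarith),
    a5.mono (by linarith), fun t ht => by
      filter_upwards [eG σ t ht, a6 t ht] with k hk hk'
      rw [hk]
      exact wave_congr hk'⟩

end

end

/-! ### Regularity of A -/

section


section

variable {Φ : Space → Space → ℝ} {m : Space → Space → ℂ} {a b a₁ a₂ b₁ b₂ a' b' : ℝ → Space → ℂ}
  {r s₁ s₂ : ℝ}

theorem bil_add_left (h : Adm r s₁ s₂ fun k l => ‖m k l‖ₑ)
    (hΦ : Measurable fun p : Space × Space => Φ p.1 p.2)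
    (hm : Measurable fun p : Space × Space => m p.1 p.2)
    (ha₁ : Bdd s₁ a₁) (ha₂ : Bdd s₁ a₂) (hb : Bdd s₂ b) (t : ℝ) :
    ∀ᵐ k, bil Φ m (fun t k => a₁ t k + a₂ t k) b t k = bil Φ m a₁ b t k + bil Φ m a₂ b t k := by
  filter_upwards [bil_integrand_integrable h hΦ hm ha₁ hb t,
    bil_integrand_integrable h hΦ hm ha₂ hb t] with k h1 h2
  refine Eq.trans ?_ (integral_add h1 h2)
  refine integral_congr_ae (Filter.Eventually.of_forall fun l => ?_)
  beta_reduce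
  ring

theorem bil_add_right (h : Adm r s₁ s₂ fun k l => ‖m k l‖ₑ)
    (hΦ : Measurable fun p : Space × Space => Φ p.1 p.2)
    (hm : Measurable fun p : Space × Space => m p.1 p.2)
    (ha : Bdd s₁ a) (hb₁ : Bdd s₂ b₁) (hb₂ : Bdd s₂ b₂) (t : ℝ) :
    ∀ᵐ k, bil Φ m a (fun t k => b₁ t k + b₂ t k) t k = bil Φ m a b₁ t k + bil Φ m a b₂ t k := by
  filter_upwards [bil_integrand_integrable h hΦ hm ha hb₁ t,
    bil_integrand_integrable h hΦ hm ha hb₂ t] with k h1 h2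
  refine Eq.trans ?_ (integral_add h1 h2)
  refine integral_congr_ae (Filter.Eventually.of_forall fun l => ?_)
  beta_reduce
  ring

/-- The product is expanded as (a, b) + (a₂, b + b₂) + (a, b₂). The normal form is used only for the
first pair; in the other two the surplus 1/64 of the boundary terms makes the product law strict, so
that they are bounded in H^{-3/4} without the use of the angle. -/
theorem split_bil_Q_add {J : Set ℝ} (hJ : MeasurableSet J) (σ₀ σ₁ σ₂ : ℤˣ)
    (hm : Measurable fun p : Space × Space => m p.1 p.2)
    (hmb : ∀ k l, ‖m k l‖ ≤
      2 * angle (((σ₁ : ℤ) : ℝ) * ((σ₂ : ℤ) : ℝ)) k l * (jb k ^ (1 : ℝ) * jb l ^ (1 : ℝ)))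
    (ha : Bdd 1 a) (hb : Bdd 1 b) (ha' : Bdd (3 / 4 - 1 / 16) a') (hb' : Bdd (3 / 4 - 1 / 16) b')
    (hda : Deriv a a') (hdb : Deriv b b') (ha₂ : Bdd (5 / 4 + 1 / 64) a₂)
    (hb₂ : Bdd (5 / 4 + 1 / 64) b₂) :
    Split J (-3 / 4) (-1 / 2)
      (bil (ph ((σ₀ : ℤ) : ℝ) ((σ₁ : ℤ) : ℝ) ((σ₂ : ℤ) : ℝ)) m (fun t k => a t k + a₂ t k)
        fun t k => b t k + b₂ t k) := by
  have hΦ := measurable_ph ((σ₀ : ℤ) : ℝ) ((σ₁ : ℤ) : ℝ) ((σ₂ : ℤ) : ℝ)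
  have hmb' := norm_le_of_angle hmb
  have A : Adm (-5 / 4) 1 1 fun k l => ‖m k l‖ₑ :=
    Adm.of_symbol (by constructor <;> norm_num) hmb'
  have A1 : Adm (-3 / 4) (5 / 4 + 1 / 64) 1 fun k l => ‖m k l‖ₑ :=
    Adm.of_symbol (by constructor <;> norm_num) hmb'
  have A2 : Adm (-3 / 4) 1 (5 / 4 + 1 / 64) fun k l => ‖m k l‖ₑ :=
    Adm.of_symbol (by constructor <;> norm_num) hmb'
  have ha₃ := ha₂.mono (show (1 : ℝ) ≤ 5 / 4 + 1 / 64 by norm_num)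
  have hb₃ := hb₂.mono (show (1 : ℝ) ≤ 5 / 4 + 1 / 64 by norm_num)
  have B0 := A.bdd hΦ hm ha hb
  have B1 := A1.bdd hΦ hm ha₂ (hb.add hb₃)
  have B2 := A2.bdd hΦ hm ha hb₂
  refine ((split_bil_Q (J := J) σ₀ σ₁ σ₂ hm hmb ha hb ha' hb' hda hdb).add
    ((Split.of_bdd B1).add (Split.of_bdd B2))).congr_time hJ (B0.add ((B1.add B2).mono (by norm_num)))
    (A.bdd hΦ hm (ha.add ha₃) (hb.add hb₃)) fun t _ => ?_
  filter_upwards [bil_add_left A hΦ hm ha ha₃ (hb.add hb₃) t, bil_add_right A hΦ hm ha hb hb₃ t]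
    with k h1 h2
  rw [h1, h2]
  ring

end

section

variable {UA : Fin 3 → ℤˣ → ℝ → Space → ℂ} {U : ℤˣ → ℝ → Space → ℂ}
  {I : Set ℝ} {α β c : ℝ} {A : Fin 3 → ℤˣ → ℝ → 𝓢'(Space, ℂ)} {φ : ℤˣ → ℝ → 𝓢'(Space, ℂ)}

/-- The bilinear expression that `Q_{νρ}(φ̄, φ)` becomes for the profiles of the solution. -/
def nullBil (σ : ℤˣ) (ν ρ : Fin 3) (G : ℤˣ → ℝ → Space → ℂ) (t : ℝ) (k : Space) : ℂ :=
  ∑ σ₁ : ℤˣ, ∑ σ₂ : ℤˣ, bil (ph ((σ : ℤ) : ℝ) ((σ₁ : ℤ) : ℝ) ((σ₂ : ℤ) : ℝ))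
    (symQ ν ρ σ₁ σ₂) (fun t => conjF (G (-σ₁) t)) (G σ₂) t k

theorem bdd_nullBil (σ : ℤˣ) (ν ρ : Fin 3) {G : ℤˣ → ℝ → Space → ℂ} (hG : ∀ σ, Bdd 1 (G σ)) :
    Bdd (-5 / 4) (nullBil σ ν ρ G) :=
  Bdd.sum _ fun σ₁ _ => Bdd.sum _ fun σ₂ _ =>
    (Adm.of_symbol (r := -5 / 4) (s₁ := 1) (s₂ := 1) (by constructor <;> norm_num)
      (norm_le_of_angle (norm_symQ_le ν ρ σ₁ σ₂))).bdd (measurable_ph _ _ _)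
        (measurable_symQ ν ρ σ₁ σ₂) (hG (-σ₁)).conj (hG σ₂)

theorem split_nullBil {J : Set ℝ} (hJ : MeasurableSet J) (σ : ℤˣ) (ν ρ : Fin 3)
    {g g' G : ℤˣ → ℝ → Space → ℂ} (hg : ∀ σ, Bdd 1 (g σ)) (hg' : ∀ σ, Bdd (3 / 4 - 1 / 16) (g' σ))
    (hd : ∀ σ, Deriv (g σ) (g' σ)) (hG : ∀ σ, Bdd (5 / 4 + 1 / 64) (G σ)) :
    Split J (-3 / 4) (-1 / 2) (nullBil σ ν ρ fun σ t k => g σ t k + G σ t k) := by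
  refine Split.sum _ fun σ₁ _ => Split.sum _ fun σ₂ _ => ?_
  have e : (fun t => conjF fun k => g (-σ₁) t k + G (-σ₁) t k) =
      fun t k => conjF (g (-σ₁) t) k + conjF (G (-σ₁) t) k := by
    funext t k
    simp only [conjF, map_add]
  rw [e]
  exact split_bil_Q_add hJ σ σ₁ σ₂ (measurable_symQ ν ρ σ₁ σ₂) (norm_symQ_le ν ρ σ₁ σ₂)
    (hg (-σ₁)).conj (hg σ₂) (hg' (-σ₁)).conj (hg' σ₂) (hd (-σ₁)).conj (hd σ₂) (hG (-σ₁)).conj (hG σ₂)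

/-- The conjugate of the half wave of sign -σ₁ is a half wave of sign σ₁, so the phases have the
standard form. -/
theorem wave_QF {t : ℝ} (σ : ℤˣ) (ν ρ : Fin 3) {G : ℤˣ → ℝ → Space → ℂ} (h : ∀ σ, Bdd 1 (U σ))
    (hG : ∀ σ, ∀ᵐ k, U σ t k = wave σ (G σ) t k) :
    ∀ᵐ k, wave (-σ) (QF U ν ρ) t k = nullBil σ ν ρ G t k := by
  filter_upwards [QF_eq h ν ρ t] with k hk
  have e1 : ∀ σ₁ : ℤˣ, conjF (U (-σ₁) t) =ᵐ[volume] wave σ₁ (fun t => conjF (G (-σ₁) t)) t :=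
    fun σ₁ => (conjF_congr (hG (-σ₁))).trans
      (Filter.Eventually.of_forall fun k => (wave_conjF σ₁ (G (-σ₁)) t k).symm)
  have e : ∀ σ₁ σ₂ : ℤˣ, cm (symQ ν ρ σ₁ σ₂) (conjF (U (-σ₁) t)) (U σ₂ t) =
      cm (symQ ν ρ σ₁ σ₂) (wave σ₁ (fun t => conjF (G (-σ₁) t)) t) (wave σ₂ (G σ₂) t) :=
    fun σ₁ σ₂ => cm_congr (e1 σ₁) (hG σ₂)
  simp only [nullBil, ← wave_cm]
  simp only [wave, hk, e, Finset.mul_sum]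

/-- The null form of the split φ is of order -3/4, hence 1/4 after ⟨∇⟩^{-1}; the linear term and R
are smoother. The Lipschitz part of the resulting profile and the boundary term are both of class
`HT` at order 1/4. -/
theorem exists_HT_A {κ : ℝ} {V : Polynomial ℝ} (hI : MeasurableSet I)
    (hJ : Set.Ioo α β ⊆ interior I) (hc : c ∈ Set.Ioo α β)
    (hA : ∀ μ, HalfRep I (1 / 2) (A μ) (UA μ)) (h : HalfRep I 1 φ U)
    (hgauge : LorenzGauge I A)
    (hsol : SolvesHalfWaveSystem κ V I A φ) (μ : Fin 3) (σ : ℤˣ) :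
    ∃ H, HT (1 / 4) H ∧ ∀ t ∈ Set.Ioo α β, ∀ᵐ k, UA μ σ t k = wave σ H t k := by
  -- With γ = 1/16 the derivative has order 3/4 - 1/16 and the boundary term order 5/4 + 1/64, the
  -- values that `split_bil_Q_add` requires.
  choose g g' G hg hd hg' hG1 hG2 e using fun σ => exists_HT_phi hI hJ hc hA h hgauge hsol
    (γ := 1 / 16) (by norm_num) (by norm_num) σ
  have hG : ∀ σ, Bdd (5 / 4 + 1 / 64) (G σ) := fun σ => (hG2 σ).mono (by norm_num)
  obtain ⟨R, hR, hF⟩ := exists_profile_A hI hJ hc hA h hsol μ (δ := 1 / 8) (by norm_num)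
    (by norm_num)
  obtain ⟨f, hf, hdf, ef⟩ := hF σ
  have bA : ∀ μ σ, Bdd (1 / 2) (UA μ σ) := fun μ => (hA μ).bdd
  have b0 : ∀ ν ρ, Bdd (-5 / 4) (nullBil σ ν ρ fun σ t k => g σ t k + G σ t k) := fun ν ρ =>
    bdd_nullBil σ ν ρ fun σ => (hg σ).add ((hG σ).mono (by norm_num))
  have b1 := Bdd.wave (σ := -σ) (bdd_totF (bA μ))
  have b2 := (Bdd.wave (σ := -σ) hR).const_mul (-(Complex.I * ((σ : ℤ) : ℂ) * (1 / 2)))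
  have S := (((Split.sum Finset.univ fun ν _ => Split.sum Finset.univ fun ρ _ =>
    ((split_nullBil (J := Set.Ioo α β) measurableSet_Ioo σ ν ρ hg hg' hd hG).const_mul
      (-Complex.I)).const_mul ((eps μ ν ρ * (metric ν * metric ρ) : ℝ) : ℂ)).const_mul
        (-((κ⁻¹ : ℝ) : ℂ))).add (Split.of_bdd (b1.mono (by norm_num)))).mul_symbol (p := -1) (C := 1)
      (m := fun k => -(Complex.I * ((σ : ℤ) : ℂ) * (1 / 2)) * ((jb k ^ (-1 : ℝ) : ℝ) : ℂ))
      (by have := measurable_jb; fun_prop) (norm_half_jb_le σ)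
  have S2 := S.add (Split.of_bdd (b2.mono (by norm_num)))
  have bS := (((((Bdd.sum Finset.univ fun ν _ => Bdd.sum Finset.univ fun ρ _ =>
    ((b0 ν ρ).const_mul
      (-Complex.I)).const_mul ((eps μ ν ρ * (metric ν * metric ρ) : ℝ) : ℂ)).const_mul
        (-((κ⁻¹ : ℝ) : ℂ))).add (b1.mono (by norm_num))).jb_mul (-1)).const_mul
          (-(Complex.I * ((σ : ℤ) : ℂ) * (1 / 2)))).add (b2.mono (by norm_num))
  simp only [← mul_assoc (-(Complex.I * ((σ : ℤ) : ℂ) * (1 / 2)))] at bS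
  have bT := Bdd.wave (σ := -σ) (((bdd_MF_jb κ bA h.bdd μ (δ := 1 / 8) (by norm_num)).add
      (hR.mono (by norm_num))).const_mul (-(Complex.I * ((σ : ℤ) : ℂ) * (1 / 2))))
  have S3 := S2.congr_time measurableSet_Ioo bS bT fun t ht => by
    filter_upwards [ae_all_iff.2 fun ν => ae_all_iff.2 fun ρ =>
      wave_QF σ ν ρ (G := fun σ t k => g σ t k + G σ t k) h.bdd fun σ => e σ t ht] with k hk
    simp only [← hk, wave, MF, Finset.mul_sum, mul_add]
    congr 1
    · congr 1
      · refine Finset.sum_congr rfl fun ν _ => Finset.sum_congr rfl fun ρ _ => ?_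
        ring
      · ring
    · ring
  obtain ⟨gs, gs', G', a1, a2, a3, a4, a5, a6⟩ := S3.profile hc hf hdf (by norm_num)
  refine ⟨fun t k => gs t k + G' t k, (HT.of_deriv (a1.mono (by norm_num)) (a3.mono (by norm_num))
    a2).add (a4.mono (by norm_num)), fun t ht => ?_⟩
  filter_upwards [ef t ht, a6 t ht] with k hk hk'
  rw [hk]
  exact wave_congr hk'

end

end

/-! ### Conclusion on the interval I -/

section


theorem MemXOn.mono {σ : ℤˣ} {s s' b : ℝ} {I : Set ℝ} {u : ℝ → 𝓢'(Space, ℂ)}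
    (h : MemXOn σ s b I u) (hs : s' ≤ s) : MemXOn σ s' b I u := by
  obtain ⟨v, ⟨f, hf, hv⟩, huv⟩ := h
  refine ⟨v, ⟨f, ?_, hv⟩, huv⟩
  set q : Spacetime → ℝ := fun k => 1 + ‖(2 * Real.pi) • spatial k‖ ^ 2
  have hq : ∀ k, 1 ≤ q k := fun k => le_add_of_nonneg_right (sq_nonneg _)
  have e : (fun k => (weight σ s' b k : ℂ) * f k) =
      fun k => ((q k ^ ((s' - s) / 2) : ℝ) : ℂ) * ((weight σ s b k : ℂ) * f k) := by
    funext k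
    have hk := Real.rpow_add (lt_of_lt_of_le one_pos (hq k)) ((s' - s) / 2) (s / 2)
    rw [show (s' - s) / 2 + s / 2 = s' / 2 by ring] at hk
    rw [← mul_assoc, ← Complex.ofReal_mul, weight, weight, ← mul_assoc, ← hk]
  have hle : ∀ k, ‖((q k ^ ((s' - s) / 2) : ℝ) : ℂ)‖ ≤ 1 := fun k => by
    rw [Complex.norm_real, Real.norm_eq_abs, abs_of_nonneg (by have := hq k; positivity)]
    exact Real.rpow_le_one_of_one_le_of_nonpos (hq k) (by linarith)
  have hqm : Measurable fun k => ((q k ^ ((s' - s) / 2) : ℝ) : ℂ) := by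
    have hsp : Measurable spatial := by
      have : Continuous spatial := by unfold spatial; fun_prop
      exact this.measurable
    fun_prop
  rw [e]
  refine hf.of_le (hqm.aestronglyMeasurable.mul hf.1) (Filter.Eventually.of_forall fun k => ?_)
  rw [norm_mul]
  exact mul_le_of_le_one_left (norm_nonneg _) (hle k)

/-- Test functions are supported over the interior of I, so for a degenerate interval the condition
is void. -/
theorem memXOn_of_interior_eq_empty {I : Set ℝ} (hI : interior I = ∅) (σ : ℤˣ) (s b : ℝ)
    (u : ℝ → 𝓢'(Space, ℂ)) : MemXOn σ s b I u := by
  refine ⟨0, ⟨0, by simp, fun ψ => by simp⟩, fun ψ hψ => ?_⟩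
  have h0 : ψ = 0 := by
    ext p
    by_contra hp
    have := hψ.2 (subset_tsupport _ hp)
    simp [hI] at this
  simp [h0]

theorem exists_halfRep {I : Set ℝ} (hI : MeasurableSet I) {s : ℝ} {u : ℤˣ → ℝ → 𝓢'(Space, ℂ)}
    (h : ∀ σ, MemCH s I (u σ)) : ∃ U, HalfRep I s u U := by
  choose U h1 h2 _ h4 using fun σ => (h σ).exists_rep hI
  exact ⟨U, h1, h2, h4⟩

/-- The profile is known on the open interval, and the end points that I may contain form a null set
of times. -/
theorem memXOn_of_profile {I : Set ℝ} {α β s r : ℝ} (hs : 0 ≤ s) (hI : MeasurableSet I)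
    (hIb : Bornology.IsBounded I) (hIJ : I ⊆ Set.Icc α β) {u : ℤˣ → ℝ → 𝓢'(Space, ℂ)}
    {U : ℤˣ → ℝ → Space → ℂ} (hU : HalfRep I r u U) {σ : ℤˣ} {H : ℝ → Space → ℂ} (hH : HT s H)
    (e : ∀ t ∈ Set.Ioo α β, ∀ᵐ k, U σ t k = wave σ H t k) : MemXOn σ s (3 / 4) I (u σ) := by
  refine memXOn_of_HT hs hI hIb hH ?_
  filter_upwards [(Ioo_ae_eq_Icc (a := α) (b := β) (μ := volume)).mem_iff] with t ht htI η
  rw [hU.rep σ t htI η]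
  refine integral_congr_ae ?_
  filter_upwards [e t (ht.2 (hIJ htI))] with k hk
  rw [hk]

end

end

end CSH

theorem proposition4p1
    (κ : ℝ) (hκ : κ ≠ 0) (V : Polynomial ℝ)
    (I : Set ℝ) (hI : I.OrdConnected) (hIb : Bornology.IsBounded I)
    (A : Fin 3 → ℤˣ → ℝ → 𝓢'(CSH.Space, ℂ)) (φ : ℤˣ → ℝ → 𝓢'(CSH.Space, ℂ))
    (hφ : ∀ σ, CSH.MemCH 1 I (φ σ))
    (hA : ∀ μ σ, CSH.MemCH (1 / 2) I (A μ σ))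
    (hgauge : CSH.LorenzGauge I A)
    (hsol : CSH.SolvesHalfWaveSystem κ V I A φ) :
    ∀ ε : ℝ, 0 < ε →
      (∀ σ, CSH.MemXOn σ (3 / 4 - ε) (3 / 4) I (φ σ)) ∧
        ∀ μ σ, CSH.MemXOn σ (1 / 4) (3 / 4) I (A μ σ) := by
  intro ε hε
  rcases (interior I).eq_empty_or_nonempty with h0 | ⟨c, hc⟩
  · exact ⟨fun σ => CSH.memXOn_of_interior_eq_empty h0 _ _ _ _,
      fun μ σ => CSH.memXOn_of_interior_eq_empty h0 _ _ _ _⟩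
  have hIm : MeasurableSet I := hI.measurableSet
  have hsub : I ⊆ Set.Icc (sInf I) (sSup I) := subset_Icc_csInf_csSup hIb.bddBelow hIb.bddAbove
  have hJ : Set.Ioo (sInf I) (sSup I) ⊆ interior I := isOpen_Ioo.subset_interior_iff.2
    (IsConnected.Ioo_csInf_csSup_subset ⟨⟨c, interior_subset hc⟩, hI.isPreconnected⟩
      hIb.bddBelow hIb.bddAbove)
  have hcJ : c ∈ Set.Ioo (sInf I) (sSup I) := by
    rw [← interior_Icc]
    exact interior_mono hsub hc
  obtain ⟨U, hU⟩ := CSH.exists_halfRep hIm hφ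
  choose UA hUA using fun μ => CSH.exists_halfRep hIm (hA μ)
  refine ⟨fun σ => ?_, fun μ σ => ?_⟩
  -- The loss is capped at 1/4, which keeps the order 3/4 - γ nonnegative; for larger ε the claim is
  -- weaker and follows by monotonicity.
  · obtain ⟨g, g', G, h1, h2, h3, h4, h5, h6⟩ := CSH.exists_HT_phi hIm hJ hcJ hUA hU hgauge hsol
      (γ := min ε (1 / 4)) (lt_min hε (by norm_num)) (min_le_right _ _) σ
    have hm : min ε (1 / 4) ≤ 1 / 4 := min_le_right _ _
    have hm0 : 0 < min ε (1 / 4) := lt_min hε (by norm_num)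
    exact (CSH.memXOn_of_profile (by linarith) hIm hIb hsub hU
      ((CSH.HT.of_deriv (h1.mono (by linarith)) h3 h2).add h4) h6).mono
        (by linarith [min_le_left ε (1 / 4)])
  · obtain ⟨H, h1, h2⟩ := CSH.exists_HT_A hIm hJ hcJ hUA hU hgauge hsol μ σ
    exact CSH.memXOn_of_profile (by norm_num) hIm hIb hsub (hUA μ) h1 h2
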